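/- **Theorem (central limit theorem for service systems with resetting).** Let $S$ be a finite set. For $t\ge 0$ let $Q(t)=(Q(t,x,y))_{x,y\in S}$ be a rate matrix (nonnegative off-diagonal entries, zero row sums), and let $r(t,x)$ and $\beta(t,x)$ be real-valued. Let $G(t,x,y,\cdot)$, $H(t,x,\cdot)$, $K(t,x,\cdot)$ be cumulative distribution functions on $\mathbb R$; write $\mathscr G(t,x,y)$, $\mathscr H(t,x)$, $\mathscr K(t,x)$ for random variables with these distributions. Let $0=t_0<t_1<t_2<\cdots$ with $t_i\to\infty$. Assume: * (A1) $Q(\cdot,x,y)$, $r(\cdot,x)$, $\beta(\cdot,x)$, $G(\cdot,x,y,z)$, $K(\cdot,x,z)$ are measurable for all $x,y\in S$, $z\in\mathbb R$. * (A2) $\mathcal B=\{(x,y):Q(t,x,y)>0\}$ does not depend on $t$, and $Q(1)$ is irreducible. * (A3) $0<\inf_t Q(t,x,y)\le\sup_t Q(t,x,y)<\infty$ for each $(x,y)\in\mathcal B$. * (A4) $r$ and $\beta$ are nonnegative, $\sup_t r(t,x)<\infty$ and $\sup_t\beta(t,x)<\infty$ for each $x$; there is a finite function $c$ on $S$ such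 that for all $t,x,y$ the laws $G(t,x,y,\cdot)$, $H(t,x,\cdot)$, $K(t,x,\cdot)$ are supported in $[0,c(x)]$; and with $\gamma(t,x)=\sum_{y:(x,y)\in\mathcal B}Q(t,x,y)\,\mathbb E\,\mathscr G(t,x,y)+\beta(t,x)\,\mathbb E\,\mathscr K(t,x)$ one has $\inf_t r(t,x)+\inf_t\gamma(t,x)>0$ for every $x$. * (A5) $\inf_{i\ge1}(t_i-t_{i-1})>0$. Let $\mu_0,\mu_1,\dots$ be probability mass functions on $S$, and let $X=(X(t):t\ge0)$ be a right-continuous $S$-valued process with left limits such that the processes $(X(n+u):0\le u<1)$, $n=0,1,2,\dots$, are independent, and the $n$-th one is a Markov jump process with rate matrices $(Q(n+u):0\le u<1)$ and initial law $\mu_n$; that is, $X$ is reset independently at each integer time $n$ according to $\mu_n$. Given $X$, let $N$ be a Poisson counting process with intensity $\beta(t,X(t))$ and event times $\Lambda_1\le\Lambda_2\le\cdots$. Let $T_1<T_2<\cdots$ be the non-integer times at which $X$ jumps (transitions caused by resetting are not counted), and let $J(t)$ be the number of them in $[0,t]$. Conditionally on $(X,N)$, let the rewards $\mathscr G_k,\mathscr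 H_k,\mathscr K_k$, $k\ge1$, be independent with cdfs $G(T_k,X(T_k-),X(T_k),\cdot)$, $H(t_k,X(t_k),\cdot)$, $K(\Lambda_k,X(\Lambda_k),\cdot)$ respectively. Put $$R(t)=\int_0^t r(s,X(s))\,ds+\sum_{k=1}^{J(t)}\mathscr G_k+\sum_{i\ge1:\,t_i\le t}\mathscr H_i+\sum_{k=1}^{N(t)}\mathscr K_k .$$ Assume that no $t_i$, $i\ge1$, is an integer, and that the summed variances of the lump-sum rewards are bounded away from zero in the following sense: for some $\delta>0$, $$\inf_{i\ge1}\ \inf_{t_{i-1}<t\le t_i}\Big[\sum_{(x,y)\in\mathcal B}\operatorname{Var}\mathscr G(t,x,y)+\mathbf 1\{t_i-\lfloor t_i\rfloor\ge\delta\}\sum_{x\in S}\operatorname{Var}\mathscr H(t_i,x)+\sum_{x\in S}\beta(t,x)\operatorname{Var}\mathscr K(t,x)\Big]>0 .$$ Then $R(n)$ has finite second moment for every $n$, $\operatorname{Var}R(n)>0$ for all large $n$, and $$\frac{R(n)-\mathbb E R(n)}{\sqrt{\operatorname{Var}R(n)}}\Rightarrow\mathcal N(0,1)\qquad(n\to\infty).$$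 -/

import Mathlib

open MeasureTheory ProbabilityTheory Filter Topology
open scoped NNReal

noncomputable section

namespace Resetting

/-- The given (deterministic) data of a non-stationary reward model on the finite state space `S`:
transition rates `Q(t,x,y)`, reward rate `r(t,x)`, intensity `β(t,x)` of the external rewards,
laws `G(t,x,y,·)`, `H(t,x,·)`, `K(t,x,·)` of the lump-sum rewards collected respectively at
jumps, at scheduled times and at external events, and the scheduled times `t_i`. -/
structure Data (S : Type*) where
  Q : ℝ≥0 → Matrix S S ℝ
  r : ℝ≥0 → S → ℝ
  β : ℝ≥0 → S → ℝ
  G : ℝ≥0 → S → S → ProbabilityMeasure ℝ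
  H : ℝ≥0 → S → ProbabilityMeasure ℝ
  K : ℝ≥0 → S → ProbabilityMeasure ℝ
  τ : ℕ → ℝ≥0

/-- The random objects: the state process `X`, the counting process `N` of external events and the
sequences (indexed from `1`) of rewards collected at the successive jumps of `X`, at the successive
scheduled times and at the successive external events. -/
structure Model (S Ω : Type*) where
  X : ℝ≥0 → Ω → S
  N : ℝ≥0 → Ω → ℕ
  g : ℕ → Ω → ℝ
  h : ℕ → Ω → ℝ
  k : ℕ → Ω → ℝ

section Assumptions

variable {S : Type*} [Fintype S] [DecidableEq S]

/-- Off-diagonal entries are nonnegative and rows sum to zero. -/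
def IsRateMatrix (A : Matrix S S ℝ) : Prop :=
  (∀ x y, x ≠ y → 0 ≤ A x y) ∧ ∀ x, ∑ y, A x y = 0

/-- Every state can be reached from every state along transitions of positive rate. -/
def IsIrreducibleRate (A : Matrix S S ℝ) : Prop :=
  ∀ x y, Relation.ReflTransGen (fun u v => 0 < A u v) x y

/-- `0 = t_0 < t_1 < t_2 < ⋯` with `t_i → ∞`. -/
def IsSchedule (τ : ℕ → ℝ≥0) : Prop :=
  τ 0 = 0 ∧ StrictMono τ ∧ Tendsto τ atTop atTop

/-- Mean of a reward law. -/
def mean (ν : ProbabilityMeasure ℝ) : ℝ := ∫ z, z ∂(ν : Measure ℝ)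

/-- Variance of a reward law. -/
def var (ν : ProbabilityMeasure ℝ) : ℝ := variance id (ν : Measure ℝ)

namespace Data

variable (E : Data S)

open Classical in
/-- The pairs of states between which transitions are possible (at time `1`, hence, under `A2`,
at every time). -/
def B : Finset (S × S) := Finset.univ.filter fun p => 0 < E.Q 1 p.1 p.2

/-- Expected rate at which lump-sum rewards from jumps and external events accrue in state `x`
at time `t`. -/
def γ (t : ℝ≥0) (x : S) : ℝ :=
  (∑ p ∈ E.B with p.1 = x, E.Q t p.1 p.2 * mean (E.G t p.1 p.2)) + E.β t x * mean (E.K t x)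

/-- Measurability in time. -/
structure A1 : Prop where
  rate : ∀ x y, Measurable fun t => E.Q t x y
  reward : ∀ x, Measurable fun t => E.r t x
  jump : ∀ x y z, Measurable fun t => cdf (E.G t x y : Measure ℝ) z
  ext : ∀ x z, Measurable fun t => cdf (E.K t x : Measure ℝ) z
  intensity : ∀ x, Measurable fun t => E.β t x

/-- The set of possible transitions does not depend on time and is irreducible. -/
structure A2 : Prop where
  indep_time : ∀ t x y, 0 < E.Q t x y ↔ 0 < E.Q 1 x y
  irreducible : IsIrreducibleRate (E.Q 1)

/-- The rates of the possible transitions are bounded and bounded away from zero. -/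
def A3 : Prop :=
  ∀ p ∈ E.B, 0 < ⨅ t, E.Q t p.1 p.2 ∧ BddAbove (Set.range fun t => E.Q t p.1 p.2)

/-- Reward rates and intensities are nonnegative and bounded, lump-sum rewards are nonnegative and
bounded, and in every state reward accrues at a positive rate. -/
structure A4 : Prop where
  reward : ∀ x, (∀ t, 0 ≤ E.r t x) ∧ BddAbove (Set.range fun t => E.r t x)
  intensity : ∀ x, (∀ t, 0 ≤ E.β t x) ∧ BddAbove (Set.range fun t => E.β t x)
  lump : ∃ c : S → ℝ, ∀ x t,
    (∀ y, (E.G t x y : Measure ℝ) (Set.Iio 0) = 0 ∧ cdf (E.G t x y : Measure ℝ) (c x) = 1) ∧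
    ((E.H t x : Measure ℝ) (Set.Iio 0) = 0 ∧ cdf (E.H t x : Measure ℝ) (c x) = 1) ∧
    ((E.K t x : Measure ℝ) (Set.Iio 0) = 0 ∧ cdf (E.K t x : Measure ℝ) (c x) = 1)
  pos : ∀ x, 0 < (⨅ t, E.r t x) + ⨅ t, E.γ t x

/-- The gaps between scheduled times are bounded away from zero. -/
def A5 : Prop := 0 < ⨅ i : ℕ, ((E.τ (i + 1) : ℝ) - E.τ i)

open Classical in
/-- Total variance of the scheduled reward at `t_i`, over all states; it is counted only when `t_i`
lies at least `δ` after the preceding integer (reset) time. -/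
def scheduledVar (δ : ℝ) (i : ℕ) : ℝ :=
  if δ ≤ Int.fract (E.τ i : ℝ) then ∑ x, var (E.H (E.τ i) x) else 0

/-- The total variance of the lump-sum rewards is bounded away from zero over all times `t > 0`.
For `t_i < t ≤ t_{i+1}` the scheduled reward is the next one, at `t_{i+1}`;
external rewards are weighted with the intensity `β` at which they are collected. -/
def VarianceBoundedBelow : Prop :=
  ∃ δ > (0 : ℝ), ∃ ε > (0 : ℝ), ∀ (i : ℕ) (t : ℝ≥0), E.τ i < t → t ≤ E.τ (i + 1) →
    ε ≤ (∑ p ∈ E.B, var (E.G t p.1 p.2)) + E.scheduledVar δ (i + 1)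
      + ∑ x, E.β t x * var (E.K t x)

end Data

/-- `P s t`, `s ≤ t`, are the transition matrices with rates `Q`: stochastic matrices that solve
the Kolmogorov forward and backward equations. -/
structure IsTransition (Q : ℝ≥0 → Matrix S S ℝ) (P : ℝ≥0 → ℝ≥0 → Matrix S S ℝ) : Prop where
  stochastic : ∀ s t, s ≤ t → P s t ∈ Matrix.rowStochastic ℝ S
  forward : ∀ s t, s ≤ t → ∀ x y, P s t x y = (1 : Matrix S S ℝ) x y
    + ∫ u in (s : ℝ)..t, (P s u.toNNReal * Q u.toNNReal) x y
  backward : ∀ s t, s ≤ t → ∀ x y, P s t x y = (1 : Matrix S S ℝ) x y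
    + ∫ u in (s : ℝ)..t, (Q u.toNNReal * P u.toNNReal t) x y

end Assumptions

section Paths

variable {S : Type*} [TopologicalSpace S]

/-- The jump times of a path; the transitions made by resetting, at integer times, are not jumps
of the underlying jump process and are left out. -/
def jumpSet (x : ℝ≥0 → S) : Set ℝ≥0 :=
  {t | Function.leftLim x t ≠ x t ∧ ∀ m : ℕ, t ≠ m}

/-- `J(t)`, the number of jumps in `[0,t]`. -/
def jumpCount (x : ℝ≥0 → S) (t : ℝ≥0) : ℕ := (jumpSet x ∩ Set.Iic t).ncard

/-- Time of the `k`-th event (`k ≥ 1`) of a counting path; only used when there is one. -/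
def eventTime (c : ℝ≥0 → ℕ) (k : ℕ) : ℝ≥0 := sInf {t | k ≤ c t}

/-- `n(t)`, the number of scheduled times `t_i`, `i ≥ 1`, in `[0,t]`. -/
def scheduleCount (τ : ℕ → ℝ≥0) (t : ℝ≥0) : ℕ := {i : ℕ | 1 ≤ i ∧ τ i ≤ t}.ncard

/-- Right-continuous with left limits. -/
def IsCadlag (x : ℝ≥0 → S) : Prop :=
  ∀ t, ContinuousWithinAt x (Set.Ici t) t ∧ ∃ y, Tendsto x (𝓝[<] t) (𝓝 y)

end Paths

section Laws

variable {S Ω : Type*} [Fintype S] [DecidableEq S] [TopologicalSpace S] [MeasurableSpace S]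
  [MeasurableSpace Ω]

/-- `σ(X(t) : t ∈ I)`. -/
abbrev sigma {α : Type*} [MeasurableSpace α] (X : ℝ≥0 → Ω → α) (I : Set ℝ≥0) : MeasurableSpace Ω :=
  ⨆ t ∈ I, MeasurableSpace.comap (X t) inferInstance

/-- On `[a,b)`, `X` is a Markov jump process with rates `Q` and law `μ` at time `a`
(in terms of finite-dimensional distributions). -/
def IsMarkovJumpOn (Q : ℝ≥0 → Matrix S S ℝ) (μ : PMF S) (X : ℝ≥0 → Ω → S) (Pr : Measure Ω)
    (a b : ℝ≥0) : Prop :=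
  ∃ P, IsTransition Q P ∧
    ∀ (m : ℕ) (u : Fin (m + 1) → ℝ≥0) (x : Fin (m + 1) → S),
      Monotone u → u 0 = a → u (Fin.last m) < b →
      Pr.real {ω | ∀ j, X (u j) ω = x j}
        = (μ (x 0)).toReal * ∏ j : Fin m, P (u j.castSucc) (u j.succ) (x j.castSucc) (x j.succ)

/-- `X` is the jump process with rates `Q` that is reset independently at every integer time `n`
according to `μ n`: the restrictions of `X` to the intervals `[n,n+1)` are independent Markov jump
processes with rates `Q` that start at time `n` from `μ n`. -/
structure IsResetJumpProcess (Q : ℝ≥0 → Matrix S S ℝ) (μ : ℕ → PMF S) (X : ℝ≥0 → Ω → S)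
    (Pr : Measure Ω) : Prop where
  measurable : ∀ t, Measurable (X t)
  cadlag : ∀ ω, IsCadlag fun t => X t ω
  markov : ∀ n : ℕ, IsMarkovJumpOn Q (μ n) X Pr n (n + 1)
  indep : iIndep (fun n : ℕ => sigma X (Set.Ico (n : ℝ≥0) (n + 1))) Pr

/-- Given `X`, the counting process `N` is Poisson with intensity `β(t,X(t))`: conditionally on
`X`, its increments over successive intervals are independent and Poisson distributed with the
integral of the intensity as parameter. -/
structure IsModulatedPoisson (β : ℝ≥0 → S → ℝ) (X : ℝ≥0 → Ω → S) (N : ℝ≥0 → Ω → ℕ)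
    (Pr : Measure Ω) : Prop where
  measurable : ∀ t, Measurable (N t)
  zero : ∀ ω, N 0 ω = 0
  mono : ∀ ω, Monotone fun t => N t ω
  rightCont : ∀ ω t, ContinuousWithinAt (fun s => N s ω) (Set.Ici t) t
  law : ∀ A, MeasurableSet[sigma X Set.univ] A →
    ∀ (m : ℕ) (u : Fin (m + 1) → ℝ≥0) (k : Fin m → ℕ), Monotone u →
      Pr.real (A ∩ {ω | ∀ j : Fin m, N (u j.succ) ω = N (u j.castSucc) ω + k j})
        = ∫ ω in A, ∏ j : Fin m, (poissonMeasure
            (∫ s in (u j.castSucc : ℝ)..(u j.succ), β s.toNNReal (X s.toNNReal ω)).toNNReal).real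
              {k j} ∂Pr

namespace Model

variable (Z : Model S Ω)

/-- Number of jumps of the state process in `[0,t]`. -/
def J (t : ℝ≥0) (ω : Ω) : ℕ := jumpCount (fun s => Z.X s ω) t

/-- Time of the `k`-th jump. -/
def T (k : ℕ) (ω : Ω) : ℝ≥0 := eventTime (fun t => Z.J t ω) k

/-- Time of the `k`-th external event. -/
def Λ (k : ℕ) (ω : Ω) : ℝ≥0 := eventTime (fun t => Z.N t ω) k

/-- State just before time `t`. -/
def Xleft (t : ℝ≥0) (ω : Ω) : S := Function.leftLim (fun s => Z.X s ω) t

/-- Conditionally on `X` and `N`, the lump-sum rewards are independent, with the laws given by `G`,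
`H`, `K`. The statement concerns the first `p` jump rewards, `l` scheduled rewards and `q` external
rewards, on events of `σ(X,N)` on which there are at least `p` jumps and `q` external events. -/
structure HasRewardLaw (E : Data S) (Pr : Measure Ω) : Prop where
  measurable_g : ∀ k, Measurable (Z.g k)
  measurable_h : ∀ i, Measurable (Z.h i)
  measurable_k : ∀ k, Measurable (Z.k k)
  law : ∀ (p l q : ℕ) (A : Set Ω),
    MeasurableSet[sigma Z.X Set.univ ⊔ sigma Z.N Set.univ] A →
    (∀ ω ∈ A, (∃ t, p ≤ Z.J t ω) ∧ ∃ t, q ≤ Z.N t ω) →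
    ∀ a b c : ℕ → ℝ,
      Pr.real (A ∩ {ω | (∀ k ∈ Finset.Icc 1 p, Z.g k ω ≤ a k) ∧
          (∀ i ∈ Finset.Icc 1 l, Z.h i ω ≤ b i) ∧ ∀ k ∈ Finset.Icc 1 q, Z.k k ω ≤ c k})
        = ∫ ω in A,
            (∏ k ∈ Finset.Icc 1 p,
              cdf (E.G (Z.T k ω) (Z.Xleft (Z.T k ω) ω) (Z.X (Z.T k ω) ω) : Measure ℝ) (a k)) *
            (∏ i ∈ Finset.Icc 1 l, cdf (E.H (E.τ i) (Z.X (E.τ i) ω) : Measure ℝ) (b i)) *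
            ∏ k ∈ Finset.Icc 1 q, cdf (E.K (Z.Λ k ω) (Z.X (Z.Λ k ω) ω) : Measure ℝ) (c k) ∂Pr

/-- The cumulative reward `R(t)`. -/
def R (E : Data S) (t : ℝ≥0) (ω : Ω) : ℝ :=
  (∫ s in (0 : ℝ)..t, E.r s.toNNReal (Z.X s.toNNReal ω))
    + ∑ j ∈ Finset.Icc 1 (Z.J t ω), Z.g j ω
    + ∑ i ∈ Finset.Icc 1 (scheduleCount E.τ t), Z.h i ω
    + ∑ k ∈ Finset.Icc 1 (Z.N t ω), Z.k k ω

end Model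

end Laws

end Resetting

end

noncomputable section

namespace Resetting

/-! Resetting makes the rewards collected in successive unit cycles independent, so `R(n)` is a sum
of independent terms. A Lyapunov argument then needs only two facts: the fourth central moment of
each cycle is at most a constant times its variance, with the same constant for all cycles, and the
total variance diverges. No single cycle has to have variance bounded below. In
`tendstoInDistribution_of_fourth_moment_le_variance` the characteristic function of the centered sum
differs from the Gaussian one by at most a constant times `(|u|³ + u⁴)` times the variance. At `u =
t/σ`, with `σ` the standard deviation of `R(n)`, this is of order `1/σ`.

Independence (`Model.indepFun_incr`, `indepFun_R`). Given `(X, N)`, the characteristic function of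
the reward of a time window is an explicit product, `Model.condCharFun`, which depends only on the
paths of `X` and of the increments of `N` in that window. Independence of the state process over two
windows extends to the increments of `N`, and from there to the rewards. The right endpoint of a
cycle is delicate, because the state there has already been redrawn. It does not matter: transitions
at integers are not counted as jumps, no scheduled time is an integer, and an external event at a
given time has probability zero. The same argument, conditionally on the state at a time inside a
cycle, gives the Markov property of the reward process.

Fourth moments (`IsMarkovAdditive.exists_fourth_moment_le`). A cycle is cut into `L` equal steps,
and the Doob martingale of its total reward is formed. An increment of this martingale is at most a
constant times the deterministic contribution of the step plus the number of random events in it.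
Two or more events in one step cost only order `L⁻²`; otherwise the increment is bounded. Hence its
conditional third and fourth moments are bounded by its conditional second moment up to `L⁻²`.
Summing gives a fourth central moment of at most `A (Var + 1/L)`, and `L → ∞` removes the last term.
The required moments of the number of events come from exponential moments
(`setLIntegral_pow_count_le`).

Variance (`tendsto_variance_R`). The variance of `R(n)` is at least the mean of its conditional
variance given `(X, N)`, which is the sum of the variances of the reward laws met along the path.
Irreducibility gives every state probability at least some `κ > 0` away from the resetting times
(`exists_le_real_state`). So between consecutive scheduled times either the scheduled reward, or the
jumps and external events in a window inside one cycle, contribute a fixed positive amount. -/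

/-! ### Central limit theorem through characteristic functions. -/

lemma norm_exp_mul_I_sub_taylor_le (x : ℝ) :
    ‖Complex.exp (x * Complex.I) - (1 + x * Complex.I - x ^ 2 / 2)‖ ≤ 4 * |x| ^ 3 := by
  -- The Taylor remainder estimate is available for `|x| ≤ 1`; beyond that every term is itself
  -- dominated by `|x| ^ 3`.
  rcases le_or_gt |x| 1 with h | h
  · have := Complex.exp_bound (x := x * Complex.I) (by simpa using h) (n := 3) (by norm_num)
    simp only [Finset.sum_range_succ, Finset.sum_range_zero, Nat.factorial] at this
    have e : (x * Complex.I : ℂ) ^ 2 = - x ^ 2 := by rw [mul_pow, Complex.I_sq]; ring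
    simp only [e] at this
    norm_num at this
    refine (le_of_eq ?_).trans (this.trans ?_)
    · congr 1; ring
    · nlinarith [pow_nonneg (abs_nonneg x) 3]
  · have h1 : ‖Complex.exp (x * Complex.I)‖ = 1 := Complex.norm_exp_ofReal_mul_I x
    have h2 : ‖(1 + x * Complex.I - x ^ 2 / 2 : ℂ)‖ ≤ 1 + |x| + |x| ^ 2 / 2 := by
      refine (norm_sub_le _ _).trans (add_le_add ((norm_add_le _ _).trans ?_) ?_) <;> simp
    refine (norm_sub_le _ _).trans ?_
    rw [h1]
    nlinarith [pow_le_pow_left₀ zero_le_one h.le 2, pow_le_pow_left₀ zero_le_one h.le 3,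
      mul_le_mul_of_nonneg_right h.le (sq_nonneg |x|), mul_le_mul_of_nonneg_right h.le (abs_nonneg x)]

/-- From `1 - y ≤ exp (-y) ≤ 1 / (1 + y) ≤ 1 - y + y²`. -/
lemma abs_exp_neg_sub_le {y : ℝ} (hy : 0 ≤ y) : |Real.exp (-y) - (1 - y)| ≤ y ^ 2 := by
  have h1 : 1 - y ≤ Real.exp (-y) := by linarith [Real.add_one_le_exp (-y)]
  rw [abs_of_nonneg (by linarith)]
  have h2 : Real.exp (-y) ≤ 1 / (1 + y) := by
    rw [Real.exp_neg, ← one_div]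
    exact one_div_le_one_div_of_le (by linarith) (by linarith [Real.add_one_le_exp y])
  have h3 : 1 / (1 + y) ≤ 1 - y + y ^ 2 := by
    rw [div_le_iff₀ (by linarith)]
    nlinarith [pow_nonneg hy 3]
  linarith

section

variable {Ω : Type*} [MeasurableSpace Ω] {P : Measure Ω} [IsProbabilityMeasure P]

/-- Both functions are compared with `1 - u² v / 2`, where `v` is the second moment. The
fourth-moment hypothesis controls the third moment through `|y|³ ≤ y² + y⁴`, and it gives `v² ≤ C v`
because the variance of `Y²` is nonnegative. The error is linear in `v`, so errors of independent
increments add up to a multiple of the total variance. -/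
lemma norm_charFun_centered_sub_le {Y : Ω → ℝ} (hY : MemLp Y 4 P) (h0 : ∫ ω, Y ω ∂P = 0)
    {C : ℝ} (hC : ∫ ω, Y ω ^ 4 ∂P ≤ C * ∫ ω, Y ω ^ 2 ∂P) (hC0 : 0 ≤ C) (u : ℝ) :
    ‖charFun (P.map Y) u - Real.exp (-(u ^ 2 * (∫ ω, Y ω ^ 2 ∂P) / 2))‖
      ≤ (4 + 4 * C) * (|u| ^ 3 + u ^ 4) * ∫ ω, Y ω ^ 2 ∂P := by
  have i1 : Integrable Y P := (hY.mono_exponent (by norm_num : (1 : ENNReal) ≤ 4)).integrable le_rfl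
  have i2 : Integrable (fun ω => Y ω ^ 2) P :=
    (hY.mono_exponent (by norm_num : (2 : ENNReal) ≤ 4)).integrable_sq
  have i4 : Integrable (fun ω => Y ω ^ 4) P := by
    have := hY.integrable_norm_pow (p := 4) (by norm_num)
    refine this.congr (ae_of_all _ fun ω => ?_)
    simp [Real.norm_eq_abs, Even.pow_abs (show Even 4 by decide)]
  have p3 (y : ℝ) : |y| ^ 3 ≤ (y ^ 2 + y ^ 4) := by
    have e2 : y ^ 2 = |y| ^ 2 := (sq_abs y).symm
    have e4 : y ^ 4 = |y| ^ 4 := (Even.pow_abs (show Even 4 by decide) y).symm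
    rw [e2, e4]
    nlinarith [sq_nonneg (|y| - |y| ^ 2), abs_nonneg y, pow_nonneg (abs_nonneg y) 3]
  have i3 : Integrable (fun ω => |Y ω| ^ 3) P := by
    refine (i2.add i4).mono' (by have := hY.aestronglyMeasurable; fun_prop) (ae_of_all _ fun ω => ?_)
    rw [Real.norm_of_nonneg (by positivity)]
    exact p3 _
  set v := ∫ ω, Y ω ^ 2 ∂P with hv
  have hv0 : 0 ≤ v := integral_nonneg fun ω => sq_nonneg _
  have hthird : ∫ ω, |Y ω| ^ 3 ∂P ≤ (1 + C) * v := by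
    have : ∫ ω, |Y ω| ^ 3 ∂P ≤ ∫ ω, (Y ω ^ 2 + Y ω ^ 4) ∂P :=
      integral_mono i3 (i2.add i4) fun ω => p3 _
    rw [integral_add i2 i4] at this
    linarith
  have hvv : v ^ 2 ≤ C * v := by
    have := variance_nonneg (fun ω => Y ω ^ 2) P
    rw [variance_eq_sub] at this
    · simp only [Pi.pow_apply] at this
      have e : ∀ ω, (Y ω ^ 2) ^ 2 = Y ω ^ 4 := fun ω => by ring
      simp only [e] at this
      linarith
    · have := hY.aestronglyMeasurable
      rw [memLp_two_iff_integrable_sq (by fun_prop)]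
      exact i4.congr (ae_of_all _ fun ω => by ring)
  have h1 : charFun (P.map Y) u - (1 - (u ^ 2 * v / 2 : ℝ) : ℂ)
      = ∫ ω, (Complex.exp ((u * Y ω : ℝ) * Complex.I)
          - (1 + (u * Y ω : ℝ) * Complex.I - (u * Y ω : ℝ) ^ 2 / 2)) ∂P := by
    have j1 : Integrable (fun ω => Complex.exp ((u * Y ω : ℝ) * Complex.I)) P := by
      refine Integrable.of_bound (C := 1) ?_ (ae_of_all _ fun ω => ?_)
      · have := hY.aestronglyMeasurable
        exact Continuous.comp_aestronglyMeasurable (g := fun y : ℝ => Complex.exp ((u * y : ℝ) * Complex.I))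
          (by fun_prop) this
      · rw [Complex.norm_exp_ofReal_mul_I]
    have j2 : Integrable (fun ω => ((u * Y ω : ℝ) * Complex.I : ℂ)) P :=
      ((i1.const_mul u).ofReal).mul_const _
    have j3 : Integrable (fun ω => ((u * Y ω : ℝ) ^ 2 / 2 : ℂ)) P := by
      refine (((i2.const_mul (u ^ 2)).ofReal (𝕜 := ℂ)).div_const 2).congr (ae_of_all _ fun ω => ?_)
      change ((u ^ 2 * Y ω ^ 2 : ℝ) : ℂ) / 2 = _
      push_cast; ring
    have j4 : Integrable (fun ω => (1 + (u * Y ω : ℝ) * Complex.I : ℂ)) P :=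
      (integrable_const _).add j2
    have j5 : Integrable (fun ω => (1 + (u * Y ω : ℝ) * Complex.I - (u * Y ω : ℝ) ^ 2 / 2 : ℂ)) P :=
      j4.sub j3
    rw [integral_sub j1 j5, integral_sub j4 j3, integral_add (integrable_const _) j2]
    rw [charFun_apply_real, integral_map hY.aestronglyMeasurable.aemeasurable (by fun_prop)]
    have k2 : ∫ ω, ((u * Y ω : ℝ) * Complex.I : ℂ) ∂P = 0 := by
      rw [integral_mul_const, integral_complex_ofReal, integral_const_mul, h0]; simp
    have k3 : ∫ ω, ((u * Y ω : ℝ) ^ 2 / 2 : ℂ) ∂P = (u ^ 2 * v / 2 : ℝ) := by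
      rw [integral_div]
      have : (fun ω => (((u * Y ω : ℝ) : ℂ) ^ 2)) = fun ω => ((u ^ 2 * Y ω ^ 2 : ℝ) : ℂ) := by
        ext ω; push_cast; ring
      rw [this, integral_complex_ofReal, integral_const_mul]
      push_cast; rfl
    rw [k2, k3]
    simp
  have h2 : ‖charFun (P.map Y) u - (1 - (u ^ 2 * v / 2 : ℝ) : ℂ)‖ ≤ 4 * |u| ^ 3 * ((1 + C) * v) := by
    rw [h1]
    refine (norm_integral_le_of_norm_le (i3.const_mul (4 * |u| ^ 3)) (ae_of_all _ fun ω => ?_)).trans ?_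
    · refine (norm_exp_mul_I_sub_taylor_le _).trans (le_of_eq ?_)
      rw [abs_mul]; ring
    · rw [integral_const_mul]
      gcongr
  have h3 : ‖(Real.exp (-(u ^ 2 * v / 2)) - (1 - (u ^ 2 * v / 2 : ℝ)) : ℂ)‖ ≤ u ^ 4 * (C * v) := by
    have := abs_exp_neg_sub_le (y := u ^ 2 * v / 2) (by positivity)
    rw [← Complex.ofReal_one, ← Complex.ofReal_sub, ← Complex.ofReal_sub, Complex.norm_real,
      Real.norm_eq_abs]
    refine this.trans ?_
    calc (u ^ 2 * v / 2) ^ 2 = u ^ 4 * (v ^ 2 / 4) := by ring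
      _ ≤ u ^ 4 * (C * v) := by gcongr; nlinarith [sq_nonneg v]
  calc _ = ‖(charFun (P.map Y) u - (1 - (u ^ 2 * v / 2 : ℝ) : ℂ))
        - (Real.exp (-(u ^ 2 * v / 2)) - (1 - (u ^ 2 * v / 2 : ℝ)) : ℂ)‖ := by congr 1; ring
    _ ≤ 4 * |u| ^ 3 * ((1 + C) * v) + u ^ 4 * (C * v) := (norm_sub_le _ _).trans (add_le_add h2 h3)
    _ ≤ _ := by
      have : 0 ≤ u ^ 4 * v * (4 + 3 * C) := by positivity
      nlinarith

/-- A Lyapunov central limit theorem for partial sums whose increments are independent of the past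
and have fourth central moments dominated by their variances. -/
theorem tendstoInDistribution_of_fourth_moment_le_variance {R : ℕ → Ω → ℝ} (h0 : R 0 =ᵐ[P] 0)
    (hL : ∀ n, MemLp (R n) 4 P)
    (hind : ∀ n, IndepFun (R n) (fun ω => R (n + 1) ω - R n ω) P) {C : ℝ}
    (hC : ∀ n, ∫ ω, (R (n + 1) ω - R n ω - ∫ ω', (R (n + 1) ω' - R n ω') ∂P) ^ 4 ∂P
      ≤ C * variance (fun ω => R (n + 1) ω - R n ω) P)
    (hvar : Tendsto (fun n => variance (R n) P) atTop atTop) :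
    TendstoInDistribution (fun n ω => (R n ω - ∫ ω', R n ω' ∂P) / √(variance (R n) P))
      atTop id (fun _ => P) (gaussianReal 0 1) := by
  wlog hC0 : 0 ≤ C generalizing C
  · exact this (C := |C|) (fun n => (hC n).trans (by
      gcongr; exacts [variance_nonneg _ _, le_abs_self C])) (abs_nonneg C)
  have i1 (n : ℕ) : Integrable (R n) P :=
    ((hL n).mono_exponent (by norm_num : (1 : ENNReal) ≤ 4)).integrable le_rfl
  have l2 (n : ℕ) : MemLp (R n) 2 P := (hL n).mono_exponent (by norm_num : (2 : ENNReal) ≤ 4)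
  have lY (n : ℕ) : MemLp (fun ω => R (n + 1) ω - R n ω) 4 P := (hL (n + 1)).sub (hL n)
  have lY2 (n : ℕ) : MemLp (fun ω => R (n + 1) ω - R n ω) 2 P := (l2 (n + 1)).sub (l2 n)
  set Y : ℕ → Ω → ℝ := fun n ω => R (n + 1) ω - R n ω - ∫ ω', (R (n + 1) ω' - R n ω') ∂P with hYdef
  -- Errors add over independent increments: for numbers of modulus at most one, `|ab - a'b'| ≤ |a -
  -- a'| + |b - b'|`, and on both sides the variances add.
  have key (n : ℕ) (u : ℝ) : ‖charFun (P.map fun ω => R n ω - ∫ ω', R n ω' ∂P) u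
      - Real.exp (-(u ^ 2 * variance (R n) P / 2))‖
      ≤ (4 + 4 * C) * (|u| ^ 3 + u ^ 4) * variance (R n) P := by
    induction n with
    | zero =>
      have e0 : ∫ ω', R 0 ω' ∂P = 0 := by rw [integral_congr_ae h0]; simp
      have e1 : variance (R 0) P = 0 := by rw [variance_congr h0]; simp
      rw [e0, e1, Measure.map_congr (g := fun _ => (0 : ℝ)) (h0.mono fun ω h => by simpa using h)]
      simp
    | succ n ih =>
      have hsplit : (fun ω => R (n + 1) ω - ∫ ω', R (n + 1) ω' ∂P)
          = fun ω => (R n ω - ∫ ω', R n ω' ∂P) + Y n ω := by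
        ext ω
        simp only [hYdef]
        rw [integral_sub (i1 _) (i1 _)]
        ring
      have hi : IndepFun (fun ω => R n ω - ∫ ω', R n ω' ∂P) (Y n) P :=
        (hind n).comp (φ := fun x => x - ∫ ω', R n ω' ∂P)
          (ψ := fun x => x - ∫ ω', (R (n + 1) ω' - R n ω') ∂P) (by fun_prop) (by fun_prop)
      have hvs : variance (R (n + 1)) P
          = variance (R n) P + variance (fun ω => R (n + 1) ω - R n ω) P := by
        rw [← IndepFun.variance_fun_add (l2 n) (lY2 n) (hind n)]
        congr 1; ext ω; ring
      have hvY : ∫ ω, Y n ω ^ 2 ∂P = variance (fun ω => R (n + 1) ω - R n ω) P := by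
        rw [variance_eq_integral (lY n).aestronglyMeasurable.aemeasurable]
      have mY : MemLp (Y n) 4 P := (lY n).sub (memLp_const _)
      have hb := norm_charFun_centered_sub_le mY
        (by simp only [hYdef]; rw [integral_sub ((lY n).integrable (by norm_num)) (integrable_const _)]; simp)
        (C := C) (by rw [hvY]; exact hC n) hC0 u
      rw [hvY] at hb
      rw [hsplit, hi.charFun_map_fun_add_eq_mul
        ((i1 n).aemeasurable.sub_const _) mY.aestronglyMeasurable.aemeasurable, Pi.mul_apply, hvs]
      set a := charFun (P.map fun ω => R n ω - ∫ ω', R n ω' ∂P) u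
      set b := charFun (P.map (Y n)) u with hbdef
      set v := variance (R n) P
      set w := variance (fun ω => R (n + 1) ω - R n ω) P
      have hb1 : ‖b‖ ≤ 1 := by
        have : IsProbabilityMeasure (P.map (Y n)) :=
          Measure.isProbabilityMeasure_map mY.aestronglyMeasurable.aemeasurable
        exact norm_charFun_le_one _
      have hv0 : 0 ≤ v := variance_nonneg _ _
      have he : ‖((Real.exp (-(u ^ 2 * v / 2)) : ℝ) : ℂ)‖ ≤ 1 := by
        rw [Complex.norm_real, Real.norm_of_nonneg (Real.exp_pos _).le, Real.exp_le_one_iff]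
        have : 0 ≤ u ^ 2 * v / 2 := by positivity
        linarith
      have hexp : Real.exp (-(u ^ 2 * (v + w) / 2))
          = Real.exp (-(u ^ 2 * v / 2)) * Real.exp (-(u ^ 2 * w / 2)) := by
        rw [← Real.exp_add]; congr 1; ring
      rw [hexp]
      push_cast only [Complex.ofReal_mul]
      calc _ = ‖(a - (Real.exp (-(u ^ 2 * v / 2)) : ℝ)) * b
            + (Real.exp (-(u ^ 2 * v / 2)) : ℝ) * (b - (Real.exp (-(u ^ 2 * w / 2)) : ℝ))‖ := by
              congr 1; ring
        _ ≤ ‖(a - (Real.exp (-(u ^ 2 * v / 2)) : ℝ))‖ * 1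
            + 1 * ‖(b - (Real.exp (-(u ^ 2 * w / 2)) : ℝ))‖ := by
              refine (norm_add_le _ _).trans ?_
              rw [norm_mul, norm_mul]
              gcongr
        _ ≤ _ := by linarith
  have hm (n : ℕ) : AEMeasurable (fun ω => (R n ω - ∫ ω', R n ω' ∂P) / √(variance (R n) P)) P :=
    ((i1 n).aemeasurable.sub_const _).div_const _
  refine ⟨hm, aemeasurable_id, ?_⟩
  refine ProbabilityMeasure.tendsto_iff_tendsto_charFun.2 fun t => ?_
  simp only [ProbabilityMeasure.coe_mk, Measure.map_id, charFun_gaussianReal]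
  have hsq : Tendsto (fun n => √(variance (R n) P)) atTop atTop :=
    Real.tendsto_sqrt_atTop.comp hvar
  have hlim : Tendsto (fun n => (4 + 4 * C) * (|t| ^ 3 * (√(variance (R n) P))⁻¹
      + t ^ 4 * ((√(variance (R n) P))⁻¹) ^ 2)) atTop (𝓝 0) := by
    have := hsq.inv_tendsto_atTop
    have h2 := ((this.const_mul (|t| ^ 3)).add ((this.pow 2).const_mul (t ^ 4))).const_mul (4 + 4 * C)
    simpa using h2
  rw [tendsto_iff_norm_sub_tendsto_zero]
  refine squeeze_zero' (Eventually.of_forall fun n => norm_nonneg _) ?_ hlim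
  filter_upwards [hvar.eventually_gt_atTop 0] with n hn
  set s := √(variance (R n) P) with hs
  have hs0 : 0 < s := Real.sqrt_pos.2 hn
  have hs2 : variance (R n) P = s ^ 2 := (Real.sq_sqrt hn.le).symm
  have e1 : (P.map fun ω => (R n ω - ∫ ω', R n ω' ∂P) / s)
      = P.map fun ω => s⁻¹ * (R n ω - ∫ ω', R n ω' ∂P) := by
    congr 1; ext ω; rw [div_eq_inv_mul]
  rw [e1, charFun_map_mul_comp ((i1 n).aemeasurable.sub_const _)]
  -- At `u = t / s`, with `s²` the variance, the Gaussian exponent is `-t² / 2` and the error is a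
  -- constant times `|t|³ / s + t⁴ / s²`.
  have := key n (s⁻¹ * t)
  rw [hs2] at this
  have e2 : (s⁻¹ * t) ^ 2 * s ^ 2 / 2 = t ^ 2 / 2 := by field_simp
  rw [e2] at this
  refine (le_of_eq ?_).trans (this.trans (le_of_eq ?_))
  · congr 2; push_cast; congr 1; simp
  · rw [abs_mul, abs_of_pos (inv_pos.2 hs0)]
    field_simp
end

/-! ### Moments after adding a conditionally centered and independent step. -/

section

variable {Ω : Type*} [MeasurableSpace Ω]

lemma integrable_pow_of_memLp {ν : Measure Ω} [IsFiniteMeasure ν] {f : Ω → ℝ} {N : ℕ}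
    (hf : MemLp f N ν) {k : ℕ} (hk : k ≤ N) : Integrable (fun ω => f ω ^ k) ν := by
  have h1 : MemLp f k ν := hf.mono_exponent (by exact_mod_cast hk)
  have h2 := h1.integrable_norm_pow'
  have := hf.aestronglyMeasurable
  exact h2.mono (by fun_prop) (ae_of_all _ fun ω => by simp)

/-- Second and fourth moments after adding an independent centered variable. -/
lemma moments_add_of_indepFun {ν : Measure Ω} [IsProbabilityMeasure ν] {M D : Ω → ℝ}
    (hMD : IndepFun M D ν) (hM : MemLp M 4 ν) (hD : MemLp D 4 ν) (hD0 : ∫ ω, D ω ∂ν = 0)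
    {B ε₁ ε₂ : ℝ} (hB : 0 ≤ B) (hε₂ : 0 ≤ ε₂) (h2 : ∫ ω, D ω ^ 2 ∂ν ≤ ε₁)
    (h3 : ∫ ω, |D ω| ^ 3 ∂ν ≤ B * (∫ ω, D ω ^ 2 ∂ν) + ε₂)
    (h4 : ∫ ω, D ω ^ 4 ∂ν ≤ B ^ 2 * (∫ ω, D ω ^ 2 ∂ν) + ε₂) :
    ∫ ω, (M ω + D ω) ^ 2 ∂ν = (∫ ω, M ω ^ 2 ∂ν) + ∫ ω, D ω ^ 2 ∂ν ∧
    ∫ ω, (M ω + D ω) ^ 4 ∂ν ≤ (∫ ω, M ω ^ 4 ∂ν)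
      + ((6 + 2 * B) * ε₁ + 2 * ε₂) * (∫ ω, M ω ^ 2 ∂ν)
      + (2 * B + B ^ 2) * (∫ ω, D ω ^ 2 ∂ν) + 3 * ε₂ := by
  have hM' : MemLp M (4 : ℕ) ν := by exact_mod_cast hM
  have hD' : MemLp D (4 : ℕ) ν := by exact_mod_cast hD
  have iM (k : ℕ) (hk : k ≤ 4) := integrable_pow_of_memLp hM' hk
  have iD (k : ℕ) (hk : k ≤ 4) := integrable_pow_of_memLp hD' hk
  have hind (a b : ℕ) : IndepFun (fun ω => M ω ^ a) (fun ω => D ω ^ b) ν :=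
    hMD.comp (φ := fun x => x ^ a) (ψ := fun x => x ^ b) (by fun_prop) (by fun_prop)
  have iMD (a b : ℕ) (ha : a ≤ 4) (hb : b ≤ 4) : Integrable (fun ω => M ω ^ a * D ω ^ b) ν :=
    (hind a b).integrable_mul (iM a ha) (iD b hb)
  have eMD (a b : ℕ) (ha : a ≤ 4) (hb : b ≤ 4) :
      ∫ ω, M ω ^ a * D ω ^ b ∂ν = (∫ ω, M ω ^ a ∂ν) * ∫ ω, D ω ^ b ∂ν :=
    (hind a b).integral_fun_mul_eq_mul_integral (iM a ha).aestronglyMeasurable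
      (iD b hb).aestronglyMeasurable
  have hD1 : ∫ ω, D ω ^ 1 ∂ν = 0 := by simpa using hD0
  have m2 : 0 ≤ ∫ ω, M ω ^ 2 ∂ν := integral_nonneg fun ω => sq_nonneg _
  have d2 : 0 ≤ ∫ ω, D ω ^ 2 ∂ν := integral_nonneg fun ω => sq_nonneg _
  constructor
  · have e : ∀ ω, (M ω + D ω) ^ 2 = (M ω ^ 2 + 2 * (M ω ^ 1 * D ω ^ 1)) + D ω ^ 2 := fun ω => by ring
    simp_rw [e]
    have j1 := (iMD 1 1 (by norm_num) (by norm_num)).const_mul 2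
    rw [integral_add ((iM 2 (by norm_num)).fun_add j1) (iD 2 (by norm_num)),
      integral_add (iM 2 (by norm_num)) j1, integral_const_mul, eMD 1 1 (by norm_num) (by norm_num), hD1]
    ring
  · have e : ∀ ω, (M ω + D ω) ^ 4 = (((M ω ^ 4 + 4 * (M ω ^ 3 * D ω ^ 1)) + 6 * (M ω ^ 2 * D ω ^ 2))
        + 4 * (M ω ^ 1 * D ω ^ 3)) + D ω ^ 4 := fun ω => by ring
    simp_rw [e]
    have j1 := (iMD 3 1 (by norm_num) (by norm_num)).const_mul 4
    have j2 := (iMD 2 2 (by norm_num) (by norm_num)).const_mul 6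
    have j3 := (iMD 1 3 (by norm_num) (by norm_num)).const_mul 4
    have k1 := (iM 4 le_rfl).fun_add j1
    have k2 := k1.fun_add j2
    have k3 := k2.fun_add j3
    rw [integral_add k3 (iD 4 le_rfl), integral_add k2 j3, integral_add k1 j2,
      integral_add (iM 4 le_rfl) j1]
    simp only [integral_const_mul]
    rw [eMD 3 1 (by norm_num) (by norm_num), eMD 2 2 (by norm_num) (by norm_num),
      eMD 1 3 (by norm_num) (by norm_num), hD1]
    -- `M` is not assumed centered, since a martingale is not centered once its current state is
    -- fixed. So the cross term `E M · E D³` survives. The constant in this bound produces the terms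
    -- of the conclusion that carry no factor `E M²`.
    have hM1 : |∫ ω, M ω ^ 1 ∂ν| ≤ ((∫ ω, M ω ^ 2 ∂ν) + 1) / 2 := by
      have hle : ∫ ω, |M ω ^ 1| ∂ν ≤ ∫ ω, (M ω ^ 2 + 1) / 2 ∂ν := by
        refine integral_mono (iM 1 (by norm_num)).abs
          (((iM 2 (by norm_num)).add (integrable_const _)).div_const _) fun ω => ?_
        have := sq_nonneg (|M ω| - 1)
        simp only [pow_one]
        nlinarith [sq_abs (M ω)]
      rw [integral_div, integral_add (iM 2 (by norm_num)) (integrable_const _)] at hle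
      simp only [integral_const, probReal_univ, smul_eq_mul, mul_one] at hle
      exact (abs_integral_le_integral_abs).trans hle
    have hD3 : |∫ ω, D ω ^ 3 ∂ν| ≤ B * (∫ ω, D ω ^ 2 ∂ν) + ε₂ := by
      refine (abs_integral_le_integral_abs).trans ?_
      simpa only [abs_pow] using h3
    have hprod : (∫ ω, M ω ^ 1 ∂ν) * (∫ ω, D ω ^ 3 ∂ν)
        ≤ ((∫ ω, M ω ^ 2 ∂ν) + 1) / 2 * (B * (∫ ω, D ω ^ 2 ∂ν) + ε₂) := by
      refine (le_abs_self _).trans ?_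
      rw [abs_mul]
      exact mul_le_mul hM1 hD3 (abs_nonneg _) (by positivity)
    have hx : (∫ ω, M ω ^ 2 ∂ν) * (∫ ω, D ω ^ 2 ∂ν) ≤ (∫ ω, M ω ^ 2 ∂ν) * ε₁ := by gcongr
    have hy : B * ((∫ ω, M ω ^ 2 ∂ν) * (∫ ω, D ω ^ 2 ∂ν)) ≤ B * ((∫ ω, M ω ^ 2 ∂ν) * ε₁) := by gcongr
    nlinarith

variable {P : Measure Ω}
variable {S : Type*} [Fintype S] [MeasurableSpace S] [DiscreteMeasurableSpace S]

lemma memLp_cond {f : Ω → ℝ} {p : ENNReal} (hf : MemLp f p P) (A : Set Ω) :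
    MemLp f p (P[|A]) := by
  by_cases h : P A = 0
  · rw [ProbabilityTheory.cond_eq_zero_of_meas_eq_zero h]
    simp
  · exact (hf.restrict A).smul_measure (by simp [h])

variable [IsProbabilityMeasure P]

lemma integral_eq_sum_cond {Y : Ω → S} (hY : Measurable Y) {f : Ω → ℝ} (hf : Integrable f P) :
    ∫ ω, f ω ∂P = ∑ x, P.real (Y ⁻¹' {x}) * ∫ ω, f ω ∂P[|Y ⁻¹' {x}] := by
  conv_lhs => rw [← sum_meas_smul_cond_fiber hY P]
  rw [integral_finsetSum_measure]
  · simp [integral_smul_measure, Measure.real]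
  · intro x _
    refine Integrable.smul_measure ?_ (measure_ne_top _ _)
    exact memLp_one_iff_integrable.1 (memLp_cond (memLp_one_iff_integrable.2 hf) _)

/-- Second and fourth moments after adding a variable that is centered and independent given a
finite-valued variable. -/
lemma moments_add_of_condIndepFun {Y : Ω → S} (hY : Measurable Y) {M D : Ω → ℝ}
    (hM : MemLp M 4 P) (hD : MemLp D 4 P) {B ε₁ ε₂ : ℝ} (hB : 0 ≤ B) (hε₂ : 0 ≤ ε₂)
    (h : ∀ x, P (Y ⁻¹' {x}) ≠ 0 → IndepFun M D P[|Y ⁻¹' {x}] ∧ ∫ ω, D ω ∂P[|Y ⁻¹' {x}] = 0 ∧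
      ∫ ω, D ω ^ 2 ∂P[|Y ⁻¹' {x}] ≤ ε₁ ∧
      ∫ ω, |D ω| ^ 3 ∂P[|Y ⁻¹' {x}] ≤ B * (∫ ω, D ω ^ 2 ∂P[|Y ⁻¹' {x}]) + ε₂ ∧
      ∫ ω, D ω ^ 4 ∂P[|Y ⁻¹' {x}] ≤ B ^ 2 * (∫ ω, D ω ^ 2 ∂P[|Y ⁻¹' {x}]) + ε₂) :
    ∫ ω, D ω ∂P = 0 ∧
    ∫ ω, (M ω + D ω) ^ 2 ∂P = (∫ ω, M ω ^ 2 ∂P) + ∫ ω, D ω ^ 2 ∂P ∧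
    ∫ ω, (M ω + D ω) ^ 4 ∂P ≤ (∫ ω, M ω ^ 4 ∂P)
      + ((6 + 2 * B) * ε₁ + 2 * ε₂) * (∫ ω, M ω ^ 2 ∂P)
      + (2 * B + B ^ 2) * (∫ ω, D ω ^ 2 ∂P) + 3 * ε₂ := by
  have hM' : MemLp M (4 : ℕ) P := by exact_mod_cast hM
  have hD' : MemLp D (4 : ℕ) P := by exact_mod_cast hD
  have hMD' : MemLp (fun ω => M ω + D ω) (4 : ℕ) P := hM'.add hD'
  have iM (k : ℕ) (hk : k ≤ 4) := integrable_pow_of_memLp hM' hk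
  have iD (k : ℕ) (hk : k ≤ 4) := integrable_pow_of_memLp hD' hk
  have iMD (k : ℕ) (hk : k ≤ 4) := integrable_pow_of_memLp hMD' hk
  have step (x : S) (hx : P (Y ⁻¹' {x}) ≠ 0) := by
    have : IsProbabilityMeasure P[|Y ⁻¹' {x}] := cond_isProbabilityMeasure hx
    obtain ⟨h1, h2, h3, h4, h5⟩ := h x hx
    exact moments_add_of_indepFun h1 (memLp_cond hM _) (memLp_cond hD _) h2 hB hε₂ h3 h4 h5
  have hone : ∑ x, P.real (Y ⁻¹' {x}) = 1 := by
    have := integral_eq_sum_cond hY (f := fun _ => (1 : ℝ)) (integrable_const _ (μ := P))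
    simp only [integral_const, probReal_univ, smul_eq_mul, mul_one] at this
    rw [this]
    refine Finset.sum_congr rfl fun x _ => ?_
    by_cases hx : P (Y ⁻¹' {x}) = 0
    · simp [Measure.real, hx]
    · have : IsProbabilityMeasure P[|Y ⁻¹' {x}] := cond_isProbabilityMeasure hx
      simp
  refine ⟨?_, ?_, ?_⟩
  · rw [integral_eq_sum_cond hY (by simpa using iD 1 (by norm_num))]
    refine Finset.sum_eq_zero fun x _ => ?_
    by_cases hx : P (Y ⁻¹' {x}) = 0
    · simp [Measure.real, hx]
    · rw [(h x hx).2.1, mul_zero]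
  · rw [integral_eq_sum_cond hY (iMD 2 (by norm_num)), integral_eq_sum_cond hY (iM 2 (by norm_num)),
      integral_eq_sum_cond hY (iD 2 (by norm_num)), ← Finset.sum_add_distrib]
    refine Finset.sum_congr rfl fun x _ => ?_
    by_cases hx : P (Y ⁻¹' {x}) = 0
    · simp [Measure.real, hx]
    · rw [(step x hx).1]; ring
  · rw [integral_eq_sum_cond hY (iMD 4 le_rfl), integral_eq_sum_cond hY (iM 2 (by norm_num)),
      integral_eq_sum_cond hY (iD 2 (by norm_num)), integral_eq_sum_cond hY (iM 4 le_rfl)]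
    rw [Finset.mul_sum, Finset.mul_sum,
      show 3 * ε₂ = ∑ x, P.real (Y ⁻¹' {x}) * (3 * ε₂) by rw [← Finset.sum_mul, hone, one_mul],
      ← Finset.sum_add_distrib, ← Finset.sum_add_distrib, ← Finset.sum_add_distrib]
    refine Finset.sum_le_sum fun x _ => ?_
    by_cases hx : P (Y ⁻¹' {x}) = 0
    · simp [Measure.real, hx]
    · have := mul_le_mul_of_nonneg_left (step x hx).2 (measureReal_nonneg (μ := P) (s := Y ⁻¹' {x}))
      linarith

end

/-! ### Fourth moments of Markov additive processes. -/

section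

/-- Recursion on `L - j`. It supplies the conditional expectations of the reward still to come,
which are determined from the end of the cycle backwards. -/
lemma exists_backward_rec {α : Type*} (L : ℕ) (a : α) (F : ℕ → α → α) :
    ∃ V : ℕ → α, V L = a ∧ ∀ j < L, V j = F j (V (j + 1)) := by
  refine ⟨fun j => Nat.rec a (fun i v => F (L - (i + 1)) v) (L - j), by simp, fun j hj => ?_⟩
  obtain ⟨i, rfl⟩ : ∃ i, L = j + (i + 1) := ⟨L - j - 1, by omega⟩
  have e1 : j + (i + 1) - j = i + 1 := by omega
  have e2 : j + (i + 1) - (j + 1) = i := by omega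
  have e3 : j + (i + 1) - (i + 1) = j := by omega
  simp only [e1, e2, e3]

variable {Ω : Type*} [MeasurableSpace Ω] {P : Measure Ω} [IsProbabilityMeasure P]
variable {S : Type*} [Fintype S] [MeasurableSpace S] [DiscreteMeasurableSpace S]

/-- One step of a Markov additive process: bounds for the conditional moments of a variable that is
dominated by the number of events. -/
lemma step_moment_bounds {ν : Measure Ω} [IsProbabilityMeasure ν] {D : Ω → ℝ} (hD : MemLp D 4 ν)
    {n : Ω → ℕ} (hn : MemLp (fun ω => (n ω : ℝ)) 4 ν) {C₁ q Q K h : ℝ} (hC : 0 ≤ C₁) (hh : 0 ≤ h)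
    (hK : 0 ≤ K)
    (hhq : h ≤ q) (hqQ : q ≤ Q) (hDn : ∀ᵐ ω ∂ν, |D ω| ≤ C₁ * (q + n ω))
    (h4 : ∫ ω, (n ω : ℝ) ^ 4 ∂ν ≤ K * h)
    (h42 : ∫ ω, (if 2 ≤ n ω then (n ω : ℝ) ^ 4 else 0) ∂ν ≤ K * h ^ 2) :
    ∫ ω, D ω ^ 2 ∂ν ≤ 2 * C₁ ^ 2 * (Q + K) * q ∧
    ∫ ω, |D ω| ^ 3 ∂ν ≤ C₁ * (Q + 1) * (∫ ω, D ω ^ 2 ∂ν)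
      + ((C₁ * (Q + 1)) ^ 3 + (C₁ * (Q + 1)) ^ 4) * K * h ^ 2 ∧
    ∫ ω, D ω ^ 4 ∂ν ≤ (C₁ * (Q + 1)) ^ 2 * (∫ ω, D ω ^ 2 ∂ν)
      + ((C₁ * (Q + 1)) ^ 3 + (C₁ * (Q + 1)) ^ 4) * K * h ^ 2 := by
  have hQ : 0 ≤ Q := hh.trans (hhq.trans hqQ)
  have hq : 0 ≤ q := hh.trans hhq
  set B := C₁ * (Q + 1) with hBdef
  have hB : 0 ≤ B := by positivity
  have hD' : MemLp D (4 : ℕ) ν := by exact_mod_cast hD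
  have hn' : MemLp (fun ω => (n ω : ℝ)) (4 : ℕ) ν := by exact_mod_cast hn
  have iD (k : ℕ) (hk : k ≤ 4) := integrable_pow_of_memLp hD' hk
  have iN (k : ℕ) (hk : k ≤ 4) := integrable_pow_of_memLp hn' hk
  have hn24 (m : ℕ) : (m : ℝ) ^ 2 ≤ (m : ℝ) ^ 4 := by
    rcases Nat.eq_zero_or_pos m with rfl | hm
    · simp
    · exact_mod_cast Nat.pow_le_pow_right hm (by norm_num)
  set e : Ω → ℝ := fun ω => if 2 ≤ n ω then (n ω : ℝ) ^ 4 else 0 with he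
  have hnm : AEMeasurable n ν := by
    have h1 := (Nat.measurable_floor (R := ℝ)).comp_aemeasurable hn.aestronglyMeasurable.aemeasurable
    refine h1.congr (ae_of_all _ fun ω => by simp)
  have iE : Integrable e ν := by
    refine (iN 4 le_rfl).mono ?_ (ae_of_all _ fun ω => ?_)
    · exact ((measurable_from_nat (f := fun m : ℕ => if 2 ≤ m then (m : ℝ) ^ 4 else 0)).comp_aemeasurable
        hnm).aestronglyMeasurable
    · simp only [he]; split_ifs <;> simp
  -- With at most one event, `|D| ≤ B`, so higher powers reduce to the square. With two or more, `q
  -- + n ≤ (Q + 1) n` gives `|D| ≤ B n`; this part is charged to `e`, whose mean is of order `h²`.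
  have key : ∀ᵐ ω ∂ν, |D ω| ^ 3 ≤ B * D ω ^ 2 + B ^ 3 * e ω ∧
      D ω ^ 4 ≤ B ^ 2 * D ω ^ 2 + B ^ 4 * e ω := by
    filter_upwards [hDn] with ω hω
    have ha : 0 ≤ |D ω| := abs_nonneg _
    have e2 : D ω ^ 2 = |D ω| ^ 2 := (sq_abs _).symm
    have e4 : D ω ^ 4 = |D ω| ^ 4 := (Even.pow_abs (show Even 4 by decide) _).symm
    rw [e2, e4]
    by_cases h2 : 2 ≤ n ω
    · simp only [he, if_pos h2]
      have hn1 : (2 : ℝ) ≤ n ω := by exact_mod_cast h2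
      have hle : |D ω| ≤ B * n ω := hω.trans (by
        rw [hBdef, mul_assoc]; gcongr; nlinarith)
      have p3 := pow_le_pow_left₀ ha hle 3
      have p4 := pow_le_pow_left₀ ha hle 4
      have hn34 : (n ω : ℝ) ^ 3 ≤ (n ω : ℝ) ^ 4 := pow_le_pow_right₀ (by linarith) (by norm_num)
      constructor
      · calc |D ω| ^ 3 ≤ B ^ 3 * (n ω : ℝ) ^ 3 := by rw [← mul_pow]; exact p3
          _ ≤ B ^ 3 * (n ω : ℝ) ^ 4 := by gcongr
          _ ≤ _ := by nlinarith [mul_nonneg hB (sq_nonneg |D ω|)]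
      · calc |D ω| ^ 4 ≤ B ^ 4 * (n ω : ℝ) ^ 4 := by rw [← mul_pow]; exact p4
          _ ≤ _ := by nlinarith [mul_nonneg (sq_nonneg B) (sq_nonneg |D ω|)]
    · simp only [he, if_neg h2, mul_zero, add_zero]
      have hn1 : (n ω : ℝ) ≤ 1 := by exact_mod_cast (by omega : n ω ≤ 1)
      have hle : |D ω| ≤ B := hω.trans (by rw [hBdef]; gcongr)
      constructor
      · nlinarith [mul_le_mul_of_nonneg_right hle (sq_nonneg |D ω|)]
      · have := pow_le_pow_left₀ ha hle 2
        nlinarith [mul_le_mul_of_nonneg_right this (sq_nonneg |D ω|)]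
  have hKh : 0 ≤ K * h ^ 2 := by positivity
  refine ⟨?_, ?_, ?_⟩
  · calc ∫ ω, D ω ^ 2 ∂ν ≤ ∫ ω, 2 * C₁ ^ 2 * (Q * q + (n ω : ℝ) ^ 4) ∂ν := by
          refine integral_mono_ae (iD 2 (by norm_num))
            (((integrable_const _).add (iN 4 le_rfl)).const_mul _) ?_
          filter_upwards [hDn] with ω hω
          have h1 := pow_le_pow_left₀ (abs_nonneg _) hω 2
          rw [sq_abs] at h1
          have h2 : (q + n ω) ^ 2 ≤ 2 * (Q * q + (n ω : ℝ) ^ 4) := by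
            nlinarith [sq_nonneg (q - n ω), hn24 (n ω)]
          calc D ω ^ 2 ≤ (C₁ * (q + n ω)) ^ 2 := h1
            _ = C₁ ^ 2 * (q + n ω) ^ 2 := by ring
            _ ≤ C₁ ^ 2 * (2 * (Q * q + (n ω : ℝ) ^ 4)) := by gcongr
            _ = _ := by ring
      _ = 2 * C₁ ^ 2 * (Q * q + ∫ ω, (n ω : ℝ) ^ 4 ∂ν) := by
          rw [integral_const_mul, integral_add (integrable_const _) (iN 4 le_rfl)]; simp
      _ ≤ 2 * C₁ ^ 2 * (Q * q + K * q) := by gcongr; exact h4.trans (by gcongr)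
      _ = _ := by ring
  · calc ∫ ω, |D ω| ^ 3 ∂ν ≤ ∫ ω, (B * D ω ^ 2 + B ^ 3 * e ω) ∂ν := by
          refine integral_mono_ae ?_ (((iD 2 (by norm_num)).const_mul _).add (iE.const_mul _))
            (key.mono fun ω h => h.1)
          simpa only [abs_pow] using (iD 3 (by norm_num)).abs
      _ = B * (∫ ω, D ω ^ 2 ∂ν) + B ^ 3 * ∫ ω, e ω ∂ν := by
          rw [integral_add ((iD 2 (by norm_num)).const_mul _) (iE.const_mul _)]
          simp only [integral_const_mul]
      _ ≤ B * (∫ ω, D ω ^ 2 ∂ν) + B ^ 3 * (K * h ^ 2) := by gcongr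
      _ ≤ _ := by nlinarith [mul_nonneg (pow_nonneg hB 4) hKh]
  · calc ∫ ω, D ω ^ 4 ∂ν ≤ ∫ ω, (B ^ 2 * D ω ^ 2 + B ^ 4 * e ω) ∂ν :=
          integral_mono_ae (iD 4 le_rfl) (((iD 2 (by norm_num)).const_mul _).add (iE.const_mul _))
            (key.mono fun ω h => h.2)
      _ = B ^ 2 * (∫ ω, D ω ^ 2 ∂ν) + B ^ 4 * ∫ ω, e ω ∂ν := by
          rw [integral_add ((iD 2 (by norm_num)).const_mul _) (iE.const_mul _)]
          simp only [integral_const_mul]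
      _ ≤ B ^ 2 * (∫ ω, D ω ^ 2 ∂ν) + B ^ 4 * (K * h ^ 2) := by gcongr
      _ ≤ _ := by nlinarith [mul_nonneg (pow_nonneg hB 3) hKh]

/-- A Markov additive process on a time grid of `L` steps: `Y` is the state, `U` the additive part,
`n` counts events in the steps, `k` bounds the contribution of deterministic times. -/
structure IsMarkovAdditive (P : Measure Ω) (C K K₁ : ℝ) (L : ℕ) (Y : ℕ → Ω → S) (U : ℕ → Ω → ℝ)
    (n : ℕ → Ω → ℕ) (k : ℕ → ℝ) : Prop where
  measurable_Y : ∀ j, Measurable (Y j)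
  zero : U 0 = 0
  memLp_U : ∀ j, MemLp (U j) 4 P
  memLp_n : ∀ j, MemLp (fun ω => (n j ω : ℝ)) 4 P
  nonneg : ∀ j, 0 ≤ k j
  sum_le : ∑ j ∈ Finset.range L, k j ≤ K₁
  incr_le : ∀ j < L, ∀ᵐ ω ∂P, |U (j + 1) ω - U j ω| ≤ C * ((L : ℝ)⁻¹ + k j + n j ω)
  stay : ∀ j, j + 1 < L → ∀ ω, n j ω = 0 → Y (j + 1) ω = Y j ω
  moment : ∀ j < L, ∀ x, P (Y j ⁻¹' {x}) ≠ 0 →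
    ∫ ω, (n j ω : ℝ) ^ 4 ∂P[|Y j ⁻¹' {x}] ≤ K * (L : ℝ)⁻¹
  moment_two : ∀ j < L, ∀ x, P (Y j ⁻¹' {x}) ≠ 0 →
    ∫ ω, (if 2 ≤ n j ω then (n j ω : ℝ) ^ 4 else 0) ∂P[|Y j ⁻¹' {x}] ≤ K * (L : ℝ)⁻¹ ^ 2
  indep : ∀ j < L, ∀ w : S → ℝ, (j + 1 = L → w = 0) → ∀ x, P (Y j ⁻¹' {x}) ≠ 0 →
    IndepFun (U j) (fun ω => U (j + 1) ω - U j ω + w (Y (j + 1) ω)) P[|Y j ⁻¹' {x}]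

set_option maxHeartbeats 1000000 in
-- With `V j x` the conditional mean of the reward still to come from state `x` at step `j`, the
-- process `U j + V j (Y j)`, centered, is the Doob martingale of `U L`. Its steps satisfy
-- `step_moment_bounds` and are added one at a time by `moments_add_of_condIndepFun`. The second
-- moments of the steps sum to at most the final variance, the `q j` sum to at most `Q`, and the `L`
-- errors of order `h²` sum to order `h`. The last grid point stands for the next resetting time,
-- where the state is already redrawn; hence `V L = 0`, and neither `stay` nor `indep` says anything
-- about the last state.
theorem IsMarkovAdditive.exists_fourth_moment_le (P : Measure Ω) [IsProbabilityMeasure P]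
    {C K K₁ : ℝ} (hC : 0 ≤ C) (hK : 0 ≤ K) (hK₁ : 0 ≤ K₁) : ∃ A : ℝ, 0 ≤ A ∧
      ∀ (L : ℕ) (Y : ℕ → Ω → S) (U : ℕ → Ω → ℝ) (n : ℕ → Ω → ℕ) (k : ℕ → ℝ), 0 < L →
        IsMarkovAdditive P C K K₁ L Y U n k →
        ∫ ω, (U L ω - ∫ ω', U L ω' ∂P) ^ 4 ∂P ≤ A * (variance (U L) P + (L : ℝ)⁻¹) := by
  obtain ⟨Q, hQ⟩ : ∃ z, z = 1 + K₁ := ⟨_, rfl⟩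
  -- `Vb` bounds all the `V j`, `C₄ * q j` bounds the change of `V` from step `j` to the next in a
  -- fixed state, and `C₁ * (q j + n j)` bounds the martingale increment. `B` bounds that increment
  -- when there is at most one event.
  obtain ⟨Vb, hVb⟩ : ∃ z, z = C * (1 + K) * Q := ⟨_, rfl⟩
  obtain ⟨C₄, hC₄⟩ : ∃ z, z = C + (C + 2 * Vb) * K := ⟨_, rfl⟩
  obtain ⟨C₁, hC₁⟩ : ∃ z, z = C + 2 * Vb + C₄ := ⟨_, rfl⟩
  obtain ⟨B, hB⟩ : ∃ z, z = C₁ * (Q + 1) := ⟨_, rfl⟩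
  have Q0 : 0 ≤ Q := by rw [hQ]; positivity
  have Vb0 : 0 ≤ Vb := by rw [hVb]; positivity
  have C40 : 0 ≤ C₄ := by rw [hC₄]; positivity
  have C10 : 0 ≤ C₁ := by rw [hC₁]; positivity
  have B0 : 0 ≤ B := by rw [hB]; positivity
  obtain ⟨E, hE⟩ : ∃ z, z = (B ^ 3 + B ^ 4) * K := ⟨_, rfl⟩
  have E0 : 0 ≤ E := by rw [hE]; positivity
  refine ⟨4 * Vb ^ 2 + ((6 + 2 * B) * (2 * C₁ ^ 2 * (Q + K) * Q) + 2 * E) + (2 * B + B ^ 2) + 3 * E,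
    by positivity, fun L Y U n k hL H => ?_⟩
  set h := (L : ℝ)⁻¹ with hh
  have L0 : (0 : ℝ) < L := by exact_mod_cast hL
  have h0 : 0 < h := by positivity
  have h1 : h ≤ 1 := inv_le_one_of_one_le₀ (by exact_mod_cast hL)
  have hLh : L * h = 1 := mul_inv_cancel₀ L0.ne'
  set q : ℕ → ℝ := fun j => h + k j with hq
  have hq0 (j : ℕ) : h ≤ q j := by simp only [hq]; linarith [H.nonneg j]
  have hqsum : ∑ j ∈ Finset.range L, q j ≤ Q := by
    simp only [hq]
    rw [Finset.sum_add_distrib]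
    simp only [Finset.sum_const, Finset.card_range, nsmul_eq_mul]
    rw [hLh]; linarith [H.sum_le]
  have hqQ (j : ℕ) (hj : j < L) : q j ≤ Q :=
    (Finset.single_le_sum (f := q) (fun i _ => h0.le.trans (hq0 i)) (Finset.mem_range.2 hj)).trans hqsum
  -- conditional expectations of the future
  obtain ⟨V, hVL, hV⟩ := exists_backward_rec L (0 : S → ℝ) fun j v x =>
    ∫ ω, (U (j + 1) ω - U j ω + v (Y (j + 1) ω)) ∂P[|Y j ⁻¹' {x}]
  have meas_comp (v : S → ℝ) (j : ℕ) : Measurable fun ω => v (Y j ω) :=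
    (measurable_of_finite v).comp (H.measurable_Y j)
  have lp_comp (v : S → ℝ) (j : ℕ) : MemLp (fun ω => v (Y j ω)) 4 P := by
    refine MemLp.of_bound (meas_comp v j).aestronglyMeasurable (∑ x, |v x|) (ae_of_all _ fun ω => ?_)
    exact Finset.single_le_sum (f := fun x => |v x|) (fun _ _ => abs_nonneg _) (Finset.mem_univ _)
  have lpζ (j : ℕ) : MemLp (fun ω => U (j + 1) ω - U j ω) 4 P := (H.memLp_U (j + 1)).sub (H.memLp_U j)
  have lpη (v : S → ℝ) (j : ℕ) : MemLp (fun ω => U (j + 1) ω - U j ω + v (Y (j + 1) ω)) 4 P :=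
    (lpζ j).add (lp_comp v (j + 1))
  have int_cond {f : Ω → ℝ} (hf : MemLp f 4 P) (A : Set Ω) (hA : P A ≠ 0) : Integrable f P[|A] := by
    have : IsProbabilityMeasure P[|A] := cond_isProbabilityMeasure hA
    exact (memLp_cond hf A).integrable (by norm_num)
  have hn1 (j : ℕ) (hj : j < L) (x : S) (hx : P (Y j ⁻¹' {x}) ≠ 0) :
      ∫ ω, (n j ω : ℝ) ∂P[|Y j ⁻¹' {x}] ≤ K * h := by
    have : IsProbabilityMeasure P[|Y j ⁻¹' {x}] := cond_isProbabilityMeasure hx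
    refine (integral_mono (int_cond (H.memLp_n j) _ hx) ?_ fun ω => ?_).trans (H.moment j hj x hx)
    · have : MemLp (fun ω => (n j ω : ℝ)) (4 : ℕ) P[|Y j ⁻¹' {x}] := by
        exact_mod_cast memLp_cond (H.memLp_n j) _
      exact integrable_pow_of_memLp this le_rfl
    · have := Nat.le_self_pow (n := 4) (by norm_num) (n j ω)
      exact (Nat.cast_le.2 this).trans (le_of_eq (by push_cast; rfl))
  have ae_cond (j : ℕ) (hj : j < L) (x : S) :
      ∀ᵐ ω ∂P[|Y j ⁻¹' {x}], Y j ω = x ∧ |U (j + 1) ω - U j ω| ≤ C * (q j + n j ω) := by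
    have hs : MeasurableSet (Y j ⁻¹' {x}) := H.measurable_Y j (measurableSet_singleton x)
    filter_upwards [ae_cond_mem hs, cond_absolutelyContinuous.ae_le (H.incr_le j hj)] with ω h1 h2
    exact ⟨h1, h2⟩
  have zero_cond (j : ℕ) (x : S) (f : Ω → ℝ) (hx : P (Y j ⁻¹' {x}) = 0) :
      ∫ ω, f ω ∂P[|Y j ⁻¹' {x}] = 0 := by
    rw [ProbabilityTheory.cond_eq_zero_of_meas_eq_zero hx, integral_zero_measure]
  -- Downward induction: a step adds at most `C (q j + E n j)`, and `E n j ≤ K h ≤ K q j`.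
  have hVbound' (i : ℕ) : ∀ j, j + i = L → ∀ x,
      |V j x| ≤ C * (1 + K) * ∑ j' ∈ Finset.Ico j L, q j' := by
    induction i with
    | zero => rintro j rfl x; simpa using congrFun hVL x
    | succ i ih =>
      intro j hj x
      have hjL : j < L := by omega
      rw [hV j hjL, Finset.sum_eq_sum_Ico_succ_bot hjL]
      have ih' := ih (j + 1) (by omega)
      have hs : 0 ≤ C * (1 + K) * ∑ j' ∈ Finset.Ico (j + 1) L, q j' :=
        mul_nonneg (by positivity) (Finset.sum_nonneg fun i _ => h0.le.trans (hq0 i))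
      by_cases hx : P (Y j ⁻¹' {x}) = 0
      · simp only [zero_cond j x _ hx, abs_zero]
        have : 0 ≤ C * (1 + K) * q j := mul_nonneg (by positivity) (h0.le.trans (hq0 j))
        linarith
      have : IsProbabilityMeasure P[|Y j ⁻¹' {x}] := cond_isProbabilityMeasure hx
      have iN := int_cond (H.memLp_n j) _ hx
      beta_reduce
      rw [← Real.norm_eq_abs]
      calc _ ≤ ∫ ω, (C * q j + C * n j ω + C * (1 + K) * ∑ j' ∈ Finset.Ico (j + 1) L, q j')
              ∂P[|Y j ⁻¹' {x}] := by
            refine norm_integral_le_of_norm_le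
              (((integrable_const _).fun_add (iN.const_mul _)).fun_add (integrable_const _)) ?_
            filter_upwards [ae_cond j hjL x] with ω hω
            refine (norm_add_le _ _).trans (add_le_add ?_ (ih' _))
            rw [← mul_add]; exact hω.2
        _ = C * q j + C * (∫ ω, (n j ω : ℝ) ∂P[|Y j ⁻¹' {x}])
              + C * (1 + K) * ∑ j' ∈ Finset.Ico (j + 1) L, q j' := by
            rw [integral_add ((integrable_const _).fun_add (iN.const_mul _)) (integrable_const _),
              integral_add (integrable_const _) (iN.const_mul _)]
            simp [integral_const_mul]
        _ ≤ C * q j + C * (K * q j) + C * (1 + K) * ∑ j' ∈ Finset.Ico (j + 1) L, q j' := by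
            gcongr
            exact (hn1 j hjL x hx).trans (by gcongr; exact hq0 j)
        _ = _ := by ring
  have hVbound (j : ℕ) (hj : j ≤ L) (x : S) : |V j x| ≤ Vb := by
    refine (hVbound' (L - j) j (by omega) x).trans ?_
    rw [hVb]
    gcongr
    refine le_trans (Finset.sum_le_sum_of_subset_of_nonneg ?_ fun i _ _ => h0.le.trans (hq0 i)) hqsum
    intro i hi; simp at hi ⊢; omega
  -- Before the last step the state moves only if there is an event; at the last step `V` vanishes.
  have hVdiff (j : ℕ) (hj : j < L) (ω : Ω) :
      |V (j + 1) (Y (j + 1) ω) - V (j + 1) (Y j ω)| ≤ 2 * Vb * n j ω := by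
    by_cases hn : n j ω = 0
    · rcases Nat.lt_or_ge (j + 1) L with h | h
      · rw [H.stay j h ω hn]; simp [hn]
      · have : j + 1 = L := by omega
        rw [this, hVL]; simp [hn]
    · have : (1 : ℝ) ≤ n j ω := by exact_mod_cast Nat.one_le_iff_ne_zero.2 hn
      have := abs_sub (V (j + 1) (Y (j + 1) ω)) (V (j + 1) (Y j ω))
      nlinarith [hVbound (j + 1) hj (Y (j + 1) ω), hVbound (j + 1) hj (Y j ω)]
  have hVstep (j : ℕ) (hj : j < L) (x : S) (hx : P (Y j ⁻¹' {x}) ≠ 0) :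
      |V j x - V (j + 1) x| ≤ C₄ * q j := by
    have : IsProbabilityMeasure P[|Y j ⁻¹' {x}] := cond_isProbabilityMeasure hx
    have iN := int_cond (H.memLp_n j) _ hx
    have e : V j x - V (j + 1) x
        = ∫ ω, (U (j + 1) ω - U j ω + V (j + 1) (Y (j + 1) ω) - V (j + 1) x) ∂P[|Y j ⁻¹' {x}] := by
      rw [integral_sub (int_cond (lpη _ j) _ hx) (integrable_const _), hV j hj]; simp
    rw [e, ← Real.norm_eq_abs]
    calc _ ≤ ∫ ω, (C * q j + (C + 2 * Vb) * n j ω) ∂P[|Y j ⁻¹' {x}] := by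
          refine norm_integral_le_of_norm_le ((integrable_const _).fun_add (iN.const_mul _)) ?_
          filter_upwards [ae_cond j hj x] with ω hω
          have h2 := hVdiff j hj ω
          rw [hω.1] at h2
          rw [add_sub_assoc]
          refine (norm_add_le _ _).trans ((add_le_add hω.2 h2).trans (le_of_eq ?_))
          ring
      _ = C * q j + (C + 2 * Vb) * ∫ ω, (n j ω : ℝ) ∂P[|Y j ⁻¹' {x}] := by
          rw [integral_add (integrable_const _) (iN.const_mul _)]; simp [integral_const_mul]
      _ ≤ C * q j + (C + 2 * Vb) * (K * q j) := by
          gcongr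
          exact (hn1 j hj x hx).trans (by gcongr; exact hq0 j)
      _ = _ := by rw [hC₄]; ring
  -- the martingale
  set c := ∫ ω, V 0 (Y 0 ω) ∂P with hc
  set M : ℕ → Ω → ℝ := fun j ω => U j ω + V j (Y j ω) - c with hM
  set D : ℕ → Ω → ℝ := fun j ω => U (j + 1) ω - U j ω + V (j + 1) (Y (j + 1) ω) - V j (Y j ω) with hD
  have hMD (j : ℕ) (ω : Ω) : M (j + 1) ω = M j ω + D j ω := by simp only [hM, hD]; ring
  have lpM (j : ℕ) : MemLp (M j) 4 P := ((H.memLp_U j).add (lp_comp _ j)).sub (memLp_const c)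
  have lpD (j : ℕ) : MemLp (D j) 4 P := (lpη _ j).sub (lp_comp _ j)
  set a : ℕ → ℝ := fun j => ∫ ω, M j ω ^ 2 ∂P with ha
  set b : ℕ → ℝ := fun j => ∫ ω, M j ω ^ 4 ∂P with hb
  set δ : ℕ → ℝ := fun j => ∫ ω, D j ω ^ 2 ∂P with hδ
  have hstep (j : ℕ) (hj : j < L) : ∫ ω, D j ω ∂P = 0 ∧ a (j + 1) = a j + δ j ∧
      b (j + 1) ≤ b j + ((6 + 2 * B) * (2 * C₁ ^ 2 * (Q + K) * q j) + 2 * (E * h ^ 2)) * a j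
        + (2 * B + B ^ 2) * δ j + 3 * (E * h ^ 2) := by
    simp only [ha, hb, hδ, hMD]
    refine moments_add_of_condIndepFun (H.measurable_Y j) (lpM j) (lpD j) B0 (by positivity) ?_
    intro x hx
    have : IsProbabilityMeasure P[|Y j ⁻¹' {x}] := cond_isProbabilityMeasure hx
    have hD_ae : D j =ᵐ[P[|Y j ⁻¹' {x}]]
        fun ω => U (j + 1) ω - U j ω + V (j + 1) (Y (j + 1) ω) - V j x := by
      filter_upwards [ae_cond j hj x] with ω hω
      simp only [hD, hω.1]
    have hM_ae : M j =ᵐ[P[|Y j ⁻¹' {x}]] fun ω => U j ω + (V j x - c) := by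
      filter_upwards [ae_cond j hj x] with ω hω
      simp only [hM, hω.1]; ring
    have hbd : ∀ᵐ ω ∂P[|Y j ⁻¹' {x}], |D j ω| ≤ C₁ * (q j + n j ω) := by
      filter_upwards [ae_cond j hj x, hD_ae] with ω hω h2
      rw [h2]
      have h3 := hVdiff j hj ω
      rw [hω.1] at h3
      have h4 := hVstep j hj x hx
      rw [abs_sub_comm] at h4
      have e : U (j + 1) ω - U j ω + V (j + 1) (Y (j + 1) ω) - V j x
        = (U (j + 1) ω - U j ω) + (V (j + 1) (Y (j + 1) ω) - V (j + 1) x)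
          + (V (j + 1) x - V j x) := by ring
      rw [e]
      refine (abs_add_le _ _).trans ((add_le_add ((abs_add_le _ _).trans
        (add_le_add hω.2 h3)) h4).trans ?_)
      have q0 : 0 ≤ q j := h0.le.trans (hq0 j)
      have n0 : (0 : ℝ) ≤ n j ω := Nat.cast_nonneg _
      rw [hC₁]
      nlinarith [mul_nonneg C40 n0, mul_nonneg Vb0 q0]
    obtain ⟨s1, s2, s3⟩ := step_moment_bounds (memLp_cond (lpD j) _) (memLp_cond (H.memLp_n j) _)
      C10 h0.le hK (hq0 j) (hqQ j hj) hbd (H.moment j hj x hx) (H.moment_two j hj x hx)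
    rw [← hB, ← hE] at s2 s3
    refine ⟨?_, ?_, s1, s2, s3⟩
    · refine IndepFun.congr ?_ hM_ae.symm hD_ae.symm
      refine (H.indep j hj (V (j + 1)) (fun e => by rw [e, hVL]) x hx).comp
        (φ := fun y => y + (V j x - c)) (ψ := fun y => y - V j x) (by fun_prop) (by fun_prop)
    · rw [integral_congr_ae hD_ae, integral_sub (int_cond (lpη _ j) _ hx) (integrable_const _), hV j hj]
      simp
  have a0 (j : ℕ) : 0 ≤ a j := integral_nonneg fun ω => sq_nonneg _
  have δ0 (j : ℕ) : 0 ≤ δ j := integral_nonneg fun ω => sq_nonneg _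
  have ha_le (i : ℕ) : ∀ j, j + i = L → a j ≤ a L := by
    induction i with
    | zero => rintro j rfl; rfl
    | succ i ih =>
      intro j hj
      have := (hstep j (by omega)).2.1
      linarith [ih (j + 1) (by omega), δ0 j]
  have hind (j : ℕ) : j ≤ L → ∫ ω, M j ω ∂P = 0 ∧ a j = a 0 + ∑ i ∈ Finset.range j, δ i ∧
      b j ≤ b 0 + ∑ i ∈ Finset.range j, (((6 + 2 * B) * (2 * C₁ ^ 2 * (Q + K) * q i)
        + 2 * (E * h ^ 2)) * a L + (2 * B + B ^ 2) * δ i + 3 * (E * h ^ 2)) := by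
    induction j with
    | zero =>
      intro _
      refine ⟨?_, by simp, by simp⟩
      simp only [hM, H.zero, Pi.zero_apply, zero_add]
      rw [integral_sub ((lp_comp _ 0).integrable (by norm_num)) (integrable_const _)]
      simp [hc]
    | succ j ih =>
      intro hj
      obtain ⟨i1, i2, i3⟩ := ih (by omega)
      obtain ⟨t1, t2, t3⟩ := hstep j (by omega)
      refine ⟨?_, ?_, ?_⟩
      · simp only [hMD]
        rw [integral_add ((lpM j).integrable (by norm_num)) ((lpD j).integrable (by norm_num)), i1, t1]
        simp
      · rw [t2, i2, Finset.sum_range_succ]; ring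
      · rw [Finset.sum_range_succ]
        have hq' : 0 ≤ q j := h0.le.trans (hq0 j)
        have : ((6 + 2 * B) * (2 * C₁ ^ 2 * (Q + K) * q j) + 2 * (E * h ^ 2)) * a j
            ≤ ((6 + 2 * B) * (2 * C₁ ^ 2 * (Q + K) * q j) + 2 * (E * h ^ 2)) * a L := by
          gcongr
          exact ha_le (L - j) j (by omega)
        linarith
  obtain ⟨f1, f2, f3⟩ := hind L le_rfl
  have hcU : c = ∫ ω, U L ω ∂P := by
    simp only [hM, hVL, Pi.zero_apply, add_zero] at f1
    rw [integral_sub ((H.memLp_U L).integrable (by norm_num)) (integrable_const _)] at f1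
    simp at f1; linarith
  have hML (ω : Ω) : M L ω = U L ω - ∫ ω', U L ω' ∂P := by simp only [hM, hVL, hcU]; simp
  have haL : a L = variance (U L) P := by
    rw [variance_eq_integral (H.memLp_U L).aestronglyMeasurable.aemeasurable]
    simp only [ha, hML]
  have hbL : b L = ∫ ω, (U L ω - ∫ ω', U L ω' ∂P) ^ 4 ∂P := by simp only [hb, hML]
  have hc_le : |c| ≤ Vb := by
    have := norm_integral_le_of_norm_le_const (μ := P) (f := fun ω => V 0 (Y 0 ω)) (C := Vb)
      (ae_of_all _ fun ω => hVbound 0 (by omega) (Y 0 ω))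
    simpa using this
  -- The initial value `V 0 (Y 0) - c` is bounded by `2 Vb`, so its fourth moment is at most `4 Vb²`
  -- times its second.
  have hb0 : b 0 ≤ 4 * Vb ^ 2 * a L := by
    have h2 : b 0 ≤ 4 * Vb ^ 2 * a 0 := by
      simp only [ha, hb]
      rw [← integral_const_mul]
      have hl : MemLp (M 0) (4 : ℕ) P := by exact_mod_cast lpM 0
      refine integral_mono (integrable_pow_of_memLp hl le_rfl)
        ((integrable_pow_of_memLp hl (by norm_num)).const_mul _) fun ω => ?_
      have h3 : |M 0 ω| ≤ 2 * Vb := by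
        simp only [hM, H.zero, Pi.zero_apply, zero_add]
        refine (abs_sub _ _).trans ?_
        linarith [hVbound 0 (by omega) (Y 0 ω)]
      have h4 : M 0 ω ^ 2 ≤ 4 * Vb ^ 2 := by
        have := pow_le_pow_left₀ (abs_nonneg _) h3 2
        rw [sq_abs] at this; linarith
      calc M 0 ω ^ 4 = M 0 ω ^ 2 * M 0 ω ^ 2 := by ring
        _ ≤ 4 * Vb ^ 2 * M 0 ω ^ 2 := by gcongr
    exact h2.trans (by gcongr; exact ha_le L 0 (by omega))
  have hδs : ∑ i ∈ Finset.range L, δ i ≤ a L := by linarith [a0 0]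
  rw [← hbL, ← haL]
  rw [Finset.sum_add_distrib, Finset.sum_add_distrib, ← Finset.sum_mul, Finset.sum_add_distrib,
    ← Finset.mul_sum, ← Finset.mul_sum, ← Finset.mul_sum] at f3
  simp only [Finset.sum_const, Finset.card_range, nsmul_eq_mul] at f3
  have hLh2 : 2 * ((L : ℝ) * (E * h ^ 2)) ≤ 2 * E := by
    have : 2 * ((L : ℝ) * (E * h ^ 2)) = 2 * E * h * (L * h) := by ring
    rw [this, hLh]; nlinarith
  have hLh3 : (L : ℝ) * (3 * (E * h ^ 2)) = 3 * E * h := by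
    have : (L : ℝ) * (3 * (E * h ^ 2)) = 3 * E * h * (L * h) := by ring
    rw [this, hLh, mul_one]
  have g1 : ((6 + 2 * B) * (2 * C₁ ^ 2 * (Q + K) * ∑ i ∈ Finset.range L, q i)
      + 2 * ((L : ℝ) * (E * h ^ 2))) * a L
      ≤ ((6 + 2 * B) * (2 * C₁ ^ 2 * (Q + K) * Q) + 2 * E) * a L := by
    have := a0 L
    gcongr
  have g2 : ∑ i ∈ Finset.range L, (2 * B + B ^ 2) * δ i ≤ (2 * B + B ^ 2) * a L := by
    rw [← Finset.mul_sum]; gcongr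
  rw [hLh3] at f3
  have p1 : 0 ≤ (4 * Vb ^ 2 + ((6 + 2 * B) * (2 * C₁ ^ 2 * (Q + K) * Q) + 2 * E)
    + (2 * B + B ^ 2)) * h := by positivity
  have p2 : 0 ≤ 3 * E * a L := mul_nonneg (by positivity) (a0 L)
  linarith

end

/-! ### Càdlàg paths in a discrete space, counting paths and event times. -/

section Paths

variable {S : Type*} [TopologicalSpace S] [DiscreteTopology S] {x : ℝ≥0 → S}

lemma IsCadlag.eventually_eq_right (hx : IsCadlag x) (t : ℝ≥0) : ∀ᶠ s in 𝓝[≥] t, x s = x t :=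
  (hx t).1.eventually (show ∀ᶠ y in 𝓝 (x t), y = x t by rw [nhds_discrete]; exact rfl)

lemma IsCadlag.eventually_eq_left (hx : IsCadlag x) (t : ℝ≥0) :
    ∀ᶠ s in 𝓝[<] t, x s = Function.leftLim x t := by
  by_cases h : 𝓝[<] t = ⊥
  · simp [h]
  · obtain ⟨y, hy⟩ := (hx t).2
    have : NeBot (𝓝[<] t) := ⟨h⟩
    rw [leftLim_eq_of_tendsto hy]
    exact hy.eventually (show ∀ᶠ z in 𝓝 y, z = y by rw [nhds_discrete]; exact rfl)

/-- At `t = 0` there is nothing to the left and `leftLim` returns the value of the path; the second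
hypothesis covers this case. -/
lemma leftLim_eq_of_eventually_eq {t : ℝ≥0} {y : S} (h : ∀ᶠ s in 𝓝[<] t, x s = y)
    (hxt : 𝓝[<] t = ⊥ → x t = y) :
    Function.leftLim x t = y := by
  by_cases hb : 𝓝[<] t = ⊥
  · rw [leftLim_eq_of_eq_bot _ hb]; exact hxt hb
  · have : NeBot (𝓝[<] t) := ⟨hb⟩
    exact leftLim_eq_of_tendsto (tendsto_nhds_of_eventually_eq h)

lemma nhdsLT_neBot_of_lt {a t : ℝ≥0} (h : a < t) : NeBot (𝓝[<] t) := nhdsLT_neBot_of_exists_lt ⟨a, h⟩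

/-- A path without jumps on `(a,b]` is constant on `[a,b]`. -/
lemma IsCadlag.eq_of_leftLim_eq (hx : IsCadlag x) {a b : ℝ≥0}
    (h : ∀ t ∈ Set.Ioc a b, Function.leftLim x t = x t) {s : ℝ≥0} (hs : s ∈ Set.Icc a b) : x s = x a := by
  have hc : ContinuousOn x (Set.Icc a b) := by
    intro t ht
    rcases eq_or_lt_of_le ht.1 with rfl | hat
    · exact (hx a).1.mono fun s hs => hs.1
    · refine ContinuousAt.continuousWithinAt ?_
      rw [continuousAt_iff_continuous_left'_right']
      refine ⟨?_, (hx t).1.mono Set.Ioi_subset_Ici_self⟩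
      have := hx.eventually_eq_left t
      rw [h t ⟨hat, ht.2⟩] at this
      exact tendsto_nhds_of_eventually_eq this
  exact isPreconnected_Icc.constant hc hs (Set.left_mem_Icc.2 (hs.1.trans hs.2))

lemma eventually_eventually_eq_of_isOpen {t : ℝ≥0} {U : Set ℝ≥0} (hU : IsOpen U) {y : S}
    (h : ∀ᶠ s in 𝓝[U] t, x s = y) : ∀ᶠ s in 𝓝[U] t, Function.leftLim x s = x s := by
  have h2 := eventually_eventually_nhdsWithin.2 h
  filter_upwards [h2, self_mem_nhdsWithin] with s hs hsU
  rw [hU.nhdsWithin_eq hsU] at hs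
  rw [hs.self_of_nhds]
  exact leftLim_eq_of_eventually_eq (nhdsWithin_le_nhds hs) fun _ => hs.self_of_nhds

lemma IsCadlag.eventually_leftLim_eq (hx : IsCadlag x) (t : ℝ≥0) :
    ∀ᶠ s in 𝓝[≠] t, Function.leftLim x s = x s := by
  rw [← nhdsLT_sup_nhdsGT, eventually_sup]
  exact ⟨eventually_eventually_eq_of_isOpen isOpen_Iio (hx.eventually_eq_left t),
    eventually_eventually_eq_of_isOpen isOpen_Ioi
      ((hx.eventually_eq_right t).filter_mono (nhdsWithin_mono _ Set.Ioi_subset_Ici_self))⟩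

omit [DiscreteTopology S] in
lemma mem_jumpSet {t : ℝ≥0} : t ∈ jumpSet x ↔ Function.leftLim x t ≠ x t ∧ ∀ m : ℕ, t ≠ m := Iff.rfl

/-- Every time has a punctured neighbourhood without jumps. By compactness of `[0,t]` finitely many
of these neighbourhoods suffice, and jumps can only sit at their centres. -/
lemma IsCadlag.finite_jumpSet (hx : IsCadlag x) (t : ℝ≥0) : (jumpSet x ∩ Set.Iic t).Finite := by
  have hK : IsCompact (Set.Icc 0 t) := isCompact_Icc
  have hU (s : ℝ≥0) (_ : s ∈ Set.Icc 0 t) : {r | r ≠ s → Function.leftLim x r = x r} ∈ 𝓝 s := by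
    have := hx.eventually_leftLim_eq s
    rwa [eventually_nhdsWithin_iff] at this
  obtain ⟨F, hF⟩ := hK.elim_nhds_subcover' _ hU
  refine ((F.finite_toSet).image Subtype.val).subset fun r hr => ?_
  have hr' : r ∈ Set.Icc 0 t := ⟨zero_le, hr.2⟩
  obtain ⟨s, hs, hrs⟩ := Set.mem_iUnion₂.1 (hF hr')
  refine ⟨s, hs, ?_⟩
  by_contra hne
  exact hr.1.1 (hrs fun h => hne h.symm)

lemma IsCadlag.jumpCount_add (hx : IsCadlag x) {a b : ℝ≥0} (hab : a ≤ b) :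
    jumpCount x a + (jumpSet x ∩ Set.Ioc a b).ncard = jumpCount x b := by
  unfold jumpCount
  rw [← Set.ncard_union_eq (Set.disjoint_left.2 fun r hr h => not_le.2 h.2.1 hr.2)
    (hx.finite_jumpSet a)
    ((hx.finite_jumpSet b).subset (Set.inter_subset_inter_right _ fun r hr => hr.2)),
    ← Set.inter_union_distrib_left, Set.Iic_union_Ioc_eq_Iic hab]

lemma IsCadlag.jumpCount_mono (hx : IsCadlag x) : Monotone (jumpCount x) := fun a b hab => by
  rw [← hx.jumpCount_add hab]; omega

lemma IsCadlag.jumpCount_eq_iff (hx : IsCadlag x) {a b : ℝ≥0} (hab : a ≤ b) :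
    jumpCount x a = jumpCount x b ↔ jumpSet x ∩ Set.Ioc a b = ∅ := by
  rw [← hx.jumpCount_add hab]
  have hf : (jumpSet x ∩ Set.Ioc a b).Finite :=
    (hx.finite_jumpSet b).subset (Set.inter_subset_inter_right _ fun r hr => hr.2)
  rw [← Set.ncard_eq_zero hf]
  omega

omit [DiscreteTopology S] in
lemma jumpCount_zero : jumpCount x 0 = 0 := by
  unfold jumpCount
  rw [Set.ncard_eq_zero (Set.Finite.subset (Set.finite_singleton 0) fun r hr => by simpa using hr.2)]
  ext r
  simp only [Set.mem_inter_iff, Set.mem_Iic, Set.mem_empty_iff_false, iff_false, not_and]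
  intro hr h0
  exact hr.2 0 (by simpa using h0)

/-- A path that is constant between resetting times and has no jumps. -/
lemma IsCadlag.eq_of_jumpCount_eq (hx : IsCadlag x) {a b : ℝ≥0} (hab : a ≤ b)
    (hi : ∀ m : ℕ, (m : ℝ≥0) ∉ Set.Ioc a b) (h : jumpCount x a = jumpCount x b) {s : ℝ≥0}
    (hs : s ∈ Set.Icc a b) : x s = x a := by
  rw [hx.jumpCount_eq_iff hab] at h
  refine hx.eq_of_leftLim_eq (fun t ht => ?_) hs
  by_contra hne
  have : t ∈ jumpSet x ∩ Set.Ioc a b := ⟨⟨hne, fun m hm => hi m (hm ▸ ht)⟩, ht⟩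
  rw [h] at this
  exact this

/-- A counting path: nondecreasing and right-continuous. -/
structure IsCounting (c : ℝ≥0 → ℕ) : Prop where
  mono : Monotone c
  rightCont : ∀ t, ContinuousWithinAt c (Set.Ici t) t

lemma IsCadlag.isCounting_jumpCount (hx : IsCadlag x) : IsCounting (jumpCount x) := by
  refine ⟨hx.jumpCount_mono, fun t => ?_⟩
  refine tendsto_nhds_of_eventually_eq ?_
  have h1 := (hx.eventually_leftLim_eq t).filter_mono (nhdsWithin_mono t (s := Set.Ioi t)
    fun r hr => ne_of_gt hr)
  rw [eventually_nhdsWithin_iff] at h1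
  obtain ⟨u, hu, hsub⟩ := (mem_nhdsGE_iff_exists_Ico_subset' (show t < t + 1 by simp)).1
    (nhdsWithin_le_nhds (s := Set.Ici t) h1)
  have : Set.Ico t u ∈ 𝓝[≥] t := Ico_mem_nhdsGE hu
  filter_upwards [this] with s hs
  refine ((hx.jumpCount_eq_iff hs.1).2 ?_).symm
  ext r
  simp only [Set.mem_inter_iff, Set.mem_Ioc, Set.mem_empty_iff_false, iff_false, not_and]
  intro hr h1 h2
  exact absurd (hsub ⟨h1.le, h2.trans_lt hs.2⟩ h1) hr.1

/-- Right-continuity makes the infimum that defines the event time attained. Existence of a `k`-th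
event excludes the default value `sInf ∅ = 0`. -/
lemma IsCounting.eventTime_le_iff {c : ℝ≥0 → ℕ} (hc : IsCounting c) {k : ℕ} (hk : ∃ t, k ≤ c t)
    {t : ℝ≥0} : eventTime c k ≤ t ↔ k ≤ c t := by
  have hmem : k ≤ c (eventTime c k) := by
    by_contra hlt
    have h1 : ∀ᶠ s in 𝓝[≥] (eventTime c k), c s = c (eventTime c k) :=
      (hc.rightCont _).eventually (show ∀ᶠ y in 𝓝 (c (eventTime c k)), y = _ by
        rw [nhds_discrete]; exact rfl)
    obtain ⟨u, hu, hsub⟩ := (mem_nhdsGE_iff_exists_Ico_subset' (show eventTime c k < eventTime c k + 1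
      by simp)).1 h1
    have h2 : u ≤ eventTime c k := by
      refine le_csInf hk fun s hs => ?_
      by_contra hsu
      rw [not_le] at hsu
      rcases le_total (eventTime c k) s with h | h
      · exact hlt ((show k ≤ c s from hs).trans_eq (hsub ⟨h, hsu⟩))
      · exact hlt ((show k ≤ c s from hs).trans (hc.mono h))
    exact absurd hu (not_lt.2 h2)
  exact ⟨fun h => hmem.trans (hc.mono h), fun h => csInf_le (OrderBot.bddBelow _) h⟩

lemma IsCounting.lt_eventTime_iff {c : ℝ≥0 → ℕ} (hc : IsCounting c) {k : ℕ} (hk : ∃ t, k ≤ c t)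
    {t : ℝ≥0} : t < eventTime c k ↔ c t < k := by
  rw [← not_le, hc.eventTime_le_iff hk, not_le]

lemma IsCounting.eventTime_mem_Ioc_iff {c : ℝ≥0 → ℕ} (hc : IsCounting c) {k : ℕ}
    (hk : ∃ t, k ≤ c t) {a b : ℝ≥0} : eventTime c k ∈ Set.Ioc a b ↔ k ∈ Finset.Ioc (c a) (c b) := by
  rw [Set.mem_Ioc, hc.lt_eventTime_iff hk, hc.eventTime_le_iff hk, Finset.mem_Ioc]

/-- Event times of a counting path restarted at time `a`. -/
lemma eventTime_shift {c c' : ℝ≥0 → ℕ} (hc : IsCounting c) (hc' : IsCounting c') {a b : ℝ≥0}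
    (hab : a ≤ b) (ha : c' a = 0) (hcc : ∀ t ∈ Set.Icc a b, c' t + c a = c t) {j : ℕ} (hj : 1 ≤ j)
    (hjb : j ≤ c' b) : eventTime c' j = eventTime c (c a + j) := by
  have e1 : ∃ t, j ≤ c' t := ⟨b, hjb⟩
  have hb := hcc b ⟨hab, le_rfl⟩
  have e2 : ∃ t, c a + j ≤ c t := ⟨b, by omega⟩
  have m1 : eventTime c' j ∈ Set.Ioc a b :=
    (hc'.eventTime_mem_Ioc_iff e1).2 (Finset.mem_Ioc.2 ⟨by omega, hjb⟩)
  have m2 : eventTime c (c a + j) ∈ Set.Ioc a b :=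
    (hc.eventTime_mem_Ioc_iff e2).2 (Finset.mem_Ioc.2 ⟨by omega, by omega⟩)
  refine le_antisymm ?_ ?_
  · rw [hc'.eventTime_le_iff e1]
    have h1 := (hc.eventTime_le_iff e2).1 le_rfl
    have := hcc _ (Set.Ioc_subset_Icc_self m2)
    omega
  · rw [hc.eventTime_le_iff e2]
    have h1 := (hc'.eventTime_le_iff e1).1 le_rfl
    have := hcc _ (Set.Ioc_subset_Icc_self m1)
    omega

open Classical in
/-- Indicator that a path has moved between the endpoints of a cell not containing a resetting
time. -/
def cellJump {S : Type*} (x : ℝ≥0 → S) (u v : ℝ≥0) : ℕ :=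
  if x u ≠ x v ∧ ∀ m : ℕ, (m : ℝ≥0) ∉ Set.Ioc u v then 1 else 0

lemma eventually_ne_natCast (t : ℝ≥0) : ∀ᶠ s in 𝓝[≠] t, ∀ m : ℕ, s ≠ (m : ℝ≥0) := by
  have hcl : IsClosed ((Set.range (Nat.cast : ℕ → ℝ≥0)) \ {t}) := by
    have h1 : IsClosed ((NNReal.toReal) ⁻¹' ((Set.range (Nat.cast : ℕ → ℝ)) \ {(t : ℝ)})) := by
      refine IsClosed.preimage NNReal.continuous_coe ?_
      have h2 := Nat.isClosedEmbedding_coe_real.isClosedMap _ (isClosed_discrete ((Nat.cast : ℕ → ℝ) ⁻¹' ({(t : ℝ)}ᶜ)))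
      rw [Set.image_preimage_eq_inter_range] at h2
      convert h2 using 1
      ext z; simp [and_comm]
    convert h1 using 1
    ext z
    constructor
    · rintro ⟨⟨m, rfl⟩, hz⟩
      exact ⟨⟨m, by simp⟩, fun h => hz (NNReal.coe_injective h)⟩
    · rintro ⟨⟨m, hm⟩, hz⟩
      exact ⟨⟨m, NNReal.coe_injective (by simpa using hm)⟩, fun h => hz (by simp [Set.mem_singleton_iff.1 h])⟩
  have : ((Set.range (Nat.cast : ℕ → ℝ≥0)) \ {t})ᶜ ∈ 𝓝 t := hcl.isOpen_compl.mem_nhds (by simp)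
  rw [eventually_nhdsWithin_iff]
  filter_upwards [this] with s hs hst m hm
  exact hs ⟨⟨m, hm.symm⟩, hst⟩

/-- On fine enough cells, jumps are detected by comparing the states at the endpoints. -/
lemma IsCadlag.exists_forall_cellJump (hx : IsCadlag x) (T : ℝ≥0) :
    ∃ δ > (0 : ℝ), ∀ u v : ℝ≥0, u ≤ v → v ≤ T → (v : ℝ) - u < δ →
      jumpCount x u + cellJump x u v = jumpCount x v := by
  have hloc (t : ℝ≥0) : ∃ ε > 0, ∀ s ∈ Metric.ball t ε, s ≠ t →
      Function.leftLim x s = x s ∧ ∀ m : ℕ, s ≠ m := by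
    have := (hx.eventually_leftLim_eq t).and (eventually_ne_natCast t)
    rw [eventually_nhdsWithin_iff, Metric.eventually_nhds_iff_ball] at this
    exact this
  choose ε hε hloc using hloc
  -- In each ball of the cover only the centre can be a discontinuity or an integer. A cell shorter
  -- than a Lebesgue number lies in one ball, so it contains at most one exceptional time.
  obtain ⟨δ, hδ, hcov⟩ := lebesgue_number_lemma_of_metric (isCompact_Icc (a := (0 : ℝ≥0)) (b := T))
    (c := fun t => Metric.ball t (ε t)) (fun t => Metric.isOpen_ball)
    (fun t _ => Set.mem_iUnion.2 ⟨t, Metric.mem_ball_self (hε t)⟩)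
  refine ⟨δ, hδ, fun u v huv hvT hlt => ?_⟩
  obtain ⟨t, ht⟩ := hcov u ⟨zero_le, huv.trans hvT⟩
  have hmem (s : ℝ≥0) (hs : s ∈ Set.Icc u v) (hst : s ≠ t) :
      Function.leftLim x s = x s ∧ ∀ m : ℕ, s ≠ m := by
    refine hloc t s (ht ?_) hst
    rw [Metric.mem_ball, NNReal.dist_eq]
    have h1 : (u : ℝ) ≤ s := hs.1
    have h2 : (s : ℝ) ≤ v := hs.2
    rw [abs_lt]; constructor <;> linarith
  by_cases htm : t ∈ Set.Ioc u v
  · by_cases hint : ∃ m : ℕ, t = m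
    · obtain ⟨m, rfl⟩ := hint
      have h0 : cellJump x u v = 0 := by
        unfold cellJump
        rw [if_neg]
        rintro ⟨-, h⟩
        exact h m htm
      rw [h0, add_zero, hx.jumpCount_eq_iff huv]
      ext s
      simp only [Set.mem_inter_iff, Set.mem_empty_iff_false, iff_false, not_and]
      intro hs hsm
      by_cases hst : s = m
      · exact hs.2 m hst
      · exact hs.1 (hmem s (Set.Ioc_subset_Icc_self hsm) hst).1
    · have hxu : x u = Function.leftLim x t := by
        have hlt : ∀ s ∈ Set.Ico u t, x s = x u := fun s hs =>
          hx.eq_of_leftLim_eq (a := u) (b := s) (fun r hr => (hmem r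
            ⟨hr.1.le, hr.2.trans (hs.2.le.trans htm.2)⟩ (hr.2.trans_lt hs.2).ne).1)
            (Set.right_mem_Icc.2 hs.1)
        symm
        refine leftLim_eq_of_eventually_eq ?_ fun hb => absurd hb (nhdsLT_neBot_of_lt htm.1).ne
        filter_upwards [Ico_mem_nhdsLT htm.1] with s hs using hlt s hs
      have hxv : x v = x t :=
        hx.eq_of_leftLim_eq (a := t) (b := v) (fun r hr => (hmem r
            ⟨(htm.1.trans hr.1).le, hr.2⟩ hr.1.ne').1) (Set.right_mem_Icc.2 htm.2)
      rw [← hx.jumpCount_add huv]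
      congr 1
      have hni : ∀ m : ℕ, (m : ℝ≥0) ∉ Set.Ioc u v := fun m hm => by
        by_cases h : (m : ℝ≥0) = t
        · exact hint ⟨m, h.symm⟩
        · exact (hmem m (Set.Ioc_subset_Icc_self hm) h).2 m rfl
      unfold cellJump
      by_cases hne : Function.leftLim x t = x t
      · rw [if_neg (by rw [hxu, hxv, hne]; simp), eq_comm, Set.ncard_eq_zero
          ((hx.finite_jumpSet v).subset (Set.inter_subset_inter_right _ fun r hr => hr.2))]
        ext s
        simp only [Set.mem_inter_iff, Set.mem_empty_iff_false, iff_false, not_and]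
        intro hs hsm
        by_cases hst : s = t
        · exact hs.1 (hst ▸ hne)
        · exact hs.1 (hmem s (Set.Ioc_subset_Icc_self hsm) hst).1
      · rw [if_pos ⟨by rw [hxu, hxv]; exact hne, hni⟩]
        symm
        rw [Set.ncard_eq_one]
        refine ⟨t, ?_⟩
        ext s
        simp only [Set.mem_inter_iff, Set.mem_singleton_iff]
        constructor
        · rintro ⟨hs, hsm⟩
          by_contra hst
          exact hs.1 (hmem s (Set.Ioc_subset_Icc_self hsm) hst).1
        · rintro rfl
          exact ⟨⟨hne, fun m hm => hint ⟨m, hm⟩⟩, htm⟩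
  · have hne (s : ℝ≥0) (hs : s ∈ Set.Ioc u v) : s ≠ t := fun h => htm (h ▸ hs)
    have hc : x v = x u := hx.eq_of_leftLim_eq
      (fun s hs => (hmem s (Set.Ioc_subset_Icc_self hs) (hne s hs)).1) (Set.right_mem_Icc.2 huv)
    have h0 : cellJump x u v = 0 := by
      unfold cellJump
      rw [if_neg]
      rintro ⟨h, -⟩
      exact h hc.symm
    rw [h0, add_zero, hx.jumpCount_eq_iff huv]
    ext s
    simp only [Set.mem_inter_iff, Set.mem_empty_iff_false, iff_false, not_and]
    intro hs hsm
    exact hs.1 (hmem s (Set.Ioc_subset_Icc_self hsm) (hne s hsm)).1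

end Paths

/-! ### Measurability of jump counts, event times and conditional reward laws. -/

section

lemma measurable_coe_probabilityMeasure_of_cdf {α : Type*} [MeasurableSpace α]
    {κ : α → ProbabilityMeasure ℝ} (h : ∀ z, Measurable fun a => cdf (κ a : Measure ℝ) z) :
    Measurable fun a => (κ a : Measure ℝ) := by
  refine Measurable.measure_of_isPiSystem_of_isProbabilityMeasure (S := Set.range Set.Iic)
    (borel_eq_generateFrom_Iic ℝ ▸ BorelSpace.measurable_eq) isPiSystem_Iic ?_
  rintro _ ⟨z, rfl⟩
  have : (fun a => (κ a : Measure ℝ) (Set.Iic z)) = fun a => ENNReal.ofReal (cdf (κ a : Measure ℝ) z) := by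
    ext a
    rw [ofReal_cdf]
  rw [this]
  exact (h z).ennreal_ofReal

variable {Ω S : Type*} [MeasurableSpace Ω] [Fintype S] [TopologicalSpace S]
  [DiscreteTopology S] [MeasurableSpace S] [DiscreteMeasurableSpace S]

/-- The cells of the uniform grid of `[0,t]` with `n+1` cells. -/
lemma IsCadlag.eventually_sum_cellJump {x : ℝ≥0 → S} (hx : IsCadlag x) {a b : ℝ≥0} (hab : a ≤ b)
    {p : ℕ → ℕ} (hp : Tendsto p atTop atTop) :
    ∀ᶠ n in atTop, jumpCount x a + ∑ j ∈ Finset.range (p n), cellJump x (a + (b - a) * (j / p n))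
      (a + (b - a) * ((j + 1 : ℕ) / p n)) = jumpCount x b := by
  obtain ⟨δ, hδ, h⟩ := hx.exists_forall_cellJump b
  have hlim : Tendsto (fun n => ((b : ℝ) - a) / p n) atTop (𝓝 0) :=
    Tendsto.const_div_atTop (tendsto_natCast_atTop_atTop.comp hp) _
  filter_upwards [hlim.eventually (gt_mem_nhds hδ), hp.eventually_ge_atTop 1] with n hn hp1
  have hpos : (0 : ℝ) < p n := by exact_mod_cast hp1
  have hp0 : (p n : ℝ≥0) ≠ 0 := by exact_mod_cast hpos.ne'
  have hmono {i j : ℕ} (hij : i ≤ j) : a + (b - a) * (i / p n : ℝ≥0) ≤ a + (b - a) * (j / p n : ℝ≥0) := by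
    gcongr
  have key (m : ℕ) (hm : m ≤ p n) : jumpCount x a + ∑ j ∈ Finset.range m,
      cellJump x (a + (b - a) * (j / p n)) (a + (b - a) * ((j + 1 : ℕ) / p n))
      = jumpCount x (a + (b - a) * (m / p n)) := by
    induction m with
    | zero => simp
    | succ m ih =>
      rw [Finset.sum_range_succ, ← add_assoc, ih (by omega)]
      refine h _ _ (hmono (Nat.le_succ m)) ?_ ?_
      · refine (hmono hm).trans ?_
        rw [div_self hp0, mul_one, add_tsub_cancel_of_le hab]
      · push_cast [NNReal.coe_sub hab]
        refine lt_of_eq_of_lt ?_ hn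
        field_simp
        ring
  rw [key _ le_rfl, div_self hp0, mul_one, add_tsub_cancel_of_le hab]

variable {X : ℝ≥0 → Ω → S}

lemma measurable_cellJump (hm : ∀ t, Measurable (X t)) (u v : ℝ≥0) :
    Measurable fun ω => cellJump (fun t => X t ω) u v := by
  classical
  have hs : MeasurableSet {ω | X u ω = X v ω} := measurableSet_eq_fun (hm u) (hm v)
  by_cases h : ∀ m : ℕ, (m : ℝ≥0) ∉ Set.Ioc u v
  · have e : (fun ω => cellJump (fun t => X t ω) u v)
        = {ω | X u ω = X v ω}.piecewise (fun _ => 0) fun _ => 1 := by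
      ext ω
      unfold cellJump
      by_cases h2 : X u ω = X v ω
      · rw [Set.piecewise_eq_of_mem _ _ _ (by exact h2), if_neg (fun h3 => h3.1 h2)]
      · rw [Set.piecewise_eq_of_notMem _ _ _ (by exact h2), if_pos ⟨h2, h⟩]
    rw [e]
    exact Measurable.piecewise hs measurable_const measurable_const
  · have e : (fun ω => cellJump (fun t => X t ω) u v) = fun _ => 0 := by
      ext ω
      unfold cellJump
      rw [if_neg fun h2 => h h2.2]
    rw [e]
    exact measurable_const

/-- On each path the jumps detected on a fine enough grid are all the jumps, so the count is a
pointwise limit of functions of finitely many states. The σ-algebra on `Ω` is arbitrary, so this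
also gives measurability with respect to `σ(X)`. -/
lemma measurable_jumpCount (hc : ∀ ω, IsCadlag fun t => X t ω) (hm : ∀ t, Measurable (X t)) (t : ℝ≥0) :
    Measurable fun ω => jumpCount (fun s => X s ω) t := by
  refine measurable_of_tendsto_metrizable (f := fun (n : ℕ) ω => ∑ j ∈ Finset.range n,
    cellJump (fun s => X s ω) (0 + (t - 0) * (j / n)) (0 + (t - 0) * ((j + 1 : ℕ) / n))) (fun n => ?_) ?_
  · exact Finset.measurable_fun_sum _ fun j _ => measurable_cellJump hm _ _
  · rw [tendsto_pi_nhds]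
    intro ω
    refine tendsto_nhds_of_eventually_eq ?_
    filter_upwards [(hc ω).eventually_sum_cellJump (zero_le (a := t)) tendsto_id] with n hn
    rw [jumpCount_zero, zero_add] at hn
    exact hn

/-- Time is rounded up to a grid of mesh `1/(n+1)`, and right-continuity gives the limit. -/
lemma measurable_uncurry_of_cadlag (hc : ∀ ω, IsCadlag fun t => X t ω) (hm : ∀ t, Measurable (X t)) :
    Measurable fun p : ℝ≥0 × Ω => X p.1 p.2 := by
  have hr (n : ℕ) : Measurable fun t : ℝ≥0 => ⌊(n + 1 : ℝ≥0) * t⌋₊ := by fun_prop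
  refine measurable_of_tendsto_metrizable (f := fun (n : ℕ) (p : ℝ≥0 × Ω) =>
    X ((⌊(n + 1 : ℝ≥0) * p.1⌋₊ + 1 : ℕ) / (n + 1 : ℝ≥0)) p.2) (fun n => ?_) ?_
  · have h1 : Measurable fun q : ℕ × Ω => X ((q.1 + 1 : ℕ) / (n + 1 : ℝ≥0)) q.2 :=
      measurable_from_prod_countable_right fun k => hm ((k + 1 : ℕ) / (n + 1 : ℝ≥0))
    exact h1.comp (((hr n).comp measurable_fst).prodMk measurable_snd)
  · rw [tendsto_pi_nhds]
    rintro ⟨t, ω⟩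
    have hlt : Tendsto (fun n : ℕ => ((⌊(n + 1 : ℝ≥0) * t⌋₊ + 1 : ℕ) / (n + 1 : ℝ≥0))) atTop (𝓝[≥] t) := by
      refine tendsto_nhdsWithin_iff.2 ⟨?_, Eventually.of_forall fun n => ?_⟩
      · refine tendsto_of_tendsto_of_tendsto_of_le_of_le (g := fun _ => t)
          (h := fun n : ℕ => t + 1 / ((n : ℝ≥0) + 1)) tendsto_const_nhds ?_ (fun n => ?_) (fun n => ?_)
        · have : Tendsto (fun n : ℕ => 1 / ((n : ℝ≥0) + 1)) atTop (𝓝 0) :=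
            tendsto_one_div_add_atTop_nhds_zero_nat
          simpa using this.const_add t
        · simp only
          rw [le_div_iff₀ (by positivity), mul_comm]
          exact_mod_cast (Nat.lt_floor_add_one _).le
        · simp only
          have e : (t + 1 / ((n : ℝ≥0) + 1)) * (n + 1) = (n + 1) * t + 1 := by field_simp
          rw [div_le_iff₀ (by positivity), e]
          push_cast
          gcongr
          exact Nat.floor_le zero_le
      · rw [Set.mem_Ici, le_div_iff₀ (by positivity), mul_comm]
        exact_mod_cast (Nat.lt_floor_add_one _).le
    exact ((hc ω) t).1.tendsto.comp hlt

/-- Time is rounded to a grid point strictly to its left. At `t = 0` truncated subtraction gives the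
point `0` itself, in agreement with the convention for `leftLim` there. -/
lemma measurable_uncurry_leftLim (hc : ∀ ω, IsCadlag fun t => X t ω) (hm : ∀ t, Measurable (X t)) :
    Measurable fun p : ℝ≥0 × Ω => Function.leftLim (fun t => X t p.2) p.1 := by
  have hr (n : ℕ) : Measurable fun t : ℝ≥0 => ⌈(n + 1 : ℝ≥0) * t⌉₊ := by fun_prop
  refine measurable_of_tendsto_metrizable (f := fun (n : ℕ) (p : ℝ≥0 × Ω) =>
    X ((⌈(n + 1 : ℝ≥0) * p.1⌉₊ - 1 : ℕ) / (n + 1 : ℝ≥0)) p.2) (fun n => ?_) ?_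
  · have gen (φ : ℕ → ℝ≥0) : Measurable fun p : ℝ≥0 × Ω => X (φ ⌈(n + 1 : ℝ≥0) * p.1⌉₊) p.2 := by
      have h1 : Measurable fun q : ℕ × Ω => X (φ q.1) q.2 :=
        measurable_from_prod_countable_right fun k => hm (φ k)
      exact h1.comp (((hr n).comp measurable_fst).prodMk measurable_snd)
    exact gen fun k => (k - 1 : ℕ) / (n + 1 : ℝ≥0)
  · rw [tendsto_pi_nhds]
    rintro ⟨t, ω⟩
    rcases eq_or_ne t 0 with ht0 | ht0
    · have hb : 𝓝[<] t = ⊥ := by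
        have : Set.Iio t = ∅ := by ext s; simp [ht0]
        rw [this, nhdsWithin_empty]
      have h2 : Function.leftLim (fun t => X t ω) t = X t ω := leftLim_eq_of_eq_bot _ hb
      have e (n : ℕ) : ((⌈(n + 1 : ℝ≥0) * t⌉₊ - 1 : ℕ) / (n + 1 : ℝ≥0)) = t := by simp [ht0]
      simp only [e, h2]
      exact tendsto_const_nhds
    have hc1 (n : ℕ) : 1 ≤ ⌈(n + 1 : ℝ≥0) * t⌉₊ :=
      Nat.one_le_ceil_iff.2 (by positivity)
    have hlt : Tendsto (fun n : ℕ => ((⌈(n + 1 : ℝ≥0) * t⌉₊ - 1 : ℕ) / (n + 1 : ℝ≥0))) atTop (𝓝[<] t) := by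
      refine tendsto_nhdsWithin_iff.2 ⟨?_, Eventually.of_forall fun n => ?_⟩
      · refine tendsto_of_tendsto_of_tendsto_of_le_of_le (h := fun _ => t)
          (g := fun n : ℕ => t - 1 / ((n : ℝ≥0) + 1)) ?_ tendsto_const_nhds (fun n => ?_) (fun n => ?_)
        · have : Tendsto (fun n : ℕ => 1 / ((n : ℝ≥0) + 1)) atTop (𝓝 0) :=
            tendsto_one_div_add_atTop_nhds_zero_nat
          simpa using (tendsto_const_nhds (x := t)).sub this
        · simp only
          rw [tsub_le_iff_right, ← add_div, le_div_iff₀ (by positivity), mul_comm]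
          have h2 := Nat.le_ceil ((n + 1 : ℝ≥0) * t)
          have h3 : ((⌈(n + 1 : ℝ≥0) * t⌉₊ - 1 : ℕ) : ℝ≥0) + 1 = (⌈(n + 1 : ℝ≥0) * t⌉₊ : ℝ≥0) := by
            exact_mod_cast Nat.sub_add_cancel (hc1 n)
          rw [h3]; exact h2
        · simp only
          rw [div_le_iff₀ (by positivity), mul_comm t]
          have h2 : ((⌈(n + 1 : ℝ≥0) * t⌉₊ - 1 : ℕ) : ℝ≥0) < (n + 1 : ℝ≥0) * t :=
            Nat.lt_ceil.1 (Nat.sub_lt (hc1 n) one_pos)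
          exact h2.le
      · rw [Set.mem_Iio, div_lt_iff₀ (by positivity), mul_comm t]
        exact Nat.lt_ceil.1 (Nat.sub_lt (hc1 n) one_pos)
    refine tendsto_nhds_of_eventually_eq (hlt.eventually ((hc ω).eventually_eq_left t))

lemma measurable_eventTime {c : ℝ≥0 → Ω → ℕ} (hc : ∀ ω, IsCounting fun t => c t ω)
    (hm : ∀ t, Measurable (c t)) (k : ℕ) : Measurable fun ω => eventTime (fun t => c t ω) k := by
  refine measurable_of_Iic fun t => ?_
  -- When there is no `k`-th event its time is `0` by convention. This adds the second set, on which
  -- the count stays below `k` at all integer times.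
  have : (fun ω => eventTime (fun t => c t ω) k) ⁻¹' Set.Iic t
      = {ω | k ≤ c t ω} ∪ ⋂ m : ℕ, {ω | k ≤ c m ω}ᶜ := by
    ext ω
    simp only [Set.mem_preimage, Set.mem_Iic, Set.mem_union, Set.mem_ofPred_eq, Set.mem_iInter,
      Set.mem_compl_iff]
    by_cases h : ∃ t, k ≤ c t ω
    · rw [(hc ω).eventTime_le_iff h]
      refine ⟨Or.inl, fun h' => h'.resolve_right fun h2 => ?_⟩
      obtain ⟨s, hs⟩ := h
      obtain ⟨m, hm⟩ := exists_nat_ge s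
      exact h2 m (hs.trans ((hc ω).mono hm))
    · push Not at h
      have h0 : eventTime (fun t => c t ω) k = 0 := by
        unfold eventTime
        have : {t | k ≤ c t ω} = ∅ := by ext s; simp [h s]
        rw [this, NNReal.sInf_empty]
      rw [h0]
      simp only [zero_le, true_iff]
      exact Or.inr fun m => not_le.2 (h m)
  rw [this]
  exact (measurableSet_le measurable_const (hm t)).union
    (MeasurableSet.iInter fun m => (measurableSet_le measurable_const (hm m)).compl)

/-- Path regularity and measurability of the state and counting processes of a model. -/
structure Model.IsRegular (Z : Model S Ω) : Prop where
  measurable_X : ∀ t, Measurable (Z.X t)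
  cadlag : ∀ ω, IsCadlag fun t => Z.X t ω
  measurable_N : ∀ t, Measurable (Z.N t)
  counting : ∀ ω, IsCounting fun t => Z.N t ω

namespace Model

variable (E : Data S) (Z : Model S Ω)

/-- Law of the `k`-th jump reward given the state and counting processes. -/
def lawG (k : ℕ) (ω : Ω) : Measure ℝ :=
  (E.G (Z.T k ω) (Z.Xleft (Z.T k ω) ω) (Z.X (Z.T k ω) ω) : Measure ℝ)

/-- Law of the `i`-th scheduled reward given the state process. -/
def lawH (i : ℕ) (ω : Ω) : Measure ℝ := (E.H (E.τ i) (Z.X (E.τ i) ω) : Measure ℝ)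

/-- Law of the `k`-th external reward given the state and counting processes. -/
def lawK (k : ℕ) (ω : Ω) : Measure ℝ := (E.K (Z.Λ k ω) (Z.X (Z.Λ k ω) ω) : Measure ℝ)

instance (k : ℕ) (ω : Ω) : IsProbabilityMeasure (lawG E Z k ω) := by unfold lawG; infer_instance
instance (k : ℕ) (ω : Ω) : IsProbabilityMeasure (lawH E Z k ω) := by unfold lawH; infer_instance
instance (k : ℕ) (ω : Ω) : IsProbabilityMeasure (lawK E Z k ω) := by unfold lawK; infer_instance

end Model

namespace Model.IsRegular

variable {E : Data S} {Z : Model S Ω} (hZ : Z.IsRegular)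
include hZ

lemma counting_J (ω : Ω) : IsCounting fun t => Z.J t ω := (hZ.cadlag ω).isCounting_jumpCount

lemma measurable_J (t : ℝ≥0) : Measurable (Z.J t) := measurable_jumpCount hZ.cadlag hZ.measurable_X t

lemma measurable_T (k : ℕ) : Measurable (Z.T k) := measurable_eventTime hZ.counting_J hZ.measurable_J k

lemma measurable_Λ (k : ℕ) : Measurable (Z.Λ k) := measurable_eventTime hZ.counting hZ.measurable_N k

lemma measurable_X_comp {T : Ω → ℝ≥0} (hT : Measurable T) : Measurable fun ω => Z.X (T ω) ω :=
  (measurable_uncurry_of_cadlag hZ.cadlag hZ.measurable_X).comp (hT.prodMk measurable_id)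

lemma measurable_Xleft_comp {T : Ω → ℝ≥0} (hT : Measurable T) : Measurable fun ω => Z.Xleft (T ω) ω :=
  (measurable_uncurry_leftLim hZ.cadlag hZ.measurable_X).comp (hT.prodMk measurable_id)

lemma measurable_comp_T {α : Type*} [MeasurableSpace α] {F : ℝ≥0 → S → S → α}
    (hF : ∀ x y, Measurable fun t => F t x y) (k : ℕ) :
    Measurable fun ω => F (Z.T k ω) (Z.Xleft (Z.T k ω) ω) (Z.X (Z.T k ω) ω) := by
  have h1 : Measurable fun q : ℝ≥0 × (S × S) => F q.1 q.2.1 q.2.2 :=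
    measurable_from_prod_countable_left fun p => hF p.1 p.2
  exact h1.comp ((hZ.measurable_T k).prodMk ((hZ.measurable_Xleft_comp (hZ.measurable_T k)).prodMk
    (hZ.measurable_X_comp (hZ.measurable_T k))))

lemma measurable_comp_Λ {α : Type*} [MeasurableSpace α] {F : ℝ≥0 → S → α}
    (hF : ∀ x, Measurable fun t => F t x) (k : ℕ) :
    Measurable fun ω => F (Z.Λ k ω) (Z.X (Z.Λ k ω) ω) := by
  have h1 : Measurable fun q : ℝ≥0 × S => F q.1 q.2 := measurable_from_prod_countable_left fun p => hF p
  exact h1.comp ((hZ.measurable_Λ k).prodMk (hZ.measurable_X_comp (hZ.measurable_Λ k)))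

lemma measurable_lawG (h1 : E.A1) (k : ℕ) : Measurable (Z.lawG E k) :=
  hZ.measurable_comp_T (F := fun t x y => (E.G t x y : Measure ℝ))
    (fun x y => measurable_coe_probabilityMeasure_of_cdf (h1.jump x y)) k

lemma measurable_lawK (h1 : E.A1) (k : ℕ) : Measurable (Z.lawK E k) :=
  hZ.measurable_comp_Λ (F := fun t x => (E.K t x : Measure ℝ))
    (fun x => measurable_coe_probabilityMeasure_of_cdf (h1.ext x)) k

lemma measurable_lawH (i : ℕ) : Measurable (Z.lawH E i) :=
  (measurable_of_finite (fun x => (E.H (E.τ i) x : Measure ℝ))).comp (hZ.measurable_X (E.τ i))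

lemma measurable_uncurry_comp {F : ℝ≥0 → S → ℝ} (hF : ∀ x, Measurable fun t => F t x) :
    Measurable fun p : ℝ × Ω => F p.1.toNNReal (Z.X p.1.toNNReal p.2) := by
  have h1 : Measurable fun q : ℝ≥0 × S => F q.1 q.2 := measurable_from_prod_countable_left fun p => hF p
  have h2 := (measurable_uncurry_of_cadlag hZ.cadlag hZ.measurable_X)
  have h3 : Measurable fun p : ℝ × Ω => (p.1.toNNReal, p.2) := by fun_prop
  exact h1.comp ((measurable_fst.comp h3).prodMk (h2.comp h3))

lemma measurable_integral {F : ℝ≥0 → S → ℝ} (hF : ∀ x, Measurable fun t => F t x) (a b : ℝ) :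
    Measurable fun ω => ∫ s in a..b, F s.toNNReal (Z.X s.toNNReal ω) := by
  have h := (hZ.measurable_uncurry_comp hF).stronglyMeasurable
  unfold intervalIntegral
  exact (StronglyMeasurable.integral_prod_left' (μ := volume.restrict (Set.Ioc a b)) h).measurable.sub
    (StronglyMeasurable.integral_prod_left' (μ := volume.restrict (Set.Ioc b a)) h).measurable

end Model.IsRegular
end

/-! ### Uniform bounds on rates, and short-time estimates for transition matrices. -/

section

/-- A primitive is measurable as a function of its lower endpoint, without integrability
assumptions. -/
lemma measurable_integral_left (f : ℝ → ℝ) (t : ℝ) :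
    Measurable fun s => if s ≤ t then ∫ u in s..t, f u else 0 := by
  -- The lower endpoints from which `f` is integrable form an interval, on which the primitive is
  -- continuous. Outside it the integral is `0` by convention.
  set I : Set ℝ := {s | s ≤ t ∧ IntervalIntegrable f volume s t} with hI
  have hord : I.OrdConnected := by
    refine ⟨fun a ha b hb c hc => ⟨hc.2.trans hb.1, ha.2.mono_set ?_⟩⟩
    rw [Set.uIcc_of_le (hc.2.trans hb.1), Set.uIcc_of_le ha.1]
    exact Set.Icc_subset_Icc_left hc.1
  have hIm : MeasurableSet I := hord.measurableSet
  have hcont : ContinuousOn (fun s => ∫ u in s..t, f u) I := by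
    intro s hs
    have key (a : ℝ) (ha : a ∈ I) : ContinuousOn (fun s => ∫ u in s..t, f u) (Set.Icc a t) := by
      have h1 := intervalIntegral.continuousOn_primitive_interval_left (μ := volume) (f := f) (a := a) (b := t)
        ((intervalIntegrable_iff_integrableOn_Icc_of_le ha.1).1 ha.2 |> fun h => by
          rwa [Set.uIcc_of_le ha.1])
      rwa [Set.uIcc_of_le ha.1] at h1
    by_cases h : ∃ a ∈ I, a < s
    · obtain ⟨a, ha, has⟩ := h
      refine (key a ha s ⟨has.le, hs.1⟩).mono_of_mem_nhdsWithin ?_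
      filter_upwards [self_mem_nhdsWithin, nhdsWithin_le_nhds (Ioi_mem_nhds has)] with r hr har
      exact ⟨le_of_lt har, hr.1⟩
    · push Not at h
      exact (key s hs s ⟨le_rfl, hs.1⟩).mono fun r hr => ⟨h r hr, hr.1⟩
  have e : (fun s => if s ≤ t then ∫ u in s..t, f u else 0)
      = I.indicator fun s => ∫ u in s..t, f u := by
    ext s
    by_cases hs : s ∈ I
    · rw [Set.indicator_of_mem hs, if_pos hs.1]
    · rw [Set.indicator_of_notMem hs]
      split_ifs with h
      · exact intervalIntegral.integral_undef fun h2 => hs ⟨h, h2⟩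
      · rfl
  classical
  rw [e, ← Set.piecewise_eq_indicator]
  exact hcont.measurable_piecewise continuousOn_const hIm

variable {S : Type*} [Fintype S] [DecidableEq S]

namespace Data

variable {E : Data S}

lemma mem_B {x y : S} : (x, y) ∈ E.B ↔ 0 < E.Q 1 x y := by
  classical
  simp [B]

/-- Off the diagonal, rates of possible transitions are bounded by `A3` and all others vanish by
`A2`; the diagonal follows from the zero row sums. -/
lemma exists_forall_abs_Q_le (hQ : ∀ t, IsRateMatrix (E.Q t)) (h2 : E.A2) (h3 : E.A3) :
    ∃ q : ℝ, 0 < q ∧ ∀ t x y, |E.Q t x y| ≤ q := by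
  have hoff : ∀ p : S × S, ∃ c : ℝ, 0 ≤ c ∧ ∀ t, p.1 ≠ p.2 → |E.Q t p.1 p.2| ≤ c := by
    intro p
    by_cases hp : p ∈ E.B
    · obtain ⟨c, hc⟩ := (h3 p hp).2
      have hc' (t : ℝ≥0) : E.Q t p.1 p.2 ≤ c := hc ⟨t, rfl⟩
      refine ⟨|c|, abs_nonneg _, fun t hne => ?_⟩
      rw [abs_of_nonneg ((hQ t).1 _ _ hne)]
      exact (hc' t).trans (le_abs_self c)
    · refine ⟨0, le_rfl, fun t hne => ?_⟩
      have h0 : ¬ 0 < E.Q t p.1 p.2 := fun h => hp (mem_B.2 ((h2.indep_time t _ _).1 h))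
      have := (hQ t).1 _ _ hne
      rw [le_antisymm (not_lt.1 h0) this]; simp
  choose c hc0 hc using hoff
  set M := ∑ p, c p with hM
  have hM0 : 0 ≤ M := Finset.sum_nonneg fun p _ => hc0 p
  have hle (t : ℝ≥0) (x y : S) (h : x ≠ y) : |E.Q t x y| ≤ M :=
    (hc (x, y) t h).trans (Finset.single_le_sum (f := c) (fun p _ => hc0 p) (Finset.mem_univ _))
  refine ⟨Fintype.card S * M + M + 1, by positivity, fun t x y => ?_⟩
  by_cases h : x = y
  · subst h
    have := (hQ t).2 x
    rw [← Finset.add_sum_erase _ _ (Finset.mem_univ x)] at this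
    have e : E.Q t x x = -∑ y ∈ Finset.univ.erase x, E.Q t x y := by linarith
    rw [e, abs_neg]
    refine (Finset.abs_sum_le_sum_abs _ _).trans ?_
    calc ∑ y ∈ Finset.univ.erase x, |E.Q t x y| ≤ ∑ y ∈ Finset.univ.erase x, M :=
          Finset.sum_le_sum fun y hy => hle t x y (Finset.ne_of_mem_erase hy).symm
      _ ≤ ∑ y : S, M := Finset.sum_le_sum_of_subset_of_nonneg (Finset.erase_subset _ _) fun _ _ _ => hM0
      _ = Fintype.card S * M := by simp
      _ ≤ _ := by linarith
  · refine (hle t x y h).trans ?_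
    have : 0 ≤ Fintype.card S * M := by positivity
    linarith

lemma exists_forall_le_Q (h2 : E.A2) (h3 : E.A3) :
    ∃ q : ℝ, 0 < q ∧ ∀ t, ∀ p ∈ E.B, q ≤ E.Q t p.1 p.2 := by
  have hpos (t : ℝ≥0) (p : S × S) (hp : p ∈ E.B) : 0 < E.Q t p.1 p.2 :=
    (h2.indep_time t _ _).2 (mem_B.1 hp)
  rcases E.B.eq_empty_or_nonempty with h | h
  · exact ⟨1, one_pos, by simp [h]⟩
  · obtain ⟨p, hp, hmin⟩ := E.B.exists_min_image (fun p => ⨅ t, E.Q t p.1 p.2) h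
    refine ⟨_, (h3 p hp).1, fun t p' hp' => (hmin p' hp').trans ?_⟩
    exact ciInf_le ⟨0, by rintro _ ⟨s, rfl⟩; exact (hpos s p' hp').le⟩ t

lemma ne_of_mem_B (hQ : ∀ t, IsRateMatrix (E.Q t)) {x y : S} (h : (x, y) ∈ E.B) : x ≠ y := by
  rintro rfl
  have h1 := mem_B.1 h
  have h2 := (hQ 1).2 x
  rw [← Finset.add_sum_erase _ _ (Finset.mem_univ x)] at h2
  have : 0 ≤ ∑ y ∈ Finset.univ.erase x, E.Q 1 x y :=
    Finset.sum_nonneg fun y hy => (hQ 1).1 _ _ (Finset.ne_of_mem_erase hy).symm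
  linarith

end Data

namespace IsTransition

variable {Q : ℝ≥0 → Matrix S S ℝ} {P : ℝ≥0 → ℝ≥0 → Matrix S S ℝ} (hP : IsTransition Q P)
include hP

lemma nonneg {s t : ℝ≥0} (h : s ≤ t) (x y : S) : 0 ≤ P s t x y :=
  Matrix.nonneg_of_mem_rowStochastic (hP.stochastic s t h)

lemma sum_eq_one {s t : ℝ≥0} (h : s ≤ t) (x : S) : ∑ y, P s t x y = 1 :=
  Matrix.sum_row_of_mem_rowStochastic (hP.stochastic s t h) x

lemma le_one {s t : ℝ≥0} (h : s ≤ t) (x y : S) : P s t x y ≤ 1 := by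
  rw [← hP.sum_eq_one h x]
  exact Finset.single_le_sum (f := fun y => P s t x y) (fun z _ => hP.nonneg h x z) (Finset.mem_univ y)

/-- By the backward equation `P(·,t)` is a constant plus a primitive in its lower endpoint, which is
measurable even before integrability of the integrand is known. That integrability is deduced from
the present measurability. -/
lemma measurable_left (t : ℝ≥0) (x y : S) :
    Measurable fun s : ℝ => if s ≤ t then P s.toNNReal t x y else 0 := by
  have h1 := measurable_integral_left (fun u => (Q u.toNNReal * P u.toNNReal t) x y) t
  have h2 : Measurable fun s : ℝ => if max s 0 ≤ t then (1 : Matrix S S ℝ) x y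
      + ∫ u in (max s 0)..t, (Q u.toNNReal * P u.toNNReal t) x y else 0 := by
    have h3 := h1.comp (measurable_id.max (measurable_const (a := (0 : ℝ))))
    have h4 : Measurable fun s : ℝ => if max s 0 ≤ t then (1 : Matrix S S ℝ) x y else 0 :=
      Measurable.ite (measurableSet_le (by fun_prop) measurable_const) measurable_const measurable_const
    convert h4.add h3 using 1
    ext s
    by_cases hh : max s 0 ≤ (t : ℝ)
    · rw [if_pos hh, Pi.add_apply, if_pos hh, Function.comp, if_pos (by exact hh)]; rfl
    · rw [if_neg hh, Pi.add_apply, if_neg hh, Function.comp, if_neg (by exact hh), add_zero]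
  convert h2 using 1
  ext s
  have hs : (max s 0 ≤ t) ↔ s ≤ t := by simp
  by_cases h : s ≤ t
  · rw [if_pos h, if_pos (hs.2 h), hP.backward s.toNNReal t (by rwa [Real.toNNReal_le_iff_le_coe]) x y,
      Real.coe_toNNReal']
  · rw [if_neg h, if_neg (by rwa [hs])]

variable {q : ℝ} (hq : ∀ t x y, |Q t x y| ≤ q) (hm : ∀ x y, Measurable fun t => Q t x y)
include hq hm

lemma integrand_le {u t : ℝ≥0} (h : u ≤ t) (x y : S) :
    |(Q u * P u t) x y| ≤ Fintype.card S * q := by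
  rw [Matrix.mul_apply]
  refine (Finset.abs_sum_le_sum_abs _ _).trans ?_
  calc ∑ z, |Q u x z * P u t z y| ≤ ∑ _z : S, q := by
        refine Finset.sum_le_sum fun z _ => ?_
        rw [abs_mul, abs_of_nonneg (hP.nonneg h z y)]
        nlinarith [hq u x z, hP.le_one h z y, hP.nonneg h z y, abs_nonneg (Q u x z)]
    _ = _ := by simp

lemma intervalIntegrable {s t : ℝ≥0} (h : s ≤ t) (x y : S) :
    IntervalIntegrable (fun u => (Q u.toNNReal * P u.toNNReal t) x y) volume s t := by
  rw [intervalIntegrable_iff_integrableOn_Ioc_of_le (by exact_mod_cast h)]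
  refine Integrable.of_bound (C := Fintype.card S * q) ?_ ?_
  · have h1 : Measurable fun u : ℝ => ∑ z, Q u.toNNReal x z * (if u ≤ t then P u.toNNReal t z y else 0) :=
      Finset.measurable_fun_sum _ fun z _ =>
        ((hm x z).comp measurable_real_toNNReal).mul (hP.measurable_left t z y)
    refine (h1.aestronglyMeasurable (μ := volume.restrict (Set.Ioc (s : ℝ) t))).congr ?_
    filter_upwards [ae_restrict_mem measurableSet_Ioc] with u hu
    simp only [if_pos hu.2, Matrix.mul_apply]
  · filter_upwards [ae_restrict_mem measurableSet_Ioc] with u hu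
    exact hP.integrand_le hq hm (Real.toNNReal_le_iff_le_coe.2 hu.2) x y

/-- On the diagonal of the backward equation the off-diagonal rates contribute nonnegatively, and
the diagonal rate contributes at least `-q`. -/
lemma one_sub_le {s t : ℝ≥0} (h : s ≤ t) (x : S) (hQ : ∀ t, IsRateMatrix (Q t)) :
    1 - P s t x x ≤ q * (t - s) := by
  rw [hP.backward s t h x x, Matrix.one_apply_eq]
  have hst : (s : ℝ) ≤ t := by exact_mod_cast h
  have : ∫ u in (s : ℝ)..t, (-q) ≤ ∫ u in (s : ℝ)..t, (Q u.toNNReal * P u.toNNReal t) x x := by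
    refine intervalIntegral.integral_mono_on hst (by simp) (hP.intervalIntegrable hq hm h x x) ?_
    intro u hu
    have hut : u.toNNReal ≤ t := Real.toNNReal_le_iff_le_coe.2 hu.2
    rw [Matrix.mul_apply, ← Finset.add_sum_erase _ _ (Finset.mem_univ x)]
    have h1 : 0 ≤ ∑ z ∈ Finset.univ.erase x, Q u.toNNReal x z * P u.toNNReal t z x :=
      Finset.sum_nonneg fun z hz => mul_nonneg ((hQ _).1 _ _ (Finset.ne_of_mem_erase hz).symm)
        (hP.nonneg hut z x)
    have h2 := abs_le.1 (hq u.toNNReal x x)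
    have h3 := hP.nonneg hut x x
    have h4 := hP.le_one hut x x
    nlinarith [abs_nonneg (Q u.toNNReal x x), hq u.toNNReal x x]
  simp only [intervalIntegral.integral_const, smul_eq_mul] at this
  linarith

lemma le_of_ne {s t : ℝ≥0} (h : s ≤ t) {x y : S} (hxy : x ≠ y) (hQ : ∀ t, IsRateMatrix (Q t)) :
    P s t x y ≤ q * (t - s) := by
  refine le_trans ?_ (hP.one_sub_le hq hm h x hQ)
  have h1 := hP.sum_eq_one h x
  rw [← Finset.add_sum_erase _ _ (Finset.mem_univ x)] at h1
  have h2 : P s t x y ≤ ∑ z ∈ Finset.univ.erase x, P s t x z :=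
    Finset.single_le_sum (f := fun y => P s t x y) (fun z _ => hP.nonneg h x z)
      (Finset.mem_erase.2 ⟨hxy.symm, Finset.mem_univ y⟩)
  linarith

lemma abs_sub_one_le {s t : ℝ≥0} (h : s ≤ t) (x y : S) (hQ : ∀ t, IsRateMatrix (Q t)) :
    |P s t x y - (1 : Matrix S S ℝ) x y| ≤ q * (t - s) := by
  by_cases hxy : x = y
  · subst hxy
    rw [Matrix.one_apply_eq, abs_sub_comm, abs_of_nonneg (by linarith [hP.le_one h x x])]
    exact hP.one_sub_le hq hm h x hQ
  · rw [Matrix.one_apply_ne hxy, sub_zero, abs_of_nonneg (hP.nonneg h x y)]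
    exact hP.le_of_ne hq hm h hxy hQ

/-- Replacing `P(u,t)` by the identity in the backward equation changes each entry by at most `q (t
- s)`. Integrated against rates bounded by `q`, this is a quadratic error. -/
lemma abs_sub_integral_le {s t : ℝ≥0} (h : s ≤ t) {x y : S} (hxy : x ≠ y)
    (hQ : ∀ t, IsRateMatrix (Q t)) :
    |P s t x y - ∫ u in (s : ℝ)..t, Q u.toNNReal x y| ≤ Fintype.card S * q ^ 2 * ((t : ℝ) - s) ^ 2 := by
  have hst : (s : ℝ) ≤ t := by exact_mod_cast h
  have q0 : 0 ≤ q := (abs_nonneg _).trans (hq 0 x y)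
  have iQ : IntervalIntegrable (fun u => Q u.toNNReal x y) volume s t := by
    rw [intervalIntegrable_iff_integrableOn_Ioc_of_le hst]
    exact Measure.integrableOn_of_bounded (M := q) (by simp)
      ((hm x y).comp measurable_real_toNNReal).aestronglyMeasurable (ae_of_all _ fun u => hq _ x y)
  rw [hP.backward s t h x y, Matrix.one_apply_ne hxy, zero_add,
    ← intervalIntegral.integral_sub (hP.intervalIntegrable hq hm h x y) iQ]
  have := intervalIntegral.norm_integral_le_of_norm_le_const (a := (s : ℝ)) (b := t)
    (f := fun u => (Q u.toNNReal * P u.toNNReal t) x y - Q u.toNNReal x y)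
    (C := Fintype.card S * q ^ 2 * ((t : ℝ) - s)) ?_
  · refine this.trans (le_of_eq ?_)
    rw [abs_of_nonneg (by linarith)]; ring
  · intro u hu
    rw [Set.uIoc_of_le hst] at hu
    have hut : u.toNNReal ≤ t := Real.toNNReal_le_iff_le_coe.2 hu.2
    have e : (Q u.toNNReal * P u.toNNReal t) x y - Q u.toNNReal x y
        = ∑ z, Q u.toNNReal x z * (P u.toNNReal t z y - (1 : Matrix S S ℝ) z y) := by
      rw [Matrix.mul_apply]
      simp only [mul_sub, Finset.sum_sub_distrib]
      rw [← Matrix.mul_apply, ← Matrix.mul_apply, Matrix.mul_one]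
    rw [e, Real.norm_eq_abs]
    refine (Finset.abs_sum_le_sum_abs _ _).trans ?_
    have hu0 : (0 : ℝ) ≤ u := s.2.trans hu.1.le
    calc ∑ z, |Q u.toNNReal x z * (P u.toNNReal t z y - (1 : Matrix S S ℝ) z y)|
        ≤ ∑ _z : S, q * (q * (t - s)) := by
          refine Finset.sum_le_sum fun z _ => ?_
          rw [abs_mul]
          refine mul_le_mul (hq _ _ _) ((hP.abs_sub_one_le hq hm hut z y hQ).trans ?_) (abs_nonneg _) q0
          rw [Real.coe_toNNReal u hu0]
          gcongr
          exact hu.1.le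
      _ = _ := by simp; ring

end IsTransition
end

/-! ### Independence checked on atoms and along increasing σ-algebras. -/

section

variable {Ω : Type*} {m0 : MeasurableSpace Ω}

lemma isPiSystem_inter_fiber {α : Type*} (m : MeasurableSpace Ω) (V : Ω → α) :
    IsPiSystem {s | ∃ C v, MeasurableSet[m] C ∧ s = C ∩ V ⁻¹' {v}} := by
  rintro _ ⟨C, v, hC, rfl⟩ _ ⟨C', v', hC', rfl⟩ ⟨ω, ⟨-, h1⟩, -, h2⟩
  have : v = v' := by rw [← h1, ← h2]
  subst this
  refine ⟨C ∩ C', v, hC.inter hC', ?_⟩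
  ext ω; simp; tauto

lemma generateFrom_inter_fiber {α : Type*} [Countable α] (m : MeasurableSpace Ω) (V : Ω → α) :
    MeasurableSpace.generateFrom {s | ∃ C v, MeasurableSet[m] C ∧ s = C ∩ V ⁻¹' {v}}
      = m ⊔ MeasurableSpace.comap V ⊤ := by
  have hgen (C : Set Ω) (hC : MeasurableSet[m] C) (B : Set α) :
      MeasurableSet[MeasurableSpace.generateFrom {s | ∃ C v, MeasurableSet[m] C ∧ s = C ∩ V ⁻¹' {v}}]
        (C ∩ V ⁻¹' B) := by
    have : C ∩ V ⁻¹' B = ⋃ v ∈ B, C ∩ V ⁻¹' {v} := by ext ω; simp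
    rw [this]
    refine MeasurableSet.biUnion (Set.to_countable B) fun v _ => ?_
    exact MeasurableSpace.measurableSet_generateFrom ⟨C, v, hC, rfl⟩
  refine le_antisymm ?_ (sup_le ?_ ?_)
  · refine MeasurableSpace.generateFrom_le ?_
    rintro _ ⟨C, v, hC, rfl⟩
    exact MeasurableSet.inter ((le_sup_left (a := m) (b := MeasurableSpace.comap V ⊤)) C hC)
      ((le_sup_right (a := m) (b := MeasurableSpace.comap V ⊤)) _ ⟨{v}, trivial, rfl⟩)
  · intro C hC
    simpa using hgen C hC Set.univ
  · rintro _ ⟨B, -, rfl⟩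
    simpa using hgen Set.univ MeasurableSet.univ B

/-- Independence of σ-algebras enlarged by countably valued variables can be checked on atoms. -/
lemma indep_sup_comap_of_atoms {α β : Type*} [Countable α] [Countable β]
    {ν : Measure Ω} [IsZeroOrProbabilityMeasure ν] {m₁ m₂ : MeasurableSpace Ω} (h₁ : m₁ ≤ m0)
    (h₂ : m₂ ≤ m0) {V : Ω → α} {W : Ω → β} (hV : MeasurableSpace.comap V ⊤ ≤ m0)
    (hW : MeasurableSpace.comap W ⊤ ≤ m0)
    (h : ∀ C₁ C₂ v w, MeasurableSet[m₁] C₁ → MeasurableSet[m₂] C₂ →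
      ν ((C₁ ∩ V ⁻¹' {v}) ∩ (C₂ ∩ W ⁻¹' {w})) = ν (C₁ ∩ V ⁻¹' {v}) * ν (C₂ ∩ W ⁻¹' {w})) :
    Indep (m₁ ⊔ MeasurableSpace.comap V ⊤) (m₂ ⊔ MeasurableSpace.comap W ⊤) ν := by
  refine IndepSets.indep (sup_le h₁ hV) (sup_le h₂ hW) (isPiSystem_inter_fiber m₁ V)
    (isPiSystem_inter_fiber m₂ W) (generateFrom_inter_fiber m₁ V).symm
    (generateFrom_inter_fiber m₂ W).symm ?_
  rw [IndepSets_iff]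
  rintro _ _ ⟨C₁, v, hC₁, rfl⟩ ⟨C₂, w, hC₂, rfl⟩
  exact h C₁ C₂ v w hC₁ hC₂

/-- The two limits are taken one after the other; indices `n` and `k` are compared through `max n
k`. -/
lemma indep_iSup_iSup_of_monotone {ν : Measure Ω} [IsZeroOrProbabilityMeasure ν]
    {m₁ m₂ : ℕ → MeasurableSpace Ω} (h₁ : ∀ n, m₁ n ≤ m0) (h₂ : ∀ n, m₂ n ≤ m0)
    (hm₁ : Monotone m₁) (hm₂ : Monotone m₂) (h : ∀ n, Indep (m₁ n) (m₂ n) ν) :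
    Indep (⨆ n, m₁ n) (⨆ n, m₂ n) ν := by
  refine indep_iSup_of_monotone (fun n => ?_) h₁ (iSup_le h₂) hm₁
  refine (indep_iSup_of_monotone (fun k => ?_) h₂ (h₁ n) hm₂).symm
  exact (indep_of_indep_of_le_left (indep_of_indep_of_le_right (h (max n k)) (hm₂ (le_max_right n k)))
    (hm₁ (le_max_left n k))).symm

end

/-! ### Dyadic grids. -/

section Grid

/-- Dyadic points of the interval `[a,b]`. -/
def dyadic (a b : ℝ≥0) (n j : ℕ) : ℝ≥0 := a + (b - a) * (j / 2 ^ n)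

lemma dyadic_mono (a b : ℝ≥0) (n : ℕ) : Monotone (dyadic a b n) := fun i j hij => by
  unfold dyadic; gcongr

@[simp] lemma dyadic_zero (a b : ℝ≥0) (n : ℕ) : dyadic a b n 0 = a := by simp [dyadic]

lemma dyadic_top {a b : ℝ≥0} (h : a ≤ b) (n : ℕ) : dyadic a b n (2 ^ n) = b := by
  simp [dyadic, add_tsub_cancel_of_le h]

lemma dyadic_succ (a b : ℝ≥0) (n j : ℕ) : dyadic a b (n + 1) (2 * j) = dyadic a b n j := by
  unfold dyadic
  congr 2
  push_cast
  rw [pow_succ, mul_comm (2 ^ n) (2 : ℝ≥0), mul_div_mul_left _ _ two_ne_zero]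

lemma dyadic_lt {a b : ℝ≥0} (h : a < b) {n j : ℕ} (hj : j < 2 ^ n) : dyadic a b n j < b := by
  have : (j / 2 ^ n : ℝ≥0) < 1 := by
    rw [div_lt_one (by positivity)]; exact_mod_cast hj
  calc dyadic a b n j < a + (b - a) * 1 := by
        unfold dyadic
        have : 0 < b - a := tsub_pos_of_lt h
        gcongr
    _ = b := by rw [mul_one, add_tsub_cancel_of_le h.le]

lemma tendsto_const_add_half_pow (θ : ℝ≥0) :
    Tendsto (fun n : ℕ => θ + (1 / 2 : ℝ≥0) ^ n) atTop (𝓝 θ) := by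
  have h : Tendsto (fun n : ℕ => (1 / 2 : ℝ≥0) ^ n) atTop (𝓝 0) :=
    NNReal.tendsto_pow_atTop_nhds_zero_of_lt_one (by
      rw [div_lt_one two_pos]; exact one_lt_two)
  simpa using h.const_add θ

/-- Rounding up gives approximations from the right, as right-continuity requires. The middle
conclusion keeps them strictly before `b` when `t < b`; this matters when `b` is a resetting time,
whose state belongs to the next cycle. -/
lemma exists_dyadic_tendsto {a b t : ℝ≥0} (hat : a ≤ t) (htb : t ≤ b) :
    ∃ k : ℕ → ℕ, (∀ n, k n ≤ 2 ^ n) ∧ (t < b → ∀ᶠ n in atTop, k n < 2 ^ n) ∧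
      Tendsto (fun n => dyadic a b n (k n)) atTop (𝓝[≥] t) := by
  rcases eq_or_lt_of_le (hat.trans htb) with hab | hab
  · have : t = a := le_antisymm (hab ▸ htb) hat
    subst this
    subst hab
    refine ⟨fun _ => 0, fun n => by positivity, fun h => absurd h (lt_irrefl _), ?_⟩
    simp only [dyadic_zero]
    exact tendsto_nhdsWithin_iff.2 ⟨tendsto_const_nhds, Eventually.of_forall fun _ => Set.self_mem_Ici⟩
  · set θ : ℝ≥0 := (t - a) / (b - a) with hθ
    have hba : 0 < b - a := tsub_pos_of_lt hab
    have hθt : a + (b - a) * θ = t := by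
      rw [hθ, mul_div_cancel₀ _ hba.ne', add_tsub_cancel_of_le hat]
    have hθ1 : θ ≤ 1 := by
      rw [hθ, div_le_one hba]; exact tsub_le_tsub_right htb a
    have hk (n : ℕ) : θ ≤ (⌈θ * 2 ^ n⌉₊ : ℝ≥0) / 2 ^ n := by
      rw [le_div_iff₀ (by positivity)]; exact Nat.le_ceil _
    have hk2 (n : ℕ) : (⌈θ * 2 ^ n⌉₊ : ℝ≥0) / 2 ^ n ≤ θ + (1 / 2) ^ n := by
      rw [div_le_iff₀ (by positivity), add_mul, ← mul_pow]
      simp only [one_div, inv_mul_cancel₀ (two_ne_zero (α := ℝ≥0)), one_pow]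
      exact (Nat.ceil_lt_add_one zero_le).le
    refine ⟨fun n => ⌈θ * 2 ^ n⌉₊, fun n => ?_, fun htb' => ?_, ?_⟩
    · rw [Nat.ceil_le]
      push_cast
      calc θ * 2 ^ n ≤ 1 * 2 ^ n := by gcongr
        _ = 2 ^ n := one_mul _
    · have hθlt : θ < 1 := by
        rw [hθ, div_lt_one hba]
        exact tsub_lt_tsub_right_of_le hat htb'
      have : Tendsto (fun n : ℕ => θ + (1 / 2 : ℝ≥0) ^ n) atTop (𝓝 θ) :=
        tendsto_const_add_half_pow θ
      filter_upwards [this.eventually (gt_mem_nhds hθlt)] with n hn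
      have h1 := (hk2 n).trans_lt hn
      rw [div_lt_one (by positivity)] at h1
      exact_mod_cast h1
    · refine tendsto_nhdsWithin_iff.2 ⟨?_, Eventually.of_forall fun n => ?_⟩
      · have h1 : Tendsto (fun n : ℕ => (⌈θ * 2 ^ n⌉₊ : ℝ≥0) / 2 ^ n) atTop (𝓝 θ) := by
          refine tendsto_of_tendsto_of_tendsto_of_le_of_le (g := fun _ => θ)
            (h := fun n : ℕ => θ + (1 / 2 : ℝ≥0) ^ n) tendsto_const_nhds
            (tendsto_const_add_half_pow θ) hk hk2
        have := (h1.const_mul (b - a)).const_add a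
        rw [hθt] at this
        exact this
      · rw [Set.mem_Ici]
        calc t = a + (b - a) * θ := hθt.symm
          _ ≤ _ := by unfold dyadic; gcongr; exact hk n

/-- A right-continuous process with values in a discrete space is measurable at `t` if it is so
along a sequence decreasing to `t`. -/
lemma measurable_of_tendsto_right {Ω S : Type*} [TopologicalSpace S] [DiscreteTopology S]
    [MeasurableSpace S] [DiscreteMeasurableSpace S] [Countable S] {m : MeasurableSpace Ω}
    {X : ℝ≥0 → Ω → S} {t : ℝ≥0}
    (hX : ∀ ω, ContinuousWithinAt (fun s => X s ω) (Set.Ici t) t) {u : ℕ → ℝ≥0}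
    (hu : Tendsto u atTop (𝓝[≥] t)) (hm : ∀ᶠ n in atTop, Measurable[m] (X (u n))) :
    Measurable[m] (X t) := by
  obtain ⟨N, hN⟩ := eventually_atTop.1 hm
  refine measurable_of_tendsto_metrizable (f := fun n => X (u (n + N)))
    (fun n => hN _ (by omega)) ?_
  rw [tendsto_pi_nhds]
  intro ω
  exact (hX ω).tendsto.comp (hu.comp (tendsto_add_atTop_nat N))

/-- Dyadic points of `[a,s]` followed by dyadic points of `[s,b]`. -/
def dyadic₂ (a s b : ℝ≥0) (n j : ℕ) : ℝ≥0 :=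
  if j ≤ 2 ^ n then dyadic a s n j else dyadic s b n (j - 2 ^ n)

lemma dyadic₂_left {a s b : ℝ≥0} {n j : ℕ} (hj : j ≤ 2 ^ n) :
    dyadic₂ a s b n j = dyadic a s n j := if_pos hj

lemma dyadic₂_right {a s b : ℝ≥0} (has : a ≤ s) {n : ℕ} (j : ℕ) :
    dyadic₂ a s b n (2 ^ n + j) = dyadic s b n j := by
  rcases Nat.eq_zero_or_pos j with rfl | hj
  · rw [add_zero, dyadic₂_left le_rfl, dyadic_top has, dyadic_zero]
  · rw [dyadic₂, if_neg (by omega), Nat.add_sub_cancel_left]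

lemma dyadic₂_mono {a s b : ℝ≥0} (has : a ≤ s) (n : ℕ) : Monotone (dyadic₂ a s b n) := by
  refine monotone_nat_of_le_succ fun j => ?_
  rcases Nat.lt_or_ge j (2 ^ n) with h | h
  · rw [dyadic₂_left h.le, dyadic₂_left h]
    exact dyadic_mono _ _ _ (Nat.le_succ j)
  · obtain ⟨i, rfl⟩ := Nat.exists_eq_add_of_le h
    rw [dyadic₂_right has, add_assoc, dyadic₂_right has]
    exact dyadic_mono _ _ _ (Nat.le_succ i)

end Grid

/-! ### σ-algebras generated by processes, and factorization criteria. -/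

section

variable {Ω : Type*} {m0 : MeasurableSpace Ω}

lemma sigma_le {α : Type*} [MeasurableSpace α] {X : ℝ≥0 → Ω → α} {I : Set ℝ≥0}
    {m : MeasurableSpace Ω} (h : ∀ t ∈ I, Measurable[m] (X t)) : sigma X I ≤ m :=
  iSup₂_le fun t ht => (h t ht).comap_le

lemma measurable_sigma {α : Type*} [MeasurableSpace α] {X : ℝ≥0 → Ω → α} {I : Set ℝ≥0} {t : ℝ≥0}
    (ht : t ∈ I) : Measurable[sigma X I] (X t) :=
  Measurable.of_comap_le (le_iSup₂ (f := fun t (_ : t ∈ I) => MeasurableSpace.comap (X t) _) t ht)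

lemma sigma_mono {α : Type*} [MeasurableSpace α] {X : ℝ≥0 → Ω → α} {I I' : Set ℝ≥0}
    (h : I ⊆ I') : sigma X I ≤ sigma X I' := sigma_le fun _ ht => measurable_sigma (h ht)

/-- A vector of finitely many coordinates in a countable space takes values in a countable space,
where every set is measurable, so `⊤` may serve as the σ-algebra of the target. -/
lemma comap_top_le {ι α : Type*} [Finite ι] [Countable α] [MeasurableSpace α]
    [MeasurableSingletonClass α] {m : MeasurableSpace Ω} {V : Ω → ι → α}
    (h : ∀ i, Measurable[m] fun ω => V ω i) : MeasurableSpace.comap V ⊤ ≤ m := by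
  rintro _ ⟨B, -, rfl⟩
  have : Measurable[m] V := @measurable_pi_lambda _ _ _ m _ V h
  exact this (Set.to_countable B).measurableSet

lemma measurable_comap_top_apply {ι α : Type*} [MeasurableSpace α] (V : Ω → ι → α) (i : ι) :
    Measurable[MeasurableSpace.comap V ⊤] fun ω => V ω i :=
  fun s _ => ⟨{v | v i ∈ s}, trivial, rfl⟩

lemma real_cond_apply {P : Measure Ω} {A : Set Ω} (hA : MeasurableSet A) (B : Set Ω) :
    (P[|A]).real B = (P.real A)⁻¹ * P.real (A ∩ B) := by
  rw [measureReal_def, cond_apply hA, ENNReal.toReal_mul, ENNReal.toReal_inv]; rfl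

/-- Summing over `v` identifies `b w` as the conditional probability of `W = w` given `A`. A
factorization through a function of `w` alone is therefore independence. -/
lemma indep_comap_of_forall_eq_mul {α β : Type*} [Fintype α] [Countable β]
    {P : Measure Ω} [IsProbabilityMeasure P] {A : Set Ω} (hA : MeasurableSet A) (hA0 : P A ≠ 0)
    {V : Ω → α} {W : Ω → β} (hV : MeasurableSpace.comap V ⊤ ≤ m0)
    (hW : MeasurableSpace.comap W ⊤ ≤ m0) (b : β → ℝ)
    (h : ∀ v w, P.real (A ∩ (V ⁻¹' {v} ∩ W ⁻¹' {w})) = P.real (A ∩ V ⁻¹' {v}) * b w) :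
    Indep (MeasurableSpace.comap V ⊤) (MeasurableSpace.comap W ⊤) P[|A] := by
  have hVm (v : α) : MeasurableSet (V ⁻¹' {v}) := hV _ ⟨{v}, trivial, rfl⟩
  have hWm (w : β) : MeasurableSet (W ⁻¹' {w}) := hW _ ⟨{w}, trivial, rfl⟩
  have hsum (B : Set Ω) (hB : MeasurableSet B) : ∑ v, P.real (V ⁻¹' {v} ∩ B) = P.real B := by
    classical
    have := measureReal_biUnion_finset (μ := P) (s := (Finset.univ : Finset α))
      (f := fun v => V ⁻¹' {v} ∩ B) (fun v _ v' _ hvv => by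
        refine Set.disjoint_left.2 fun ω h1 h2 => hvv ?_
        rw [← h1.1, ← h2.1]) (fun v _ => (hVm v).inter hB)
    rw [← this]
    congr 1
    ext ω; simp
  have hW' (w : β) : P.real (A ∩ W ⁻¹' {w}) = P.real A * b w := by
    rw [← hsum _ (hA.inter (hWm w)), ← hsum A hA, Finset.sum_mul]
    refine Finset.sum_congr rfl fun v _ => ?_
    rw [Set.inter_comm _ A, ← h v w]
    congr 1
    ext ω; simp; tauto
  have hA1 : P.real A ≠ 0 := by rwa [measureReal_ne_zero_iff]
  have key := indep_sup_comap_of_atoms (ν := P[|A]) (m₁ := ⊥) (m₂ := ⊥) bot_le bot_le hV hW ?_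
  · simpa using key
  · intro C₁ C₂ v w hC₁ hC₂
    rw [MeasurableSpace.measurableSet_bot_iff] at hC₁ hC₂
    rcases hC₁ with rfl | rfl
    · simp
    rcases hC₂ with rfl | rfl
    · simp
    simp only [Set.univ_inter]
    have : (P[|A]).real (V ⁻¹' {v} ∩ W ⁻¹' {w}) = (P[|A]).real (V ⁻¹' {v}) * (P[|A]).real (W ⁻¹' {w}) := by
      rw [real_cond_apply hA, real_cond_apply hA, real_cond_apply hA, h, hW']
      field_simp
    rw [← ENNReal.toReal_eq_toReal_iff' (measure_ne_top _ _)
      (ENNReal.mul_ne_top (measure_ne_top _ _) (measure_ne_top _ _)), ENNReal.toReal_mul]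
    exact this

end

/-! ### Markov property of the reset state process. -/

section

variable {S Ω : Type*} [Fintype S] [DecidableEq S] [TopologicalSpace S] [DiscreteTopology S]
  [MeasurableSpace S] [DiscreteMeasurableSpace S] [MeasurableSpace Ω] {Pr : Measure Ω}
  [IsProbabilityMeasure Pr] {Q : ℝ≥0 → Matrix S S ℝ} {X : ℝ≥0 → Ω → S}

lemma IsMarkovJumpOn.exists_forall_nat {μ : PMF S} {a b : ℝ≥0} (h : IsMarkovJumpOn Q μ X Pr a b) :
    ∃ P, IsTransition Q P ∧ ∀ (M : ℕ) (u : ℕ → ℝ≥0) (x : ℕ → S), Monotone u → u 0 = a → u M < b →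
      Pr.real {ω | ∀ j ≤ M, X (u j) ω = x j}
        = (μ (x 0)).toReal * ∏ j ∈ Finset.range M, P (u j) (u (j + 1)) (x j) (x (j + 1)) := by
  obtain ⟨P, hP, h⟩ := h
  refine ⟨P, hP, fun M u x hu h0 hM => ?_⟩
  have := h M (fun j => u j) (fun j => x j) (fun i j hij => hu hij) h0 hM
  simp only [Fin.val_zero, Fin.val_castSucc, Fin.val_succ] at this
  rw [Fin.prod_univ_eq_prod_range (fun j => P (u j) (u (j + 1)) (x j) (x (j + 1))) M] at this
  rw [← this]
  congr 1
  ext ω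
  exact ⟨fun h j => h j (by omega), fun h j hj => h ⟨j, by omega⟩⟩

/-- The product formula for finite-dimensional probabilities splits at the `K`-th grid point into a
factor of the past and a factor of the future that start from the same state. -/
lemma IsMarkovJumpOn.indep_cond_grid {μ : PMF S} {a b : ℝ≥0} (h : IsMarkovJumpOn Q μ X Pr a b)
    (hm : ∀ t, Measurable (X t)) {u : ℕ → ℝ≥0} (hu : Monotone u) (h0 : u 0 = a) {K L : ℕ}
    (hb : u (K + L) < b) (y : S) (hy : Pr (X (u K) ⁻¹' {y}) ≠ 0) :
    Indep (MeasurableSpace.comap (fun ω (j : Fin (K + 1)) => X (u j) ω) ⊤)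
      (MeasurableSpace.comap (fun ω (j : Fin (L + 1)) => X (u (K + j)) ω) ⊤)
      Pr[|X (u K) ⁻¹' {y}] := by
  obtain ⟨P, hP, h⟩ := h.exists_forall_nat
  have hbK : u K < b := (hu (by omega)).trans_lt hb
  refine indep_comap_of_forall_eq_mul (hm _ (measurableSet_singleton y)) hy
    (comap_top_le fun i => hm _) (comap_top_le fun i => hm _)
    -- Both vectors contain the state at the conditioning time, so a future vector that does not
    -- start at `y` has weight zero.
    (fun w => if w 0 = y then ∏ j ∈ Finset.range L, P (u (K + j)) (u (K + (j + 1)))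
      (w (Fin.ofNat (L + 1) j)) (w (Fin.ofNat (L + 1) (j + 1))) else 0) fun v w => ?_
  by_cases hv : v (Fin.last K) = y
  swap
  · have (B : Set Ω) :
        X (u K) ⁻¹' {y} ∩ ((fun ω (j : Fin (K + 1)) => X (u j) ω) ⁻¹' {v} ∩ B) = ∅ := by
      refine Set.eq_empty_of_forall_notMem fun ω hω => hv ?_
      obtain ⟨h1, h2, -⟩ := hω
      have h2 : (fun j : Fin (K + 1) => X (u j) ω) = v := h2
      rw [← h2]; exact h1
    have h' := this Set.univ
    rw [Set.inter_univ] at h'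
    rw [this, h']; simp
  by_cases hw : w 0 = y
  swap
  · rw [if_neg hw, mul_zero]
    convert measureReal_empty (μ := Pr)
    refine Set.eq_empty_of_forall_notMem fun ω hω => hw ?_
    obtain ⟨h1, -, h2⟩ := hω
    have h2 : (fun j : Fin (L + 1) => X (u (K + j)) ω) = w := h2
    rw [← h2]; exact h1
  rw [if_pos hw]
  -- The two vectors are concatenated into one path; they overlap at index `K`, where both equal
  -- `y`.
  set x : ℕ → S := fun j => if hj : j ≤ K then v ⟨j, by omega⟩ else w (Fin.ofNat (L + 1) (j - K)) with hx
  have hxK (j : ℕ) (hj : j ≤ L) : x (K + j) = w (Fin.ofNat (L + 1) j) := by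
    rcases Nat.eq_zero_or_pos j with rfl | hj0
    · simp only [hx, add_zero, le_refl, dif_pos]
      rw [show (⟨K, by omega⟩ : Fin (K + 1)) = Fin.last K from rfl, hv, ← hw]; rfl
    · simp only [hx]
      rw [dif_neg (by omega), Nat.add_sub_cancel_left]
  have e1 : X (u K) ⁻¹' {y} ∩ (fun ω (j : Fin (K + 1)) => X (u j) ω) ⁻¹' {v}
      = {ω | ∀ j ≤ K, X (u j) ω = x j} := by
    ext ω
    simp only [Set.mem_inter_iff, Set.mem_preimage, Set.mem_singleton_iff, Set.mem_setOf_eq]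
    constructor
    · rintro ⟨-, h2⟩ j hj
      rw [hx]; simp only [hj, dif_pos]; rw [← h2]
    · intro h2
      refine ⟨?_, ?_⟩
      · rw [h2 K le_rfl, ← hv]; simp [hx]; rfl
      · ext j
        rw [h2 j (by omega)]; simp only [hx]; rw [dif_pos (by omega)]
  have e2 : X (u K) ⁻¹' {y} ∩ ((fun ω (j : Fin (K + 1)) => X (u j) ω) ⁻¹' {v}
      ∩ (fun ω (j : Fin (L + 1)) => X (u (K + j)) ω) ⁻¹' {w})
      = {ω | ∀ j ≤ K + L, X (u j) ω = x j} := by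
    rw [← Set.inter_assoc, e1]
    ext ω
    simp only [Set.mem_inter_iff, Set.mem_preimage, Set.mem_singleton_iff, Set.mem_setOf_eq]
    constructor
    · rintro ⟨h1, h2⟩ j hj
      rcases le_total j K with hjK | hjK
      · exact h1 j hjK
      · obtain ⟨i, rfl⟩ := Nat.exists_eq_add_of_le hjK
        rw [hxK i (by omega), ← h2]
        simp [Nat.mod_eq_of_lt (show i < L + 1 by omega)]
    · intro h1
      refine ⟨fun j hj => h1 j (by omega), ?_⟩
      ext j
      rw [h1 _ (by omega), hxK _ (by omega)]
      congr 1
      exact Fin.cast_val_eq_self j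
  rw [e2, e1, h (K + L) u x hu h0 hb, h K u x hu h0 hbK, Finset.prod_range_add, mul_assoc]
  congr 2
  refine Finset.prod_congr rfl fun j hj => ?_
  rw [Finset.mem_range] at hj
  rw [add_assoc, hxK j (by omega), hxK (j + 1) (by omega)]

/-- The grid version is exhausted along dyadic refinements of `[m,s]` and `[s,m+1)`, and
right-continuity recovers the remaining times. The point `m + 1` is left out because the state there
has been reset, which is why the second grid stops one step early. -/
theorem IsResetJumpProcess.indep_cond {μ : ℕ → PMF S} (hX : IsResetJumpProcess Q μ X Pr) {m : ℕ}
    {s : ℝ≥0} (hs : m ≤ s) (hs' : s < m + 1) (y : S) (hy : Pr (X s ⁻¹' {y}) ≠ 0) :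
    Indep (sigma X (Set.Icc m s)) (sigma X (Set.Ico s (m + 1))) Pr[|X s ⁻¹' {y}] := by
  set u : ℕ → ℕ → ℝ≥0 := dyadic₂ m s (m + 1) with hu
  have hrc (t : ℝ≥0) (ω : Ω) : ContinuousWithinAt (fun s => X s ω) (Set.Ici t) t := (hX.cadlag ω t).1
  have hL (n : ℕ) : 2 ^ n - 1 + 1 = 2 ^ n := Nat.sub_add_cancel Nat.one_le_two_pow
  have hus (n : ℕ) : u n (2 ^ n) = s := by rw [hu, dyadic₂_left le_rfl, dyadic_top hs]
  set m₁ : ℕ → MeasurableSpace Ω :=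
    fun n => MeasurableSpace.comap (fun ω (j : Fin (2 ^ n + 1)) => X (u n j) ω) ⊤ with hm₁
  set m₂ : ℕ → MeasurableSpace Ω :=
    fun n => MeasurableSpace.comap (fun ω (j : Fin (2 ^ n - 1 + 1)) => X (u n (2 ^ n + j)) ω) ⊤ with hm₂
  have hmeas₁ (n j : ℕ) (hj : j ≤ 2 ^ n) : Measurable[m₁ n] (X (u n j)) :=
    measurable_comap_top_apply (fun ω (j : Fin (2 ^ n + 1)) => X (u n j) ω) ⟨j, by omega⟩
  have hmeas₂ (n j : ℕ) (hj : j < 2 ^ n) : Measurable[m₂ n] (X (u n (2 ^ n + j))) :=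
    measurable_comap_top_apply (fun ω (j : Fin (2 ^ n - 1 + 1)) => X (u n (2 ^ n + j)) ω)
      ⟨j, by omega⟩
  have hmono₁ : Monotone m₁ := monotone_nat_of_le_succ fun n => comap_top_le fun i => by
    have h1 : u n i = u (n + 1) (2 * i) := by
      rw [hu, dyadic₂_left (by omega), dyadic₂_left (by rw [pow_succ]; omega), dyadic_succ]
    rw [h1]
    exact hmeas₁ _ _ (by rw [pow_succ]; omega)
  have hmono₂ : Monotone m₂ := monotone_nat_of_le_succ fun n => comap_top_le fun i => by
    have h1 : u n (2 ^ n + i) = u (n + 1) (2 ^ (n + 1) + 2 * i) := by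
      rw [hu, dyadic₂_right hs, dyadic₂_right hs, dyadic_succ]
    have h2 := hL n
    rw [h1]
    exact hmeas₂ _ _ (by rw [pow_succ]; omega)
  have hind (n : ℕ) : Indep (m₁ n) (m₂ n) Pr[|X s ⁻¹' {y}] := by
    have := (hX.markov m).indep_cond_grid hX.measurable (u := u n) (dyadic₂_mono hs n)
      (K := 2 ^ n) (L := 2 ^ n - 1)
      (by rw [hu, dyadic₂_left (Nat.zero_le _), dyadic_zero])
      (by
        rw [hu, dyadic₂_right hs]
        exact dyadic_lt hs' (by have := hL n; omega)) y (by rwa [hus])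
    rwa [hus] at this
  have hall := indep_iSup_iSup_of_monotone (ν := Pr[|X s ⁻¹' {y}])
    (fun n => comap_top_le fun i => hX.measurable _) (fun n => comap_top_le fun i => hX.measurable _)
    hmono₁ hmono₂ hind
  refine indep_of_indep_of_le_left (indep_of_indep_of_le_right hall (sigma_le fun t ht => ?_))
    (sigma_le fun t ht => ?_)
  · obtain ⟨k, hk, hk', hkt⟩ := exists_dyadic_tendsto ht.1 ht.2.le
    refine measurable_of_tendsto_right (hrc t) hkt ?_
    filter_upwards [hk' ht.2] with n hn
    have := hmeas₂ n (k n) hn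
    rw [hu, dyadic₂_right hs] at this
    exact this.mono (le_iSup m₂ n) le_rfl
  · obtain ⟨k, hk, -, hkt⟩ := exists_dyadic_tendsto ht.1 ht.2
    refine measurable_of_tendsto_right (hrc t) hkt (Eventually.of_forall fun n => ?_)
    have := hmeas₁ n (k n) (hk n)
    rw [hu, dyadic₂_left (hk n)] at this
    exact this.mono (le_iSup m₁ n) le_rfl

theorem IsResetJumpProcess.indep_nat {μ : ℕ → PMF S} (hX : IsResetJumpProcess Q μ X Pr) (n : ℕ) :
    Indep (sigma X (Set.Ico 0 n)) (sigma X (Set.Ico n (n + 1))) Pr := by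
  have h := indep_iSup_of_disjoint (m := fun n : ℕ => sigma X (Set.Ico (n : ℝ≥0) (n + 1)))
    (fun k => sigma_le fun t _ => hX.measurable t) hX.indep (S := Set.Iio n) (T := {n}) (by simp)
  refine indep_of_indep_of_le_left (indep_of_indep_of_le_right h (by simp)) (sigma_le fun t ht => ?_)
  have hk : ⌊t⌋₊ < n := (Nat.floor_lt zero_le).2 ht.2
  refine (measurable_sigma (X := X) (I := Set.Ico (⌊t⌋₊ : ℝ≥0) (⌊t⌋₊ + 1))
    ⟨Nat.floor_le zero_le, Nat.lt_floor_add_one t⟩).mono ?_ le_rfl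
  exact le_iSup₂ (f := fun (k : ℕ) (_ : k ∈ Set.Iio n) => sigma X (Set.Ico (k : ℝ≥0) (k + 1))) _ hk

end

/-! ### The modulated Poisson process: conditioning and independence over windows. -/

section

variable {S Ω : Type*} [Fintype S] [DecidableEq S] [TopologicalSpace S] [DiscreteTopology S]
  [MeasurableSpace S] [DiscreteMeasurableSpace S] {m₁ m₂ m0 : MeasurableSpace Ω}
  {Pr : Measure Ω} [IsProbabilityMeasure Pr]

lemma setIntegral_cond {E : Type*} [NormedAddCommGroup E] [NormedSpace ℝ E] {A : Set Ω}
    (hA : MeasurableSet A) {B : Set Ω} (hB : MeasurableSet B) (f : Ω → E) :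
    ∫ ω in B, f ω ∂(Pr[|A]) = (Pr.real A)⁻¹ • ∫ ω in A ∩ B, f ω ∂Pr := by
  rw [ProbabilityTheory.cond, Measure.restrict_smul, integral_smul_measure,
    Measure.restrict_restrict hB, ENNReal.toReal_inv, Set.inter_comm]
  rfl

section Poisson

variable {β : ℝ≥0 → S → ℝ} {X : ℝ≥0 → Ω → S} {N : ℝ≥0 → Ω → ℕ}

/-- The law of `N` is prescribed on every event of `σ(X)`, so conditioning on such an event only
intersects the events and rescales both sides. -/
lemma IsModulatedPoisson.cond (hN : IsModulatedPoisson β X N Pr) (hX : ∀ t, Measurable (X t))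
    {A₀ : Set Ω} (hA₀ : MeasurableSet[sigma X Set.univ] A₀) : IsModulatedPoisson β X N Pr[|A₀] := by
  have hle : sigma X Set.univ ≤ m0 := sigma_le fun t _ => hX t
  refine ⟨hN.measurable, hN.zero, hN.mono, hN.rightCont, fun A hA m u k hu => ?_⟩
  rw [real_cond_apply (hle _ hA₀), setIntegral_cond (hle _ hA₀) (hle _ hA), ← Set.inter_assoc,
    hN.law _ (hA₀.inter hA) m u k hu, smul_eq_mul]

lemma HasRewardLaw_cond {E : Data S} {Z : Model S Ω} (hZ : Z.HasRewardLaw E Pr)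
    (hX : ∀ t, Measurable (Z.X t)) (hN : ∀ t, Measurable (Z.N t))
    {A₀ : Set Ω} (hA₀ : MeasurableSet[sigma Z.X Set.univ ⊔ sigma Z.N Set.univ] A₀) :
    Z.HasRewardLaw E Pr[|A₀] := by
  have hle : sigma Z.X Set.univ ⊔ sigma Z.N Set.univ ≤ m0 :=
    sup_le (sigma_le fun t _ => hX t) (sigma_le fun t _ => hN t)
  refine ⟨hZ.measurable_g, hZ.measurable_h, hZ.measurable_k, fun p l q A hA hpq a b c => ?_⟩
  rw [real_cond_apply (hle _ hA₀), setIntegral_cond (hle _ hA₀) (hle _ hA), ← Set.inter_assoc,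
    hZ.law p l q _ (hA₀.inter hA) (fun ω hω => hpq ω hω.2) a b c, smul_eq_mul]

/-- Conditional probability, given `X`, of `k` events in `(u,v]`. -/
def poissonWeight (β : ℝ≥0 → S → ℝ) (X : ℝ≥0 → Ω → S) (u v : ℝ≥0) (k : ℕ) (ω : Ω) : ℝ :=
  (poissonMeasure (∫ s in (u : ℝ)..v, β s.toNNReal (X s.toNNReal ω)).toNNReal).real {k}

lemma poissonWeight_nonneg (u v : ℝ≥0) (k : ℕ) (ω : Ω) : 0 ≤ poissonWeight β X u v k ω :=
  measureReal_nonneg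

lemma poissonWeight_le_one (u v : ℝ≥0) (k : ℕ) (ω : Ω) : poissonWeight β X u v k ω ≤ 1 :=
  measureReal_le_one

lemma measurable_poissonWeight {m : MeasurableSpace Ω} {u v : ℝ≥0}
    (h : Measurable[m] fun ω => ∫ s in (u : ℝ)..v, β s.toNNReal (X s.toNNReal ω)) (k : ℕ) :
    Measurable[m] (poissonWeight β X u v k) := by
  have h1 : Measurable fun r : ℝ≥0 => (poissonMeasure r).real {k} := by
    simp only [poissonMeasure_real_singleton]
    fun_prop
  exact h1.comp h.real_toNNReal

lemma IsModulatedPoisson.law_nat (hN : IsModulatedPoisson β X N Pr) {A : Set Ω}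
    (hA : MeasurableSet[sigma X Set.univ] A) (M : ℕ) {u : ℕ → ℝ≥0} (hu : Monotone u) (k : ℕ → ℕ) :
    Pr.real (A ∩ {ω | ∀ j < M, N (u (j + 1)) ω = N (u j) ω + k j})
      = ∫ ω in A, ∏ j ∈ Finset.range M, poissonWeight β X (u j) (u (j + 1)) (k j) ω ∂Pr := by
  have := hN.law A hA M (fun j => u j) (fun j => k j) (fun i j hij => hu hij)
  simp only [Fin.val_castSucc, Fin.val_succ] at this
  have e (ω : Ω) := Fin.prod_univ_eq_prod_range
    (fun j => poissonWeight β X (u j) (u (j + 1)) (k j) ω) M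
  simp only [← e]
  refine Eq.trans ?_ this
  congr 2
  ext ω
  exact ⟨fun h j => h j j.2, fun h j hj => h ⟨j, hj⟩⟩

/-- Translates counts relative to the start of a window into successive increments, whose law is the
one prescribed. Monotonicity of `c` and of `v` makes truncated subtraction harmless. -/
lemma forall_sub_eq_iff {c v : ℕ → ℕ} (hc : Monotone c) (K : ℕ) :
    (∀ j ≤ K, c j - c 0 = v j) ↔ (v 0 = 0 ∧ ∀ j < K, v j ≤ v (j + 1)) ∧
      ∀ j < K, c (j + 1) = c j + (v (j + 1) - v j) := by
  constructor
  · intro h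
    refine ⟨⟨by have := h 0 (Nat.zero_le _); omega, fun j hj => ?_⟩, fun j hj => ?_⟩ <;>
    · have h1 := h j hj.le
      have h2 := h (j + 1) hj
      have h3 := hc (Nat.le_succ j)
      have h4 := hc (Nat.zero_le j)
      simp only [Nat.succ_eq_add_one] at h3
      omega
  · rintro ⟨⟨h0, h1⟩, h2⟩ j hj
    induction j with
    | zero => omega
    | succ j ih =>
      have e1 := ih (by omega)
      have e2 := h1 j (by omega)
      have e3 := h2 j (by omega)
      have h4 := hc (Nat.zero_le j)
      omega

/-- Given `X`, the counts on a grid have a product of Poisson weights as their law. The weights of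
each window are measurable for the σ-algebra of that window, so independence of `m₁` and `m₂`
factorizes their mean. Dyadic refinement then gives all times. -/
theorem IsModulatedPoisson.indep_sup (hN : IsModulatedPoisson β X N Pr)
    (hX : ∀ t, Measurable (X t)) (h₁ : m₁ ≤ sigma X Set.univ)
    (h₂ : m₂ ≤ sigma X Set.univ) (hind : Indep m₁ m₂ Pr) {a s b : ℝ≥0} (has : a ≤ s) (hsb : s ≤ b)
    (hβ₁ : ∀ u v : ℝ≥0, a ≤ u → u ≤ v → v ≤ s →
      Measurable[m₁] fun ω => ∫ w in (u : ℝ)..v, β w.toNNReal (X w.toNNReal ω))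
    (hβ₂ : ∀ u v : ℝ≥0, s ≤ u → u ≤ v → v ≤ b →
      Measurable[m₂] fun ω => ∫ w in (u : ℝ)..v, β w.toNNReal (X w.toNNReal ω)) :
    Indep (m₁ ⊔ sigma (fun t ω => N t ω - N a ω) (Set.Icc a s))
      (m₂ ⊔ sigma (fun t ω => N t ω - N s ω) (Set.Icc s b)) Pr := by
  have hle : sigma X Set.univ ≤ m0 := sigma_le fun t _ => hX t
  have h₁' := h₁.trans hle
  have h₂' := h₂.trans hle
  set u : ℕ → ℕ → ℝ≥0 := dyadic₂ a s b with hu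
  have humono (n : ℕ) : Monotone (u n) := dyadic₂_mono has n
  have hu0 (n : ℕ) : u n 0 = a := by rw [hu, dyadic₂_left (Nat.zero_le _), dyadic_zero]
  have hus (n : ℕ) : u n (2 ^ n) = s := by rw [hu, dyadic₂_left le_rfl, dyadic_top has]
  have hub (n : ℕ) : u n (2 ^ n + 2 ^ n) = b := by rw [hu, dyadic₂_right has, dyadic_top hsb]
  set V : (n : ℕ) → Ω → Fin (2 ^ n + 1) → ℕ := fun n ω j => N (u n j) ω - N a ω with hV
  set W : (n : ℕ) → Ω → Fin (2 ^ n + 1) → ℕ := fun n ω j => N (u n (2 ^ n + j)) ω - N s ω with hW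
  have hVm (n : ℕ) : MeasurableSpace.comap (V n) ⊤ ≤ m0 :=
    comap_top_le fun i => (hN.measurable _).sub (hN.measurable _)
  have hWm (n : ℕ) : MeasurableSpace.comap (W n) ⊤ ≤ m0 :=
    comap_top_le fun i => (hN.measurable _).sub (hN.measurable _)
  have hmeas₁ (n j : ℕ) (hj : j ≤ 2 ^ n) :
      Measurable[MeasurableSpace.comap (V n) ⊤] fun ω => N (u n j) ω - N a ω :=
    measurable_comap_top_apply (V n) ⟨j, by omega⟩
  have hmeas₂ (n j : ℕ) (hj : j ≤ 2 ^ n) :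
      Measurable[MeasurableSpace.comap (W n) ⊤] fun ω => N (u n (2 ^ n + j)) ω - N s ω :=
    measurable_comap_top_apply (W n) ⟨j, by omega⟩
  have hmono₁ : Monotone fun n => m₁ ⊔ MeasurableSpace.comap (V n) ⊤ :=
    monotone_nat_of_le_succ fun n => sup_le_sup_left (comap_top_le fun i => by
      have h1 : u n i = u (n + 1) (2 * i) := by
        rw [hu, dyadic₂_left (by omega), dyadic₂_left (by rw [pow_succ]; omega), dyadic_succ]
      simp only [hV]
      rw [h1]
      exact hmeas₁ _ _ (by rw [pow_succ]; omega)) _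
  have hmono₂ : Monotone fun n => m₂ ⊔ MeasurableSpace.comap (W n) ⊤ :=
    monotone_nat_of_le_succ fun n => sup_le_sup_left (comap_top_le fun i => by
      have h1 : u n (2 ^ n + i) = u (n + 1) (2 ^ (n + 1) + 2 * i) := by
        rw [hu, dyadic₂_right has, dyadic₂_right has, dyadic_succ]
      simp only [hW]
      rw [h1]
      exact hmeas₂ _ _ (by rw [pow_succ]; omega)) _
  have hindn (n : ℕ) : Indep (m₁ ⊔ MeasurableSpace.comap (V n) ⊤)
      (m₂ ⊔ MeasurableSpace.comap (W n) ⊤) Pr := by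
    refine indep_sup_comap_of_atoms h₁' h₂' (hVm n) (hWm n) ?_
    set K := 2 ^ n with hK
    intro C₁ C₂ v w hC₁ hC₂
    set v' : ℕ → ℕ := fun j => v (Fin.ofNat (K + 1) j) with hv'
    set w' : ℕ → ℕ := fun j => w (Fin.ofNat (K + 1) j) with hw'
    have eV (ω : Ω) : V n ω = v ↔ ∀ j ≤ K, N (u n j) ω - N (u n 0) ω = v' j := by
      rw [funext_iff, hu0]
      constructor
      · intro h j hj
        have := h ⟨j, by omega⟩
        simp only [hV] at this
        rw [this, hv']
        congr 1
        ext
        exact (Nat.mod_eq_of_lt (show j < K + 1 by omega)).symm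
      · intro h j
        simp only [hV]
        rw [h j (by omega)]
        exact congrArg v (Fin.cast_val_eq_self j)
    have eW (ω : Ω) : W n ω = w ↔ ∀ j ≤ K, N (u n (K + j)) ω - N (u n (K + 0)) ω = w' j := by
      rw [funext_iff, add_zero, hus]
      constructor
      · intro h j hj
        have := h ⟨j, by omega⟩
        simp only [hW] at this
        rw [this, hw']
        congr 1
        ext
        exact (Nat.mod_eq_of_lt (show j < K + 1 by omega)).symm
      · intro h j
        simp only [hW]
        rw [h j (by omega)]
        exact congrArg w (Fin.cast_val_eq_self j)
    have eV2 (ω : Ω) := (eV ω).trans (forall_sub_eq_iff (c := fun j => N (u n j) ω) (v := v')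
      ((hN.mono ω).comp (humono n)) K)
    have humono' : Monotone fun j => u n (K + j) :=
      (humono n).comp fun i j hij => by simpa using hij
    have eW2 (ω : Ω) := (eW ω).trans (forall_sub_eq_iff (c := fun j => N (u n (K + j)) ω) (v := w')
      ((hN.mono ω).comp humono') K)
    -- Prescribed counts that do not start at zero or are not monotone describe an empty event.
    by_cases hv : v' 0 = 0 ∧ ∀ j < K, v' j ≤ v' (j + 1)
    swap
    · have : V n ⁻¹' {v} = ∅ := Set.eq_empty_of_forall_notMem fun ω hω => hv ((eV2 ω).1 hω).1
      simp [this]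
    by_cases hw : w' 0 = 0 ∧ ∀ j < K, w' j ≤ w' (j + 1)
    swap
    · have : W n ⁻¹' {w} = ∅ := Set.eq_empty_of_forall_notMem fun ω hω => hw ((eW2 ω).1 hω).1
      simp [this]
    set k₁ : ℕ → ℕ := fun j => v' (j + 1) - v' j with hk₁
    set k₂ : ℕ → ℕ := fun j => w' (j + 1) - w' j with hk₂
    set k : ℕ → ℕ := fun j => if j < K then k₁ j else k₂ (j - K) with hk
    have sV : V n ⁻¹' {v} = {ω | ∀ j < K, N (u n (j + 1)) ω = N (u n j) ω + k₁ j} := by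
      ext ω; exact (eV2 ω).trans (and_iff_right hv)
    have sW : W n ⁻¹' {w}
        = {ω | ∀ j < K, N (u n (K + (j + 1))) ω = N (u n (K + j)) ω + k₂ j} := by
      ext ω; exact (eW2 ω).trans (and_iff_right hw)
    have sVW : V n ⁻¹' {v} ∩ W n ⁻¹' {w}
        = {ω | ∀ j < K + K, N (u n (j + 1)) ω = N (u n j) ω + k j} := by
      rw [sV, sW]
      ext ω
      constructor
      · rintro ⟨ha, hb⟩ j hj
        by_cases hjK : j < K
        · simp only [hk, hjK, if_true]; exact ha j hjK
        · obtain ⟨i, rfl⟩ := Nat.exists_eq_add_of_le (not_lt.1 hjK)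
          have := hb i (by omega)
          simp only [hk, hjK, if_false, Nat.add_sub_cancel_left]
          exact this
      · intro h
        refine ⟨fun j hj => ?_, fun j hj => ?_⟩
        · have := h j (by omega)
          simpa only [hk, hj, if_true] using this
        · have := h (K + j) (by omega)
          simp only [hk, if_neg (show ¬ K + j < K by omega), Nat.add_sub_cancel_left] at this
          exact this
    set F : Ω → ℝ := fun ω => ∏ j ∈ Finset.range K, poissonWeight β X (u n j) (u n (j + 1)) (k₁ j) ω
    set G : Ω → ℝ := fun ω => ∏ j ∈ Finset.range K,
      poissonWeight β X (u n (K + j)) (u n (K + (j + 1))) (k₂ j) ω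
    have hF : Measurable[m₁] F := by
      refine @Finset.measurable_fun_prod _ _ _ _ _ _ m₁ _ _ fun j hj => measurable_poissonWeight ?_ _
      rw [Finset.mem_range] at hj
      refine hβ₁ _ _ ?_ (humono n (Nat.le_succ j)) ?_
      · rw [← hu0 n]; exact humono n (Nat.zero_le j)
      · rw [← hus n]; exact humono n hj
    have hG : Measurable[m₂] G := by
      refine @Finset.measurable_fun_prod _ _ _ _ _ _ m₂ _ _ fun j hj => measurable_poissonWeight ?_ _
      rw [Finset.mem_range] at hj
      refine hβ₂ _ _ ?_ (humono' (Nat.le_succ j)) ?_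
      · rw [← hus n]; exact humono n (by omega)
      · rw [← hub n]; exact humono n (by omega)
    have l1 := hN.law_nat (h₁ _ hC₁) K (humono n) k₁
    have l2 := hN.law_nat (h₂ _ hC₂) K humono' k₂
    have l3 := hN.law_nat ((h₁ _ hC₁).inter (h₂ _ hC₂)) (K + K) (humono n) k
    have eprod (ω : Ω) : ∏ j ∈ Finset.range (K + K), poissonWeight β X (u n j) (u n (j + 1)) (k j) ω
        = F ω * G ω := by
      rw [Finset.prod_range_add]
      congr 1
      · refine Finset.prod_congr rfl fun j hj => ?_
        rw [Finset.mem_range] at hj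
        simp only [hk, hj, if_true]
      · refine Finset.prod_congr rfl fun j hj => ?_
        simp only [hk, if_neg (show ¬ K + j < K by omega), Nat.add_sub_cancel_left]
        rfl
    simp only [eprod] at l3
    have hprod : ∫ ω in C₁ ∩ C₂, F ω * G ω ∂Pr = (∫ ω in C₁, F ω ∂Pr) * ∫ ω in C₂, G ω ∂Pr := by
      rw [← integral_indicator ((h₁' _ hC₁).inter (h₂' _ hC₂)), ← integral_indicator (h₁' _ hC₁),
        ← integral_indicator (h₂' _ hC₂)]
      have f1 : Measurable[m₁] (C₁.indicator F) := hF.indicator hC₁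
      have f2 : Measurable[m₂] (C₂.indicator G) := hG.indicator hC₂
      have hI : IndepFun (C₁.indicator F) (C₂.indicator G) Pr :=
        indep_of_indep_of_le_left (indep_of_indep_of_le_right hind f2.comap_le) f1.comap_le
      rw [← hI.integral_fun_mul_eq_mul_integral (f1.mono h₁' le_rfl).aestronglyMeasurable
        (f2.mono h₂' le_rfl).aestronglyMeasurable]
      congr 1
      ext ω
      by_cases hω1 : ω ∈ C₁ <;> by_cases hω2 : ω ∈ C₂ <;> simp [hω1, hω2]
    have hreal : Pr.real ((C₁ ∩ V n ⁻¹' {v}) ∩ (C₂ ∩ W n ⁻¹' {w}))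
        = Pr.real (C₁ ∩ V n ⁻¹' {v}) * Pr.real (C₂ ∩ W n ⁻¹' {w}) := by
      rw [Set.inter_inter_inter_comm, sVW, l3, hprod, sV, sW, l1, ← l2]
    rw [← ENNReal.toReal_eq_toReal_iff' (measure_ne_top _ _)
      (ENNReal.mul_ne_top (measure_ne_top _ _) (measure_ne_top _ _)), ENNReal.toReal_mul]
    exact hreal
  have hall := indep_iSup_iSup_of_monotone (fun n => sup_le h₁' (hVm n))
    (fun n => sup_le h₂' (hWm n)) hmono₁ hmono₂ hindn
  have hrc (x : ℝ≥0) (t : ℝ≥0) (ω : Ω) :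
      ContinuousWithinAt (fun s => N s ω - N x ω) (Set.Ici t) t :=
    (continuous_of_discreteTopology (f := fun k : ℕ => k - N x ω)).continuousAt.comp_continuousWithinAt
      (hN.rightCont ω t)
  refine indep_of_indep_of_le_left (indep_of_indep_of_le_right hall (sup_le ?_ (sigma_le fun t ht => ?_)))
    (sup_le ?_ (sigma_le fun t ht => ?_))
  · exact le_sup_left.trans (le_iSup (fun n => m₂ ⊔ MeasurableSpace.comap (W n) ⊤) 0)
  · obtain ⟨k, hk, -, hkt⟩ := exists_dyadic_tendsto ht.1 ht.2
    refine measurable_of_tendsto_right (X := fun t ω => N t ω - N s ω) (hrc s t) hkt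
      (Eventually.of_forall fun n => ?_)
    have := hmeas₂ n (k n) (hk n)
    rw [hu, dyadic₂_right has] at this
    exact this.mono (le_sup_right.trans (le_iSup (fun n => m₂ ⊔ MeasurableSpace.comap (W n) ⊤) n)) le_rfl
  · exact le_sup_left.trans (le_iSup (fun n => m₁ ⊔ MeasurableSpace.comap (V n) ⊤) 0)
  · obtain ⟨k, hk, -, hkt⟩ := exists_dyadic_tendsto ht.1 ht.2
    refine measurable_of_tendsto_right (X := fun t ω => N t ω - N a ω) (hrc a t) hkt
      (Eventually.of_forall fun n => ?_)
    have := hmeas₁ n (k n) (hk n)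
    rw [hu, dyadic₂_left (hk n)] at this
    exact this.mono (le_sup_right.trans (le_iSup (fun n => m₁ ⊔ MeasurableSpace.comap (V n) ⊤) n)) le_rfl

/-- Almost surely, there is no event at a given time. -/
lemma IsModulatedPoisson.ae_exists_lt_eq (hN : IsModulatedPoisson β X N Pr) {C : ℝ}
    (hC : ∀ t x, β t x ≤ C) (hβ : ∀ t x, 0 ≤ β t x) 
    (hm : ∀ u v : ℝ≥0, Measurable fun ω => ∫ s in (u : ℝ)..v, β s.toNNReal (X s.toNNReal ω))
    {v : ℝ≥0} (hv : 0 < v) :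
    ∀ᵐ ω ∂Pr, ∃ u < v, N u ω = N v ω := by
  obtain ⟨w, -, hwv, hw⟩ := exists_seq_strictMono_tendsto' hv
  have hC0 : 0 ≤ C := by
    obtain ⟨x⟩ : Nonempty S := by
      obtain ⟨ω⟩ : Nonempty Ω := nonempty_of_isProbabilityMeasure Pr
      exact ⟨X 0 ω⟩
    exact (hβ 0 x).trans (hC 0 x)
  -- Given `X`, there is no event in `(u,v]` with probability `exp (-∫ β) ≥ 1 - C (v - u)`; then `u`
  -- increases to `v`.
  have hbound (u : ℝ≥0) (huv : u ≤ v) : 1 - C * (v - u) ≤ Pr.real {ω | N u ω = N v ω} := by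
    have l := hN.law_nat (A := Set.univ) MeasurableSet.univ 1 (u := fun j => if j = 0 then u else v)
      (by
        refine monotone_nat_of_le_succ fun j => ?_
        by_cases hj : j = 0 <;> simp [hj, huv]) (fun _ => 0)
    simp only [Set.univ_inter, Nat.lt_one_iff, forall_eq, zero_add, one_ne_zero, if_true, if_false,
      add_zero, Finset.range_one, Finset.prod_singleton, Measure.restrict_univ] at l
    have e : {ω | N u ω = N v ω} = {ω | N v ω = N u ω} := by ext ω; exact eq_comm
    rw [e, l]
    have hpt (ω : Ω) : 1 - C * (v - u) ≤ poissonWeight β X u v 0 ω := by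
      unfold poissonWeight
      rw [poissonMeasure_real_singleton]
      simp only [pow_zero, mul_one, Nat.factorial_zero, Nat.cast_one, div_one]
      have hnn : (0 : ℝ) ≤ ∫ s in (u : ℝ)..v, β s.toNNReal (X s.toNNReal ω) :=
        intervalIntegral.integral_nonneg (by exact_mod_cast huv) fun s _ => hβ _ _
      rw [Real.coe_toNNReal _ hnn]
      have hle : ∫ s in (u : ℝ)..v, β s.toNNReal (X s.toNNReal ω) ≤ C * (v - u) := by
        have := intervalIntegral.norm_integral_le_of_norm_le_const (a := (u : ℝ)) (b := v) (C := C)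
          (f := fun s => β s.toNNReal (X s.toNNReal ω)) fun s _ => by
            rw [Real.norm_eq_abs, abs_of_nonneg (hβ _ _)]; exact hC _ _
        rw [abs_of_nonneg (sub_nonneg.2 (by exact_mod_cast huv))] at this
        exact (le_abs_self _).trans this
      have := Real.add_one_le_exp (-(∫ s in (u : ℝ)..v, β s.toNNReal (X s.toNNReal ω)))
      linarith
    have hi : Integrable (poissonWeight β X u v 0) Pr :=
      Integrable.of_bound (measurable_poissonWeight (hm u v) 0).aestronglyMeasurable 1
        (Eventually.of_forall fun ω => by
          rw [Real.norm_eq_abs, abs_of_nonneg (poissonWeight_nonneg _ _ _ _)]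
          exact poissonWeight_le_one _ _ _ _)
    calc 1 - C * (v - u) = ∫ _, (1 - C * (v - u)) ∂Pr := by simp
      _ ≤ _ := integral_mono (integrable_const _) hi hpt
  have hzero : Pr {ω | ¬ ∃ u < v, N u ω = N v ω} = 0 := by
    rw [← measureReal_eq_zero_iff]
    refine le_antisymm ?_ measureReal_nonneg
    have hlim : Tendsto (fun n => C * ((v : ℝ) - w n)) atTop (𝓝 0) := by
      have h1 : Tendsto (fun n => (w n : ℝ)) atTop (𝓝 v) := (NNReal.tendsto_coe).2 hw
      have := (h1.const_sub (v : ℝ)).const_mul C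
      simpa using this
    refine ge_of_tendsto hlim (Eventually.of_forall fun n => ?_)
    · have hm : MeasurableSet {ω | N (w n) ω = N v ω} :=
        measurableSet_eq_fun (hN.measurable _) (hN.measurable _)
      have h1 := hbound (w n) (hwv n).2.le
      have h2 := probReal_compl_eq_one_sub (μ := Pr) hm
      calc Pr.real {ω | ¬ ∃ u < v, N u ω = N v ω} ≤ Pr.real {ω | N (w n) ω = N v ω}ᶜ :=
            measureReal_mono fun ω hω h => hω ⟨w n, (hwv n).2, h⟩
        _ ≤ _ := by rw [h2]; linarith
  exact hzero

end Poisson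

end

/-! ### Paths clamped to a time window. -/

section

/-- The identity on `[a,b)`, stopped at `a` before `a`, and equal to `e` from `b` on. -/
def clampTime (a b e t : ℝ≥0) : ℝ≥0 := if t < a then a else if t < b then t else e

lemma clampTime_of_lt {a b e t : ℝ≥0} (h : t < a) : clampTime a b e t = a := if_pos h

lemma clampTime_of_mem {a b e t : ℝ≥0} (h : a ≤ t) (h' : t < b) : clampTime a b e t = t := by
  rw [clampTime, if_neg (not_lt.2 h), if_pos h']

lemma clampTime_of_ge {a b e t : ℝ≥0} (hab : a ≤ b) (h : b ≤ t) : clampTime a b e t = e := by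
  rw [clampTime, if_neg (not_lt.2 (hab.trans h)), if_neg (not_lt.2 h)]

variable {S : Type*} [TopologicalSpace S] [DiscreteTopology S] {x : ℝ≥0 → S} {a b e : ℝ≥0}

lemma IsCadlag.clamp (hx : IsCadlag x) (hab : a ≤ b) :
    IsCadlag fun t => x (clampTime a b e t) := by
  intro t
  constructor
  · refine tendsto_nhds_of_eventually_eq ?_
    rcases lt_or_ge t a with h | h
    · filter_upwards [nhdsWithin_le_nhds (gt_mem_nhds h)] with s hs
      rw [clampTime_of_lt hs, clampTime_of_lt h]
    rcases lt_or_ge t b with h' | h'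
    · filter_upwards [nhdsWithin_le_nhds (gt_mem_nhds h'), self_mem_nhdsWithin,
        hx.eventually_eq_right t] with s hs hs' hst
      rw [clampTime_of_mem (h.trans hs') hs, clampTime_of_mem h h', hst]
    · filter_upwards [self_mem_nhdsWithin] with s hs
      rw [clampTime_of_ge hab (h'.trans hs), clampTime_of_ge hab h']
  · rcases le_or_gt t a with h | h
    · refine ⟨x a, tendsto_nhds_of_eventually_eq ?_⟩
      filter_upwards [self_mem_nhdsWithin] with s hs
      rw [clampTime_of_lt (lt_of_lt_of_le hs h)]
    rcases le_or_gt t b with h' | h'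
    · refine ⟨Function.leftLim x t, tendsto_nhds_of_eventually_eq ?_⟩
      filter_upwards [self_mem_nhdsWithin, nhdsWithin_le_nhds (lt_mem_nhds h),
        hx.eventually_eq_left t] with s hs hs' hst
      rw [clampTime_of_mem hs'.le (lt_of_lt_of_le hs h'), hst]
    · refine ⟨x e, tendsto_nhds_of_eventually_eq ?_⟩
      filter_upwards [nhdsWithin_le_nhds (lt_mem_nhds h')] with s hs
      rw [clampTime_of_ge hab hs.le]

lemma IsCadlag.leftLim_clamp (hx : IsCadlag x) {t : ℝ≥0} (ht : t ∈ Set.Ioc a b) :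
    Function.leftLim (fun t => x (clampTime a b e t)) t = Function.leftLim x t := by
  refine leftLim_eq_of_eventually_eq ?_ fun h => absurd h (nhdsLT_neBot_of_lt ht.1).ne
  filter_upwards [self_mem_nhdsWithin, nhdsWithin_le_nhds (lt_mem_nhds ht.1),
    hx.eventually_eq_left t] with s hs hs' hst
  rw [clampTime_of_mem hs'.le (lt_of_lt_of_le hs ht.2), hst]

lemma leftLim_clamp_of_le {t : ℝ≥0} (hab : a < b ∨ e = a) (ht : t ≤ a) :
    Function.leftLim (fun t => x (clampTime a b e t)) t = x (clampTime a b e t) := by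
  have e1 : clampTime a b e t = a := by
    rcases lt_or_eq_of_le ht with h | rfl
    · exact clampTime_of_lt h
    · unfold clampTime
      rcases hab with h | rfl <;> simp_all
  refine leftLim_eq_of_eventually_eq ?_ fun _ => rfl
  filter_upwards [self_mem_nhdsWithin] with s hs
  rw [clampTime_of_lt (lt_of_lt_of_le hs ht), e1]

/-- Clamping creates no jump up to `a`. At `b` either the clamped value is the true one, or `b` is
an integer and no transition there is counted. -/
lemma IsCadlag.jumpCount_clamp (hx : IsCadlag x) (hab : a < b ∨ a = b ∧ e = a)
    (he : e = b ∨ ∃ m : ℕ, b = m) {t : ℝ≥0} (ht : t ∈ Set.Icc a b) :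
    jumpCount (fun t => x (clampTime a b e t)) t + jumpCount x a = jumpCount x t := by
  rw [← hx.jumpCount_add ht.1, add_comm]
  congr 1
  unfold jumpCount
  congr 1
  ext u
  simp only [Set.mem_inter_iff, mem_jumpSet, Set.mem_Iic, Set.mem_Ioc]
  rcases le_or_gt u a with h | h
  · rw [leftLim_clamp_of_le (hab.imp id fun h => h.2) h]
    simp [not_lt.2 h]
  · simp only [h, true_and]
    refine and_congr_left fun hut => ?_
    have hub : u ≤ b := hut.trans ht.2
    rw [hx.leftLim_clamp ⟨h, hub⟩]
    rcases lt_or_eq_of_le hub with hub | rfl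
    · rw [clampTime_of_mem h.le hub]
    rcases he with rfl | ⟨m, rfl⟩
    · rw [clampTime_of_ge h.le le_rfl]
    · exact ⟨fun h => absurd rfl (h.2 m), fun h => absurd rfl (h.2 m)⟩

/-- The counted jumps exclude integers, and none accumulate at `m` from the left. The count is
therefore constant on some `[w,m]` with `w < m`. -/
lemma IsCadlag.eventTime_ne_natCast (hx : IsCadlag x) {k : ℕ} (hk : 1 ≤ k)
    (h : ∃ t, k ≤ jumpCount x t) (m : ℕ) : eventTime (jumpCount x) k ≠ m := by
  intro hm
  have hc := hx.isCounting_jumpCount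
  have h1 : k ≤ jumpCount x m := (hc.eventTime_le_iff h).1 hm.le
  have hm0 : (0 : ℝ≥0) < m := by
    rcases eq_or_lt_of_le (zero_le (a := (m : ℝ≥0))) with h0 | h0
    · rw [← h0, jumpCount_zero] at h1; omega
    · exact h0
  have h2 := (hx.eventually_leftLim_eq m).filter_mono (nhdsWithin_mono (m : ℝ≥0) (s := Set.Iio (m : ℝ≥0))
    fun r hr => ne_of_lt hr)
  obtain ⟨u, hu, hsub⟩ := (mem_nhdsLT_iff_exists_Ioo_subset' hm0).1 h2
  obtain ⟨w, huw, hwm⟩ := exists_between (show u < m from hu)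
  have h3 : jumpCount x w = jumpCount x m := by
    rw [hx.jumpCount_eq_iff hwm.le]
    refine Set.eq_empty_of_forall_notMem fun r hr => ?_
    rcases lt_or_eq_of_le hr.2.2 with h | h
    · exact hr.1.1 (hsub ⟨huw.trans hr.2.1, h⟩)
    · exact hr.1.2 m h
  have : eventTime (jumpCount x) k ≤ w := (hc.eventTime_le_iff h).2 (h3 ▸ h1)
  rw [hm] at this
  exact absurd hwm (not_lt.2 this)

end

/-! ### Clamped models and conditional characteristic functions. -/

section

variable {S Ω : Type*} [Fintype S] [TopologicalSpace S] [DiscreteTopology S] [MeasurableSpace S]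
  [DiscreteMeasurableSpace S] {Z : Model S Ω} {E : Data S}

/-- The model seen from the time window between `a` and `b`. -/
def Model.clamp (Z : Model S Ω) (a b e : ℝ≥0) : Model S Ω where
  X t := Z.X (clampTime a b e t)
  N t ω := Z.N (max a (min t b)) ω - Z.N a ω
  g := Z.g
  h := Z.h
  k := Z.k

lemma isCounting_restrict {c : ℝ≥0 → ℕ} (hc : IsCounting c) (a b : ℝ≥0) :
    IsCounting fun t => c (max a (min t b)) - c a := by
  have hm : Monotone fun t : ℝ≥0 => max a (min t b) := fun s t hst => by dsimp only; gcongr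
  refine ⟨fun s t hst => Nat.sub_le_sub_right (hc.mono (hm hst)) _, fun t => ?_⟩
  have h1 : ContinuousWithinAt (fun t => c (max a (min t b))) (Set.Ici t) t :=
    (hc.rightCont _).comp (f := fun t : ℝ≥0 => max a (min t b)) (by fun_prop) fun s hs => hm hs
  exact (continuous_of_discreteTopology (f := fun k : ℕ => k - c a)).continuousAt.comp_continuousWithinAt h1

/-- The σ-algebra on `Ω` is free here and is later taken to be that of the window. Every
measurability statement for regular models then shows that the quantity depends only on what happens
in the window. The parameter `e` allows the state at a resetting time `b` to be replaced by one from
inside the window. -/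
lemma Model.isRegular_clamp [MeasurableSpace Ω] (hc : ∀ ω, IsCadlag fun t => Z.X t ω)
    (hn : ∀ ω, IsCounting fun t => Z.N t ω) {a b e : ℝ≥0} (hab : a ≤ b)
    (hX : ∀ t, Measurable (Z.X (clampTime a b e t)))
    (hN : ∀ t ∈ Set.Icc a b, Measurable fun ω => Z.N t ω - Z.N a ω) :
    (Z.clamp a b e).IsRegular where
  measurable_X := hX
  cadlag ω := (hc ω).clamp hab
  measurable_N _ := hN _ ⟨le_max_left _ _, max_le hab (min_le_right _ _)⟩
  counting ω := isCounting_restrict (hn ω) a b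

namespace Model

variable [MeasurableSpace Ω] (hZ : Z.IsRegular) {a b e : ℝ≥0} {ω : Ω}
include hZ

lemma clamp_J (hab : a < b ∨ a = b ∧ e = a) (he : e = b ∨ ∃ m : ℕ, b = m) {t : ℝ≥0}
    (ht : t ∈ Set.Icc a b) : (Z.clamp a b e).J t ω + Z.J a ω = Z.J t ω :=
  (hZ.cadlag ω).jumpCount_clamp hab he ht

lemma clamp_J_left (hab : a < b ∨ a = b ∧ e = a) (he : e = b ∨ ∃ m : ℕ, b = m) :
    (Z.clamp a b e).J a ω = 0 := by
  have := clamp_J hZ (ω := ω) hab he ⟨le_rfl, by rcases hab with h | h; exacts [h.le, h.1.le]⟩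
  omega

omit hZ [Fintype S] [TopologicalSpace S] [DiscreteTopology S] [MeasurableSpace S]
  [DiscreteMeasurableSpace S] [MeasurableSpace Ω] in
lemma clamp_N {t : ℝ≥0} (ht : t ∈ Set.Icc a b) : (Z.clamp a b e).N t ω = Z.N t ω - Z.N a ω := by
  simp [clamp, min_eq_left ht.2, max_eq_right ht.1]

lemma clamp_lawG (hab : a < b ∨ a = b ∧ e = a) (he : e = b ∨ ∃ m : ℕ, b = m) {j : ℕ} (hj : 1 ≤ j)
    (hjb : j ≤ (Z.clamp a b e).J b ω) :
    (Z.clamp a b e).lawG E j ω = Z.lawG E (Z.J a ω + j) ω := by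
  have hle : a ≤ b := by rcases hab with h | h; exacts [h.le, h.1.le]
  have hJ := clamp_J hZ (ω := ω) hab he ⟨hle, le_rfl⟩
  have hT : (Z.clamp a b e).T j ω = Z.T (Z.J a ω + j) ω :=
    eventTime_shift (hZ.counting_J ω) ((hZ.cadlag ω).clamp hle).isCounting_jumpCount hle
      (clamp_J_left hZ hab he) (fun t ht => clamp_J hZ hab he ht) hj hjb
  have hex : ∃ t, Z.J a ω + j ≤ Z.J t ω := ⟨b, by omega⟩
  have hmem : Z.T (Z.J a ω + j) ω ∈ Set.Ioc a b :=
    ((hZ.counting_J ω).eventTime_mem_Ioc_iff hex).2 (Finset.mem_Ioc.2 ⟨by omega, by omega⟩)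
  have hX : (Z.clamp a b e).X (Z.T (Z.J a ω + j) ω) ω = Z.X (Z.T (Z.J a ω + j) ω) ω := by
    change Z.X (clampTime a b e _) ω = _
    rcases lt_or_eq_of_le hmem.2 with h | h
    · rw [clampTime_of_mem hmem.1.le h]
    rcases he with rfl | ⟨m, rfl⟩
    · rw [clampTime_of_ge hle h.ge, h]
    · exact absurd h ((hZ.cadlag ω).eventTime_ne_natCast (by omega) hex m)
  have hXl : (Z.clamp a b e).Xleft (Z.T (Z.J a ω + j) ω) ω = Z.Xleft (Z.T (Z.J a ω + j) ω) ω :=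
    (hZ.cadlag ω).leftLim_clamp hmem
  unfold lawG
  rw [hT, hX, hXl]

/-- The two models can disagree only at time `b`, where either the clamped state is correct or no
event occurs. -/
lemma clamp_lawK (hle : a ≤ b) (he : e = b ∨ ∃ u < b, Z.N u ω = Z.N b ω) {j : ℕ} (hj : 1 ≤ j)
    (hjb : j ≤ Z.N b ω - Z.N a ω) :
    (Z.clamp a b e).lawK E j ω = Z.lawK E (Z.N a ω + j) ω := by
  have hT : (Z.clamp a b e).Λ j ω = Z.Λ (Z.N a ω + j) ω :=
    eventTime_shift (hZ.counting ω) (isCounting_restrict (hZ.counting ω) a b) hle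
      (by simp) (fun t ht => by
        have h1 := clamp_N (Z := Z) (e := e) (ω := ω) ht
        have h2 := (hZ.counting ω).mono ht.1
        change (Z.clamp a b e).N t ω + Z.N a ω = _
        rw [h1]; exact Nat.sub_add_cancel h2) hj (by
        have h1 := clamp_N (Z := Z) (e := e) (ω := ω) (t := b) ⟨hle, le_rfl⟩
        exact hjb.trans h1.ge)
  have hex : ∃ t, Z.N a ω + j ≤ Z.N t ω := ⟨b, by omega⟩
  have hmem : Z.Λ (Z.N a ω + j) ω ∈ Set.Ioc a b :=
    ((hZ.counting ω).eventTime_mem_Ioc_iff hex).2 (Finset.mem_Ioc.2 ⟨by omega, by omega⟩)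
  have hX : (Z.clamp a b e).X (Z.Λ (Z.N a ω + j) ω) ω = Z.X (Z.Λ (Z.N a ω + j) ω) ω := by
    change Z.X (clampTime a b e _) ω = _
    rcases lt_or_eq_of_le hmem.2 with h | h
    · rw [clampTime_of_mem hmem.1.le h]
    rcases he with rfl | ⟨u, hu, huN⟩
    · rw [clampTime_of_ge hle h.ge, h]
    · have : Z.Λ (Z.N a ω + j) ω ≤ u := ((hZ.counting ω).eventTime_le_iff hex).2 (by omega)
      exact absurd (h ▸ this) (not_le.2 hu)
  unfold lawK
  rw [hT, hX]

/-- Conditional characteristic function, given the state and counting processes, of the rewards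
collected in `(a,b]`. -/
def condCharFun {S Ω : Type*} [TopologicalSpace S] (E : Data S) (Z : Model S Ω) (a b : ℝ≥0) (ξ : ℝ)
    (ω : Ω) : ℂ :=
  Complex.exp (ξ * (∫ s in (a : ℝ)..b, E.r s.toNNReal (Z.X s.toNNReal ω) : ℝ) * Complex.I) *
    (∏ k ∈ Finset.Ioc (Z.J a ω) (Z.J b ω), charFun (Z.lawG E k ω) ξ) *
    (∏ i ∈ Finset.Ioc (scheduleCount E.τ a) (scheduleCount E.τ b), charFun (Z.lawH E i ω) ξ) *
    ∏ k ∈ Finset.Ioc (Z.N a ω) (Z.N b ω), charFun (Z.lawK E k ω) ξ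

/-- The state at `b` is irrelevant when it is altered: the integral ignores a point, counted jumps
and scheduled times avoid integers, and `he'` excludes an external event at `b`. -/
lemma condCharFun_clamp (hab : a < b ∨ a = b ∧ e = a) (he : e = b ∨ ∃ m : ℕ, b = m)
    (he' : e = b ∨ ∃ u < b, Z.N u ω = Z.N b ω)
    (hτ : ∀ i ∈ Finset.Ioc (scheduleCount E.τ a) (scheduleCount E.τ b),
      E.τ i ∈ Set.Ioc a b ∧ ∀ m : ℕ, E.τ i ≠ m) (ξ : ℝ) :
    condCharFun E (Z.clamp a b e) a b ξ ω = condCharFun E Z a b ξ ω := by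
  have hle : a ≤ b := by rcases hab with h | h; exacts [h.le, h.1.le]
  have hJ := clamp_J hZ (ω := ω) hab he ⟨hle, le_rfl⟩
  have hJa := clamp_J_left hZ (ω := ω) hab he
  have hNb := clamp_N (Z := Z) (e := e) (ω := ω) (t := b) ⟨hle, le_rfl⟩
  have hNa := clamp_N (Z := Z) (e := e) (ω := ω) (t := a) ⟨le_rfl, hle⟩
  have hNab := (hZ.counting ω).mono hle
  have hprod {f g : ℕ → ℂ} {c d p : ℕ} (hd : p + c = d) (h : ∀ j, 1 ≤ j → j ≤ p → f j = g (c + j)) :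
      ∏ k ∈ Finset.Ioc 0 p, f k = ∏ k ∈ Finset.Ioc c d, g k := by
    refine Finset.prod_bij (fun j _ => c + j) ?_ ?_ ?_ ?_
    · intro j hj; simp only [Finset.mem_Ioc] at hj ⊢; omega
    · intro i _ j _ hij; simpa using hij
    · intro k hk
      simp only [Finset.mem_Ioc] at hk
      exact ⟨k - c, by simp only [Finset.mem_Ioc]; omega, by omega⟩
    · intro j hj
      simp only [Finset.mem_Ioc] at hj
      exact h j (by omega) hj.2
  have hint : ∫ s in (a : ℝ)..b, E.r s.toNNReal ((Z.clamp a b e).X s.toNNReal ω)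
      = ∫ s in (a : ℝ)..b, E.r s.toNNReal (Z.X s.toNNReal ω) := by
    refine intervalIntegral.integral_congr_ae ?_
    have hb : ∀ᵐ s : ℝ, s ≠ b := by simp [ae_iff]
    filter_upwards [hb] with s hs hmem
    rw [Set.uIoc_of_le (by exact_mod_cast hle)] at hmem
    have hs0 : (0 : ℝ) ≤ s := a.2.trans hmem.1.le
    have h1 : a ≤ s.toNNReal := by
      rw [Real.le_toNNReal_iff_coe_le hs0]; exact hmem.1.le
    have h2 : s.toNNReal < b := by
      rw [Real.toNNReal_lt_iff_lt_coe hs0]; exact lt_of_le_of_ne hmem.2 hs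
    change E.r _ (Z.X (clampTime a b e _) ω) = _
    rw [clampTime_of_mem h1 h2]
  unfold condCharFun
  congr 1
  · congr 1
    · congr 1
      · rw [hint]
      · rw [hJa]
        exact hprod hJ fun j hj hjb => by rw [clamp_lawG hZ hab he hj hjb]
    · refine Finset.prod_congr rfl fun i hi => ?_
      obtain ⟨hmem, hne⟩ := hτ i hi
      have : (Z.clamp a b e).X (E.τ i) ω = Z.X (E.τ i) ω := by
        change Z.X (clampTime a b e _) ω = _
        rcases lt_or_eq_of_le hmem.2 with h | h
        · rw [clampTime_of_mem hmem.1.le h]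
        rcases he with rfl | ⟨m, rfl⟩
        · rw [clampTime_of_ge hle h.ge, h]
        · exact absurd h (hne m)
      unfold lawH
      rw [this]
  · rw [hNa, hNb, Nat.sub_self]
    exact hprod (by omega) fun j hj hjb => by rw [clamp_lawK hZ hle he' hj hjb]

omit hZ [Fintype S] [TopologicalSpace S] [DiscreteTopology S] [MeasurableSpace S]
  [DiscreteMeasurableSpace S] in
lemma measurable_finset_prod {M : Type*} [CommMonoid M] [MeasurableSpace M] [MeasurableMul₂ M]
    {c d : Ω → ℕ} (hc : Measurable c) (hd : Measurable d) {f : ℕ → Ω → M} (hf : ∀ k, Measurable (f k)) :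
    Measurable fun ω => ∏ k ∈ Finset.Ioc (c ω) (d ω), f k ω := by
  have h1 : Measurable fun q : (ℕ × ℕ) × Ω => ∏ k ∈ Finset.Ioc q.1.1 q.1.2, f k q.2 :=
    measurable_from_prod_countable_right fun p =>
      Finset.measurable_fun_prod (Finset.Ioc p.1 p.2) fun k _ => hf k
  exact h1.comp ((hc.prodMk hd).prodMk measurable_id)

omit hZ [Fintype S] [TopologicalSpace S] [DiscreteTopology S] [MeasurableSpace S]
  [DiscreteMeasurableSpace S] in
lemma measurable_integral_law {F : Type*} [NormedAddCommGroup F] [NormedSpace ℝ F] [MeasurableSpace F]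
    [BorelSpace F] {κ : Ω → Measure ℝ} (hκ : Measurable κ) [∀ ω, IsProbabilityMeasure (κ ω)] {f : ℝ → F}
    (hf : StronglyMeasurable f) : Measurable fun ω => ∫ z, f z ∂κ ω := by
  let K : Kernel Ω ℝ := ⟨κ, hκ⟩
  have : IsMarkovKernel K := ⟨fun ω => inferInstanceAs (IsProbabilityMeasure (κ ω))⟩
  exact (hf.integral_kernel (κ := K)).measurable

omit hZ [Fintype S] [TopologicalSpace S] [DiscreteTopology S] [MeasurableSpace S]
  [DiscreteMeasurableSpace S] in
lemma measurable_charFun_law {κ : Ω → Measure ℝ} (hκ : Measurable κ) [∀ ω, IsProbabilityMeasure (κ ω)]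
    (ξ : ℝ) : Measurable fun ω => charFun (κ ω) ξ := by
  simp only [charFun_apply_real]
  exact measurable_integral_law hκ (Continuous.stronglyMeasurable (by fun_prop))

lemma IsRegular.measurable_condCharFun (h1 : E.A1) (a b : ℝ≥0) (ξ : ℝ) :
    Measurable (condCharFun E Z a b ξ) := by
  unfold condCharFun
  have e1 := hZ.measurable_integral h1.reward a b
  have e2 := measurable_finset_prod (hZ.measurable_J a) (hZ.measurable_J b)
    fun k => measurable_charFun_law (hZ.measurable_lawG h1 k) ξ
  have e3 := measurable_finset_prod (hZ.measurable_N a) (hZ.measurable_N b)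
    fun k => measurable_charFun_law (hZ.measurable_lawK h1 k) ξ
  have e4 : Measurable fun ω => ∏ i ∈ Finset.Ioc (scheduleCount E.τ a) (scheduleCount E.τ b),
      charFun (Z.lawH E i ω) ξ :=
    Finset.measurable_fun_prod _ fun i _ => measurable_charFun_law (hZ.measurable_lawH i) ξ
  exact ((Complex.measurable_exp.comp (by fun_prop)).mul e2).mul e4 |>.mul e3

omit hZ [Fintype S] [DiscreteTopology S] [MeasurableSpace S] [DiscreteMeasurableSpace S]
  [MeasurableSpace Ω] in
lemma norm_condCharFun_le_one (a b : ℝ≥0) (ξ : ℝ) : ‖condCharFun E Z a b ξ ω‖ ≤ 1 := by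
  have hp {s : Finset ℕ} {f : ℕ → ℂ} (h : ∀ k, ‖f k‖ ≤ 1) : ‖∏ k ∈ s, f k‖ ≤ 1 := by
    rw [norm_prod]
    exact Finset.prod_le_one (fun _ _ => norm_nonneg _) fun k _ => h k
  have h0 : ‖Complex.exp (ξ * (∫ s in (a : ℝ)..b, E.r s.toNNReal (Z.X s.toNNReal ω) : ℝ) * Complex.I)‖ ≤ 1 := by
    rw [← Complex.ofReal_mul, Complex.norm_exp_ofReal_mul_I]
  unfold condCharFun
  rw [norm_mul, norm_mul, norm_mul]
  have a1 := hp (s := Finset.Ioc (Z.J a ω) (Z.J b ω)) fun k => norm_charFun_le_one (μ := Z.lawG E k ω) ξ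
  have a2 := hp (s := Finset.Ioc (scheduleCount E.τ a) (scheduleCount E.τ b))
    fun k => norm_charFun_le_one (μ := Z.lawH E k ω) ξ
  have a3 := hp (s := Finset.Ioc (Z.N a ω) (Z.N b ω)) fun k => norm_charFun_le_one (μ := Z.lawK E k ω) ξ
  exact mul_le_one₀ (mul_le_one₀ (mul_le_one₀ h0 (norm_nonneg _) a1) (norm_nonneg _) a2) (norm_nonneg _) a3

end Model

end

/-! ### Disintegration of the rewards given the state and counting processes. -/

section

variable {Ω Ω' ι : Type*} [Fintype ι] {m0 : MeasurableSpace Ω} {m' : MeasurableSpace Ω'}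
  {P : Measure Ω} [IsFiniteMeasure P] {e : Ω → Ω'} {κ : ι → Ω' → Measure ℝ}
  [∀ i ω, IsProbabilityMeasure (κ i ω)] {Y : ι → Ω → ℝ}

omit [Fintype ι] in
lemma isPiSystem_pi_Iic : IsPiSystem (Set.pi Set.univ '' Set.pi Set.univ
    (fun _ : ι => Set.range (Set.Iic : ℝ → Set ℝ))) :=
  IsPiSystem.pi fun _ => isPiSystem_Iic

lemma generateFrom_pi_Iic : (MeasurableSpace.pi : MeasurableSpace (ι → ℝ)) =
    MeasurableSpace.generateFrom (Set.pi Set.univ '' Set.pi Set.univ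
      (fun _ : ι => Set.range (Set.Iic : ℝ → Set ℝ))) := by
  have hs : IsCountablySpanning (Set.range (Set.Iic : ℝ → Set ℝ)) := by
    refine ⟨fun n => Set.Iic (n : ℝ), fun n => ⟨n, rfl⟩, ?_⟩
    refine Set.eq_univ_of_forall fun x => Set.mem_iUnion.2 ?_
    obtain ⟨n, hn⟩ := exists_nat_ge x
    exact ⟨n, hn⟩
  refine (generateFrom_eq_pi (fun _ => ?_) fun _ => hs).symm
  rw [← borel_eq_generateFrom_Iic ℝ]; exact BorelSpace.measurable_eq.symm

/-- The kernel whose measures are products of given laws. -/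
def piKernel (κ : ι → Ω' → Measure ℝ) [∀ i ω, IsProbabilityMeasure (κ i ω)]
    (hκ : ∀ i, Measurable (κ i)) : Kernel Ω' (ι → ℝ) where
  toFun ω := Measure.pi fun i => κ i ω
  measurable' := by
    refine Measurable.measure_of_isPiSystem_of_isProbabilityMeasure generateFrom_pi_Iic
      isPiSystem_pi_Iic ?_
    rintro _ ⟨s, hs, rfl⟩
    simp only [Measure.pi_pi]
    refine Finset.measurable_fun_prod _ fun i _ => ?_
    obtain ⟨a, ha⟩ := hs i trivial
    rw [← ha]
    exact (Measure.measurable_coe measurableSet_Iic).comp (hκ i)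

instance (hκ : ∀ i, Measurable (κ i)) : IsMarkovKernel (piKernel κ hκ) :=
  ⟨fun ω => inferInstanceAs (IsProbabilityMeasure (Measure.pi fun i => κ i ω))⟩

/-- Disintegration of a random vector whose coordinates are conditionally independent with given
conditional distribution functions. -/
lemma map_eq_compProd_piKernel (he : Measurable e) (hκ : ∀ i, Measurable (κ i))
    (hY : ∀ i, Measurable (Y i))
    (h : ∀ A, MeasurableSet A → ∀ a : ι → ℝ,
      P.real (e ⁻¹' A ∩ {ω | ∀ i, Y i ω ≤ a i}) = ∫ ω in e ⁻¹' A, ∏ i, cdf (κ i (e ω)) (a i) ∂P) :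
    P.map (fun ω => (e ω, fun i => Y i ω)) = (P.map e) ⊗ₘ piKernel κ hκ := by
  have hm : Measurable fun ω => (e ω, fun i => Y i ω) := he.prodMk (measurable_pi_lambda _ hY)
  have hbox (A : Set Ω') (hA : MeasurableSet A) (a : ι → ℝ) :
      P.map (fun ω => (e ω, fun i => Y i ω)) (A ×ˢ Set.pi Set.univ fun i => Set.Iic (a i))
        = ((P.map e) ⊗ₘ piKernel κ hκ) (A ×ˢ Set.pi Set.univ fun i => Set.Iic (a i)) := by
    have ht : MeasurableSet (Set.pi Set.univ fun i => Set.Iic (a i)) :=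
      MeasurableSet.univ_pi fun i => measurableSet_Iic
    rw [Measure.map_apply hm (hA.prod ht), Measure.compProd_apply_prod hA ht,
      setLIntegral_map hA ((piKernel κ hκ).measurable_coe ht) he]
    have e1 : (fun ω => (e ω, fun i => Y i ω)) ⁻¹' (A ×ˢ Set.pi Set.univ fun i => Set.Iic (a i))
        = e ⁻¹' A ∩ {ω | ∀ i, Y i ω ≤ a i} := by
      ext ω; simp [Pi.le_def]
    have e2 (ω : Ω) : (piKernel κ hκ) (e ω) (Set.pi Set.univ fun i => Set.Iic (a i))
        = ENNReal.ofReal (∏ i, cdf (κ i (e ω)) (a i)) := by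
      change Measure.pi (fun i => κ i (e ω)) _ = _
      rw [Measure.pi_pi, ENNReal.ofReal_prod_of_nonneg fun i _ => cdf_nonneg _ _]
      simp only [ofReal_cdf]
    have hcm (i : ι) : Measurable fun ω => cdf (κ i (e ω)) (a i) := by
      simp only [cdf_eq_real, measureReal_def]
      exact ((Measure.measurable_coe measurableSet_Iic).comp ((hκ i).comp he)).ennreal_toReal
    simp only [e1, e2]
    rw [← ofReal_integral_eq_lintegral_ofReal, ← h A hA a, measureReal_def,
      ENNReal.ofReal_toReal (measure_ne_top _ _)]
    · refine Integrable.of_bound (Finset.measurable_fun_prod _ fun i _ => hcm i).aestronglyMeasurable 1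
        (Eventually.of_forall fun ω => ?_)
      rw [Real.norm_eq_abs, abs_of_nonneg (Finset.prod_nonneg fun i _ => cdf_nonneg _ _)]
      exact Finset.prod_le_one (fun i _ => cdf_nonneg _ _) fun i _ => cdf_le_one _ _
    · exact Eventually.of_forall fun ω => Finset.prod_nonneg fun i _ => cdf_nonneg _ _
  refine Measure.ext_prod fun {A t} hA ht => ?_
  set ν₁ := (P.map (fun ω => (e ω, fun i => Y i ω))).restrict (A ×ˢ Set.univ) with hν₁
  set ν₂ := ((P.map e) ⊗ₘ piKernel κ hκ).restrict (A ×ˢ Set.univ) with hν₂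
  -- For fixed `A` both sides are finite measures in the reward coordinates which agree on products
  -- of half-lines, a generating π-system.
  have key : ν₁.map Prod.snd = ν₂.map Prod.snd := by
    have hr {t : Set (ι → ℝ)} (ht : MeasurableSet t) (ν : Measure (Ω' × (ι → ℝ))) :
        (ν.restrict (A ×ˢ Set.univ)).map Prod.snd t = ν (A ×ˢ t) := by
      rw [Measure.map_apply measurable_snd ht, Measure.restrict_apply (measurable_snd ht)]
      congr 1
      ext ⟨x, y⟩; simp [and_comm]
    have hfin : IsFiniteMeasure (ν₁.map Prod.snd) := by
      rw [hν₁]; infer_instance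
    refine ext_of_generate_finite _ generateFrom_pi_Iic isPiSystem_pi_Iic ?_ ?_
    · rintro _ ⟨s, hs, rfl⟩
      choose a ha using fun i => hs i trivial
      obtain rfl : (fun i => Set.Iic (a i)) = s := funext ha
      rw [hr (MeasurableSet.univ_pi fun i => measurableSet_Iic),
        hr (MeasurableSet.univ_pi fun i => measurableSet_Iic), hbox A hA a]
    · rw [hr MeasurableSet.univ, hr MeasurableSet.univ, Measure.compProd_apply_prod hA MeasurableSet.univ,
        Measure.map_apply hm (hA.prod MeasurableSet.univ)]
      simp only [measure_univ, lintegral_const, one_mul, Measure.restrict_apply MeasurableSet.univ,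
        Set.univ_inter, Measure.map_apply he hA]
      congr 1
      ext ω; simp
  have := congrArg (fun ν => ν t) key
  simp only [Measure.map_apply measurable_snd ht, hν₁, hν₂,
    Measure.restrict_apply (measurable_snd ht)] at this
  convert this using 2 <;> · ext ⟨x, y⟩; simp [and_comm]

lemma lintegral_eq_of_map_eq_compProd (he : Measurable e) {hκ : ∀ i, Measurable (κ i)}
    (hY : ∀ i, Measurable (Y i))
    (h : P.map (fun ω => (e ω, fun i => Y i ω)) = (P.map e) ⊗ₘ piKernel κ hκ)
    {F : Ω' × (ι → ℝ) → ENNReal} (hF : Measurable F) :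
    ∫⁻ ω, F (e ω, fun i => Y i ω) ∂P = ∫⁻ ω, ∫⁻ y, F (e ω, y) ∂(Measure.pi fun i => κ i (e ω)) ∂P := by
  have hm : Measurable fun ω => (e ω, fun i => Y i ω) := he.prodMk (measurable_pi_lambda _ hY)
  rw [← lintegral_map hF hm, h, Measure.lintegral_compProd hF]
  exact lintegral_map (Measurable.lintegral_kernel_prod_right' hF) he

lemma integral_exp_eq_of_map_eq_compProd (he : Measurable e) {hκ : ∀ i, Measurable (κ i)}
    (hY : ∀ i, Measurable (Y i))
    (h : P.map (fun ω => (e ω, fun i => Y i ω)) = (P.map e) ⊗ₘ piKernel κ hκ)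
    {w : Ω' → ℂ} (hw : Measurable w) {C : ℝ} (hC : ∀ ω, ‖w ω‖ ≤ C) {θ : ι → Ω' → ℝ}
    (hθ : ∀ i, Measurable (θ i)) :
    ∫ ω, w (e ω) * Complex.exp ((∑ i, θ i (e ω) * Y i ω : ℝ) * Complex.I) ∂P
      = ∫ ω, w (e ω) * ∏ i, charFun (κ i (e ω)) (θ i (e ω)) ∂P := by
  have hm : Measurable fun ω => (e ω, fun i => Y i ω) := he.prodMk (measurable_pi_lambda _ hY)
  set F : Ω' × (ι → ℝ) → ℂ := fun q =>
    w q.1 * Complex.exp ((∑ i, θ i q.1 * q.2 i : ℝ) * Complex.I) with hF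
  have hFm : StronglyMeasurable F := by
    refine Measurable.stronglyMeasurable ?_
    have h1 : Measurable fun q : Ω' × (ι → ℝ) => ∑ i, θ i q.1 * q.2 i :=
      Finset.measurable_fun_sum _ fun i _ =>
        ((hθ i).comp measurable_fst).mul ((measurable_pi_apply i).comp measurable_snd)
    exact (hw.comp measurable_fst).mul (Complex.measurable_exp.comp
      ((Complex.measurable_ofReal.comp h1).mul_const _))
  have hFi : Integrable F ((P.map e) ⊗ₘ piKernel κ hκ) := by
    refine Integrable.of_bound hFm.aestronglyMeasurable C (Eventually.of_forall fun q => ?_)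
    rw [hF, norm_mul, Complex.norm_exp_ofReal_mul_I, mul_one]
    exact hC _
  have h1 : ∫ ω, F (e ω, fun i => Y i ω) ∂P = ∫ q, F q ∂(P.map (fun ω => (e ω, fun i => Y i ω))) :=
    (integral_map hm.aemeasurable hFm.aestronglyMeasurable).symm
  change ∫ ω, F (e ω, fun i => Y i ω) ∂P = _
  rw [h1, h, Measure.integral_compProd hFi, integral_map he.aemeasurable
    (StronglyMeasurable.integral_kernel_prod_right' hFm).aestronglyMeasurable]
  refine integral_congr_ae (Eventually.of_forall fun ω => ?_)
  change ∫ y, F (e ω, y) ∂(Measure.pi fun i => κ i (e ω)) = _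
  simp only [hF]
  rw [integral_const_mul]
  congr 1
  simp only [charFun_apply_real]
  rw [← integral_fintype_prod_eq_prod]
  refine integral_congr_ae (Eventually.of_forall fun y => ?_)
  simp only
  rw [← Complex.exp_sum]
  congr 1
  push_cast
  rw [Finset.sum_mul]

/-- Lower bound for second moments by conditional variances. -/
lemma lintegral_variance_le_of_map_eq_compProd (he : Measurable e) {hκ : ∀ i, Measurable (κ i)}
    (hY : ∀ i, Measurable (Y i))
    (h : P.map (fun ω => (e ω, fun i => Y i ω)) = (P.map e) ⊗ₘ piKernel κ hκ)
    (hL : ∀ i ω, MemLp id 2 (κ i ω)) {a : Ω' → ℝ} (ha : Measurable a) (s : Finset ι) :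
    ∫⁻ ω, ENNReal.ofReal (∑ i ∈ s, variance id (κ i (e ω))) ∂P
      ≤ ∫⁻ ω, ENNReal.ofReal ((a (e ω) + ∑ i ∈ s, Y i ω) ^ 2) ∂P := by
  classical
  have hF : Measurable fun q : Ω' × (ι → ℝ) => ENNReal.ofReal ((a q.1 + ∑ i ∈ s, q.2 i) ^ 2) := by
    have h1 : Measurable fun q : Ω' × (ι → ℝ) => ∑ i ∈ s, q.2 i :=
      Finset.measurable_fun_sum _ fun i _ => (measurable_pi_apply i).comp measurable_snd
    exact (((ha.comp measurable_fst).add h1).pow_const 2).ennreal_ofReal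
  rw [lintegral_eq_of_map_eq_compProd he hY h hF]
  refine lintegral_mono fun ω => ?_
  set ν := Measure.pi fun i => κ i (e ω) with hν
  -- Coordinates outside `s` are replaced by zero, so that the variance formula for the full product
  -- measure applies.
  set f : ι → ℝ → ℝ := fun i => if i ∈ s then id else fun _ => 0 with hf
  have hfL (i : ι) : MemLp (f i) 2 (κ i (e ω)) := by
    by_cases hi : i ∈ s
    · simp only [hf, hi, if_true]; exact hL i _
    · simp only [hf, hi, if_false]; exact memLp_const 0
  have hvar := variance_sum_pi (μ := fun i => κ i (e ω)) hfL
  have hL2 : MemLp (∑ i, fun y : ι → ℝ => f i (y i)) 2 ν :=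
    memLp_finsetSum' _ fun i _ => (hfL i).comp_measurePreserving (measurePreserving_eval _ i)
  have hsum (y : ι → ℝ) : (∑ i, fun y : ι → ℝ => f i (y i)) y = ∑ i ∈ s, y i := by
    rw [Finset.sum_apply, ← Finset.sum_filter_add_sum_filter_not Finset.univ (· ∈ s)]
    rw [Finset.sum_congr (g := fun i => y i) rfl fun i hi => by
        simp only [Finset.mem_filter] at hi; simp [hf, hi.2],
      Finset.sum_congr (s₁ := Finset.univ.filter (· ∉ s)) (g := fun i => (0 : ℝ)) rfl fun i hi => by
        simp only [Finset.mem_filter] at hi; simp [hf, hi.2]]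
    simp
  have hvs : ∑ i, variance (f i) (κ i (e ω)) = ∑ i ∈ s, variance id (κ i (e ω)) := by
    rw [← Finset.sum_filter_add_sum_filter_not Finset.univ (· ∈ s)]
    rw [Finset.sum_congr (g := fun i => variance id (κ i (e ω))) rfl fun i hi => by
        simp only [Finset.mem_filter] at hi; simp [hf, hi.2],
      Finset.sum_congr (s₁ := Finset.univ.filter (· ∉ s)) (g := fun i => (0 : ℝ)) rfl fun i hi => by
        simp only [Finset.mem_filter] at hi
        have : f i = fun _ => 0 := by simp [hf, hi.2]
        rw [this]; exact variance_zero _]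
    simp
  set U : (ι → ℝ) → ℝ := fun y => a (e ω) + (∑ i, fun y : ι → ℝ => f i (y i)) y with hU
  have hUL : MemLp U 2 ν := (memLp_const (a (e ω))).add hL2
  have hUvar : variance U ν = ∑ i ∈ s, variance id (κ i (e ω)) := by
    rw [← hvs, ← hvar, hU]
    exact variance_const_add hL2.aestronglyMeasurable _
  have hle : variance U ν ≤ ∫ y, U y ^ 2 ∂ν := variance_le_expectation_sq hUL.aestronglyMeasurable
  rw [hUvar] at hle
  refine (ENNReal.ofReal_le_ofReal hle).trans ?_
  rw [ofReal_integral_eq_lintegral_ofReal hUL.integrable_sq (Eventually.of_forall fun y => sq_nonneg _)]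
  refine le_of_eq (lintegral_congr fun y => ?_)
  simp only [hU]
  rw [hsum]

end

/-- As `τ` increases to infinity, the indices of the scheduled times up to `t` form a finite initial
segment of the positive integers. -/
lemma IsSchedule.le_scheduleCount_iff {τ : ℕ → ℝ≥0} (hτ : IsSchedule τ) {i : ℕ} (hi : 1 ≤ i)
    (t : ℝ≥0) : i ≤ scheduleCount τ t ↔ τ i ≤ t := by
  have hfin : {j : ℕ | τ j ≤ t}.Finite := by
    obtain ⟨n, hn⟩ := (hτ.2.2.eventually_gt_atTop t).exists
    exact (Set.finite_Iio n).subset fun j hj => by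
      by_contra h
      exact absurd (hτ.2.1.monotone (not_lt.1 h)) (not_le.2 (lt_of_le_of_lt hj hn))
  have hfin' : {j : ℕ | 1 ≤ j ∧ τ j ≤ t}.Finite := hfin.subset fun j hj => hj.2
  unfold scheduleCount
  constructor
  · intro h
    by_contra hlt
    have hsub : {j : ℕ | 1 ≤ j ∧ τ j ≤ t} ⊆ ↑(Finset.Icc 1 (i - 1)) := fun j hj => by
      have : j < i := by
        by_contra hji
        exact hlt ((hτ.2.1.monotone (not_lt.1 hji)).trans hj.2)
      have := hj.1
      simp only [Finset.coe_Icc, Set.mem_Icc]; omega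
    have := Set.ncard_le_ncard hsub (Finset.finite_toSet _)
    rw [Set.ncard_coe_finset, Nat.card_Icc] at this
    omega
  · intro h
    have hsub : ↑(Finset.Icc 1 i) ⊆ {j : ℕ | 1 ≤ j ∧ τ j ≤ t} := fun j hj => by
      simp only [Finset.coe_Icc, Set.mem_Icc] at hj
      exact ⟨hj.1, (hτ.2.1.monotone hj.2).trans h⟩
    have := Set.ncard_le_ncard hsub hfin'
    rw [Set.ncard_coe_finset, Nat.card_Icc] at this
    omega

lemma IsSchedule.scheduleCount_mono {τ : ℕ → ℝ≥0} (hτ : IsSchedule τ) : Monotone (scheduleCount τ) := by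
  intro s t hst
  rcases Nat.eq_zero_or_pos (scheduleCount τ s) with h | h
  · omega
  · exact (hτ.le_scheduleCount_iff h t).2 (((hτ.le_scheduleCount_iff h s).1 le_rfl).trans hst)

lemma IsSchedule.mem_Ioc {τ : ℕ → ℝ≥0} (hτ : IsSchedule τ) {i : ℕ} {a b : ℝ≥0}
    (hi : i ∈ Finset.Ioc (scheduleCount τ a) (scheduleCount τ b)) : 1 ≤ i ∧ τ i ∈ Set.Ioc a b := by
  rw [Finset.mem_Ioc] at hi
  have h1 : 1 ≤ i := by omega
  refine ⟨h1, ?_, (hτ.le_scheduleCount_iff h1 b).1 hi.2⟩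
  rw [← not_le, ← hτ.le_scheduleCount_iff h1 a]
  omega

/-- Giving a reward the frequency `0` before the first window, `ξ₁` in it and `ξ₂` in the second
turns one characteristic function of all rewards up to a time into a joint one for two adjacent
windows. -/
lemma prod_Icc_ite {M : Type*} [CommMonoid M] {c d p : ℕ} (hcd : c ≤ d) (hdp : d ≤ p)
    (F : ℕ → ℝ → M) (ξ₁ ξ₂ : ℝ) :
    ∏ k ∈ Finset.Icc 1 p, F k (if k ≤ c then 0 else if k ≤ d then ξ₁ else ξ₂)
      = (∏ k ∈ Finset.Ioc 0 c, F k 0) * (∏ k ∈ Finset.Ioc c d, F k ξ₁) * ∏ k ∈ Finset.Ioc d p, F k ξ₂ := by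
  have : Finset.Icc 1 p = Finset.Ioc 0 p := rfl
  rw [this, ← Finset.prod_Ioc_consecutive _ (Nat.zero_le d) hdp,
    ← Finset.prod_Ioc_consecutive _ (Nat.zero_le c) hcd]
  congr 1
  · congr 1
    · refine Finset.prod_congr rfl fun k hk => ?_
      rw [Finset.mem_Ioc] at hk
      rw [if_pos hk.2]
    · refine Finset.prod_congr rfl fun k hk => ?_
      rw [Finset.mem_Ioc] at hk
      rw [if_neg (by omega), if_pos hk.2]
  · refine Finset.prod_congr rfl fun k hk => ?_
    rw [Finset.mem_Ioc] at hk
    rw [if_neg (by omega), if_neg (by omega)]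

lemma sum_Icc_ite {c d p : ℕ} (hcd : c ≤ d) (hdp : d ≤ p) (f : ℕ → ℝ) (ξ₁ ξ₂ : ℝ) :
    ∑ k ∈ Finset.Icc 1 p, (if k ≤ c then 0 else if k ≤ d then ξ₁ else ξ₂) * f k
      = ξ₁ * (∑ k ∈ Finset.Ioc c d, f k) + ξ₂ * ∑ k ∈ Finset.Ioc d p, f k := by
  have := prod_Icc_ite (M := Multiplicative ℝ) hcd hdp
    (fun k ξ => Multiplicative.ofAdd (ξ * f k)) ξ₁ ξ₂
  simp only [← ofAdd_sum] at this
  have h2 := congrArg Multiplicative.toAdd this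
  simp only [toAdd_mul, toAdd_ofAdd, zero_mul, Finset.sum_const_zero, zero_add, ← Finset.mul_sum] at h2
  exact h2

/-! ### The conditional law of the rewards of a model. -/

section

variable {S Ω : Type*} [Fintype S] [DecidableEq S] [TopologicalSpace S] [DiscreteTopology S]
  [MeasurableSpace S] [DiscreteMeasurableSpace S]

/-- The σ-algebra of the state and counting processes. -/
abbrev Model.field (Z : Model S Ω) : MeasurableSpace Ω := sigma Z.X Set.univ ⊔ sigma Z.N Set.univ

omit [Fintype S] [DecidableEq S] in
lemma Model.isRegular_field {Z : Model S Ω} (hc : ∀ ω, IsCadlag fun t => Z.X t ω)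
    (hn : ∀ ω, IsCounting fun t => Z.N t ω) : @Model.IsRegular Ω S Z.field _ _ Z :=
  @Model.IsRegular.mk Ω S Z.field _ _ Z
    (fun _ => (measurable_sigma (Set.mem_univ _)).mono le_sup_left le_rfl) hc
    (fun _ => (measurable_sigma (Set.mem_univ _)).mono le_sup_right le_rfl) hn

/-- Indices of the first `p` jump, `l` scheduled and `q` external rewards. -/
abbrev RewardIndex (p l q : ℕ) : Type :=
  {k // k ∈ Finset.Icc 1 p} ⊕ {k // k ∈ Finset.Icc 1 l} ⊕ {k // k ∈ Finset.Icc 1 q}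

namespace Model

variable {m0 : MeasurableSpace Ω} {Pr : Measure Ω} [IsProbabilityMeasure Pr] {Z : Model S Ω}
  {E : Data S}

/-- Conditional law of the reward with given index. -/
def rewardLaw (E : Data S) (Z : Model S Ω) {p l q : ℕ} : RewardIndex p l q → Ω → Measure ℝ :=
  Sum.elim (fun k => Z.lawG E k) (Sum.elim (fun k => Z.lawH E k) fun k => Z.lawK E k)

/-- The reward with given index. -/
def reward (Z : Model S Ω) {p l q : ℕ} : RewardIndex p l q → Ω → ℝ :=
  Sum.elim (fun k => Z.g k) (Sum.elim (fun k => Z.h k) fun k => Z.k k)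

instance {p l q : ℕ} (i : RewardIndex p l q) (ω : Ω) : IsProbabilityMeasure (rewardLaw E Z i ω) := by
  rcases i with k | k | k <;> · simp only [rewardLaw, Sum.elim_inl, Sum.elim_inr]; infer_instance

lemma measurable_rewardLaw [MeasurableSpace Ω] (hZ : Z.IsRegular) (h1 : E.A1) {p l q : ℕ} (i : RewardIndex p l q) :
    Measurable (rewardLaw E Z i) := by
  rcases i with k | k | k
  · exact hZ.measurable_lawG h1 _
  · exact hZ.measurable_lawH _
  · exact hZ.measurable_lawK h1 _

lemma HasRewardLaw.measurable_reward (hL : Z.HasRewardLaw E Pr) {p l q : ℕ} (i : RewardIndex p l q) :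
    Measurable (reward Z i) := by
  rcases i with k | k | k
  · exact hL.measurable_g _
  · exact hL.measurable_h _
  · exact hL.measurable_k _

lemma field_le (hZ : Z.IsRegular) : Z.field ≤ m0 :=
  sup_le (sigma_le fun t _ => hZ.measurable_X t) (sigma_le fun t _ => hZ.measurable_N t)

/-- Puts the reward law in the form required by `map_eq_compProd_piKernel`: the conditioning
variable is the identity map into `Ω` with the σ-algebra `σ(X,N)`, and the measure is restricted to
an event on which enough jumps and external events occur. -/
lemma HasRewardLaw.real_eq (hL : Z.HasRewardLaw E Pr) (hle : Z.field ≤ m0) {p l q : ℕ} {Γ : Set Ω}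
    (hΓ : MeasurableSet[Z.field] Γ) (hpq : ∀ ω ∈ Γ, (∃ t, p ≤ Z.J t ω) ∧ ∃ t, q ≤ Z.N t ω)
    (A : Set Ω) (hA : MeasurableSet[Z.field] A) (a : RewardIndex p l q → ℝ) :
    (Pr.restrict Γ).real (id ⁻¹' A ∩ {ω | ∀ i, reward Z i ω ≤ a i})
      = ∫ ω in id ⁻¹' A, ∏ i, cdf (rewardLaw E Z i (id ω)) (a i) ∂(Pr.restrict Γ) := by
  classical
  set f : ℕ → ℝ := fun k => if h : k ∈ Finset.Icc 1 p then a (.inl ⟨k, h⟩) else 0 with hf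
  set g : ℕ → ℝ := fun k => if h : k ∈ Finset.Icc 1 l then a (.inr (.inl ⟨k, h⟩)) else 0 with hg
  set h : ℕ → ℝ := fun k => if h : k ∈ Finset.Icc 1 q then a (.inr (.inr ⟨k, h⟩)) else 0 with hh
  have hlaw := hL.law p l q (A ∩ Γ) (MeasurableSet.inter hA hΓ) (fun ω hω => hpq ω hω.2) f g h
  rw [measureReal_restrict_apply' (hle _ hΓ), Measure.restrict_restrict (show MeasurableSet (id ⁻¹' A) from hle _ hA)]
  have e1 : id ⁻¹' A ∩ {ω | ∀ i, reward Z i ω ≤ a i} ∩ Γ = A ∩ Γ ∩ {ω |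
      (∀ k ∈ Finset.Icc 1 p, Z.g k ω ≤ f k) ∧ (∀ i ∈ Finset.Icc 1 l, Z.h i ω ≤ g i) ∧
        ∀ k ∈ Finset.Icc 1 q, Z.k k ω ≤ h k} := by
    ext ω
    simp only [Set.mem_inter_iff, Set.mem_preimage, id, Set.mem_ofPred_eq, Sum.forall, reward,
      Sum.elim_inl, Sum.elim_inr, Subtype.forall]
    constructor
    · rintro ⟨⟨hω, b1, b2, b3⟩, hωΓ⟩
      refine ⟨⟨hω, hωΓ⟩, fun k hk => ?_, fun k hk => ?_, fun k hk => ?_⟩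
      · rw [hf]; simp only [hk, dif_pos]; exact b1 k hk
      · rw [hg]; simp only [hk, dif_pos]; exact b2 k hk
      · rw [hh]; simp only [hk, dif_pos]; exact b3 k hk
    · rintro ⟨⟨hω, hωΓ⟩, b1, b2, b3⟩
      refine ⟨⟨hω, fun k hk => ?_, fun k hk => ?_, fun k hk => ?_⟩, hωΓ⟩
      · have := b1 k hk; rw [hf] at this; simpa only [hk, dif_pos] using this
      · have := b2 k hk; rw [hg] at this; simpa only [hk, dif_pos] using this
      · have := b3 k hk; rw [hh] at this; simpa only [hk, dif_pos] using this
  rw [e1, hlaw]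
  refine integral_congr_ae (Eventually.of_forall fun ω => ?_)
  simp only [Fintype.prod_sum_type, rewardLaw, Sum.elim_inl, Sum.elim_inr, id]
  rw [← mul_assoc]
  congr 1
  · congr 1
    · rw [← Finset.prod_coe_sort]
      refine Finset.prod_congr rfl fun k _ => ?_
      rw [hf]; simp only [k.2, dif_pos]; rfl
    · rw [← Finset.prod_coe_sort]
      refine Finset.prod_congr rfl fun k _ => ?_
      rw [hg]; simp only [k.2, dif_pos]; rfl
  · rw [← Finset.prod_coe_sort]
    refine Finset.prod_congr rfl fun k _ => ?_
    rw [hh]; simp only [k.2, dif_pos]; rfl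

lemma HasRewardLaw.setIntegral_exp (hL : Z.HasRewardLaw E Pr) (hZ : Z.IsRegular) (h1 : E.A1)
    {p l q : ℕ} {Γ : Set Ω} (hΓ : MeasurableSet[Z.field] Γ)
    (hpq : ∀ ω ∈ Γ, (∃ t, p ≤ Z.J t ω) ∧ ∃ t, q ≤ Z.N t ω)
    {w : Ω → ℂ} (hw : Measurable[Z.field] w) {C : ℝ} (hC : ∀ ω, ‖w ω‖ ≤ C) {f g h : ℕ → Ω → ℝ}
    (hf : ∀ k, Measurable[Z.field] (f k)) (hg : ∀ k, Measurable[Z.field] (g k))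
    (hh : ∀ k, Measurable[Z.field] (h k)) :
    ∫ ω in Γ, w ω * Complex.exp (((∑ k ∈ Finset.Icc 1 p, f k ω * Z.g k ω)
        + (∑ k ∈ Finset.Icc 1 l, g k ω * Z.h k ω)
        + ∑ k ∈ Finset.Icc 1 q, h k ω * Z.k k ω : ℝ) * Complex.I) ∂Pr
      = ∫ ω in Γ, w ω * ((∏ k ∈ Finset.Icc 1 p, charFun (Z.lawG E k ω) (f k ω))
        * (∏ k ∈ Finset.Icc 1 l, charFun (Z.lawH E k ω) (g k ω))
        * ∏ k ∈ Finset.Icc 1 q, charFun (Z.lawK E k ω) (h k ω)) ∂Pr := by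
  have hle := field_le hZ
  have hreg := isRegular_field hZ.cadlag hZ.counting
  set θ : RewardIndex p l q → Ω → ℝ :=
    Sum.elim (fun k => f k) (Sum.elim (fun k => g k) fun k => h k) with hθ
  have hθm : ∀ i, Measurable[Z.field] (θ i) := by
    rintro (k | k | k)
    exacts [hf k, hg k, hh k]
  have hmap := map_eq_compProd_piKernel (m0 := m0) (m' := Z.field) (P := Pr.restrict Γ) (e := id)
    (κ := rewardLaw E Z (p := p) (l := l) (q := q)) (Y := reward Z) (measurable_id'' hle)
    (fun i => @measurable_rewardLaw S Ω _ _ _ _ _ _ Z E Z.field hreg h1 p l q i)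
    (fun i => hL.measurable_reward i) (hL.real_eq hle hΓ hpq)
  have key := integral_exp_eq_of_map_eq_compProd (m0 := m0) (m' := Z.field) (measurable_id'' hle)
    (fun i => hL.measurable_reward i) hmap hw hC hθm
  simp only [id] at key
  convert key using 1
  · refine integral_congr_ae (Eventually.of_forall fun ω => ?_)
    simp only
    congr 4
    simp only [Fintype.sum_sum_type, hθ, reward, Sum.elim_inl, Sum.elim_inr]
    rw [Finset.sum_coe_sort (Finset.Icc 1 p) (fun k => f k ω * Z.g k ω),
      Finset.sum_coe_sort (Finset.Icc 1 l) (fun k => g k ω * Z.h k ω),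
      Finset.sum_coe_sort (Finset.Icc 1 q) (fun k => h k ω * Z.k k ω), add_assoc]
  · refine integral_congr_ae (Eventually.of_forall fun ω => ?_)
    simp only
    congr 1
    simp only [Fintype.prod_sum_type, hθ, rewardLaw, Sum.elim_inl, Sum.elim_inr]
    rw [Finset.prod_coe_sort (Finset.Icc 1 p) (fun k => charFun (Z.lawG E k ω) (f k ω)),
      Finset.prod_coe_sort (Finset.Icc 1 l) (fun k => charFun (Z.lawH E k ω) (g k ω)),
      Finset.prod_coe_sort (Finset.Icc 1 q) (fun k => charFun (Z.lawK E k ω) (h k ω)), mul_assoc]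

lemma HasRewardLaw.setLIntegral_variance_le (hL : Z.HasRewardLaw E Pr) (hZ : Z.IsRegular) (h1 : E.A1)
    {p l q : ℕ} {Γ : Set Ω} (hΓ : MeasurableSet[Z.field] Γ)
    (hpq : ∀ ω ∈ Γ, (∃ t, p ≤ Z.J t ω) ∧ ∃ t, q ≤ Z.N t ω)
    (hG : ∀ k ω, MemLp id 2 (Z.lawG E k ω)) (hH : ∀ k ω, MemLp id 2 (Z.lawH E k ω))
    (hK : ∀ k ω, MemLp id 2 (Z.lawK E k ω)) {a : Ω → ℝ} (ha : Measurable[Z.field] a) :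
    ∫⁻ ω in Γ, ENNReal.ofReal ((∑ k ∈ Finset.Icc 1 p, variance id (Z.lawG E k ω))
        + (∑ k ∈ Finset.Icc 1 l, variance id (Z.lawH E k ω))
        + ∑ k ∈ Finset.Icc 1 q, variance id (Z.lawK E k ω)) ∂Pr
      ≤ ∫⁻ ω in Γ, ENNReal.ofReal ((a ω + ((∑ k ∈ Finset.Icc 1 p, Z.g k ω)
        + (∑ k ∈ Finset.Icc 1 l, Z.h k ω) + ∑ k ∈ Finset.Icc 1 q, Z.k k ω)) ^ 2) ∂Pr := by
  have hle := field_le hZ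
  have hreg := isRegular_field hZ.cadlag hZ.counting
  have hmap := map_eq_compProd_piKernel (m0 := m0) (m' := Z.field) (P := Pr.restrict Γ) (e := id)
    (κ := rewardLaw E Z (p := p) (l := l) (q := q)) (Y := reward Z) (measurable_id'' hle)
    (fun i => @measurable_rewardLaw S Ω _ _ _ _ _ _ Z E Z.field hreg h1 p l q i)
    (fun i => hL.measurable_reward i) (hL.real_eq hle hΓ hpq)
  have hm2 : ∀ (i : RewardIndex p l q) ω, MemLp id 2 (rewardLaw E Z i ω) := by
    rintro (k | k | k) ω
    exacts [hG k ω, hH k ω, hK k ω]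
  have key := lintegral_variance_le_of_map_eq_compProd (m0 := m0) (m' := Z.field) (measurable_id'' hle)
    (fun i => hL.measurable_reward i) hmap hm2 ha Finset.univ
  simp only [id] at key
  convert key using 1
  · refine lintegral_congr fun ω => ?_
    congr 1
    simp only [Fintype.sum_sum_type, rewardLaw, Sum.elim_inl, Sum.elim_inr]
    rw [Finset.sum_coe_sort (Finset.Icc 1 p) (fun k => variance id (Z.lawG E k ω)),
      Finset.sum_coe_sort (Finset.Icc 1 l) (fun k => variance id (Z.lawH E k ω)),
      Finset.sum_coe_sort (Finset.Icc 1 q) (fun k => variance id (Z.lawK E k ω)), add_assoc]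
  · refine lintegral_congr fun ω => ?_
    congr 3
    simp only [Fintype.sum_sum_type, reward, Sum.elim_inl, Sum.elim_inr]
    rw [Finset.sum_coe_sort (Finset.Icc 1 p) (fun k => Z.g k ω),
      Finset.sum_coe_sort (Finset.Icc 1 l) (fun k => Z.h k ω),
      Finset.sum_coe_sort (Finset.Icc 1 q) (fun k => Z.k k ω), add_assoc]

end Model

end

/-! ### Independence of the rewards of adjacent windows. -/

section

/-- Used to reduce to the events on which the numbers of jumps and of external events are fixed,
where sums of rewards have deterministic length. -/
lemma integral_eq_of_forall_fiber {Ω α F : Type*} [MeasurableSpace Ω] [NormedAddCommGroup F]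
    [NormedSpace ℝ F] [Countable α] [MeasurableSpace α] [MeasurableSingletonClass α] {P : Measure Ω}
    {V : Ω → α} (hV : Measurable V) {f g : Ω → F} (hf : Integrable f P) (hg : Integrable g P)
    (h : ∀ v, ∫ ω in V ⁻¹' {v}, f ω ∂P = ∫ ω in V ⁻¹' {v}, g ω ∂P) : ∫ ω, f ω ∂P = ∫ ω, g ω ∂P := by
  have hu : ⋃ v, V ⁻¹' {v} = Set.univ :=
    Set.eq_univ_of_forall fun ω => Set.mem_iUnion.2 ⟨V ω, rfl⟩
  have hd : Pairwise (Function.onFun Disjoint fun v => V ⁻¹' {v}) := fun v w hvw =>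
    Set.disjoint_left.2 fun ω h1 h2 => hvw (h1.symm.trans h2)
  have e (k : Ω → F) (hk : Integrable k P) := integral_iUnion (μ := P) (f := k) (s := fun v => V ⁻¹' {v})
    (fun v => hV (measurableSet_singleton v)) hd hk.integrableOn
  have ef := e f hf
  have eg := e g hg
  rw [hu, setIntegral_univ] at ef eg
  rw [ef, eg]
  exact tsum_congr h

variable {S Ω : Type*} [Fintype S] [DecidableEq S] [TopologicalSpace S] [DiscreteTopology S]
  [MeasurableSpace S] [DiscreteMeasurableSpace S]

namespace Model

/-- The reward collected in `(a,b]`. -/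
def incr (E : Data S) (Z : Model S Ω) (a b : ℝ≥0) (ω : Ω) : ℝ :=
  (∫ s in (a : ℝ)..b, E.r s.toNNReal (Z.X s.toNNReal ω))
    + ((∑ k ∈ Finset.Ioc (Z.J a ω) (Z.J b ω), Z.g k ω)
    + (∑ i ∈ Finset.Ioc (scheduleCount E.τ a) (scheduleCount E.τ b), Z.h i ω)
    + ∑ k ∈ Finset.Ioc (Z.N a ω) (Z.N b ω), Z.k k ω)

variable {m₁ m₂ m0 : MeasurableSpace Ω} {Pr : Measure Ω} [IsProbabilityMeasure Pr] {Z : Model S Ω}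
  {E : Data S}

lemma IsRegular.intervalIntegrable (hZ : Z.IsRegular) {F : ℝ≥0 → S → ℝ}
    (hF : ∀ x, Measurable fun t => F t x) {C : ℝ} (hC : ∀ t x, |F t x| ≤ C) (ω : Ω) (a b : ℝ) :
    IntervalIntegrable (fun s => F s.toNNReal (Z.X s.toNNReal ω)) volume a b := by
  rw [intervalIntegrable_iff]
  refine IntegrableOn.of_bound measure_Ioc_lt_top ?_ C (Eventually.of_forall fun s => ?_)
  · exact ((hZ.measurable_uncurry_comp hF).comp (measurable_id.prodMk measurable_const)).aestronglyMeasurable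
  · rw [Real.norm_eq_abs]; exact hC _ _

lemma R_sub_R (hZ : Z.IsRegular) (hτ : IsSchedule E.τ) (h1 : E.A1) {C : ℝ}
    (hC : ∀ t x, |E.r t x| ≤ C) {a b : ℝ≥0} (hab : a ≤ b) (ω : Ω) :
    Z.R E b ω - Z.R E a ω = incr E Z a b ω := by
  have hs {c d : ℕ} (hcd : c ≤ d) (f : ℕ → ℝ) :
      ∑ k ∈ Finset.Icc 1 d, f k - ∑ k ∈ Finset.Icc 1 c, f k = ∑ k ∈ Finset.Ioc c d, f k := by
    have := Finset.sum_Ioc_consecutive f (Nat.zero_le c) hcd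
    have e (n : ℕ) : Finset.Icc 1 n = Finset.Ioc 0 n := rfl
    rw [e, e, ← this]; ring
  have hi (a b : ℝ) := hZ.intervalIntegrable h1.reward hC ω a b
  unfold R incr
  rw [← hs ((hZ.counting_J ω).mono hab), ← hs (hτ.scheduleCount_mono hab),
    ← hs ((hZ.counting ω).mono hab), ← intervalIntegral.integral_interval_sub_left (hi 0 b) (hi 0 a)]
  ring

lemma measurable_sum_Ioc [MeasurableSpace Ω] {c d : Ω → ℕ} (hc : Measurable c) (hd : Measurable d)
    {f : ℕ → Ω → ℝ} (hf : ∀ k, Measurable (f k)) :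
    Measurable fun ω => ∑ k ∈ Finset.Ioc (c ω) (d ω), f k ω := by
  have h1 : Measurable fun q : (ℕ × ℕ) × Ω => ∑ k ∈ Finset.Ioc q.1.1 q.1.2, f k q.2 :=
    measurable_from_prod_countable_right fun p =>
      Finset.measurable_fun_sum (Finset.Ioc p.1 p.2) fun k _ => hf k
  exact h1.comp ((hc.prodMk hd).prodMk measurable_id)

lemma measurable_incr (hZ : Z.IsRegular) (hL : Z.HasRewardLaw E Pr) (h1 : E.A1) (a b : ℝ≥0) :
    Measurable (incr E Z a b) :=
  (hZ.measurable_integral h1.reward a b).add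
    (((measurable_sum_Ioc (hZ.measurable_J a) (hZ.measurable_J b) hL.measurable_g).add
      (Finset.measurable_fun_sum _ fun i _ => hL.measurable_h i)).add
      (measurable_sum_Ioc (hZ.measurable_N a) (hZ.measurable_N b) hL.measurable_k))

lemma condCharFun_zero (a b : ℝ≥0) (ω : Ω) : condCharFun E Z a b 0 ω = 1 := by
  simp [condCharFun]

/-- Once `J b` and `N b` are fixed, the reward law applies to all rewards up to time `b`. Which
window a reward falls into is still random but known from `(X,N)`, so the window is encoded in
frequencies that are measurable for that σ-algebra. -/
lemma integral_exp_incr (hL : Z.HasRewardLaw E Pr) (hZ : Z.IsRegular) (h1 : E.A1)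
    (hτ : IsSchedule E.τ) {a s b : ℝ≥0} (has : a ≤ s) (hsb : s ≤ b)
    {w : Ω → ℂ} (hw : Measurable[Z.field] w) {C : ℝ} (hC : ∀ ω, ‖w ω‖ ≤ C) (ξ₁ ξ₂ : ℝ) :
    ∫ ω, w ω * Complex.exp ((ξ₁ * incr E Z a s ω + ξ₂ * incr E Z s b ω : ℝ) * Complex.I) ∂Pr
      = ∫ ω, w ω * (condCharFun E Z a s ξ₁ ω * condCharFun E Z s b ξ₂ ω) ∂Pr := by
  have hle := field_le hZ
  have hreg := isRegular_field hZ.cadlag hZ.counting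
  have hwm := hw.mono hle le_rfl
  have hma := measurable_incr hZ hL h1 a s
  have hmb := measurable_incr hZ hL h1 s b
  refine integral_eq_of_forall_fiber ((hZ.measurable_J b).prodMk (hZ.measurable_N b)) ?_ ?_ ?_
  · refine Integrable.of_bound (hwm.mul (Complex.measurable_exp.comp (by fun_prop))).aestronglyMeasurable
      C (Eventually.of_forall fun ω => ?_)
    rw [norm_mul, Complex.norm_exp_ofReal_mul_I, mul_one]
    exact hC ω
  · refine Integrable.of_bound (hwm.mul ((hZ.measurable_condCharFun h1 a s ξ₁).mul
      (hZ.measurable_condCharFun h1 s b ξ₂))).aestronglyMeasurable C (Eventually.of_forall fun ω => ?_)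
    rw [norm_mul, norm_mul]
    calc _ ≤ C * 1 := mul_le_mul (hC ω) (mul_le_one₀ (norm_condCharFun_le_one _ _ _) (norm_nonneg _)
            (norm_condCharFun_le_one _ _ _)) (by positivity) ((norm_nonneg _).trans (hC ω))
      _ = C := mul_one C
  rintro ⟨p, q⟩
  have hm1 : ∀ t, Measurable[Z.field] (Z.J t) := fun t =>
    @IsRegular.measurable_J Ω S Z.field _ _ _ _ _ Z hreg t
  have hm2 : ∀ t, Measurable[Z.field] (Z.N t) := fun t =>
    @IsRegular.measurable_N Ω S Z.field _ _ Z hreg t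
  have hm3 : ∀ c d : ℝ, Measurable[Z.field] fun ω => ∫ t in c..d, E.r t.toNNReal (Z.X t.toNNReal ω) :=
    fun c d => @IsRegular.measurable_integral Ω S Z.field _ _ _ _ _ Z hreg _ h1.reward c d
  have hΓ : MeasurableSet[Z.field] ((fun ω => (Z.J b ω, Z.N b ω)) ⁻¹' {(p, q)}) :=
    ((hm1 b).prodMk (hm2 b)) (measurableSet_singleton _)
  have hite (c d : Ω → ℕ) (hc : Measurable[Z.field] c) (hd : Measurable[Z.field] d) (k : ℕ) :
      Measurable[Z.field] fun ω => if k ≤ c ω then (0 : ℝ) else if k ≤ d ω then ξ₁ else ξ₂ := by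
    have : Measurable fun q : ℕ × ℕ => if k ≤ q.1 then (0 : ℝ) else if k ≤ q.2 then ξ₁ else ξ₂ :=
      measurable_of_countable _
    exact this.comp (hc.prodMk hd)
  have key := hL.setIntegral_exp (l := scheduleCount E.τ b) (p := p) (q := q) hZ h1 hΓ
    (fun ω hω => by
      have h1 : (Z.J b ω, Z.N b ω) = (p, q) := hω
      rw [Prod.mk.injEq] at h1
      exact ⟨⟨b, h1.1.ge⟩, b, h1.2.ge⟩)
    (w := fun ω => w ω * Complex.exp ((ξ₁ * (∫ t in (a : ℝ)..s, E.r t.toNNReal (Z.X t.toNNReal ω))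
      + ξ₂ * (∫ t in (s : ℝ)..b, E.r t.toNNReal (Z.X t.toNNReal ω)) : ℝ) * Complex.I))
    (hw.mul (Complex.measurable_exp.comp ((Complex.measurable_ofReal.comp
      (((hm3 a s).const_mul ξ₁).add ((hm3 s b).const_mul ξ₂))).mul_const _)))
    (C := C) (fun ω => by rw [norm_mul, Complex.norm_exp_ofReal_mul_I, mul_one]; exact hC ω)
    (hite (Z.J a) (Z.J s) (hm1 a) (hm1 s))
    (hite (fun _ => scheduleCount E.τ a) (fun _ => scheduleCount E.τ s) measurable_const measurable_const)
    (hite (Z.N a) (Z.N s) (hm2 a) (hm2 s))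
  have hpq (ω : Ω) (hω : ω ∈ (fun ω => (Z.J b ω, Z.N b ω)) ⁻¹' {(p, q)}) :
      Z.J b ω = p ∧ Z.N b ω = q := by
    have h1 : (Z.J b ω, Z.N b ω) = (p, q) := hω
    rwa [Prod.mk.injEq] at h1
  convert key using 1
  · refine setIntegral_congr_fun (hle _ hΓ) fun ω hω => ?_
    obtain ⟨rfl, rfl⟩ := hpq ω hω
    rw [sum_Icc_ite ((hZ.counting_J ω).mono has) ((hZ.counting_J ω).mono hsb),
      sum_Icc_ite (hτ.scheduleCount_mono has) (hτ.scheduleCount_mono hsb),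
      sum_Icc_ite ((hZ.counting ω).mono has) ((hZ.counting ω).mono hsb), mul_assoc, ← Complex.exp_add,
      ← add_mul, ← Complex.ofReal_add]
    congr 4
    unfold incr
    ring
  · refine setIntegral_congr_fun (hle _ hΓ) fun ω hω => ?_
    obtain ⟨rfl, rfl⟩ := hpq ω hω
    rw [prod_Icc_ite ((hZ.counting_J ω).mono has) ((hZ.counting_J ω).mono hsb)
        (fun k ξ => charFun (Z.lawG E k ω) ξ),
      prod_Icc_ite (hτ.scheduleCount_mono has) (hτ.scheduleCount_mono hsb)
        (fun k ξ => charFun (Z.lawH E k ω) ξ),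
      prod_Icc_ite ((hZ.counting ω).mono has) ((hZ.counting ω).mono hsb)
        (fun k ξ => charFun (Z.lawK E k ω) ξ)]
    simp only [charFun_zero, probReal_univ, Complex.ofReal_one, Finset.prod_const_one, one_mul]
    unfold condCharFun
    rw [Complex.ofReal_add, add_mul, Complex.exp_add]
    push_cast
    ring

lemma clamp_measurable_integral (hZ : Z.IsRegular) {F : ℝ≥0 → S → ℝ}
    (hF : ∀ x, Measurable fun t => F t x) {a b e : ℝ≥0} (hab : a ≤ b) 
    (hX : ∀ t, Measurable[m₁] (Z.X (clampTime a b e t))) {u v : ℝ≥0} (hau : a ≤ u) (huv : u ≤ v)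
    (hvb : v ≤ b) :
    Measurable[m₁] fun ω => ∫ w in (u : ℝ)..v, F w.toNNReal (Z.X w.toNNReal ω) := by
  -- The integral involves the state only. With a trivial counting process, regularity of the
  -- clamped model requires nothing about `N`.
  let Z' : Model S Ω := { Z with N := fun _ _ => 0 }
  have hreg : @Model.IsRegular Ω S m₁ _ _ (Z'.clamp a b e) :=
    @isRegular_clamp S Ω _ _ _ _ _ Z' m₁ hZ.cadlag
      (fun ω => ⟨fun _ _ _ => le_rfl, fun t => continuousWithinAt_const⟩) _ _ _ hab hX
      (fun t _ => @measurable_const _ _ _ m₁ _)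
  have h := @IsRegular.measurable_integral Ω S m₁ _ _ _ _ _ _ hreg F hF u v
  convert h using 2 with ω
  refine intervalIntegral.integral_congr_ae ?_
  have hb : ∀ᵐ s : ℝ, s ≠ b := by simp [ae_iff]
  filter_upwards [hb] with s hs hmem
  rw [Set.uIoc_of_le (by exact_mod_cast huv)] at hmem
  have hs0 : (0 : ℝ) ≤ s := u.2.trans hmem.1.le
  have h1 : a ≤ s.toNNReal := by
    rw [Real.le_toNNReal_iff_coe_le hs0]
    exact (NNReal.coe_le_coe.2 hau).trans hmem.1.le
  have h2 : s.toNNReal < b := by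
    rw [Real.toNNReal_lt_iff_lt_coe hs0]
    exact lt_of_le_of_ne (hmem.2.trans (NNReal.coe_le_coe.2 hvb)) hs
  change _ = F _ (Z.X (clampTime a b e _) ω)
  rw [clampTime_of_mem h1 h2]

/-- The rewards collected in adjacent time windows are independent when the state process is. -/
theorem indepFun_incr (hL : Z.HasRewardLaw E Pr) (hZ : Z.IsRegular)
    (hN : IsModulatedPoisson E.β Z.X Z.N Pr) (h1 : E.A1) (hτ : IsSchedule E.τ)
    (hint : ∀ i, 1 ≤ i → ∀ m : ℕ, E.τ i ≠ m)
    (h₁ : m₁ ≤ sigma Z.X Set.univ) (h₂ : m₂ ≤ sigma Z.X Set.univ) (hind : Indep m₁ m₂ Pr)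
    {a s b e₁ e₂ : ℝ≥0} (has : a < s ∨ a = s ∧ e₁ = a) (hsb : s < b ∨ s = b ∧ e₂ = s)
    (he₁ : e₁ = s ∨ ∃ m : ℕ, s = m) (he₂ : e₂ = b ∨ ∃ m : ℕ, b = m)
    (he₁' : ∀ᵐ ω ∂Pr, e₁ = s ∨ ∃ u < s, Z.N u ω = Z.N s ω)
    (he₂' : ∀ᵐ ω ∂Pr, e₂ = b ∨ ∃ u < b, Z.N u ω = Z.N b ω)
    (hX₁ : ∀ t, Measurable[m₁] (Z.X (clampTime a s e₁ t)))
    (hX₂ : ∀ t, Measurable[m₂] (Z.X (clampTime s b e₂ t))) {f : Ω → ℝ} (hf : Measurable[m₂] f) :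
    IndepFun (incr E Z a s) (fun ω => incr E Z s b ω + f ω) Pr := by
  have has' : a ≤ s := by rcases has with h | h; exacts [h.le, h.1.le]
  have hsb' : s ≤ b := by rcases hsb with h | h; exacts [h.le, h.1.le]
  have hle := field_le hZ
  have hXle : sigma Z.X Set.univ ≤ m0 := sigma_le fun t _ => hZ.measurable_X t
  have hI := hN.indep_sup hZ.measurable_X h₁ h₂ hind has' hsb'
    (fun u v hu huv hv => clamp_measurable_integral hZ h1.intensity has' hX₁ hu huv hv)
    (fun u v hu huv hv => clamp_measurable_integral hZ h1.intensity hsb' hX₂ hu huv hv)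
  have hτ' (a b : ℝ≥0) : ∀ i ∈ Finset.Ioc (scheduleCount E.τ a) (scheduleCount E.τ b),
      E.τ i ∈ Set.Ioc a b ∧ ∀ m : ℕ, E.τ i ≠ m := fun i hi =>
    ⟨(hτ.mem_Ioc hi).2, hint i (hτ.mem_Ioc hi).1⟩
  have hΨ₁ (ξ : ℝ) : condCharFun E (Z.clamp a s e₁) a s ξ =ᵐ[Pr] condCharFun E Z a s ξ := by
    filter_upwards [he₁'] with ω hω
    exact condCharFun_clamp hZ has he₁ hω (hτ' a s) ξ
  have hΨ₂ (ξ : ℝ) : condCharFun E (Z.clamp s b e₂) s b ξ =ᵐ[Pr] condCharFun E Z s b ξ := by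
    filter_upwards [he₂'] with ω hω
    exact condCharFun_clamp hZ hsb he₂ hω (hτ' s b) ξ
  have hf0 : Measurable f := hf.mono (h₂.trans hXle) le_rfl
  have hU := measurable_incr hZ hL h1 a s
  have hV := measurable_incr hZ hL h1 s b
  have hVf : Measurable fun ω => incr E Z s b ω + f ω := hV.add hf0
  have hw (ξ : ℝ) : Measurable[m₂] fun ω => Complex.exp ((ξ * f ω : ℝ) * Complex.I) :=
    Complex.measurable_exp.comp ((Complex.measurable_ofReal.comp (hf.const_mul ξ)).mul_const _)
  have hcad := hZ.cadlag
  have hcount := hZ.counting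
  have hNm := hZ.measurable_N
  have hexp := fun (ξ₁ ξ₂ : ℝ) {w : Ω → ℂ} (hw : Measurable[Z.field] w) (hC : ∀ ω, ‖w ω‖ ≤ 1) =>
    integral_exp_incr hL hZ h1 hτ has' hsb' hw hC ξ₁ ξ₂
  set M₁ := m₁ ⊔ sigma (fun t ω => Z.N t ω - Z.N a ω) (Set.Icc a s) with hM₁
  set M₂ := m₂ ⊔ sigma (fun t ω => Z.N t ω - Z.N s ω) (Set.Icc s b) with hM₂
  have hM₁le : M₁ ≤ m0 := sup_le (h₁.trans hXle)
    (sigma_le fun t _ => (hNm t).sub (hNm a))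
  have hM₂le : M₂ ≤ m0 := sup_le (h₂.trans hXle)
    (sigma_le fun t _ => (hNm t).sub (hNm s))
  have hreg₁ : @Model.IsRegular Ω S M₁ _ _ (Z.clamp a s e₁) :=
    @isRegular_clamp S Ω _ _ _ _ _ Z M₁ hcad hcount _ _ _ has'
      (fun t => (hX₁ t).mono le_sup_left le_rfl)
      (fun t ht => (measurable_sigma (X := fun t ω => Z.N t ω - Z.N a ω) ht).mono le_sup_right le_rfl)
  have hreg₂ : @Model.IsRegular Ω S M₂ _ _ (Z.clamp s b e₂) :=
    @isRegular_clamp S Ω _ _ _ _ _ Z M₂ hcad hcount _ _ _ hsb'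
      (fun t => (hX₂ t).mono le_sup_left le_rfl)
      (fun t ht => (measurable_sigma (X := fun t ω => Z.N t ω - Z.N s ω) ht).mono le_sup_right le_rfl)
  have hΨm₁ (ξ : ℝ) : Measurable[M₁] (condCharFun E (Z.clamp a s e₁) a s ξ) :=
    @IsRegular.measurable_condCharFun S Ω _ _ _ _ _ (Z.clamp a s e₁) E M₁ hreg₁ h1 a s ξ
  have hΨm₂ (ξ : ℝ) : Measurable[M₂] (condCharFun E (Z.clamp s b e₂) s b ξ) :=
    @IsRegular.measurable_condCharFun S Ω _ _ _ _ _ (Z.clamp s b e₂) E M₂ hreg₂ h1 s b ξ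
  -- The joint characteristic function is the mean of a product of two conditional ones. After
  -- clamping they are measurable for the independent σ-algebras `M₁` and `M₂`, so the mean
  -- factorizes.
  have hmain (ξ₁ ξ₂ : ℝ) :
      ∫ ω, Complex.exp ((ξ₁ * incr E Z a s ω + ξ₂ * (incr E Z s b ω + f ω) : ℝ) * Complex.I) ∂Pr
      = (∫ ω, condCharFun E (Z.clamp a s e₁) a s ξ₁ ω ∂Pr)
        * ∫ ω, Complex.exp ((ξ₂ * f ω : ℝ) * Complex.I) * condCharFun E (Z.clamp s b e₂) s b ξ₂ ω ∂Pr := by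
    have e1 := hexp ξ₁ ξ₂ ((hw ξ₂).mono (h₂.trans le_sup_left) le_rfl)
      (fun ω => by rw [Complex.norm_exp_ofReal_mul_I])
    have f2 : Measurable[M₂] fun ω => Complex.exp ((ξ₂ * f ω : ℝ) * Complex.I)
        * condCharFun E (Z.clamp s b e₂) s b ξ₂ ω :=
      ((hw ξ₂).mono le_sup_left le_rfl).mul (hΨm₂ ξ₂)
    have hIF : IndepFun (condCharFun E (Z.clamp a s e₁) a s ξ₁)
        (fun ω => Complex.exp ((ξ₂ * f ω : ℝ) * Complex.I) * condCharFun E (Z.clamp s b e₂) s b ξ₂ ω) Pr :=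
      indep_of_indep_of_le_left (indep_of_indep_of_le_right hI f2.comap_le) (hΨm₁ ξ₁).comap_le
    rw [← hIF.integral_fun_mul_eq_mul_integral ((hΨm₁ ξ₁).mono hM₁le le_rfl).aestronglyMeasurable
      (f2.mono hM₂le le_rfl).aestronglyMeasurable]
    calc _ = _ := integral_congr_ae (Eventually.of_forall fun ω => ?_)
      _ = _ := e1
      _ = _ := integral_congr_ae ?_
    · rw [← Complex.exp_add]
      congr 1
      push_cast
      ring
    · filter_upwards [hΨ₁ ξ₁, hΨ₂ ξ₂] with ω h1 h2
      rw [h1, h2]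
      ring
  -- Setting one frequency to zero identifies the two factors as the marginal characteristic
  -- functions.
  have hz₁ : ∫ ω, condCharFun E (Z.clamp a s e₁) a s 0 ω ∂Pr = 1 := by
    simp [condCharFun_zero]
  have hz₂ : ∫ ω, Complex.exp (((0 : ℝ) * f ω : ℝ) * Complex.I)
      * condCharFun E (Z.clamp s b e₂) s b 0 ω ∂Pr = 1 := by
    simp [condCharFun_zero]
  rw [indepFun_iff_charFun_prod hU.aemeasurable hVf.aemeasurable]
  intro t
  have e0 := hmain t.ofLp.1 t.ofLp.2
  have e1 := hmain t.ofLp.1 0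
  have e2 := hmain 0 t.ofLp.2
  rw [hz₂, mul_one] at e1
  rw [hz₁, one_mul] at e2
  rw [← e1, ← e2] at e0
  rw [charFun_apply, charFun_apply_real, charFun_apply_real,
    integral_map (by fun_prop) (Continuous.aestronglyMeasurable (by fun_prop)),
    integral_map (by fun_prop) (Continuous.aestronglyMeasurable (by fun_prop)),
    integral_map (by fun_prop) (Continuous.aestronglyMeasurable (by fun_prop))]
  convert e0 using 1
  · refine integral_congr_ae (Eventually.of_forall fun ω => ?_)
    simp [WithLp.prod_inner_apply, mul_comm]
  · congr 1 <;>
    · refine integral_congr_ae (Eventually.of_forall fun ω => ?_)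
      simp

end Model

end

/-! ### Models with resetting: bounds, independence of cycles, Markov property within a cycle. -/

section

variable {S Ω : Type*} [Fintype S] [DecidableEq S] [TopologicalSpace S] [DiscreteTopology S]
  [MeasurableSpace S] [DiscreteMeasurableSpace S] [MeasurableSpace Ω]

/-- The standing assumptions on a reward model with resetting. -/
structure Model.IsResetting (E : Data S) (μ : ℕ → PMF S) (Z : Model S Ω) (Pr : Measure Ω) : Prop where
  rate : ∀ t, IsRateMatrix (E.Q t)
  schedule : IsSchedule E.τ
  a1 : E.A1
  a2 : E.A2
  a3 : E.A3
  a4 : E.A4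
  a5 : E.A5
  state : IsResetJumpProcess E.Q μ Z.X Pr
  poisson : IsModulatedPoisson E.β Z.X Z.N Pr
  law : Z.HasRewardLaw E Pr
  not_nat : ∀ i, 1 ≤ i → ∀ m : ℕ, E.τ i ≠ m

/-- A common bound for the rates, intensities, reward rates and lump-sum rewards. -/
structure Data.BoundedBy (E : Data S) (C : ℝ) : Prop where
  pos : 0 < C
  rate : ∀ t x y, |E.Q t x y| ≤ C
  reward : ∀ t x, |E.r t x| ≤ C
  intensity_nonneg : ∀ t x, 0 ≤ E.β t x
  intensity : ∀ t x, E.β t x ≤ C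
  jump : ∀ t x y, (E.G t x y : Measure ℝ) (Set.Icc 0 C)ᶜ = 0
  sched : ∀ t x, (E.H t x : Measure ℝ) (Set.Icc 0 C)ᶜ = 0
  ext : ∀ t x, (E.K t x : Measure ℝ) (Set.Icc 0 C)ᶜ = 0

lemma compl_Icc_eq_zero {ν : Measure ℝ} [IsProbabilityMeasure ν] {c C : ℝ} (hcC : c ≤ C)
    (h : ν (Set.Iio 0) = 0 ∧ cdf ν c = 1) : ν (Set.Icc 0 C)ᶜ = 0 := by
  have h2 : ν (Set.Ioi c) = 0 := by
    rw [cdf_eq_real] at h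
    have := probReal_compl_eq_one_sub (μ := ν) (measurableSet_Iic (a := c))
    rw [h.2, sub_self, Set.compl_Iic, measureReal_eq_zero_iff] at this
    exact this
  refine measure_mono_null (t := Set.Iio 0 ∪ Set.Ioi c) (fun z hz => ?_) (measure_union_null h.1 h2)
  by_contra hn
  simp only [Set.mem_union, Set.mem_Iio, Set.mem_Ioi, not_or, not_lt] at hn
  exact hz ⟨hn.1, hn.2.trans hcC⟩

variable {E : Data S} {μ : ℕ → PMF S} {Z : Model S Ω} {Pr : Measure Ω}

namespace Model.IsResetting

variable (h : Z.IsResetting E μ Pr)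
include h

lemma exists_boundedBy : ∃ C, E.BoundedBy C := by
  obtain ⟨q, -, hq⟩ := Data.exists_forall_abs_Q_le h.rate h.a2 h.a3
  have hr : ∃ C, ∀ t x, |E.r t x| ≤ C := by
    choose c hc using fun x => (h.a4.reward x).2
    refine ⟨∑ x, |c x|, fun t x => ?_⟩
    rw [abs_of_nonneg ((h.a4.reward x).1 t)]
    exact ((hc x ⟨t, rfl⟩).trans (le_abs_self _)).trans
      (Finset.single_le_sum (f := fun x => |c x|) (fun _ _ => abs_nonneg _) (Finset.mem_univ x))
  have hb : ∃ C, ∀ t x, E.β t x ≤ C := by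
    choose c hc using fun x => (h.a4.intensity x).2
    refine ⟨∑ x, |c x|, fun t x => ?_⟩
    exact ((hc x ⟨t, rfl⟩).trans (le_abs_self _)).trans
      (Finset.single_le_sum (f := fun x => |c x|) (fun _ _ => abs_nonneg _) (Finset.mem_univ x))
  obtain ⟨Cr, hr⟩ := hr
  obtain ⟨Cb, hb⟩ := hb
  obtain ⟨c, hc⟩ := h.a4.lump
  set D := 1 + |q| + |Cr| + |Cb| + ∑ x, |c x| with hD
  have hsum : 0 ≤ ∑ x, |c x| := Finset.sum_nonneg fun _ _ => abs_nonneg _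
  have a1 := abs_nonneg q
  have a2 := abs_nonneg Cr
  have a3 := abs_nonneg Cb
  have hcD (x : S) : c x ≤ D := by
    have := Finset.single_le_sum (f := fun x => |c x|) (fun _ _ => abs_nonneg _) (Finset.mem_univ x)
    have := le_abs_self (c x)
    linarith
  refine ⟨D, by linarith, fun t x y => (hq t x y).trans ?_, fun t x => (hr t x).trans ?_,
    fun t x => (h.a4.intensity x).1 t, fun t x => (hb t x).trans ?_,
    fun t x y => compl_Icc_eq_zero (hcD x) ((hc x t).1 y),
    fun t x => compl_Icc_eq_zero (hcD x) (hc x t).2.1,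
    fun t x => compl_Icc_eq_zero (hcD x) (hc x t).2.2⟩
  · have := le_abs_self q; linarith
  · have := le_abs_self Cr; linarith
  · have := le_abs_self Cb; linarith

lemma isRegular : Z.IsRegular :=
  ⟨h.state.measurable, h.state.cadlag, h.poisson.measurable, fun ω => ⟨h.poisson.mono ω, h.poisson.rightCont ω⟩⟩

lemma R_zero (ω : Ω) : Z.R E 0 ω = 0 := by
  have hs : scheduleCount E.τ 0 = 0 := by
    by_contra hne
    have h1 := (h.schedule.le_scheduleCount_iff (i := scheduleCount E.τ 0) (by omega) 0).1 le_rfl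
    have h2 := h.schedule.2.1 (show 0 < scheduleCount E.τ 0 by omega)
    rw [h.schedule.1] at h2
    exact absurd h2 (not_lt.2 h1)
  have hJ : Z.J 0 ω = 0 := jumpCount_zero
  unfold Model.R
  rw [hJ, hs, h.poisson.zero ω]
  simp

variable [IsProbabilityMeasure Pr]

lemma measurable_R (t : ℝ≥0) : Measurable (Z.R E t) := by
  have hZ := h.isRegular
  have e : Z.R E t = Model.incr E Z 0 t := by
    obtain ⟨C, hC⟩ := h.exists_boundedBy
    ext ω
    rw [← Model.R_sub_R hZ h.schedule h.a1 hC.reward zero_le, h.R_zero, sub_zero]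
  rw [e]
  exact Model.measurable_incr hZ h.law h.a1 0 t

lemma ae_exists_lt_eq {v : ℝ≥0} (hv : 0 < v) : ∀ᵐ ω ∂Pr, ∃ u < v, Z.N u ω = Z.N v ω := by
  obtain ⟨C, hC⟩ := h.exists_boundedBy
  exact h.poisson.ae_exists_lt_eq hC.intensity hC.intensity_nonneg
    (fun u v => h.isRegular.measurable_integral h.a1.intensity u v) hv

omit h [Fintype S] [DecidableEq S] [TopologicalSpace S] [DiscreteTopology S] [MeasurableSpace S]
  [DiscreteMeasurableSpace S] [MeasurableSpace Ω] [IsProbabilityMeasure Pr] in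
lemma clampTime_mem {I : Set ℝ≥0} {a b e : ℝ≥0} (ha : a ∈ I) (hI : Set.Ico a b ⊆ I) (he : e ∈ I)
    (t : ℝ≥0) : clampTime a b e t ∈ I := by
  unfold clampTime
  split_ifs with h1 h2
  · exact ha
  · exact hI ⟨not_lt.1 h1, h2⟩
  · exact he

/-- Independence of the cycles of `X` passes to the rewards. The states at the right ends `n` and `n
+ 1` belong to the following cycles; the clamped paths show `X 0` and `X n` there instead, which is
harmless because almost surely no external event falls on these times. -/
theorem indepFun_R (n : ℕ) :
    IndepFun (Z.R E n) (fun ω => Z.R E (n + 1 : ℕ) ω - Z.R E n ω) Pr := by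
  obtain ⟨C, hC⟩ := h.exists_boundedBy
  have hZ := h.isRegular
  rcases Nat.eq_zero_or_pos n with rfl | hn
  · have : Z.R E (0 : ℕ) = fun _ => (0 : ℝ) := by
      ext ω; rw [Nat.cast_zero, h.R_zero]
    rw [this]
    exact indepFun_const_left _ _
  have hn0 : (0 : ℝ≥0) < n := by exact_mod_cast hn
  have e1 (ω : Ω) : Model.incr E Z 0 n ω = Z.R E n ω := by
    rw [← Model.R_sub_R hZ h.schedule h.a1 hC.reward zero_le, h.R_zero, sub_zero]
  have e2 (ω : Ω) : Model.incr E Z n (n + 1) ω + 0 = Z.R E (n + 1 : ℕ) ω - Z.R E n ω := by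
    rw [← Model.R_sub_R hZ h.schedule h.a1 hC.reward (by simp), add_zero]; push_cast; rfl
  have key := Model.indepFun_incr h.law hZ h.poisson h.a1 h.schedule h.not_nat
    (sigma_mono (Set.subset_univ _)) (sigma_mono (Set.subset_univ _)) (h.state.indep_nat n)
    (a := 0) (s := n) (b := n + 1) (e₁ := 0) (e₂ := n) (Or.inl hn0) (Or.inl (by simp))
    (Or.inr ⟨n, rfl⟩) (Or.inr ⟨n + 1, by simp⟩)
    ((h.ae_exists_lt_eq hn0).mono fun ω hω => Or.inr hω)
    ((h.ae_exists_lt_eq (by positivity)).mono fun ω hω => Or.inr hω)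
    (fun t => measurable_sigma (clampTime_mem (I := Set.Ico 0 (n : ℝ≥0)) ⟨le_rfl, hn0⟩ subset_rfl ⟨le_rfl, hn0⟩ t))
    (fun t => measurable_sigma (clampTime_mem (I := Set.Ico (n : ℝ≥0) (n + 1)) ⟨le_rfl, by simp⟩ subset_rfl ⟨le_rfl, by simp⟩ t))
    (f := fun _ => 0) measurable_const
  simp only [e2] at key
  rwa [show Model.incr E Z 0 n = Z.R E n from funext e1] at key

/-- The conditional version inside a cycle, with the Markov property at `s` in place of independence
of cycles. The term `w` is there for the expected future reward from the state at `v`; it must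
vanish at `v = m + 1`, where that state is redrawn. -/
theorem indepFun_R_cond {m : ℕ} {s v : ℝ≥0} (hms : m ≤ s) (hsv : s < v) (hv : v ≤ m + 1) {x : S}
    (hx : Pr (Z.X s ⁻¹' {x}) ≠ 0) {w : S → ℝ} (hw : v = m + 1 → w = 0) :
    IndepFun (fun ω => Z.R E s ω - Z.R E m ω)
      (fun ω => Z.R E v ω - Z.R E s ω + w (Z.X v ω)) Pr[|Z.X s ⁻¹' {x}] := by
  obtain ⟨C, hC⟩ := h.exists_boundedBy
  have hZ := h.isRegular
  have hs1 : s < m + 1 := hsv.trans_le hv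
  have e1 (ω : Ω) : Z.R E s ω - Z.R E m ω = Model.incr E Z m s ω :=
    Model.R_sub_R hZ h.schedule h.a1 hC.reward hms ω
  have e2 (ω : Ω) : Z.R E v ω - Z.R E s ω = Model.incr E Z s v ω :=
    Model.R_sub_R hZ h.schedule h.a1 hC.reward hsv.le ω
  simp only [e1, e2]
  have hA : MeasurableSet[sigma Z.X Set.univ] (Z.X s ⁻¹' {x}) :=
    measurable_sigma (X := Z.X) (Set.mem_univ s) (measurableSet_singleton x)
  have : IsProbabilityMeasure Pr[|Z.X s ⁻¹' {x}] := cond_isProbabilityMeasure hx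
  have hac : Pr[|Z.X s ⁻¹' {x}] ≪ Pr := cond_absolutelyContinuous
  have hsub : Set.Ico s v ⊆ Set.Ico s (m + 1) := Set.Ico_subset_Ico_right hv
  have hsmem : s ∈ Set.Ico s ((m : ℝ≥0) + 1) := ⟨le_rfl, hs1⟩
  -- At the end of the cycle the state must be taken from `[s, m + 1)`, and the one at `s` serves;
  -- otherwise the true state at `v` is used.
  set e₂ : ℝ≥0 := if v = m + 1 then s else v with he₂
  have hvlt (hne : v ≠ m + 1) : v ∈ Set.Ico s ((m : ℝ≥0) + 1) := ⟨hsv.le, lt_of_le_of_ne hv hne⟩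
  refine Model.indepFun_incr (m₁ := sigma Z.X (Set.Icc m s)) (m₂ := sigma Z.X (Set.Ico s (m + 1)))
    (e₁ := s) (e₂ := e₂) (f := fun ω => w (Z.X v ω))
    (HasRewardLaw_cond h.law h.state.measurable h.poisson.measurable
      (le_sup_left (a := sigma Z.X Set.univ) (b := sigma Z.N Set.univ) _ hA)) hZ
    (h.poisson.cond h.state.measurable hA) h.a1 h.schedule h.not_nat
    (sigma_mono (Set.subset_univ _)) (sigma_mono (Set.subset_univ _)) (h.state.indep_cond hms hs1 x hx)
    ?_ (Or.inl hsv) (Or.inl rfl) ?_ (Eventually.of_forall fun _ => Or.inl rfl) ?_ ?_ ?_ ?_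
  · rcases lt_or_eq_of_le hms with hlt | heq
    · exact Or.inl hlt
    · exact Or.inr ⟨heq, heq.symm⟩
  · by_cases hv1 : v = m + 1
    · exact Or.inr ⟨m + 1, by rw [hv1]; push_cast; rfl⟩
    · left; rw [he₂, if_neg hv1]
  · exact hac.ae_le ((h.ae_exists_lt_eq (zero_le.trans_lt hsv)).mono fun ω hω => Or.inr hω)
  · exact fun t => measurable_sigma
      (clampTime_mem (I := Set.Icc (m : ℝ≥0) s) ⟨le_rfl, hms⟩ Set.Ico_subset_Icc_self ⟨hms, le_rfl⟩ t)
  · refine fun t => measurable_sigma (clampTime_mem hsmem hsub ?_ t)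
    rw [he₂]
    split_ifs with hv1
    · exact hsmem
    · exact hvlt hv1
  · by_cases hv1 : v = m + 1
    · rw [hw hv1]; exact measurable_const
    · exact (measurable_of_finite w).comp (measurable_sigma (hvlt hv1))

/-- Markov property between two resetting times. -/
theorem exists_transition (m : ℕ) : ∃ P, IsTransition E.Q P ∧
    (∀ u : ℝ≥0, m ≤ u → u < m + 1 → ∀ y,
      Pr.real (Z.X u ⁻¹' {y}) = ∑ x, (μ m x).toReal * P m u x y) ∧
    ∀ u v : ℝ≥0, m ≤ u → u ≤ v → v < m + 1 → ∀ A, MeasurableSet[sigma Z.X (Set.Icc m u)] A → ∀ y z,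
      Pr.real (A ∩ (Z.X u ⁻¹' {y} ∩ Z.X v ⁻¹' {z})) = Pr.real (A ∩ Z.X u ⁻¹' {y}) * P u v y z := by
  obtain ⟨P, hP, hlaw⟩ := (h.state.markov m).exists_forall_nat
  have hXm := h.state.measurable
  have hsum (B : Set Ω) (hB : MeasurableSet B) : ∑ x, Pr.real (Z.X m ⁻¹' {x} ∩ B) = Pr.real B := by
    have := measureReal_biUnion_finset (μ := Pr) (s := (Finset.univ : Finset S))
      (f := fun v => Z.X m ⁻¹' {v} ∩ B) (fun v _ v' _ hvv => by
        refine Set.disjoint_left.2 fun ω h1 h2 => hvv ?_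
        have e1 : Z.X m ω = v := h1.1
        have e2 : Z.X m ω = v' := h2.1
        rw [← e1, ← e2]) (fun v _ => (hXm m (measurableSet_singleton v)).inter hB)
    rw [← this]
    congr 1
    ext ω; simp
  have hS (u : ℝ≥0) (y : S) : MeasurableSet (Z.X u ⁻¹' {y}) := hXm u (measurableSet_singleton y)
  have l1 (u : ℝ≥0) (hu : m ≤ u) (hu1 : u < m + 1) (y : S) :
      Pr.real (Z.X u ⁻¹' {y}) = ∑ x, (μ m x).toReal * P m u x y := by
    rw [← hsum _ (hS u y)]
    refine Finset.sum_congr rfl fun x _ => ?_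
    have := hlaw 1 (fun j => if j = 0 then m else u) (fun j => if j = 0 then x else y)
      (monotone_nat_of_le_succ fun j => by by_cases hj : j = 0 <;> simp [hj, hu]) (by simp) (by simpa using hu1)
    simp only [Finset.range_one, Finset.prod_singleton, if_true, zero_add, one_ne_zero, if_false] at this
    rw [← this]
    congr 1
    ext ω
    simp only [Set.mem_inter_iff, Set.mem_preimage, Set.mem_singleton_iff, Set.mem_ofPred_eq]
    constructor
    · rintro ⟨a1, a2⟩ j hj
      interval_cases j <;> simpa
    · intro hj
      exact ⟨by simpa using hj 0 (by omega), by simpa using hj 1 le_rfl⟩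
  have l2 (u v : ℝ≥0) (hu : m ≤ u) (huv : u ≤ v) (hv1 : v < m + 1) (y z : S) :
      Pr.real (Z.X u ⁻¹' {y} ∩ Z.X v ⁻¹' {z}) = Pr.real (Z.X u ⁻¹' {y}) * P u v y z := by
    rw [l1 u hu (huv.trans_lt hv1), ← hsum _ ((hS u y).inter (hS v z)), Finset.sum_mul]
    refine Finset.sum_congr rfl fun x _ => ?_
    have := hlaw 2 (fun j => if j = 0 then m else if j = 1 then u else v)
      (fun j => if j = 0 then x else if j = 1 then y else z)
      (monotone_nat_of_le_succ fun j => by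
        by_cases hj : j = 0
        · simp [hj, hu]
        · by_cases hj1 : j = 1 <;> simp [hj, hj1, huv]) (by simp) (by simpa using hv1)
    simp only [Finset.prod_range_succ, Finset.range_zero, Finset.prod_empty, one_mul, if_true, zero_add,
      one_ne_zero, if_false, show (1 + 1 : ℕ) ≠ 0 by omega, show (1 + 1 : ℕ) ≠ 1 by omega] at this
    rw [mul_assoc, ← this]
    congr 1
    ext ω
    simp only [Set.mem_inter_iff, Set.mem_preimage, Set.mem_singleton_iff, Set.mem_ofPred_eq]
    constructor
    · rintro ⟨a1, a2, a3⟩ j hj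
      interval_cases j <;> simpa
    · intro hj
      exact ⟨by simpa using hj 0 (by omega), by simpa using hj 1 (by omega), by simpa using hj 2 le_rfl⟩
  refine ⟨P, hP, l1, fun u v hu huv hv1 A hA y z => ?_⟩
  have hA0 : MeasurableSet A := sigma_le (fun t _ => hXm t) _ hA
  by_cases hy : Pr (Z.X u ⁻¹' {y}) = 0
  · have h1 : Pr.real (A ∩ (Z.X u ⁻¹' {y} ∩ Z.X v ⁻¹' {z})) = 0 := by
      rw [measureReal_eq_zero_iff]
      exact measure_mono_null (fun ω hω => hω.2.1) hy
    have h2 : Pr.real (A ∩ Z.X u ⁻¹' {y}) = 0 := by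
      rw [measureReal_eq_zero_iff]
      exact measure_mono_null (fun ω hω => hω.2) hy
    rw [h1, h2, zero_mul]
  have hI := h.state.indep_cond hu (huv.trans_lt hv1) y hy
  have h1 := ((Indep_iff _ _ _).1 hI A (Z.X v ⁻¹' {z}) hA
    (measurable_sigma (X := Z.X) (I := Set.Ico u ((m : ℝ≥0) + 1)) ⟨huv, hv1⟩ (measurableSet_singleton z)))
  have h2 := congrArg ENNReal.toReal h1
  rw [ENNReal.toReal_mul] at h2
  change (Pr[|Z.X u ⁻¹' {y}]).real _ = (Pr[|Z.X u ⁻¹' {y}]).real _ * (Pr[|Z.X u ⁻¹' {y}]).real _ at h2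
  rw [real_cond_apply (hS u y), real_cond_apply (hS u y), real_cond_apply (hS u y),
    l2 u v hu huv hv1] at h2
  have hy' : Pr.real (Z.X u ⁻¹' {y}) ≠ 0 := by rwa [measureReal_ne_zero_iff]
  field_simp at h2
  rw [Set.inter_comm A (Z.X u ⁻¹' {y}), ← h2]
  congr 1
  ext ω; simp; tauto

end Model.IsResetting

end

/-! ### Exponential moments of the number of jumps and external events. -/

section

/-- This says that `E[g | m] ≤ c` may be used under the integral: on `m`, the measure with density
`g` is at most `c P`. -/
lemma lintegral_mul_le_of_forall {Ω : Type*} {m m0 : MeasurableSpace Ω} {P : Measure Ω}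
    [IsFiniteMeasure P] (hm : m ≤ m0) {g : Ω → ENNReal} (hg : Measurable g) {c : ENNReal}
    (h : ∀ A, MeasurableSet[m] A → ∫⁻ ω in A, g ω ∂P ≤ c * P A) {f : Ω → ENNReal}
    (hf : Measurable[m] f) : ∫⁻ ω, f ω * g ω ∂P ≤ c * ∫⁻ ω, f ω ∂P := by
  have h1 : (P.withDensity g).trim hm ≤ c • P.trim hm := by
    refine Measure.le_iff.2 fun A hA => ?_
    rw [trim_measurableSet_eq hm hA, withDensity_apply _ (hm _ hA), Measure.smul_apply,
      trim_measurableSet_eq hm hA]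
    exact h A hA
  calc ∫⁻ ω, f ω * g ω ∂P = ∫⁻ ω, f ω ∂(P.withDensity g) := by
        rw [lintegral_withDensity_eq_lintegral_mul _ hg (hf.mono hm le_rfl)]
        refine lintegral_congr fun ω => ?_
        rw [Pi.mul_apply, mul_comm]
    _ = ∫⁻ ω, f ω ∂((P.withDensity g).trim hm) := (lintegral_trim hm hf).symm
    _ ≤ ∫⁻ ω, f ω ∂(c • P.trim hm) := lintegral_mono' h1 le_rfl
    _ = c * ∫⁻ ω, f ω ∂P := by rw [lintegral_smul_measure, lintegral_trim hm hf, smul_eq_mul]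

lemma sum_real_inter_fiber {Ω S : Type*} [Fintype S] [MeasurableSpace S] [MeasurableSingletonClass S]
    [MeasurableSpace Ω] {P : Measure Ω} [IsFiniteMeasure P] {V : Ω → S} (hV : Measurable V) {B : Set Ω}
    (hB : MeasurableSet B) : ∑ x, P.real (B ∩ V ⁻¹' {x}) = P.real B := by
  have := measureReal_biUnion_finset (μ := P) (s := (Finset.univ : Finset S))
    (f := fun v => B ∩ V ⁻¹' {v}) (fun v _ v' _ hvv => by
      refine Set.disjoint_left.2 fun ω h1 h2 => hvv ?_
      have e1 : V ω = v := h1.2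
      have e2 : V ω = v' := h2.2
      rw [← e1, ← e2]) (fun v _ => hB.inter (hV (measurableSet_singleton v)))
  rw [← this]
  congr 1
  ext ω; simp

variable {S Ω : Type*} [Fintype S] [DecidableEq S] [TopologicalSpace S] [DiscreteTopology S]
  [MeasurableSpace S] [DiscreteMeasurableSpace S] [m0 : MeasurableSpace Ω]
  {E : Data S} {μ : ℕ → PMF S} {Z : Model S Ω} {Pr : Measure Ω} [IsProbabilityMeasure Pr] {C : ℝ}

namespace Model.IsResetting

variable (h : Z.IsResetting E μ Pr) (hC : E.BoundedBy C) {m : ℕ}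
include h hC

/-- Given the past and the state `y` at `u`, the state at `v` differs with probability `1 -
P(u,v)(y,y) ≤ C (v - u)`. -/
lemma real_inter_ne_le {u v : ℝ≥0} (hu : m ≤ u) (huv : u ≤ v) (hv : v < m + 1) {B : Set Ω}
    (hB : MeasurableSet[sigma Z.X (Set.Icc m u)] B) :
    Pr.real (B ∩ {ω | Z.X u ω ≠ Z.X v ω}) ≤ C * ((v : ℝ) - u) * Pr.real B := by
  obtain ⟨P, hP, -, hlaw⟩ := h.exists_transition m
  have hXm := h.state.measurable
  have hB0 : MeasurableSet B := sigma_le (fun t _ => hXm t) _ hB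
  have hS (u : ℝ≥0) (y : S) : MeasurableSet (Z.X u ⁻¹' {y}) := hXm u (measurableSet_singleton y)
  have hne : MeasurableSet {ω | Z.X u ω ≠ Z.X v ω} := (measurableSet_eq_fun (hXm u) (hXm v)).compl
  rw [← sum_real_inter_fiber (hXm u) (hB0.inter hne), ← sum_real_inter_fiber (hXm u) hB0, Finset.mul_sum]
  refine Finset.sum_le_sum fun y _ => ?_
  have e1 : B ∩ {ω | Z.X u ω ≠ Z.X v ω} ∩ Z.X u ⁻¹' {y}
      = (B ∩ Z.X u ⁻¹' {y}) \ (B ∩ (Z.X u ⁻¹' {y} ∩ Z.X v ⁻¹' {y})) := by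
    ext ω
    simp only [Set.mem_inter_iff, Set.mem_preimage, Set.mem_singleton_iff, Set.mem_sdiff,
      Set.mem_ofPred_eq]
    constructor
    · rintro ⟨⟨a, b⟩, c⟩
      exact ⟨⟨a, c⟩, fun hh => b (by rw [c, hh.2.2])⟩
    · rintro ⟨⟨a, b⟩, c⟩
      exact ⟨⟨a, fun hh => c ⟨a, b, by rw [← hh, b]⟩⟩, b⟩
  rw [e1, measureReal_sdiff (by intro ω hω; exact ⟨hω.1, hω.2.1⟩)
    (hB0.inter ((hS u y).inter (hS v y))), hlaw u v hu huv hv B hB y y]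
  have := hP.one_sub_le hC.rate h.a1.rate huv y h.rate
  nlinarith [measureReal_nonneg (μ := Pr) (s := B ∩ Z.X u ⁻¹' {y})]

/-- Inside the cycle, given the past, a cell shows a jump with probability at most `C (v - u)`. A
cell that ends at the resetting time never shows one, by definition of `cellJump`. -/
lemma lintegral_mul_pow_cellJump_le {u v : ℝ≥0} (hu : m ≤ u) (huv : u < v) (hv : v ≤ m + 1) (ζ : ℝ≥0)
    {f : Ω → ENNReal} (hf : Measurable[sigma Z.X (Set.Icc m u)] f) :
    ∫⁻ ω, f ω * (1 + ζ : ENNReal) ^ cellJump (fun t => Z.X t ω) u v ∂Pr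
      ≤ ENNReal.ofReal (1 + ζ * (C * ((v : ℝ) - u))) * ∫⁻ ω, f ω ∂Pr := by
  have hXm := h.state.measurable
  have hle : sigma Z.X (Set.Icc (m : ℝ≥0) u) ≤ m0 := sigma_le fun t _ => hXm t
  have hnn : 0 ≤ C * ((v : ℝ) - u) := mul_nonneg hC.pos.le (sub_nonneg.2 (NNReal.coe_le_coe.2 huv.le))
  have hmeas : Measurable fun ω => (1 + ζ : ENNReal) ^ cellJump (fun t => Z.X t ω) u v :=
    (measurable_of_countable fun k : ℕ => (1 + ζ : ENNReal) ^ k).comp (measurable_cellJump hXm u v)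
  refine lintegral_mul_le_of_forall hle hmeas (fun A hA => ?_) hf
  have hA0 := hle _ hA
  rcases lt_or_eq_of_le hv with hv1 | hv1
  · have hne : MeasurableSet {ω | Z.X u ω ≠ Z.X v ω} := (measurableSet_eq_fun (hXm u) (hXm v)).compl
    have hpt (ω : Ω) : (1 + ζ : ENNReal) ^ cellJump (fun t => Z.X t ω) u v
        ≤ 1 + ζ * {ω | Z.X u ω ≠ Z.X v ω}.indicator (fun _ => 1) ω := by
      unfold cellJump
      split_ifs with hc
      · rw [pow_one, Set.indicator_of_mem (by exact hc.1), mul_one]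
      · rw [pow_zero]; exact le_self_add
    calc _ ≤ ∫⁻ ω in A, (1 + ζ * {ω | Z.X u ω ≠ Z.X v ω}.indicator (fun _ => 1) ω) ∂Pr :=
          lintegral_mono hpt
      _ = Pr A + ζ * Pr (A ∩ {ω | Z.X u ω ≠ Z.X v ω}) := by
          rw [lintegral_add_left measurable_const, lintegral_const_mul _ (measurable_const.indicator hne),
            lintegral_indicator_const hne, Measure.restrict_apply hne, Set.inter_comm A]
          simp
      _ ≤ Pr A + ζ * (ENNReal.ofReal (C * ((v : ℝ) - u)) * Pr A) := by
          gcongr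
          rw [← ofReal_measureReal (s := A ∩ _), ← ofReal_measureReal (s := A), ← ENNReal.ofReal_mul hnn]
          exact ENNReal.ofReal_le_ofReal (h.real_inter_ne_le hC hu huv.le hv1 hA)
      _ = _ := by
          rw [ENNReal.ofReal_add zero_le_one (mul_nonneg ζ.coe_nonneg hnn), ENNReal.ofReal_mul ζ.coe_nonneg,
            ENNReal.ofReal_one, ENNReal.ofReal_coe_nnreal]
          ring
  · have hcell (ω : Ω) : cellJump (fun t => Z.X t ω) u v = 0 := by
      unfold cellJump
      rw [if_neg]
      intro hc
      exact hc.2 (m + 1) ⟨by push_cast; rw [← hv1]; exact huv, by push_cast; exact hv1.ge⟩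
    simp only [hcell, pow_zero, lintegral_const, one_mul, Measure.restrict_apply MeasurableSet.univ,
      Set.univ_inter]
    refine le_mul_of_one_le_left zero_le ?_
    rw [← ENNReal.ofReal_one]
    exact ENNReal.ofReal_le_ofReal (by linarith [mul_nonneg ζ.coe_nonneg hnn])

lemma setLIntegral_prod_cellJump_le {u : ℕ → ℝ≥0} (hu : StrictMono u) (h0 : m ≤ u 0) (ζ : ℝ≥0)
    {A : Set Ω} (hA : MeasurableSet[sigma Z.X (Set.Icc m (u 0))] A) (M : ℕ) (hM : u M ≤ m + 1) :
    ∫⁻ ω in A, ∏ j ∈ Finset.range M, (1 + ζ : ENNReal) ^ cellJump (fun t => Z.X t ω) (u j) (u (j + 1)) ∂Pr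
      ≤ ENNReal.ofReal (Real.exp (ζ * (C * ((u M : ℝ) - u 0)))) * Pr A := by
  have hXm := h.state.measurable
  have hA0 : MeasurableSet A := sigma_le (fun t _ => hXm t) _ hA
  induction M with
  | zero => simp
  | succ M ih =>
    have hlt : u M < u (M + 1) := hu (Nat.lt_succ_self M)
    have hu0 (j : ℕ) : u 0 ≤ u j := hu.monotone (Nat.zero_le j)
    set f : Ω → ENNReal := A.indicator fun ω =>
      ∏ j ∈ Finset.range M, (1 + ζ : ENNReal) ^ cellJump (fun t => Z.X t ω) (u j) (u (j + 1)) with hf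
    have hmem (j : ℕ) (hj : j ≤ M) : Measurable[sigma Z.X (Set.Icc m (u M))] (Z.X (u j)) :=
      measurable_sigma ⟨h0.trans (hu0 j), hu.monotone hj⟩
    have hcell (j : ℕ) (hj : j < M) : Measurable[sigma Z.X (Set.Icc m (u M))]
        fun ω => cellJump (fun t => Z.X t ω) (u j) (u (j + 1)) := by
      classical
      have : Measurable fun q : S × S =>
          if q.1 ≠ q.2 ∧ ∀ n : ℕ, (n : ℝ≥0) ∉ Set.Ioc (u j) (u (j + 1)) then 1 else 0 :=
        measurable_of_countable _
      convert this.comp ((hmem j hj.le).prodMk (hmem (j + 1) hj)) using 2 with ω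
      simp only [cellJump, Function.comp_apply]
      congr
    have hfm : Measurable[sigma Z.X (Set.Icc m (u M))] f := by
      refine Measurable.indicator ?_ (sigma_mono (Set.Icc_subset_Icc_right (hu0 M)) _ hA)
      refine @Finset.measurable_fun_prod _ _ _ _ _ _ (sigma Z.X (Set.Icc m (u M))) _ _ fun j hj => ?_
      exact (measurable_of_countable fun k : ℕ => (1 + ζ : ENNReal) ^ k).comp
        (hcell j (Finset.mem_range.1 hj))
    have step := h.lintegral_mul_pow_cellJump_le hC (h0.trans (hu0 M)) hlt hM ζ hfm
    have ih' := ih (hlt.le.trans hM)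
    rw [← lintegral_indicator hA0] at ih' ⊢
    calc _ = ∫⁻ ω, f ω * (1 + ζ : ENNReal) ^ cellJump (fun t => Z.X t ω) (u M) (u (M + 1)) ∂Pr := by
          refine lintegral_congr fun ω => ?_
          by_cases hω : ω ∈ A
          · simp only [hf, Set.indicator_of_mem hω, Finset.prod_range_succ]
          · simp [hf, Set.indicator_of_notMem hω]
      _ ≤ _ := step
      _ ≤ ENNReal.ofReal (1 + ζ * (C * ((u (M + 1) : ℝ) - u M)))
          * (ENNReal.ofReal (Real.exp (ζ * (C * ((u M : ℝ) - u 0)))) * Pr A) := by gcongr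
      _ ≤ ENNReal.ofReal (Real.exp (ζ * (C * ((u (M + 1) : ℝ) - u M))))
          * (ENNReal.ofReal (Real.exp (ζ * (C * ((u M : ℝ) - u 0)))) * Pr A) := by
          gcongr
          linarith [Real.add_one_le_exp (ζ * (C * ((u (M + 1) : ℝ) - u M)))]
      _ = _ := by
          rw [← mul_assoc, ← ENNReal.ofReal_mul (Real.exp_nonneg _), ← Real.exp_add]
          congr 3
          ring

/-- Fatou's lemma along uniform grids, on which the detected jumps are eventually all the jumps of
the path. -/
lemma setLIntegral_pow_J_le {s v : ℝ≥0} (hs : m ≤ s) (hsv : s < v) (hv : v ≤ m + 1) (ζ : ℝ≥0)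
    {A : Set Ω} (hA : MeasurableSet[sigma Z.X (Set.Icc m s)] A) :
    ∫⁻ ω in A, (1 + ζ : ENNReal) ^ (Z.J v ω - Z.J s ω) ∂Pr
      ≤ ENNReal.ofReal (Real.exp (ζ * (C * ((v : ℝ) - s)))) * Pr A := by
  have hXm := h.state.measurable
  set u : ℕ → ℕ → ℝ≥0 := fun n j => s + (v - s) * (j / (n + 1 : ℕ)) with hu
  have hvs : 0 < v - s := tsub_pos_of_lt hsv
  have humono (n : ℕ) : StrictMono (u n) := fun i j hij => by
    simp only [hu]
    have : (i : ℝ≥0) < j := by exact_mod_cast hij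
    have h2 : (0 : ℝ≥0) < (n + 1 : ℕ) := by positivity
    gcongr
  have hu0 (n : ℕ) : u n 0 = s := by simp [hu]
  have hun (n : ℕ) : u n (n + 1) = v := by
    simp only [hu]
    rw [div_self (by positivity), mul_one, add_tsub_cancel_of_le hsv.le]
  set F : ℕ → Ω → ENNReal := fun n ω => ∏ j ∈ Finset.range (n + 1),
    (1 + ζ : ENNReal) ^ cellJump (fun t => Z.X t ω) (u n j) (u n (j + 1)) with hF
  have hFm (n : ℕ) : Measurable (F n) := Finset.measurable_fun_prod _ fun j _ =>
    (measurable_of_countable fun k : ℕ => (1 + ζ : ENNReal) ^ k).comp (measurable_cellJump hXm _ _)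
  have hlim (ω : Ω) : (1 + ζ : ENNReal) ^ (Z.J v ω - Z.J s ω) = liminf (fun n => F n ω) atTop := by
    have hev := (h.state.cadlag ω).eventually_sum_cellJump hsv.le (p := fun n => n + 1)
      (tendsto_add_atTop_nat 1)
    refine (Tendsto.liminf_eq (tendsto_nhds_of_eventually_eq ?_)).symm
    filter_upwards [hev] with n hn
    simp only [hF]
    rw [Finset.prod_pow_eq_pow_sum]
    congr 1
    have hn' : Z.J s ω + ∑ j ∈ Finset.range (n + 1), cellJump (fun t => Z.X t ω) (u n j) (u n (j + 1))
      = Z.J v ω := hn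
    omega
  simp only [hlim]
  refine (lintegral_liminf_le hFm).trans ?_
  refine liminf_le_of_frequently_le' (Frequently.of_forall fun n => ?_)
  have := h.setLIntegral_prod_cellJump_le hC (humono n) (by rw [hu0]; exact hs) ζ
    (by rw [hu0]; exact hA) (n + 1) (by rw [hun]; exact hv)
  rwa [hun, hu0] at this

/-- Given `X`, the increment is Poisson with a parameter at most `C (v - s)`, and a Poisson variable
of parameter `λ` has `E (1 + ζ)^n = exp (ζ λ)`. -/
lemma setLIntegral_pow_N_le {s v : ℝ≥0} (hsv : s ≤ v) (ζ : ℝ≥0)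
    {A : Set Ω} (hA : MeasurableSet[sigma Z.X Set.univ] A) :
    ∫⁻ ω in A, (1 + ζ : ENNReal) ^ (Z.N v ω - Z.N s ω) ∂Pr
      ≤ ENNReal.ofReal (Real.exp (ζ * (C * ((v : ℝ) - s)))) * Pr A := by
  have hA0 : MeasurableSet A := sigma_le (fun t _ => h.state.measurable t) _ hA
  have hNm : Measurable fun ω => Z.N v ω - Z.N s ω := (h.poisson.measurable v).sub (h.poisson.measurable s)
  have hsv' : (s : ℝ) ≤ v := NNReal.coe_le_coe.2 hsv
  have hlaw (k : ℕ) : Pr (A ∩ {ω | Z.N v ω - Z.N s ω = k})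
      = ENNReal.ofReal (∫ ω in A, poissonWeight E.β Z.X s v k ω ∂Pr) := by
    have l := h.poisson.law_nat hA 1 (u := fun j => if j = 0 then s else v)
      (monotone_nat_of_le_succ fun j => by by_cases hj : j = 0 <;> simp [hj, hsv]) (fun _ => k)
    simp only [Nat.lt_one_iff, forall_eq, zero_add, one_ne_zero, if_true, if_false,
      Finset.range_one, Finset.prod_singleton] at l
    rw [← l, ofReal_measureReal]
    congr 1
    ext ω
    have := h.poisson.mono ω hsv
    simp only [Set.mem_inter_iff, Set.mem_ofPred_eq, and_congr_right_iff]
    intro _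
    simp only at this
    omega
  have hpm (k : ℕ) : Measurable (poissonWeight E.β Z.X s v k) :=
    measurable_poissonWeight (h.isRegular.measurable_integral h.a1.intensity s v) k
  have hpi (k : ℕ) : ENNReal.ofReal (∫ ω in A, poissonWeight E.β Z.X s v k ω ∂Pr)
      = ∫⁻ ω in A, ENNReal.ofReal (poissonWeight E.β Z.X s v k ω) ∂Pr := by
    refine ofReal_integral_eq_lintegral_ofReal ?_ (Eventually.of_forall fun ω => poissonWeight_nonneg _ _ _ _)
    refine Integrable.of_bound (hpm k).aestronglyMeasurable 1 (Eventually.of_forall fun ω => ?_)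
    rw [Real.norm_eq_abs, abs_of_nonneg (poissonWeight_nonneg _ _ _ _)]
    exact poissonWeight_le_one _ _ _ _
  have e1 : ∫⁻ ω in A, (1 + ζ : ENNReal) ^ (Z.N v ω - Z.N s ω) ∂Pr
      = ∑' k : ℕ, (1 + ζ : ENNReal) ^ k * Pr (A ∩ {ω | Z.N v ω - Z.N s ω = k}) := by
    have : ∫⁻ ω in A, (1 + ζ : ENNReal) ^ (Z.N v ω - Z.N s ω) ∂Pr
        = ∫⁻ k, (1 + ζ : ENNReal) ^ k ∂((Pr.restrict A).map fun ω => Z.N v ω - Z.N s ω) :=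
      (lintegral_map (measurable_of_countable _) hNm).symm
    rw [this, lintegral_countable']
    refine tsum_congr fun k => ?_
    rw [Measure.map_apply hNm (measurableSet_singleton k),
      Measure.restrict_apply (hNm (measurableSet_singleton k)), Set.inter_comm]
    rfl
  rw [e1]
  simp only [hlaw, hpi]
  calc _ = ∑' k : ℕ, ∫⁻ ω in A, (1 + ζ : ENNReal) ^ k * ENNReal.ofReal (poissonWeight E.β Z.X s v k ω) ∂Pr :=
        tsum_congr fun k => (lintegral_const_mul _ (hpm k).ennreal_ofReal).symm
    _ = ∫⁻ ω in A, ∑' k : ℕ, (1 + ζ : ENNReal) ^ k * ENNReal.ofReal (poissonWeight E.β Z.X s v k ω) ∂Pr :=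
        (lintegral_tsum fun k => ((hpm k).ennreal_ofReal.const_mul _).aemeasurable).symm
    _ ≤ ∫⁻ _ in A, ENNReal.ofReal (Real.exp (ζ * (C * ((v : ℝ) - s)))) ∂Pr := by
        refine lintegral_mono fun ω => ?_
        set lam : ℝ≥0 := (∫ t in (s : ℝ)..v, E.β t.toNNReal (Z.X t.toNNReal ω)).toNNReal with hlam
        have hle : (lam : ℝ) ≤ C * (v - s) := by
          rw [hlam, Real.coe_toNNReal', max_le_iff]
          refine ⟨?_, mul_nonneg hC.pos.le (sub_nonneg.2 hsv')⟩
          have := intervalIntegral.norm_integral_le_of_norm_le_const (a := (s : ℝ)) (b := v) (C := C)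
            (f := fun t => E.β t.toNNReal (Z.X t.toNNReal ω)) fun t _ => by
              rw [Real.norm_eq_abs, abs_of_nonneg (hC.intensity_nonneg _ _)]; exact hC.intensity _ _
          rw [abs_of_nonneg (sub_nonneg.2 hsv')] at this
          exact (le_abs_self _).trans this
        have hterm (k : ℕ) : (1 + ζ : ENNReal) ^ k * ENNReal.ofReal (poissonWeight E.β Z.X s v k ω)
            = ENNReal.ofReal (Real.exp (-lam) * (((1 + ζ) * lam) ^ k / (k.factorial : ℝ))) := by
          have e2 : (1 + ζ : ENNReal) = ENNReal.ofReal (1 + ζ) := by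
            rw [ENNReal.ofReal_add zero_le_one ζ.coe_nonneg, ENNReal.ofReal_one, ENNReal.ofReal_coe_nnreal]
          rw [e2, ← ENNReal.ofReal_pow (by positivity), ← ENNReal.ofReal_mul (by positivity)]
          congr 1
          unfold poissonWeight
          rw [poissonMeasure_real_singleton, mul_pow]
          ring
        simp only [hterm]
        have hs := (NormedSpace.expSeries_div_hasSum_exp (𝔸 := ℝ) ((1 + ζ) * lam)).mul_left (Real.exp (-lam))
        rw [← Real.exp_eq_exp_ℝ] at hs
        rw [← ENNReal.ofReal_tsum_of_nonneg (fun k => by positivity) hs.summable, hs.tsum_eq, ← Real.exp_add]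
        refine ENNReal.ofReal_le_ofReal (Real.exp_le_exp.2 ?_)
        nlinarith [mul_le_mul_of_nonneg_left hle ζ.coe_nonneg]
    _ = _ := by simp

/-- Exponential moment of the number of random events in a time window. -/
theorem setLIntegral_pow_count_le {s v : ℝ≥0} (hs : m ≤ s) (hsv : s < v) (hv : v ≤ m + 1) (ζ : ℝ≥0)
    {A : Set Ω} (hA : MeasurableSet[sigma Z.X (Set.Icc m s)] A) :
    ∫⁻ ω in A, (1 + ζ : ENNReal) ^ (Z.J v ω - Z.J s ω + (Z.N v ω - Z.N s ω)) ∂Pr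
      ≤ ENNReal.ofReal (Real.exp (2 * ζ * (C * ((v : ℝ) - s)))) * Pr A := by
  have hXm := h.state.measurable
  have hle : sigma Z.X Set.univ ≤ m0 := sigma_le fun t _ => hXm t
  have hAu : MeasurableSet[sigma Z.X Set.univ] A := sigma_mono (Set.subset_univ _) _ hA
  have hJ (t : ℝ≥0) : Measurable[sigma Z.X Set.univ] (Z.J t) :=
    @measurable_jumpCount Ω S (sigma Z.X Set.univ) _ _ _ _ _ Z.X h.state.cadlag
      (fun t => measurable_sigma (Set.mem_univ t)) t
  have hf : Measurable[sigma Z.X Set.univ]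
      (A.indicator fun ω => (1 + ζ : ENNReal) ^ (Z.J v ω - Z.J s ω)) :=
    ((measurable_of_countable fun k : ℕ => (1 + ζ : ENNReal) ^ k).comp ((hJ v).sub (hJ s))).indicator hAu
  have key := lintegral_mul_le_of_forall hle
    ((measurable_of_countable fun k : ℕ => (1 + ζ : ENNReal) ^ k).comp
      ((h.poisson.measurable v).sub (h.poisson.measurable s)))
    (fun B hB => h.setLIntegral_pow_N_le hC hsv.le ζ hB) hf
  rw [lintegral_indicator (hle _ hAu)] at key
  rw [← lintegral_indicator (hle _ hAu)]
  calc _ = ∫⁻ ω, A.indicator (fun ω => (1 + ζ : ENNReal) ^ (Z.J v ω - Z.J s ω)) ω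
        * (1 + ζ : ENNReal) ^ (Z.N v ω - Z.N s ω) ∂Pr := by
        refine lintegral_congr fun ω => ?_
        by_cases hω : ω ∈ A
        · simp only [Set.indicator_of_mem hω, pow_add]
        · simp [Set.indicator_of_notMem hω]
    _ ≤ _ := key
    _ ≤ ENNReal.ofReal (Real.exp (ζ * (C * ((v : ℝ) - s)))) *
        (ENNReal.ofReal (Real.exp (ζ * (C * ((v : ℝ) - s)))) * Pr A) := by
        gcongr
        exact h.setLIntegral_pow_J_le hC hs hsv hv ζ hA
    _ = _ := by
        rw [← mul_assoc, ← ENNReal.ofReal_mul (Real.exp_nonneg _), ← Real.exp_add]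
        congr 3
        ring

end Model.IsResetting

end

/-! ### Fourth moments of the reward of one cycle. -/

section

lemma pow_four_le_two_pow (n : ℕ) : n ^ 4 ≤ 32 * 2 ^ n := by
  rcases Nat.lt_or_ge n 6 with h | h
  · interval_cases n <;> norm_num
  · induction n, h using Nat.le_induction with
    | base => norm_num
    | succ n hn ih =>
      rw [pow_succ 2 n]
      have : (n + 1) ^ 4 ≤ 2 * n ^ 4 := by
        -- For `n ≥ 6` one has `(n + 1)/n ≤ 7/6`, and `(7/6)^4 < 2`.
        have : (6 * (n + 1)) ^ 4 ≤ (7 * n) ^ 4 := Nat.pow_le_pow_left (by omega) 4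
        rw [mul_pow, mul_pow] at this
        omega
      omega

/-- Turns exponential moments into fourth moments. When `ζ` is the inverse length of a window, the
factor `ζ ^ j` produces the `j`-th power of that length on the event of at least `j` events. -/
lemma mul_pow_four_le {ζ : ℝ≥0} (hζ : 1 ≤ ζ) {n j : ℕ} (hj : j ≤ n) (hj2 : j ≤ 2) :
    ζ ^ j * (n : ℝ≥0) ^ 4 ≤ 128 * (1 + ζ) ^ n := by
  have h1 : (n : ℝ≥0) ^ 4 ≤ 32 * 2 ^ n := by exact_mod_cast pow_four_le_two_pow n
  obtain ⟨d, rfl⟩ := Nat.exists_eq_add_of_le hj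
  have h2 : (2 : ℝ≥0) ≤ 1 + ζ := by rw [← one_add_one_eq_two]; gcongr
  calc ζ ^ j * ((j + d : ℕ) : ℝ≥0) ^ 4 ≤ (1 + ζ) ^ j * (32 * 2 ^ (j + d)) := by
        gcongr; exact le_add_self
    _ = 32 * 2 ^ j * ((1 + ζ) ^ j * 2 ^ d) := by ring
    _ ≤ 32 * 2 ^ 2 * ((1 + ζ) ^ j * (1 + ζ) ^ d) := by
        gcongr; norm_num
    _ = 128 * (1 + ζ) ^ (j + d) := by rw [← pow_add]; norm_num

variable {S Ω : Type*} [Fintype S] [DecidableEq S] [TopologicalSpace S] [DiscreteTopology S]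
  [MeasurableSpace S] [DiscreteMeasurableSpace S] [m0 : MeasurableSpace Ω]
  {E : Data S} {μ : ℕ → PMF S} {Z : Model S Ω} {Pr : Measure Ω} {C : ℝ}

/-- With gaps of at least `g`, a unit interval contains at most `1 + 1/g` scheduled times. -/
lemma Data.exists_scheduleCount_le (hτ : IsSchedule E.τ) (h5 : E.A5) : ∃ K₁ : ℝ, 0 ≤ K₁ ∧
    ∀ m : ℕ, (scheduleCount E.τ (m + 1) : ℝ) ≤ scheduleCount E.τ m + K₁ := by
  set g := ⨅ i : ℕ, ((E.τ (i + 1) : ℝ) - E.τ i) with hg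
  have hg0 : 0 < g := h5
  have hle (i : ℕ) : g ≤ (E.τ (i + 1) : ℝ) - E.τ i := ciInf_le ⟨0, by
    rintro _ ⟨j, rfl⟩
    exact sub_nonneg.2 (NNReal.coe_le_coe.2 (hτ.2.1.monotone (Nat.le_succ j)))⟩ i
  have hadd (i d : ℕ) : d * g ≤ (E.τ (i + d) : ℝ) - E.τ i := by
    induction d with
    | zero => simp
    | succ d ih =>
      have := hle (i + d)
      push_cast
      rw [← add_assoc]
      linarith
  refine ⟨1 + 1 / g, by positivity, fun m => ?_⟩
  have hmono : scheduleCount E.τ m ≤ scheduleCount E.τ (m + 1) := hτ.scheduleCount_mono (by simp)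
  rcases hmono.eq_or_lt with he | hlt
  · rw [← he]
    have : 0 ≤ 1 + 1 / g := by positivity
    linarith
  obtain ⟨d, hd⟩ := Nat.exists_eq_add_of_lt hlt
  have h1 := (hτ.mem_Ioc (a := (m : ℝ≥0)) (b := m + 1) (i := scheduleCount E.τ m + 1)
    (Finset.mem_Ioc.2 ⟨by omega, by omega⟩)).2
  have h2 := (hτ.mem_Ioc (a := (m : ℝ≥0)) (b := m + 1) (i := scheduleCount E.τ m + 1 + d)
    (Finset.mem_Ioc.2 ⟨by omega, by omega⟩)).2
  have h3 := hadd (scheduleCount E.τ m + 1) d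
  have h4 : ((m : ℝ≥0) : ℝ) < E.τ (scheduleCount E.τ m + 1) := NNReal.coe_lt_coe.2 h1.1
  have h6 : (E.τ (scheduleCount E.τ m + 1 + d) : ℝ) ≤ ((m + 1 : ℝ≥0) : ℝ) := NNReal.coe_le_coe.2 h2.2
  push_cast at h4 h6
  have h7 : (d : ℝ) ≤ 1 / g := by
    rw [le_div_iff₀ hg0]; linarith
  rw [hd]
  push_cast
  linarith

variable [IsProbabilityMeasure Pr]

/-- The conditional laws give no mass outside `[0,C]`. There are countably many quadruples
`(p,l,q,T)`, so one null set serves for all of them. -/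
lemma Model.HasRewardLaw.ae_reward_mem (hL : Z.HasRewardLaw E Pr) (hZ : Z.IsRegular) (h1 : E.A1)
    (hC : E.BoundedBy C) : ∀ᵐ ω ∂Pr, ∀ (p l q T : ℕ), p ≤ Z.J T ω → q ≤ Z.N T ω →
      ∀ i : RewardIndex p l q, Model.reward Z i ω ∈ Set.Icc 0 C := by
  refine ae_all_iff.2 fun p => ae_all_iff.2 fun l => ae_all_iff.2 fun q => ae_all_iff.2 fun T => ?_
  have hle := field_le hZ
  have hreg := isRegular_field hZ.cadlag hZ.counting
  have hm1 : Measurable[Z.field] (Z.J T) := @IsRegular.measurable_J Ω S Z.field _ _ _ _ _ Z hreg T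
  have hm2 : Measurable[Z.field] (Z.N T) := @IsRegular.measurable_N Ω S Z.field _ _ Z hreg T
  have hΓ : MeasurableSet[Z.field] ((fun ω => (Z.J T ω, Z.N T ω)) ⁻¹' {v | p ≤ v.1 ∧ q ≤ v.2}) :=
    (hm1.prodMk hm2) (Set.to_countable _).measurableSet
  set Γ := (fun ω => (Z.J T ω, Z.N T ω)) ⁻¹' {v : ℕ × ℕ | p ≤ v.1 ∧ q ≤ v.2} with hΓ'
  have hmap := map_eq_compProd_piKernel (m0 := m0) (m' := Z.field) (P := Pr.restrict Γ) (e := id)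
    (κ := rewardLaw E Z (p := p) (l := l) (q := q)) (Y := reward Z) (measurable_id'' hle)
    (fun i => @measurable_rewardLaw S Ω _ _ _ _ _ _ Z E Z.field hreg h1 p l q i)
    (fun i => hL.measurable_reward i) (hL.real_eq hle hΓ fun ω hω => ⟨⟨T, hω.1⟩, T, hω.2⟩)
  have hbad : MeasurableSet {y : RewardIndex p l q → ℝ | ¬ ∀ i, y i ∈ Set.Icc 0 C} := by
    have : {y : RewardIndex p l q → ℝ | ¬ ∀ i, y i ∈ Set.Icc 0 C}
        = (Set.pi Set.univ fun _ => Set.Icc 0 C)ᶜ := by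
      ext y; simp only [Set.mem_ofPred_eq, Set.mem_compl_iff, Set.mem_pi, Set.mem_univ, forall_true_left]
    rw [this]
    exact (MeasurableSet.univ_pi fun _ => measurableSet_Icc).compl
  have key := @lintegral_eq_of_map_eq_compProd Ω Ω (RewardIndex p l q) _ m0 Z.field (Pr.restrict Γ) _ id
    (rewardLaw E Z (p := p) (l := l) (q := q)) _ (reward Z) (measurable_id'' hle) _
    (fun i => hL.measurable_reward i) hmap
    (fun v => {y : RewardIndex p l q → ℝ | ¬ ∀ i, y i ∈ Set.Icc 0 C}.indicator 1 v.2)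
    ((measurable_one.indicator hbad).comp measurable_snd)
  have hzero (ω : Ω) : ∫⁻ y, {y : RewardIndex p l q → ℝ | ¬ ∀ i, y i ∈ Set.Icc 0 C}.indicator 1 y
      ∂(Measure.pi fun i => rewardLaw E Z i ω) = 0 := by
    rw [lintegral_indicator_one hbad]
    have h0 (i : RewardIndex p l q) : rewardLaw E Z i ω (Set.Icc 0 C)ᶜ = 0 := by
      rcases i with k | k | k
      exacts [hC.jump _ _ _, hC.sched _ _, hC.ext _ _]
    have h2 : ∀ᵐ y ∂(Measure.pi fun i : RewardIndex p l q => rewardLaw E Z i ω), ∀ i, y i ∈ Set.Icc 0 C := by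
      refine ae_all_iff.2 fun i => ?_
      have h3 : ∀ᵐ z ∂(rewardLaw E Z i ω), z ∈ Set.Icc 0 C := h0 i
      exact (measurePreserving_eval (fun i => rewardLaw E Z i ω) i).quasiMeasurePreserving.ae h3
    exact h2
  simp only [id, hzero, lintegral_zero] at key
  have hm : Measurable fun ω => fun i : RewardIndex p l q => reward Z i ω :=
    measurable_pi_lambda _ fun i => hL.measurable_reward i
  have key' := (ae_restrict_iff' (hle _ hΓ)).1
    ((lintegral_eq_zero_iff ((measurable_one.indicator hbad).comp hm)).1 key)
  filter_upwards [key'] with ω hω hp hq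
  have := hω ⟨hp, hq⟩
  by_contra hn
  exact one_ne_zero ((Set.indicator_of_mem (s := {y : RewardIndex p l q → ℝ | ¬ ∀ i, y i ∈ Set.Icc 0 C})
    hn (1 : (RewardIndex p l q → ℝ) → ENNReal)).symm.trans this)

namespace Model.IsResetting

variable (h : Z.IsResetting E μ Pr) (hC : E.BoundedBy C)
include h hC

lemma ae_abs_incr_le : ∀ᵐ ω ∂Pr, ∀ a b : ℝ≥0, a ≤ b → |incr E Z a b ω|
    ≤ C * (((b : ℝ) - a) + ((scheduleCount E.τ b : ℝ) - scheduleCount E.τ a)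
      + (Z.J b ω - Z.J a ω + (Z.N b ω - Z.N a ω) : ℕ)) := by
  have hZ := h.isRegular
  filter_upwards [h.law.ae_reward_mem hZ h.a1 hC] with ω hω a b hab
  obtain ⟨T, hT⟩ := exists_nat_ge b
  have hJ := (hZ.counting_J ω).mono hT
  have hN := (hZ.counting ω).mono hT
  have hω' := hω (Z.J b ω) (scheduleCount E.τ b) (Z.N b ω) T hJ hN
  have hsum (f : ℕ → ℝ) (c d : ℕ) (hcd : c ≤ d) (hf : ∀ k ∈ Finset.Icc 1 d, f k ∈ Set.Icc 0 C) :
      |∑ k ∈ Finset.Ioc c d, f k| ≤ ((d : ℝ) - c) * C := by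
    refine (Finset.abs_sum_le_sum_abs _ _).trans ?_
    refine (Finset.sum_le_card_nsmul _ _ C fun k hk => ?_).trans ?_
    · rw [Finset.mem_Ioc] at hk
      have := hf k (Finset.mem_Icc.2 ⟨by omega, hk.2⟩)
      rw [abs_of_nonneg this.1]; exact this.2
    · rw [nsmul_eq_mul, Nat.card_Ioc, Nat.cast_sub hcd]
  have hJab := (hZ.counting_J ω).mono hab
  have hNab := (hZ.counting ω).mono hab
  have s1 := hsum (fun k => Z.g k ω) (Z.J a ω) (Z.J b ω) hJab fun k hk => hω' (.inl ⟨k, hk⟩)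
  have s2 := hsum (fun k => Z.h k ω) _ _ (h.schedule.scheduleCount_mono hab) fun k hk => hω' (.inr (.inl ⟨k, hk⟩))
  have s3 := hsum (fun k => Z.k k ω) (Z.N a ω) (Z.N b ω) hNab fun k hk => hω' (.inr (.inr ⟨k, hk⟩))
  have hab' : (a : ℝ) ≤ b := NNReal.coe_le_coe.2 hab
  have s0 := intervalIntegral.norm_integral_le_of_norm_le_const (a := (a : ℝ)) (b := b) (C := C)
    (f := fun t => E.r t.toNNReal (Z.X t.toNNReal ω)) fun t _ => hC.reward _ _
  rw [abs_of_nonneg (sub_nonneg.2 hab'), Real.norm_eq_abs] at s0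
  rw [Nat.cast_add, Nat.cast_sub hJab, Nat.cast_sub hNab]
  unfold incr
  refine (abs_add_le _ _).trans ?_
  have := (abs_add_le ((∑ k ∈ Finset.Ioc (Z.J a ω) (Z.J b ω), Z.g k ω)
    + (∑ i ∈ Finset.Ioc (scheduleCount E.τ a) (scheduleCount E.τ b), Z.h i ω))
    (∑ k ∈ Finset.Ioc (Z.N a ω) (Z.N b ω), Z.k k ω))
  have := abs_add_le (∑ k ∈ Finset.Ioc (Z.J a ω) (Z.J b ω), Z.g k ω)
    (∑ i ∈ Finset.Ioc (scheduleCount E.τ a) (scheduleCount E.τ b), Z.h i ω)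
  linarith

omit hC [IsProbabilityMeasure Pr] in
lemma measurable_count (s v : ℝ≥0) : Measurable fun ω => Z.J v ω - Z.J s ω + (Z.N v ω - Z.N s ω) :=
  ((h.isRegular.measurable_J v).sub (h.isRegular.measurable_J s)).add
    ((h.poisson.measurable v).sub (h.poisson.measurable s))

lemma setLIntegral_count_pow_le {m : ℕ} {s v : ℝ≥0} (hs : m ≤ s) (hsv : s < v) (hv : v ≤ m + 1)
    {A : Set Ω} (hA : MeasurableSet[sigma Z.X (Set.Icc m s)] A) {j : ℕ} (hj : j ≤ 2) :
    ∫⁻ ω in A, ENNReal.ofReal (if j ≤ Z.J v ω - Z.J s ω + (Z.N v ω - Z.N s ω) then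
        ((Z.J v ω - Z.J s ω + (Z.N v ω - Z.N s ω) : ℕ) : ℝ) ^ 4 else 0) ∂Pr
      ≤ ENNReal.ofReal (128 * Real.exp (2 * C) * ((v : ℝ) - s) ^ j) * Pr A := by
  have hvs : 0 < v - s := tsub_pos_of_lt hsv
  have hvs' : ((v - s : ℝ≥0) : ℝ) = v - s := NNReal.coe_sub hsv.le
  -- This choice makes the exponential moment at most `exp (2 C)`, whatever the length of the
  -- window.
  set ζ : ℝ≥0 := (v - s)⁻¹ with hζ
  have hζ1 : 1 ≤ ζ := by
    rw [hζ, one_le_inv₀ hvs, tsub_le_iff_left]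
    calc v ≤ m + 1 := hv
      _ ≤ s + 1 := by gcongr
  have key := h.setLIntegral_pow_count_le hC hs hsv hv ζ hA
  have e1 : 2 * (ζ : ℝ) * (C * ((v : ℝ) - s)) = 2 * C := by
    rw [hζ, NNReal.coe_inv, hvs']
    have : (v : ℝ) - s ≠ 0 := by rw [← hvs']; exact_mod_cast hvs.ne'
    field_simp
  rw [e1] at key
  have hpt (n : ℕ) : ENNReal.ofReal (if j ≤ n then (n : ℝ) ^ 4 else 0)
      ≤ (128 * (v - s) ^ j : ℝ≥0) * (1 + ζ : ENNReal) ^ n := by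
    split_ifs with hjn
    · have h1 := mul_pow_four_le hζ1 hjn hj
      have h2 : (n : ℝ≥0) ^ 4 ≤ 128 * (v - s) ^ j * (1 + ζ) ^ n := by
        calc (n : ℝ≥0) ^ 4 = (v - s) ^ j * (ζ ^ j * (n : ℝ≥0) ^ 4) := by
              rw [← mul_assoc, ← mul_pow, hζ, mul_inv_cancel₀ hvs.ne', one_pow, one_mul]
          _ ≤ (v - s) ^ j * (128 * (1 + ζ) ^ n) := by gcongr
          _ = _ := by ring
      have e3 : ENNReal.ofReal ((n : ℝ) ^ 4) = (((n : ℝ≥0) ^ 4 : ℝ≥0) : ENNReal) := by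
        rw [← ENNReal.ofReal_coe_nnreal]; push_cast; rfl
      rw [e3]
      calc _ ≤ ((128 * (v - s) ^ j * (1 + ζ) ^ n : ℝ≥0) : ENNReal) := ENNReal.coe_le_coe.2 h2
        _ = _ := by push_cast; rfl
    · simp
  calc _ ≤ ∫⁻ ω in A, (128 * (v - s) ^ j : ℝ≥0)
        * (1 + ζ : ENNReal) ^ (Z.J v ω - Z.J s ω + (Z.N v ω - Z.N s ω)) ∂Pr :=
        lintegral_mono fun ω => hpt _
    _ = (128 * (v - s) ^ j : ℝ≥0)
        * ∫⁻ ω in A, (1 + ζ : ENNReal) ^ (Z.J v ω - Z.J s ω + (Z.N v ω - Z.N s ω)) ∂Pr :=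
        lintegral_const_mul _ ((measurable_of_countable fun k : ℕ => (1 + ζ : ENNReal) ^ k).comp
          (h.measurable_count s v))
    _ ≤ (128 * (v - s) ^ j : ℝ≥0) * (ENNReal.ofReal (Real.exp (2 * C)) * Pr A) := by gcongr
    _ = _ := by
        rw [← mul_assoc, ← ENNReal.ofReal_coe_nnreal, ← ENNReal.ofReal_mul NNReal.zero_le_coe]
        congr 2
        push_cast
        rw [hvs']
        ring

lemma integral_cond_count_pow_le {m : ℕ} {s v : ℝ≥0} (hs : m ≤ s) (hsv : s < v) (hv : v ≤ m + 1)
    {x : S} (hx : Pr (Z.X s ⁻¹' {x}) ≠ 0) {j : ℕ} (hj : j ≤ 2) :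
    ∫ ω, (if j ≤ Z.J v ω - Z.J s ω + (Z.N v ω - Z.N s ω) then
        ((Z.J v ω - Z.J s ω + (Z.N v ω - Z.N s ω) : ℕ) : ℝ) ^ 4 else 0) ∂Pr[|Z.X s ⁻¹' {x}]
      ≤ 128 * Real.exp (2 * C) * ((v : ℝ) - s) ^ j := by
  have key := h.setLIntegral_count_pow_le hC hs hsv hv
    (measurable_sigma (X := Z.X) (I := Set.Icc (m : ℝ≥0) s) ⟨hs, le_rfl⟩ (measurableSet_singleton x)) hj
  have hvs : 0 ≤ (v : ℝ) - s := sub_nonneg.2 (NNReal.coe_le_coe.2 hsv.le)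
  rw [integral_eq_lintegral_of_nonneg_ae (Eventually.of_forall fun ω => by
    simp only [Pi.zero_apply]; split_ifs <;> positivity)
    (by exact ((measurable_of_countable fun k : ℕ => if j ≤ k then (k : ℝ) ^ 4 else 0).comp
      (h.measurable_count s v)).aestronglyMeasurable)]
  refine ENNReal.toReal_le_of_le_ofReal (by positivity) ?_
  rw [ProbabilityTheory.cond, lintegral_smul_measure, smul_eq_mul]
  calc _ ≤ (Pr (Z.X s ⁻¹' {x}))⁻¹ * (ENNReal.ofReal (128 * Real.exp (2 * C) * ((v : ℝ) - s) ^ j)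
        * Pr (Z.X s ⁻¹' {x})) := by gcongr
    _ = _ := by
        rw [mul_comm, mul_assoc, ENNReal.mul_inv_cancel hx (measure_ne_top _ _), mul_one]

lemma memLp_count {m : ℕ} {s v : ℝ≥0} (hs : m ≤ s) (hsv : s ≤ v) (hv : v ≤ m + 1) :
    MemLp (fun ω => ((Z.J v ω - Z.J s ω + (Z.N v ω - Z.N s ω) : ℕ) : ℝ)) 4 Pr := by
  have hm : Measurable fun ω => ((Z.J v ω - Z.J s ω + (Z.N v ω - Z.N s ω) : ℕ) : ℝ) :=
    (measurable_of_countable fun k : ℕ => (k : ℝ)).comp (h.measurable_count s v)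
  rcases hsv.eq_or_lt with rfl | hlt
  · simp
  have key := h.setLIntegral_count_pow_le hC hs hlt hv MeasurableSet.univ (j := 0) (by norm_num)
  simp only [zero_le, if_true, Measure.restrict_univ, measure_univ, mul_one] at key
  refine (integrable_norm_rpow_iff hm.aestronglyMeasurable (by norm_num) (by norm_num)).1 ?_
  have e (ω : Ω) : ‖((Z.J v ω - Z.J s ω + (Z.N v ω - Z.N s ω) : ℕ) : ℝ)‖ ^ (4 : ENNReal).toReal
      = ((Z.J v ω - Z.J s ω + (Z.N v ω - Z.N s ω) : ℕ) : ℝ) ^ 4 := by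
    rw [Real.norm_natCast, ENNReal.toReal_ofNat, ← Nat.cast_ofNat, Real.rpow_natCast]
  simp only [e]
  refine ⟨(hm.pow_const 4).aestronglyMeasurable, ?_⟩
  rw [hasFiniteIntegral_iff_ofReal (Eventually.of_forall fun ω => by positivity)]
  exact key.trans_lt ENNReal.ofReal_lt_top

lemma memLp_R_sub_R {m : ℕ} {s v : ℝ≥0} (hs : m ≤ s) (hsv : s ≤ v) (hv : v ≤ m + 1) :
    MemLp (fun ω => Z.R E v ω - Z.R E s ω) 4 Pr := by
  have hb : MemLp (fun ω => C * (((v : ℝ) - s) + ((scheduleCount E.τ v : ℝ) - scheduleCount E.τ s)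
      + (Z.J v ω - Z.J s ω + (Z.N v ω - Z.N s ω) : ℕ))) 4 Pr := by
    have h1 := h.memLp_count hC hs hsv hv
    have h2 : MemLp (fun _ : Ω => ((v : ℝ) - s) + ((scheduleCount E.τ v : ℝ) - scheduleCount E.τ s)) 4 Pr :=
      memLp_const _
    exact (h2.add h1).const_mul C
  refine hb.mono' ((h.measurable_R v).sub (h.measurable_R s)).aestronglyMeasurable ?_
  filter_upwards [h.ae_abs_incr_le hC] with ω hω
  rw [R_sub_R h.isRegular h.schedule h.a1 hC.reward hsv, Real.norm_eq_abs]
  exact hω s v hsv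

omit hC in
theorem memLp_R (n : ℕ) : MemLp (Z.R E n) 4 Pr := by
  obtain ⟨C, hC⟩ := h.exists_boundedBy
  induction n with
  | zero =>
    have : Z.R E (0 : ℕ) = fun _ => (0 : ℝ) := by
      ext ω; rw [Nat.cast_zero, h.R_zero]
    rw [this]; exact memLp_const 0
  | succ n ih =>
    have h1 := h.memLp_R_sub_R hC (m := n) (s := n) (v := (n + 1 : ℕ)) le_rfl (by simp) (by simp)
    have e : Z.R E (n + 1 : ℕ) = fun ω => Z.R E n ω + (Z.R E (n + 1 : ℕ) ω - Z.R E n ω) := by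
      ext ω; ring
    rw [e]
    exact ih.add h1

/-- The cycle `[m, m + 1]` is divided into `L` equal cells, with the grid frozen at `m + 1` for
indices beyond `L`. The deterministic contribution `k` counts the scheduled times in a cell; over
the cycle these number at most `K₁`. -/
lemma isMarkovAdditive {K₁ : ℝ}
    (hK : ∀ m : ℕ, (scheduleCount E.τ (m + 1) : ℝ) ≤ scheduleCount E.τ m + K₁) (m : ℕ) {L : ℕ}
    (hL : 0 < L) {u : ℕ → ℝ≥0} (hu : u = fun j => (m : ℝ≥0) + ((min j L : ℕ) : ℝ≥0) / L) :
    IsMarkovAdditive Pr C (128 * Real.exp (2 * C)) K₁ L (fun j => Z.X (u j))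
      (fun j ω => Z.R E (u j) ω - Z.R E m ω)
      (fun j ω => Z.J (u (j + 1)) ω - Z.J (u j) ω + (Z.N (u (j + 1)) ω - Z.N (u j) ω))
      (fun j => (scheduleCount E.τ (u (j + 1)) : ℝ) - scheduleCount E.τ (u j)) := by
  have hL0 : (0 : ℝ≥0) < L := by exact_mod_cast hL
  have hum : Monotone u := fun i j hij => by
    rw [hu]; simp only
    have : min i L ≤ min j L := by omega
    gcongr
  have hu0 : u 0 = m := by rw [hu]; simp
  have huL : u L = m + 1 := by rw [hu]; simp [hL0.ne']
  have hge (j : ℕ) : m ≤ u j := by rw [← hu0]; exact hum (Nat.zero_le j)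
  have hle (j : ℕ) : u j ≤ m + 1 := by
    rw [hu]; simp only
    gcongr
    rw [div_le_one hL0]
    exact_mod_cast Nat.min_le_right j L
  have hlt (j : ℕ) (hj : j < L) : u j < m + 1 := by
    rw [hu]; simp only
    gcongr
    rw [div_lt_one hL0, min_eq_left hj.le]
    exact_mod_cast hj
  have hstep (j : ℕ) (hj : j < L) : u (j + 1) = u j + (L : ℝ≥0)⁻¹ := by
    rw [hu]; simp only
    rw [min_eq_left hj.le, min_eq_left hj, add_assoc]
    push_cast
    rw [add_div, one_div]
  have hstep' (j : ℕ) (hj : j < L) : (u (j + 1) : ℝ) - u j = (L : ℝ)⁻¹ := by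
    rw [hstep j hj]; push_cast; ring
  have hslt (j : ℕ) (hj : j < L) : u j < u (j + 1) := by
    rw [hstep j hj]; exact lt_add_of_pos_right _ (by positivity)
  have hincr (a b : ℝ≥0) (hab : a ≤ b) (ω : Ω) := R_sub_R h.isRegular h.schedule h.a1 hC.reward hab ω
  refine ⟨fun j => h.state.measurable _, by ext ω; simp [hu0], fun j => ?_, fun j => ?_, fun j => ?_, ?_,
    fun j hj => ?_, fun j hj ω hω => ?_, fun j hj x hx => ?_, fun j hj x hx => ?_, fun j hj w hw x hx => ?_⟩
  · exact h.memLp_R_sub_R hC le_rfl (hge j) (hle j)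
  · exact h.memLp_count hC (hge j) (hum (Nat.le_succ j)) (hle (j + 1))
  · exact sub_nonneg.2 (by exact_mod_cast h.schedule.scheduleCount_mono (hum (Nat.le_succ j)))
  · rw [Finset.sum_range_sub (fun j => (scheduleCount E.τ (u j) : ℝ)), huL, hu0]
    linarith [hK m]
  · filter_upwards [h.ae_abs_incr_le hC] with ω hω
    have := hω (u j) (u (j + 1)) (hslt j hj).le
    rw [← hincr _ _ (hslt j hj).le, hstep' j hj] at this
    rw [sub_sub_sub_cancel_right]
    exact this
  · have hJ := (h.isRegular.counting_J ω).mono (hslt j (by omega)).le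
    refine (h.state.cadlag ω).eq_of_jumpCount_eq (hslt j (by omega)).le (fun i hi => ?_)
      (show Z.J (u j) ω = Z.J (u (j + 1)) ω by omega) ⟨(hslt j (by omega)).le, le_rfl⟩
    have h1 : (m : ℝ≥0) < i := (hge j).trans_lt hi.1
    have h2 : (i : ℝ≥0) < m + 1 := hi.2.trans_lt (hlt (j + 1) hj)
    have h1' : m < i := by exact_mod_cast h1
    have h2' : i < m + 1 := by exact_mod_cast h2
    omega
  · have := h.integral_cond_count_pow_le hC (hge j) (hslt j hj) (hle (j + 1)) hx (j := 1) (by norm_num)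
    rw [hstep' j hj, pow_one] at this
    refine le_of_eq_of_le (integral_congr_ae (Eventually.of_forall fun ω => ?_)) this
    simp only
    split_ifs with h1
    · rfl
    · rw [Nat.lt_one_iff.1 (not_le.1 h1)]; norm_num
  · have := h.integral_cond_count_pow_le hC (hge j) (hslt j hj) (hle (j + 1)) hx (j := 2) le_rfl
    rwa [hstep' j hj] at this
  · have := h.indepFun_R_cond (hge j) (hslt j hj) (hle (j + 1)) hx (w := w) (fun hv => hw ?_)
    · simpa only [sub_sub_sub_cancel_right] using this
    · by_contra hne
      exact absurd (hlt (j + 1) (by omega)) (by rw [hv]; exact lt_irrefl _)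

omit hC in
/-- The fourth central moments of the rewards collected between resetting times are controlled by
their variances. -/
theorem exists_fourth_moment_le : ∃ A : ℝ, ∀ m : ℕ,
    ∫ ω, (Z.R E (m + 1 : ℕ) ω - Z.R E m ω - ∫ ω', (Z.R E (m + 1 : ℕ) ω' - Z.R E m ω') ∂Pr) ^ 4 ∂Pr
      ≤ A * variance (fun ω => Z.R E (m + 1 : ℕ) ω - Z.R E m ω) Pr := by
  obtain ⟨C, hC⟩ := h.exists_boundedBy
  obtain ⟨K₁, hK₁, hK⟩ := Data.exists_scheduleCount_le h.schedule h.a5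
  obtain ⟨A, hA, hA'⟩ := IsMarkovAdditive.exists_fourth_moment_le (S := S) Pr hC.pos.le
    (K := 128 * Real.exp (2 * C)) (by positivity) hK₁
  refine ⟨A, fun m => ?_⟩
  have key (L : ℕ) : ∫ ω, (Z.R E (m + 1 : ℕ) ω - Z.R E m ω
      - ∫ ω', (Z.R E (m + 1 : ℕ) ω' - Z.R E m ω') ∂Pr) ^ 4 ∂Pr
      ≤ A * (variance (fun ω => Z.R E (m + 1 : ℕ) ω - Z.R E m ω) Pr + ((L + 1 : ℕ) : ℝ)⁻¹) := by
    have := hA' (L + 1) _ _ _ _ (Nat.succ_pos L) (h.isMarkovAdditive hC hK m (Nat.succ_pos L) rfl)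
    have e : (m : ℝ≥0) + ((min (L + 1) (L + 1) : ℕ) : ℝ≥0) / (L + 1 : ℕ) = (m + 1 : ℕ) := by
      rw [min_self, div_self (by positivity)]; push_cast; rfl
    simpa only [e] using this
  -- `A` depends neither on the grid nor on the cycle, so refining the grid removes the extra term.
  have hlim : Tendsto (fun L : ℕ => A * (variance (fun ω => Z.R E (m + 1 : ℕ) ω - Z.R E m ω) Pr
      + ((L + 1 : ℕ) : ℝ)⁻¹)) atTop
      (𝓝 (A * (variance (fun ω => Z.R E (m + 1 : ℕ) ω - Z.R E m ω) Pr + 0))) :=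
    ((tendsto_inv_atTop_nhds_zero_nat.comp (tendsto_add_atTop_nat 1)).const_add _).const_mul A
  rw [add_zero] at hlim
  exact ge_of_tendsto' hlim key

end Model.IsResetting

end

/-! ### Lower bounds for the probabilities of states, jumps and external events. -/

section

/-- A path from `x` to `y` can be stretched to any greater number of steps by staying in place, so
finiteness of `S` gives a length that works for all pairs. Here `p k` is to be the law of the state
at the `k`-th grid time and `θ` a lower bound for one-step probabilities. -/
lemma exists_pow_mul_le_of_reflTransGen {S : Type*} [Finite S] {r : S → S → Prop}
    (hr : ∀ x y, Relation.ReflTransGen r x y) : ∃ l : ℕ, ∀ n ≥ l, ∀ (θ : ℝ) (p : ℕ → S → ℝ), 0 ≤ θ →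
      (∀ k < n, ∀ y z, (y = z ∨ r y z) → θ * p k y ≤ p (k + 1) z) → ∀ x y, θ ^ n * p 0 x ≤ p n y := by
  have h1 (x y : S) : ∃ l : ℕ, ∀ n ≥ l, ∀ (θ : ℝ) (p : ℕ → S → ℝ), 0 ≤ θ →
      (∀ k < n, ∀ y z, (y = z ∨ r y z) → θ * p k y ≤ p (k + 1) z) → θ ^ n * p 0 x ≤ p n y := by
    induction hr x y with
    | refl =>
      refine ⟨0, fun n _ θ p hθ hp => ?_⟩
      induction n with
      | zero => simp
      | succ n ih =>
        have := ih (Nat.zero_le n) fun k hk => hp k (by omega)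
        calc θ ^ (n + 1) * p 0 x = θ * (θ ^ n * p 0 x) := by ring
          _ ≤ θ * p n x := by gcongr
          _ ≤ _ := hp n (by omega) x x (Or.inl rfl)
    | tail _ hbc ih =>
      rename_i b c _
      obtain ⟨l, hl⟩ := ih
      refine ⟨l + 1, fun n hn θ p hθ hp => ?_⟩
      obtain ⟨n, rfl⟩ : ∃ n', n = n' + 1 := ⟨n - 1, by omega⟩
      have := hl n (by omega) θ p hθ fun k hk => hp k (by omega)
      calc θ ^ (n + 1) * p 0 x = θ * (θ ^ n * p 0 x) := by ring
        _ ≤ θ * p n b := by gcongr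
        _ ≤ _ := hp n (by omega) b c (Or.inr hbc)
  choose l hl using h1
  have := Fintype.ofFinite S
  refine ⟨Finset.univ.sup fun q : S × S => l q.1 q.2, fun n hn θ p hθ hp x y => hl x y n ?_ θ p hθ hp⟩
  exact (Finset.le_sup (f := fun q : S × S => l q.1 q.2) (Finset.mem_univ (x, y))).trans hn

variable {S Ω : Type*} [Fintype S] [DecidableEq S] [TopologicalSpace S] [DiscreteTopology S]
  [MeasurableSpace S] [DiscreteMeasurableSpace S] [m0 : MeasurableSpace Ω]
  {E : Data S} {μ : ℕ → PMF S} {Z : Model S Ω} {Pr : Measure Ω} [IsProbabilityMeasure Pr] {C : ℝ}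

namespace Model.IsResetting

variable (h : Z.IsResetting E μ Pr) (hC : E.BoundedBy C)
include h hC

omit [TopologicalSpace S] [DiscreteTopology S] [DiscreteMeasurableSpace S] [MeasurableSpace S]
  [MeasurableSpace Ω] h [IsProbabilityMeasure Pr] in
lemma le_transition (hm : E.A1) (hQ : ∀ t, IsRateMatrix (E.Q t)) {P : ℝ≥0 → ℝ≥0 → Matrix S S ℝ}
    (hP : IsTransition E.Q P) {q : ℝ}
    (hq : ∀ t, ∀ p ∈ E.B, q ≤ E.Q t p.1 p.2) {u v : ℝ≥0} (huv : u ≤ v) {y z : S} (hyz : (y, z) ∈ E.B) :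
    q * ((v : ℝ) - u) - Fintype.card S * C ^ 2 * ((v : ℝ) - u) ^ 2 ≤ P u v y z := by
  have h1 := hP.abs_sub_integral_le hC.rate hm.rate huv (Data.ne_of_mem_B hQ hyz) hQ
  have huv' : (u : ℝ) ≤ v := NNReal.coe_le_coe.2 huv
  have iQ : IntervalIntegrable (fun t : ℝ => E.Q t.toNNReal y z) volume u v := by
    rw [intervalIntegrable_iff_integrableOn_Ioc_of_le huv']
    exact Measure.integrableOn_of_bounded (M := C) (by simp)
      ((hm.rate y z).comp measurable_real_toNNReal).aestronglyMeasurable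
      (Eventually.of_forall fun t => by rw [Real.norm_eq_abs]; exact hC.rate _ _ _)
  have h2 : ∫ _ in (u : ℝ)..v, q ≤ ∫ t in (u : ℝ)..v, E.Q t.toNNReal y z :=
    intervalIntegral.integral_mono_on huv' (by simp) iQ fun t _ => hq _ _ hyz
  simp only [intervalIntegral.integral_const, smul_eq_mul] at h2
  have := (abs_le.1 h1).1
  linarith

/-- Uniform positivity of the state probabilities away from the resetting times. -/
theorem exists_le_real_state {η : ℝ≥0} (hη : 0 < η) : ∃ κ : ℝ, 0 < κ ∧ ∀ (m : ℕ) (t : ℝ≥0),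
    m + η ≤ t → t < m + 1 → ∀ x, κ ≤ Pr.real (Z.X t ⁻¹' {x}) := by
  have hXm := h.state.measurable
  obtain ⟨q, hq0, hq⟩ := Data.exists_forall_le_Q h.a2 h.a3
  obtain ⟨l, hl⟩ := exists_pow_mul_le_of_reflTransGen h.a2.irreducible
  have hS : Nonempty S := let ⟨x, _⟩ := (μ 0).support_nonempty; ⟨x⟩
  have hcard : (0 : ℝ) < Fintype.card S := by exact_mod_cast Fintype.card_pos
  set K := Fintype.card S * C ^ 2 with hK
  have hK0 : 0 < K := by have := hC.pos; positivity
  -- `N` is at least `l` and makes the step `d = η / N` so short that the quadratic error in the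
  -- transition probabilities is at most half the main term `q d`, and that staying in place has
  -- probability at least `1/2 ≥ q d / 2`.
  obtain ⟨N, hN⟩ := exists_nat_ge (l + 1 + η * (2 * K / q + 2 * C + q))
  have hfac : 0 < 2 * K / q + 2 * C + q := by have := hC.pos; positivity
  have hN0 : 0 < N := by
    have : (0 : ℝ) < N := by have := hC.pos; exact lt_of_lt_of_le (by positivity) hN
    exact_mod_cast this
  have hNl : l ≤ N := by
    have : (l : ℝ) ≤ N := by
      have : 0 ≤ η * (2 * K / q + 2 * C + q) := by positivity
      linarith
    exact_mod_cast this
  set d : ℝ≥0 := η / N with hd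
  have hNR : (0 : ℝ) < N := by exact_mod_cast hN0
  have hd0 : (0 : ℝ) < d := by rw [hd]; push_cast; positivity
  have hd1 : d * (2 * K / q + 2 * C + q) ≤ 1 := by
    rw [hd]; push_cast
    rw [div_mul_eq_mul_div, div_le_one hNR]
    have : (0 : ℝ) ≤ l := by positivity
    linarith
  have hdK : d * K ≤ q / 2 := by
    have h1 : 0 ≤ d * (2 * C + q) := by have := hC.pos; positivity
    have h2 : d * (2 * K / q) ≤ 1 := by nlinarith
    rw [mul_div_assoc', div_le_one hq0] at h2
    linarith
  have hdC : d * (2 * C) ≤ 1 := by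
    have h1 : 0 ≤ d * (2 * K / q + q) := by positivity
    nlinarith
  have hdq : d * q ≤ 1 := by
    have h1 : 0 ≤ d * (2 * K / q + 2 * C) := by have := hC.pos; positivity
    nlinarith
  set θ : ℝ := q / 2 * d with hθ
  refine ⟨θ ^ N * (1 / Fintype.card S), by positivity, fun m t hmt ht y => ?_⟩
  obtain ⟨P, hP, -, hlaw⟩ := h.exists_transition m
  set u : ℕ → ℝ≥0 := fun k => (t - η) + k * d with hu
  have hηt : η ≤ t := le_trans le_add_self hmt
  have hu0 : u 0 = t - η := by simp [hu]
  have huN : u N = t := by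
    simp only [hu, hd]
    rw [mul_div_cancel₀ _ (by exact_mod_cast hN0.ne'), tsub_add_cancel_of_le hηt]
  have hmu (k : ℕ) : m ≤ u k := by
    refine le_trans ?_ (le_self_add : t - η ≤ _)
    exact le_tsub_of_add_le_right hmt
  have hmono : Monotone u := fun i j hij => by simp only [hu]; gcongr
  have hstep (k : ℕ) : (u (k + 1) : ℝ) - u k = d := by simp only [hu]; push_cast; ring
  -- Nothing is known about the initial law of the cycle, but at time `t - η` some state has at
  -- least the average probability.
  obtain ⟨x, hx⟩ : ∃ x, 1 / (Fintype.card S : ℝ) ≤ Pr.real (Z.X (u 0) ⁻¹' {x}) := by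
    by_contra! hn
    have h1 := sum_real_inter_fiber (P := Pr) (hXm (u 0)) MeasurableSet.univ
    have h2 : ∑ x, Pr.real (Set.univ ∩ Z.X (u 0) ⁻¹' {x}) < ∑ _x : S, 1 / (Fintype.card S : ℝ) :=
      Finset.sum_lt_sum_of_nonempty Finset.univ_nonempty fun x _ => by rw [Set.univ_inter]; exact hn x
    rw [h1] at h2
    simp [hcard.ne'] at h2
  have key := hl N hNl θ (fun k z => Pr.real (Z.X (u k) ⁻¹' {z})) (by positivity) (fun k hk y z hyz => ?_) x y
  · simp only [huN] at key
    refine le_trans ?_ key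
    gcongr
  · have hkN : u (k + 1) < m + 1 := (hmono (show k + 1 ≤ N by omega)).trans_lt (by rw [huN]; exact ht)
    have e := hlaw (u k) (u (k + 1)) (hmu k) (hmono (Nat.le_succ k)) hkN Set.univ MeasurableSet.univ y z
    rw [Set.univ_inter, Set.univ_inter] at e
    have hle : Pr.real (Z.X (u k) ⁻¹' {y} ∩ Z.X (u (k + 1)) ⁻¹' {z}) ≤ Pr.real (Z.X (u (k + 1)) ⁻¹' {z}) :=
      measureReal_mono Set.inter_subset_right
    have hPθ : θ ≤ P (u k) (u (k + 1)) y z := by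
      rcases hyz with rfl | hyz
      · have := hP.one_sub_le hC.rate h.a1.rate (hmono (Nat.le_succ k)) y h.rate
        rw [hstep] at this
        rw [hθ]
        linarith
      · have := le_transition hC h.a1 h.rate hP hq (hmono (Nat.le_succ k)) (Data.mem_B.2 hyz)
        rw [hstep] at this
        rw [hθ]
        nlinarith
    rw [e] at hle
    refine le_trans ?_ hle
    rw [mul_comm]
    gcongr

lemma real_two_le_count_le {m : ℕ} {s v : ℝ≥0} (hs : m ≤ s) (hsv : s < v) (hv : v ≤ m + 1) {j : ℕ}
    (hj : j ≤ 2) (hj1 : 1 ≤ j) : Pr.real {ω | j ≤ Z.J v ω - Z.J s ω + (Z.N v ω - Z.N s ω)}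
      ≤ 128 * Real.exp (2 * C) * ((v : ℝ) - s) ^ j := by
  have key := h.setLIntegral_count_pow_le hC hs hsv hv MeasurableSet.univ hj
  rw [Measure.restrict_univ, measure_univ, mul_one] at key
  have hvs : 0 ≤ (v : ℝ) - s := sub_nonneg.2 (NNReal.coe_le_coe.2 hsv.le)
  refine ENNReal.toReal_le_of_le_ofReal (by positivity) (le_trans ?_ key)
  have hm : MeasurableSet {ω | j ≤ Z.J v ω - Z.J s ω + (Z.N v ω - Z.N s ω)} :=
    measurableSet_le measurable_const (h.measurable_count s v)
  rw [← lintegral_indicator_one hm]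
  refine lintegral_mono fun ω => ?_
  by_cases hω : j ≤ Z.J v ω - Z.J s ω + (Z.N v ω - Z.N s ω)
  · rw [Set.indicator_of_mem (by exact hω), if_pos hω, Pi.one_apply, ← ENNReal.ofReal_one]
    refine ENNReal.ofReal_le_ofReal (one_le_pow₀ ?_)
    exact_mod_cast hj1.trans hω
  · rw [Set.indicator_of_notMem (by exact hω)]
    exact zero_le

/-- Lower bound for the probability of a transition in a short time window. -/
lemma le_real_jump {q : ℝ} (hq : ∀ t, ∀ p ∈ E.B, q ≤ E.Q t p.1 p.2) {m : ℕ} {u v : ℝ≥0} (hu : m ≤ u)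
    (huv : u < v) (hv : v < m + 1) {x y : S} (hxy : (x, y) ∈ E.B) :
    Pr.real (Z.X u ⁻¹' {x}) * (q * ((v : ℝ) - u))
      ≤ Pr.real (Z.X u ⁻¹' {x} ∩ Z.X v ⁻¹' {y} ∩ {ω | Z.J v ω = Z.J u ω + 1})
        + (Fintype.card S * C ^ 2 + 128 * Real.exp (2 * C)) * ((v : ℝ) - u) ^ 2 := by
  obtain ⟨P, hP, -, hlaw⟩ := h.exists_transition m
  have hne := Data.ne_of_mem_B h.rate hxy
  have e := hlaw u v hu huv.le hv Set.univ MeasurableSet.univ x y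
  rw [Set.univ_inter, Set.univ_inter] at e
  have h1 := le_transition hC h.a1 h.rate hP hq huv.le hxy
  have h2 := h.real_two_le_count_le hC hu huv hv.le (j := 2) le_rfl (by norm_num)
  -- Going from `x` to `y ≠ x` takes a jump. If there is more than one, at least two events occur in
  -- the window, which has probability of order `(v - u)²`.
  have hsub : Z.X u ⁻¹' {x} ∩ Z.X v ⁻¹' {y} ⊆
      (Z.X u ⁻¹' {x} ∩ Z.X v ⁻¹' {y} ∩ {ω | Z.J v ω = Z.J u ω + 1})
        ∪ {ω | 2 ≤ Z.J v ω - Z.J u ω + (Z.N v ω - Z.N u ω)} := by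
    rintro ω ⟨hx, hy⟩
    by_cases hJ : Z.J v ω = Z.J u ω + 1
    · exact Or.inl ⟨⟨hx, hy⟩, hJ⟩
    · right
      have hmono := (h.isRegular.counting_J ω).mono huv.le
      have hJne : Z.J u ω ≠ Z.J v ω := fun hJe => by
        have := (h.state.cadlag ω).eq_of_jumpCount_eq huv.le (fun i hi => ?_) hJe ⟨huv.le, le_rfl⟩
        · exact hne (by rw [← show Z.X u ω = x from hx, ← show Z.X v ω = y from hy]; exact this.symm)
        · have a1 : (m : ℝ≥0) < i := hu.trans_lt hi.1
          have a2 : (i : ℝ≥0) < m + 1 := hi.2.trans_lt hv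
          have a1' : m < i := by exact_mod_cast a1
          have a2' : i < m + 1 := by exact_mod_cast a2
          omega
      simp only [Set.mem_ofPred_eq]
      omega
  have h3 := (measureReal_mono (μ := Pr) hsub).trans (measureReal_union_le _ _)
  rw [e] at h3
  have h4 := mul_le_mul_of_nonneg_left h1 (measureReal_nonneg (μ := Pr) (s := Z.X u ⁻¹' {x}))
  have h5 : Pr.real (Z.X u ⁻¹' {x}) * (Fintype.card S * C ^ 2 * ((v : ℝ) - u) ^ 2)
      ≤ 1 * (Fintype.card S * C ^ 2 * ((v : ℝ) - u) ^ 2) := by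
    gcongr; exact measureReal_le_one
  nlinarith

/-- Lower bound for the probability of an external event in a short time window. -/
lemma le_real_event {m : ℕ} {u v : ℝ≥0} (hu : m ≤ u) (huv : u < v) (hv : v < m + 1) (x : S) :
    Pr.real (Z.X u ⁻¹' {x}) * (∫ t in (u : ℝ)..v, E.β t.toNNReal x)
      ≤ Pr.real (Z.X u ⁻¹' {x} ∩ {ω | Z.J u ω = Z.J v ω} ∩ {ω | Z.N v ω = Z.N u ω + 1})
        + (C ^ 2 + 128 * Real.exp (2 * C) * C) * ((v : ℝ) - u) ^ 2 := by
  have hXm := h.state.measurable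
  have huv' : (u : ℝ) < v := NNReal.coe_lt_coe.2 huv
  set lam := ∫ t in (u : ℝ)..v, E.β t.toNNReal x with hlam
  have hlam0 : 0 ≤ lam := intervalIntegral.integral_nonneg huv'.le fun t _ => hC.intensity_nonneg _ _
  have hlam1 : lam ≤ C * (v - u) := by
    have := intervalIntegral.norm_integral_le_of_norm_le_const (a := (u : ℝ)) (b := v) (C := C)
      (f := fun t => E.β t.toNNReal x) fun t _ => by
        rw [Real.norm_eq_abs, abs_of_nonneg (hC.intensity_nonneg _ _)]; exact hC.intensity _ _
    rw [abs_of_nonneg (sub_nonneg.2 huv'.le)] at this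
    exact (le_abs_self _).trans this
  have hJ (t : ℝ≥0) : Measurable[sigma Z.X Set.univ] (Z.J t) :=
    @measurable_jumpCount Ω S (sigma Z.X Set.univ) _ _ _ _ _ Z.X h.state.cadlag
      (fun t => measurable_sigma (Set.mem_univ t)) t
  have hA : MeasurableSet[sigma Z.X Set.univ] (Z.X u ⁻¹' {x} ∩ {ω | Z.J u ω = Z.J v ω}) := by
    refine MeasurableSet.inter (measurable_sigma (X := Z.X) (Set.mem_univ u) (measurableSet_singleton x)) ?_
    exact ((hJ u).prodMk (hJ v)) ((Set.to_countable {p : ℕ × ℕ | p.1 = p.2}).measurableSet)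
  set A := Z.X u ⁻¹' {x} ∩ {ω | Z.J u ω = Z.J v ω} with hAdef
  have hA0 : MeasurableSet A := sigma_le (fun t _ => hXm t) _ hA
  have hlaw := h.poisson.law_nat hA 1 (u := fun j => if j = 0 then u else v)
    (monotone_nat_of_le_succ fun j => by by_cases hj : j = 0 <;> simp [hj, huv.le]) (fun _ => 1)
  simp only [Nat.lt_one_iff, forall_eq, zero_add, one_ne_zero, if_true, if_false,
    Finset.range_one, Finset.prod_singleton] at hlaw
  -- Without a jump the state is `x` throughout the window, and the Poisson parameter is the
  -- deterministic number `lam`.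
  have hw (ω : Ω) (hω : ω ∈ A) : poissonWeight E.β Z.X u v 1 ω = Real.exp (-lam) * lam := by
    have e : ∫ t in (u : ℝ)..v, E.β t.toNNReal (Z.X t.toNNReal ω) = lam := by
      refine intervalIntegral.integral_congr fun t ht => ?_
      rw [Set.uIcc_of_le huv'.le] at ht
      congr 1
      have := (h.state.cadlag ω).eq_of_jumpCount_eq huv.le (fun i hi => ?_) hω.2
        (s := t.toNNReal) ⟨NNReal.le_toNNReal_of_coe_le ht.1, Real.toNNReal_le_iff_le_coe.2 ht.2⟩
      · rw [this]; exact hω.1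
      · have a1 : (m : ℝ≥0) < i := hu.trans_lt hi.1
        have a2 : (i : ℝ≥0) < m + 1 := hi.2.trans_lt hv
        have a1' : m < i := by exact_mod_cast a1
        have a2' : i < m + 1 := by exact_mod_cast a2
        omega
    unfold poissonWeight
    rw [e, poissonMeasure_real_singleton, Real.coe_toNNReal _ hlam0]
    simp
  rw [setIntegral_congr_fun hA0 hw, setIntegral_const, smul_eq_mul] at hlaw
  rw [hlaw]
  have h1 := h.real_two_le_count_le hC hu huv hv.le (j := 1) (by norm_num) le_rfl
  rw [pow_one] at h1
  have hsub : Z.X u ⁻¹' {x} ⊆ A ∪ {ω | 1 ≤ Z.J v ω - Z.J u ω + (Z.N v ω - Z.N u ω)} := by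
    intro ω hx
    by_cases hJe : Z.J u ω = Z.J v ω
    · exact Or.inl ⟨hx, hJe⟩
    · right
      have hmono := (h.isRegular.counting_J ω).mono huv.le
      simp only [Set.mem_ofPred_eq]
      omega
  have h2 := (measureReal_mono (μ := Pr) hsub).trans (measureReal_union_le _ _)
  have h3 : 1 - lam ≤ Real.exp (-lam) := by linarith [Real.add_one_le_exp (-lam)]
  have h4 : Pr.real A * (lam - lam ^ 2) ≤ Pr.real A * (Real.exp (-lam) * lam) := by
    refine mul_le_mul_of_nonneg_left ?_ measureReal_nonneg
    nlinarith
  have h5 : Pr.real A * lam ^ 2 ≤ 1 * (C * (v - u)) ^ 2 := by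
    gcongr; exact measureReal_le_one
  have h6 : (128 * Real.exp (2 * C) * ((v : ℝ) - u)) * lam
      ≤ (128 * Real.exp (2 * C) * ((v : ℝ) - u)) * (C * (v - u)) := by
    have := sub_nonneg.2 huv'.le
    gcongr
  have h7 : Pr.real (Z.X u ⁻¹' {x}) * lam ≤ (Pr.real A + 128 * Real.exp (2 * C) * ((v : ℝ) - u)) * lam := by
    gcongr; linarith
  nlinarith

end Model.IsResetting

end

/-! ### Comparison of measures on the line and mean sums over events. -/

section

lemma continuousWithinAt_measureReal_Iic (ν : Measure ℝ) [IsFiniteMeasure ν] (x : ℝ) :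
    ContinuousWithinAt (fun t => ν.real (Set.Iic t)) (Set.Ici x) x := by
  rw [← continuousWithinAt_Ioi_iff_Ici]
  have h1 := tendsto_measure_biInter_gt (μ := ν) (s := fun t : ℝ => Set.Iic t) (a := x)
    (fun r _ => measurableSet_Iic.nullMeasurableSet) (fun i j _ hij => Set.Iic_subset_Iic.2 hij)
    ⟨x + 1, by simp, measure_ne_top _ _⟩
  have h2 : ⋂ r > x, Set.Iic r = Set.Iic x := by
    ext z
    simp only [gt_iff_lt, Set.mem_iInter, Set.mem_Iic]
    exact ⟨fun hz => le_of_forall_gt_imp_ge_of_dense hz, fun hz r hr => hz.trans hr.le⟩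
  rw [h2] at h1
  exact (ENNReal.tendsto_toReal (measure_ne_top _ _)).comp h1

lemma measureReal_Ioc_eq_sub (ν : Measure ℝ) [IsFiniteMeasure ν] {u v : ℝ} (huv : u ≤ v) :
    ν.real (Set.Ioc u v) = ν.real (Set.Iic v) - ν.real (Set.Iic u) := by
  rw [← Set.Iic_sdiff_Iic, measureReal_sdiff (Set.Iic_subset_Iic.2 huv) measurableSet_Iic]

/-- Finite measures on the line can be compared on half-open intervals. -/
lemma le_of_forall_Ioc_le {κ ν : Measure ℝ} [IsFiniteMeasure κ] [IsFiniteMeasure ν]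
    (h : ∀ u v, u < v → κ.real (Set.Ioc u v) ≤ ν.real (Set.Ioc u v)) : κ ≤ ν := by
  -- The difference of the distribution functions is nondecreasing and right-continuous, so `ν` is
  -- `κ` plus its Stieltjes measure.
  set f : StieltjesFunction ℝ :=
    { toFun := fun t => ν.real (Set.Iic t) - κ.real (Set.Iic t)
      mono' := fun u v huv => by
        rcases huv.eq_or_lt with rfl | hlt
        · exact le_rfl
        · have := h u v hlt
          rw [measureReal_Ioc_eq_sub _ huv, measureReal_Ioc_eq_sub _ huv] at this
          simp only
          linarith
      right_continuous' := fun x =>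
        (continuousWithinAt_measureReal_Iic ν x).sub (continuousWithinAt_measureReal_Iic κ x) } with hf
  have e : ν = κ + f.measure := by
    refine Measure.ext_of_Ioc _ _ fun u v huv => ?_
    rw [Measure.add_apply, StieltjesFunction.measure_Ioc, ← ofReal_measureReal (μ := κ),
      ← ENNReal.ofReal_add measureReal_nonneg, ← ofReal_measureReal (μ := ν)]
    · congr 1
      change _ = _ + (ν.real (Set.Iic v) - κ.real (Set.Iic v) - (ν.real (Set.Iic u) - κ.real (Set.Iic u)))
      rw [measureReal_Ioc_eq_sub _ huv.le, measureReal_Ioc_eq_sub _ huv.le]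
      ring
    · exact sub_nonneg.2 (f.mono huv.le)
  rw [e]
  exact Measure.le_add_right le_rfl

/-- Quadratic errors disappear on subdivision: `n + 1` equal pieces of `(u,v]` have total error `K
(v - u)² / (n + 1)`. -/
lemma restrict_Ioc_le_of_forall_le_add_sq {κ ν : Measure ℝ} [IsFiniteMeasure κ] [IsFiniteMeasure ν]
    {a b K : ℝ} (h : ∀ u v, a ≤ u → u < v → v ≤ b →
      κ.real (Set.Ioc u v) ≤ ν.real (Set.Ioc u v) + K * (v - u) ^ 2) :
    κ.restrict (Set.Ioc a b) ≤ ν.restrict (Set.Ioc a b) := by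
  have h' (u v : ℝ) (hu : a ≤ u) (huv : u < v) (hv : v ≤ b) :
      κ.real (Set.Ioc u v) ≤ ν.real (Set.Ioc u v) := by
    set F : ℝ → ℝ := fun t => κ.real (Set.Iic t) - ν.real (Set.Iic t) with hF
    have hn (n : ℕ) : F v - F u ≤ K * (v - u) ^ 2 * ((n + 1 : ℕ) : ℝ)⁻¹ := by
      have hn0 : (0 : ℝ) < ((n + 1 : ℕ) : ℝ) := by positivity
      set t : ℕ → ℝ := fun j => u + (v - u) * (j / (n + 1 : ℕ)) with ht
      have ht0 : t 0 = u := by simp [ht]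
      have htn : t (n + 1) = v := by simp only [ht]; rw [div_self hn0.ne']; ring
      have hstep (j : ℕ) : t (j + 1) - t j = (v - u) * ((n + 1 : ℕ) : ℝ)⁻¹ := by
        simp only [ht]; push_cast; field_simp; ring
      have hpos : 0 < (v - u) * ((n + 1 : ℕ) : ℝ)⁻¹ := mul_pos (sub_pos.2 huv) (inv_pos.2 hn0)
      have hmono : Monotone t := monotone_nat_of_le_succ fun j => by linarith [hstep j]
      have hsum := Finset.sum_range_sub (fun j => F (t j)) (n + 1)
      rw [ht0, htn] at hsum
      rw [← hsum]
      calc _ ≤ ∑ _j ∈ Finset.range (n + 1), K * ((v - u) * ((n + 1 : ℕ) : ℝ)⁻¹) ^ 2 := by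
            refine Finset.sum_le_sum fun j hj => ?_
            rw [Finset.mem_range] at hj
            have hlt : t j < t (j + 1) := by linarith [hstep j]
            have := h (t j) (t (j + 1)) (by rw [← ht0] at hu; exact hu.trans (hmono (Nat.zero_le j))) hlt
              (by rw [← htn] at hv; exact (hmono (by omega)).trans hv)
            rw [measureReal_Ioc_eq_sub _ hlt.le, measureReal_Ioc_eq_sub _ hlt.le, hstep] at this
            simp only [hF]
            linarith
        _ = _ := by
            rw [Finset.sum_const, Finset.card_range, nsmul_eq_mul]
            field_simp
    have hlim : Tendsto (fun n : ℕ => K * (v - u) ^ 2 * ((n + 1 : ℕ) : ℝ)⁻¹) atTop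
        (𝓝 (K * (v - u) ^ 2 * 0)) :=
      (tendsto_inv_atTop_nhds_zero_nat.comp (tendsto_add_atTop_nat 1)).const_mul _
    have := ge_of_tendsto' hlim hn
    simp only [hF] at this
    rw [measureReal_Ioc_eq_sub _ huv.le, measureReal_Ioc_eq_sub _ huv.le]
    linarith
  refine le_of_forall_Ioc_le fun u v huv => ?_
  rw [measureReal_restrict_apply measurableSet_Ioc, measureReal_restrict_apply measurableSet_Ioc,
    Set.Ioc_inter_Ioc]
  rcases lt_or_ge (max u a) (min v b) with hlt | hge
  · exact h' _ _ (le_max_right _ _) hlt (min_le_right _ _)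
  · rw [Set.Ioc_eq_empty (not_lt.2 hge)]; simp

/-- Lower bound for the mean of a sum over the events of a counting process, from lower bounds for
the probability of an event in short time windows. -/
lemma setLIntegral_le_lintegral_sum_events {Ω : Type*} [MeasurableSpace Ω] {P : Measure Ω}
    [IsFiniteMeasure P] {c : ℝ≥0 → Ω → ℕ} (hc : ∀ ω, IsCounting fun t => c t ω)
    (hcm : ∀ t, Measurable (c t)) {Γ : ℕ → Set Ω} (hΓ : ∀ k, MeasurableSet (Γ k)) {a b : ℝ≥0}
    (hfin : ∫⁻ ω, ((c b ω - c a ω : ℕ) : ENNReal) ∂P ≠ ⊤) {κ : Measure ℝ} [IsFiniteMeasure κ]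
    {K : ℝ} (h : ∀ u v : ℝ≥0, a ≤ u → u < v → v ≤ b → κ.real (Set.Ioc (u : ℝ) v)
      ≤ P.real {ω | ∃ k ∈ Finset.Ioc (c u ω) (c v ω), ω ∈ Γ k} + K * ((v : ℝ) - u) ^ 2)
    {φ : ℝ≥0 → ENNReal} (hφ : Measurable φ) :
    ∫⁻ t in Set.Ioc (a : ℝ) b, φ t.toNNReal ∂κ ≤ ∫⁻ ω, ∑ k ∈ Finset.Ioc (c a ω) (c b ω),
      (Γ k).indicator (fun ω => φ (eventTime (fun t => c t ω) k)) ω ∂P := by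
  set T : ℕ → Ω → ℝ≥0 := fun k ω => eventTime (fun t => c t ω) k with hT
  have hTm (k : ℕ) : Measurable (T k) := measurable_eventTime hc hcm k
  have hTm' (k : ℕ) : Measurable fun ω => (T k ω : ℝ) := (hTm k).coe_nnreal_real
  set W : ℕ → Set Ω := fun k => {ω | k ∈ Finset.Ioc (c a ω) (c b ω)} with hW
  have hWm (k : ℕ) : MeasurableSet (W k) :=
    ((hcm a).prodMk (hcm b)) ((Set.to_countable {p : ℕ × ℕ | k ∈ Finset.Ioc p.1 p.2}).measurableSet)
  have hΔm (k : ℕ) : MeasurableSet (Γ k ∩ W k) := (hΓ k).inter (hWm k)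
  have htsum (g : ℕ → Ω → ENNReal) (ω : Ω) : ∑ k ∈ Finset.Ioc (c a ω) (c b ω), g k ω
      = ∑' k, (W k).indicator (g k) ω := by
    rw [tsum_eq_sum (s := Finset.Ioc (c a ω) (c b ω)) fun k hk => Set.indicator_of_notMem (by exact hk) _]
    exact Finset.sum_congr rfl fun k hk => (Set.indicator_of_mem (by exact hk) _).symm
  -- `ν` is the mean measure of the times of those events in `(a,b]` that satisfy the condition `Γ`.
  -- The hypothesis says that it dominates `κ` on short intervals up to a quadratic error.
  set ν : Measure ℝ := Measure.sum fun k => (P.restrict (Γ k ∩ W k)).map fun ω => (T k ω : ℝ) with hν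
  have hνfin : IsFiniteMeasure ν := by
    refine ⟨?_⟩
    rw [hν, Measure.sum_apply _ MeasurableSet.univ]
    calc _ ≤ ∑' k, P (W k) := by
          refine ENNReal.tsum_le_tsum fun k => ?_
          rw [Measure.map_apply (hTm' k) MeasurableSet.univ, Set.preimage_univ,
            Measure.restrict_apply MeasurableSet.univ, Set.univ_inter]
          exact measure_mono Set.inter_subset_right
      _ = ∫⁻ ω, ((c b ω - c a ω : ℕ) : ENNReal) ∂P := by
          simp only [← lintegral_indicator_one (hWm _)]
          rw [← lintegral_tsum fun k => (measurable_one.indicator (hWm k)).aemeasurable]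
          refine lintegral_congr fun ω => ?_
          have := htsum (fun _ => 1) ω
          rw [← this]
          simp
      _ < ⊤ := hfin.lt_top
  have hle := restrict_Ioc_le_of_forall_le_add_sq (κ := κ) (ν := ν) (a := a) (b := b) (K := K)
    fun u v hu huv hv => ?_
  · calc ∫⁻ t in Set.Ioc (a : ℝ) b, φ t.toNNReal ∂κ
        ≤ ∫⁻ t in Set.Ioc (a : ℝ) b, φ t.toNNReal ∂ν := lintegral_mono' hle le_rfl
      _ ≤ ∫⁻ t, φ t.toNNReal ∂ν := setLIntegral_le_lintegral _ _
      _ = ∑' k, ∫⁻ ω in Γ k ∩ W k, φ (T k ω) ∂P := by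
          rw [hν, lintegral_sum_measure]
          refine tsum_congr fun k => ?_
          refine (lintegral_map (hφ.comp measurable_real_toNNReal) (hTm' k)).trans ?_
          simp only [Function.comp_apply, Real.toNNReal_coe]
      _ = ∫⁻ ω, ∑' k, (Γ k ∩ W k).indicator (fun ω => φ (T k ω)) ω ∂P := by
          refine Eq.trans ?_ (lintegral_tsum fun k => ((hφ.comp (hTm k)).indicator (hΔm k)).aemeasurable).symm
          refine tsum_congr fun k => ?_
          rw [lintegral_indicator (hΔm k)]
          rfl
      _ = _ := by
          refine lintegral_congr fun ω => ?_
          rw [htsum fun k => (Γ k).indicator fun ω => φ (T k ω)]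
          refine tsum_congr fun k => ?_
          rw [Set.indicator_indicator, Set.inter_comm]
  · lift u to ℝ≥0 using (NNReal.coe_nonneg a).trans hu
    lift v to ℝ≥0 using (NNReal.coe_nonneg u).trans huv.le
    have hu' : a ≤ u := hu
    have huv' : u < v := huv
    have hv' : v ≤ b := hv
    refine (h u v hu' huv' hv').trans ?_
    gcongr
    refine ENNReal.toReal_mono (measure_ne_top _ _) ?_
    rw [hν, Measure.sum_apply _ measurableSet_Ioc]
    calc P {ω | ∃ k ∈ Finset.Ioc (c u ω) (c v ω), ω ∈ Γ k}
        ≤ P (⋃ k, (fun ω => (T k ω : ℝ)) ⁻¹' Set.Ioc (u : ℝ) v ∩ (Γ k ∩ W k)) := by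
          refine measure_mono fun ω => ?_
          rintro ⟨k, hk, hkΓ⟩
          have h1 := (hc ω).mono hu'
          have h2 := (hc ω).mono hv'
          have hkT := ((hc ω).eventTime_mem_Ioc_iff (k := k) (a := u) (b := v)
            ⟨v, (Finset.mem_Ioc.1 hk).2⟩).2 hk
          rw [Finset.mem_Ioc] at hk
          refine Set.mem_iUnion.2 ⟨k, ⟨NNReal.coe_lt_coe.2 hkT.1, NNReal.coe_le_coe.2 hkT.2⟩, hkΓ, ?_⟩
          exact show k ∈ Finset.Ioc (c a ω) (c b ω) from Finset.mem_Ioc.2 ⟨by omega, by omega⟩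
      _ ≤ ∑' k, P ((fun ω => (T k ω : ℝ)) ⁻¹' Set.Ioc (u : ℝ) v ∩ (Γ k ∩ W k)) := measure_iUnion_le _
      _ = _ := by
          refine tsum_congr fun k => ?_
          rw [Measure.map_apply (hTm' k) measurableSet_Ioc,
            Measure.restrict_apply ((hTm' k) measurableSet_Ioc)]

end

/-! ### Conditional variance collected at jumps and external events. -/

section

lemma setLIntegral_ofReal_mul_le_lintegral_sum_events {Ω : Type*} [MeasurableSpace Ω] {P : Measure Ω}
    [IsFiniteMeasure P] {c : ℝ≥0 → Ω → ℕ} (hc : ∀ ω, IsCounting fun t => c t ω)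
    (hcm : ∀ t, Measurable (c t)) {Γ : ℕ → Set Ω} (hΓ : ∀ k, MeasurableSet (Γ k)) {a b : ℝ≥0}
    (hfin : ∫⁻ ω, ((c b ω - c a ω : ℕ) : ENNReal) ∂P ≠ ⊤) {w : ℝ≥0 → ℝ} (hw : Measurable w)
    (h0 : ∀ t, 0 ≤ w t) {M : ℝ} (hM : ∀ t, w t ≤ M)
    {K : ℝ} (h : ∀ u v : ℝ≥0, a ≤ u → u < v → v ≤ b → ∫ t in (u : ℝ)..v, w t.toNNReal
      ≤ P.real {ω | ∃ k ∈ Finset.Ioc (c u ω) (c v ω), ω ∈ Γ k} + K * ((v : ℝ) - u) ^ 2)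
    {φ : ℝ≥0 → ENNReal} (hφ : Measurable φ) :
    ∫⁻ t in Set.Ioc (a : ℝ) b, ENNReal.ofReal (w t.toNNReal) * φ t.toNNReal
      ≤ ∫⁻ ω, ∑ k ∈ Finset.Ioc (c a ω) (c b ω),
        (Γ k).indicator (fun ω => φ (eventTime (fun t => c t ω) k)) ω ∂P := by
  have hwm : Measurable fun t : ℝ => w t.toNNReal := hw.comp measurable_real_toNNReal
  have hint (s : Set ℝ) (hs : volume s < ⊤) : IntegrableOn (fun t : ℝ => w t.toNNReal) s :=
    IntegrableOn.of_bound hs hwm.aestronglyMeasurable M (Eventually.of_forall fun t => by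
      rw [Real.norm_eq_abs, abs_of_nonneg (h0 _)]; exact hM _)
  set κ : Measure ℝ := (volume.restrict (Set.Ioc (a : ℝ) b)).withDensity
    fun t => ENNReal.ofReal (w t.toNNReal) with hκ
  have hκfin : IsFiniteMeasure κ := isFiniteMeasure_withDensity_ofReal (hint _ (by simp)).2
  have key := setLIntegral_le_lintegral_sum_events (κ := κ) hc hcm hΓ hfin (K := K)
    (fun u v hu huv hv => ?_) hφ
  · rw [hκ, restrict_withDensity measurableSet_Ioc, Measure.restrict_restrict measurableSet_Ioc,
      Set.inter_self] at key
    exact (lintegral_withDensity_eq_lintegral_mul _ hwm.ennreal_ofReal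
      (hφ.comp measurable_real_toNNReal)).symm.le.trans key
  · refine le_of_eq_of_le ?_ (h u v hu huv hv)
    have huv' : (u : ℝ) ≤ v := NNReal.coe_le_coe.2 huv.le
    have hsub : Set.Ioc (u : ℝ) v ⊆ Set.Ioc (a : ℝ) b :=
      Set.Ioc_subset_Ioc (NNReal.coe_le_coe.2 hu) (NNReal.coe_le_coe.2 hv)
    rw [measureReal_def, hκ, withDensity_apply _ measurableSet_Ioc,
      Measure.restrict_restrict measurableSet_Ioc, Set.inter_eq_left.2 hsub,
      intervalIntegral.integral_of_le huv',
      integral_eq_lintegral_of_nonneg_ae (Eventually.of_forall fun t => h0 _) hwm.aestronglyMeasurable]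

lemma sum_range_sum_Ioc {c : ℕ → ℕ} (hc : Monotone c) (f : ℕ → ℝ) (M : ℕ) :
    ∑ i ∈ Finset.range M, ∑ k ∈ Finset.Ioc (c i) (c (i + 1)), f k = ∑ k ∈ Finset.Ioc (c 0) (c M), f k := by
  induction M with
  | zero => simp
  | succ M ih =>
    rw [Finset.sum_range_succ, ih, Finset.sum_Ioc_consecutive f (hc (Nat.zero_le M)) (hc (Nat.le_succ M))]

/-- The lower integral is superadditive, so no measurability is needed in this direction. -/
lemma sum_lintegral_le_lintegral_sum {Ω ι : Type*} [MeasurableSpace Ω] (P : Measure Ω) (s : Finset ι)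
    (f : ι → Ω → ENNReal) : ∑ i ∈ s, ∫⁻ ω, f i ω ∂P ≤ ∫⁻ ω, ∑ i ∈ s, f i ω ∂P := by
  classical
  induction s using Finset.induction_on with
  | empty => simp
  | insert i s hi ih =>
    simp only [Finset.sum_insert hi]
    exact (add_le_add_right ih _).trans (le_lintegral_add _ _)

/-- With exactly one jump and no resetting time in `(u,v]`, the path is constant before the jump and
constant from it on. -/
lemma IsCadlag.eventTime_jump {S : Type*} [TopologicalSpace S] [DiscreteTopology S] {x : ℝ≥0 → S}
    (hx : IsCadlag x) {u v : ℝ≥0} (hi : ∀ i : ℕ, (i : ℝ≥0) ∉ Set.Ioc u v)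
    (hJ : jumpCount x v = jumpCount x u + 1) :
    Function.leftLim x (eventTime (jumpCount x) (jumpCount x v)) = x u ∧
      x (eventTime (jumpCount x) (jumpCount x v)) = x v := by
  have hc := hx.isCounting_jumpCount
  have hk : ∃ t, jumpCount x v ≤ jumpCount x t := ⟨v, le_rfl⟩
  set T := eventTime (jumpCount x) (jumpCount x v) with hT
  obtain ⟨h1, h2⟩ := (hc.eventTime_mem_Ioc_iff hk (a := u) (b := v)).2
    (Finset.mem_Ioc.2 ⟨by omega, le_rfl⟩)
  constructor
  · have hb := nhdsLT_neBot_of_lt h1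
    refine leftLim_eq_of_eventually_eq ?_ fun h => absurd h hb.ne
    filter_upwards [Ioo_mem_nhdsLT h1] with s hs
    have h3 : jumpCount x s < jumpCount x v := (hc.lt_eventTime_iff hk).1 hs.2
    have h4 := hc.mono hs.1.le
    exact hx.eq_of_jumpCount_eq hs.1.le
      (fun i hi' => hi i ⟨hi'.1, hi'.2.trans (hs.2.le.trans h2)⟩) (by omega) ⟨hs.1.le, le_rfl⟩
  · have h3 : jumpCount x v ≤ jumpCount x T := (hc.eventTime_le_iff hk).1 le_rfl
    have h4 := hc.mono h2
    exact (hx.eq_of_jumpCount_eq h2 (fun i hi' => hi i ⟨h1.trans hi'.1, hi'.2⟩) (le_antisymm h4 h3)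
      ⟨h2, le_rfl⟩).symm

lemma natCast_notMem_Ioc {m : ℕ} {u v : ℝ≥0} (hu : m ≤ u) (hv : v < m + 1) (i : ℕ) :
    (i : ℝ≥0) ∉ Set.Ioc u v := fun hi => by
  have a1 : (m : ℝ≥0) < i := hu.trans_lt hi.1
  have a2 : (i : ℝ≥0) < m + 1 := hi.2.trans_lt hv
  have a1' : m < i := by exact_mod_cast a1
  have a2' : i < m + 1 := by exact_mod_cast a2
  omega

lemma memLp_id_of_compl_Icc {ν : Measure ℝ} [IsProbabilityMeasure ν] {C : ℝ}
    (h : ν (Set.Icc 0 C)ᶜ = 0) : MemLp id 2 ν := by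
  refine MemLp.of_bound measurable_id.aestronglyMeasurable C ?_
  have h' : ∀ᵐ z ∂ν, z ∈ Set.Icc 0 C := h
  filter_upwards [h'] with z hz
  rw [id, Real.norm_eq_abs, abs_of_nonneg hz.1]
  exact hz.2

lemma measurable_var {κ : ℝ≥0 → ProbabilityMeasure ℝ} (hκ : ∀ z, Measurable fun t => cdf (κ t : Measure ℝ) z)
    {C : ℝ} (hC : ∀ t, (κ t : Measure ℝ) (Set.Icc 0 C)ᶜ = 0) : Measurable fun t => var (κ t) := by
  have hm := measurable_coe_probabilityMeasure_of_cdf hκ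
  have e : (fun t => var (κ t)) = fun t => (∫ z, z ^ 2 ∂(κ t : Measure ℝ)) - (∫ z, z ∂(κ t : Measure ℝ)) ^ 2 := by
    ext t
    exact variance_eq_sub (memLp_id_of_compl_Icc (hC t))
  rw [e]
  exact (Model.measurable_integral_law hm (Continuous.stronglyMeasurable (by fun_prop))).sub
    ((Model.measurable_integral_law hm (Continuous.stronglyMeasurable (by fun_prop))).pow_const 2)

variable {S Ω : Type*} [Fintype S] [DecidableEq S] [TopologicalSpace S] [DiscreteTopology S]
  [MeasurableSpace S] [DiscreteMeasurableSpace S] [m0 : MeasurableSpace Ω]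
  {E : Data S} {μ : ℕ → PMF S} {Z : Model S Ω} {Pr : Measure Ω} [IsProbabilityMeasure Pr] {C : ℝ}

namespace Model.IsResetting

variable (h : Z.IsResetting E μ Pr) (hC : E.BoundedBy C)
include h hC

lemma lintegral_count_ne_top {m : ℕ} {a b : ℝ≥0} (ha : m ≤ a) (hab : a ≤ b) (hb : b ≤ m + 1) :
    ∫⁻ ω, ((Z.J b ω - Z.J a ω + (Z.N b ω - Z.N a ω) : ℕ) : ENNReal) ∂Pr ≠ ⊤ := by
  have h1 := ((h.memLp_count hC ha hab hb).integrable (by norm_num)).2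
  rw [hasFiniteIntegral_iff_ofReal (Eventually.of_forall fun ω => Nat.cast_nonneg _)] at h1
  simpa only [ENNReal.ofReal_natCast] using h1.ne

/-- Variance contributed by the rewards at jumps in a time window. -/
lemma setLIntegral_varG_le {m : ℕ} {a b : ℝ≥0} (ha : m ≤ a) (hab : a ≤ b) (hb : b < m + 1) {κ q : ℝ}
    (hκ0 : 0 ≤ κ) (hq0 : 0 ≤ q) (hκ : ∀ t : ℝ≥0, a ≤ t → t < m + 1 → ∀ x, κ ≤ Pr.real (Z.X t ⁻¹' {x}))
    (hq : ∀ t, ∀ p ∈ E.B, q ≤ E.Q t p.1 p.2) :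
    ∑ p ∈ E.B, ∫⁻ t in Set.Ioc (a : ℝ) b,
        ENNReal.ofReal (κ * q) * ENNReal.ofReal (var (E.G t.toNNReal p.1 p.2))
      ≤ ∫⁻ ω, ∑ k ∈ Finset.Ioc (Z.J a ω) (Z.J b ω),
        ENNReal.ofReal (variance id (Z.lawG E k ω)) ∂Pr := by
  have hZ := h.isRegular
  set Γ : S × S → ℕ → Set Ω := fun p k => {ω | Z.Xleft (Z.T k ω) ω = p.1 ∧ Z.X (Z.T k ω) ω = p.2} with hΓ
  have hΓm (p : S × S) (k : ℕ) : MeasurableSet (Γ p k) :=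
    (hZ.measurable_Xleft_comp (hZ.measurable_T k) (measurableSet_singleton p.1)).inter
      (hZ.measurable_X_comp (hZ.measurable_T k) (measurableSet_singleton p.2))
  have hfin : ∫⁻ ω, ((Z.J b ω - Z.J a ω : ℕ) : ENNReal) ∂Pr ≠ ⊤ :=
    ne_top_of_le_ne_top (h.lintegral_count_ne_top hC ha hab hb.le)
      (lintegral_mono fun ω => by gcongr; exact Nat.le_add_right _ _)
  have step (p : S × S) (hp : p ∈ E.B) := setLIntegral_ofReal_mul_le_lintegral_sum_events
    hZ.counting_J hZ.measurable_J (hΓm p) (a := a) (b := b) hfin (w := fun _ => κ * q) measurable_const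
    (fun _ => mul_nonneg hκ0 hq0) (fun _ => le_rfl)
    (K := Fintype.card S * C ^ 2 + 128 * Real.exp (2 * C)) (fun u v hu huv hv => by
      have hmu := ha.trans hu
      have hvm := hv.trans_lt hb
      have key := h.le_real_jump hC hq hmu huv hvm (x := p.1) (y := p.2) hp
      have huv' : 0 ≤ (v : ℝ) - u := sub_nonneg.2 (NNReal.coe_le_coe.2 huv.le)
      have h1 : κ * (q * ((v : ℝ) - u)) ≤ Pr.real (Z.X u ⁻¹' {p.1}) * (q * ((v : ℝ) - u)) := by
        gcongr
        exact hκ u hu (huv.trans hvm) p.1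
      have h2 : Pr.real (Z.X u ⁻¹' {p.1} ∩ Z.X v ⁻¹' {p.2} ∩ {ω | Z.J v ω = Z.J u ω + 1})
          ≤ Pr.real {ω | ∃ k ∈ Finset.Ioc (Z.J u ω) (Z.J v ω), ω ∈ Γ p k} := by
        refine measureReal_mono fun ω hω => ?_
        have hJ : Z.J v ω = Z.J u ω + 1 := hω.2
        obtain ⟨e1, e2⟩ := (h.state.cadlag ω).eventTime_jump (natCast_notMem_Ioc hmu hvm) hω.2
        exact ⟨Z.J v ω, Finset.mem_Ioc.2 ⟨by omega, le_rfl⟩, e1.trans hω.1.1, e2.trans hω.1.2⟩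
      rw [intervalIntegral.integral_const, smul_eq_mul]
      linarith)
    (φ := fun t => ENNReal.ofReal (var (E.G t p.1 p.2)))
    (measurable_var (h.a1.jump p.1 p.2) (fun t => hC.jump t p.1 p.2)).ennreal_ofReal
  refine (Finset.sum_le_sum step).trans ((sum_lintegral_le_lintegral_sum _ _ _).trans ?_)
  refine lintegral_mono fun ω => ?_
  simp only
  rw [Finset.sum_comm]
  refine Finset.sum_le_sum fun k _ => ?_
  -- A jump has one pair of states before and after, so exactly one indicator in the full sum is
  -- nonzero.
  calc _ ≤ ∑ p : S × S, (Γ p k).indicator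
        (fun ω => ENNReal.ofReal (var (E.G (eventTime (fun t => Z.J t ω) k) p.1 p.2))) ω :=
        Finset.sum_le_sum_of_subset (Finset.subset_univ _)
    _ = _ := by
        rw [Finset.sum_eq_single (Z.Xleft (Z.T k ω) ω, Z.X (Z.T k ω) ω)]
        · rw [Set.indicator_of_mem (by exact ⟨rfl, rfl⟩)]
          rfl
        · intro p _ hp
          refine Set.indicator_of_notMem (fun hω => hp ?_) _
          exact Prod.ext hω.1.symm hω.2.symm
        · exact fun hn => absurd (Finset.mem_univ _) hn

/-- Variance contributed by the rewards at external events in a time window. -/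
lemma setLIntegral_varK_le {m : ℕ} {a b : ℝ≥0} (ha : m ≤ a) (hab : a ≤ b) (hb : b < m + 1) {κ : ℝ}
    (hκ0 : 0 ≤ κ) (hκ : ∀ t : ℝ≥0, a ≤ t → t < m + 1 → ∀ x, κ ≤ Pr.real (Z.X t ⁻¹' {x})) :
    ∑ x, ∫⁻ t in Set.Ioc (a : ℝ) b,
        ENNReal.ofReal (κ * E.β t.toNNReal x) * ENNReal.ofReal (var (E.K t.toNNReal x))
      ≤ ∫⁻ ω, ∑ k ∈ Finset.Ioc (Z.N a ω) (Z.N b ω),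
        ENNReal.ofReal (variance id (Z.lawK E k ω)) ∂Pr := by
  have hZ := h.isRegular
  set Γ : S → ℕ → Set Ω := fun x k => {ω | Z.X (Z.Λ k ω) ω = x} with hΓ
  have hΓm (x : S) (k : ℕ) : MeasurableSet (Γ x k) :=
    hZ.measurable_X_comp (hZ.measurable_Λ k) (measurableSet_singleton x)
  have hfin : ∫⁻ ω, ((Z.N b ω - Z.N a ω : ℕ) : ENNReal) ∂Pr ≠ ⊤ :=
    ne_top_of_le_ne_top (h.lintegral_count_ne_top hC ha hab hb.le)
      (lintegral_mono fun ω => by gcongr; exact Nat.le_add_left _ _)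
  have step (x : S) (_ : x ∈ Finset.univ) := setLIntegral_ofReal_mul_le_lintegral_sum_events
    hZ.counting hZ.measurable_N (hΓm x) (a := a) (b := b) hfin (w := fun t => κ * E.β t x)
    ((h.a1.intensity x).const_mul κ)
    (fun _ => mul_nonneg hκ0 (hC.intensity_nonneg _ _)) (M := κ * C) (fun t => by
      gcongr; exact hC.intensity t x)
    (K := C ^ 2 + 128 * Real.exp (2 * C) * C) (fun u v hu huv hv => by
      have hmu := ha.trans hu
      have hvm := hv.trans_lt hb
      have key := h.le_real_event hC hmu huv hvm x
      have huv' : (u : ℝ) ≤ v := NNReal.coe_le_coe.2 huv.le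
      have h1 : κ * (∫ t in (u : ℝ)..v, E.β t.toNNReal x)
          ≤ Pr.real (Z.X u ⁻¹' {x}) * (∫ t in (u : ℝ)..v, E.β t.toNNReal x) := by
        gcongr
        · exact intervalIntegral.integral_nonneg huv' fun t _ => hC.intensity_nonneg _ _
        · exact hκ u hu (huv.trans hvm) x
      have h2 : Pr.real (Z.X u ⁻¹' {x} ∩ {ω | Z.J u ω = Z.J v ω} ∩ {ω | Z.N v ω = Z.N u ω + 1})
          ≤ Pr.real {ω | ∃ k ∈ Finset.Ioc (Z.N u ω) (Z.N v ω), ω ∈ Γ x k} := by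
        refine measureReal_mono fun ω hω => ?_
        have hN : Z.N v ω = Z.N u ω + 1 := hω.2
        have hmem : Z.N v ω ∈ Finset.Ioc (Z.N u ω) (Z.N v ω) := Finset.mem_Ioc.2 ⟨by omega, le_rfl⟩
        refine ⟨Z.N v ω, hmem, ?_⟩
        have hΛ := ((hZ.counting ω).eventTime_mem_Ioc_iff (k := Z.N v ω) ⟨v, le_rfl⟩).2 hmem
        exact ((h.state.cadlag ω).eq_of_jumpCount_eq huv.le (natCast_notMem_Ioc hmu hvm) hω.1.2
          ⟨hΛ.1.le, hΛ.2⟩).trans hω.1.1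
      rw [intervalIntegral.integral_const_mul]
      linarith)
    (φ := fun t => ENNReal.ofReal (var (E.K t x)))
    (measurable_var (h.a1.ext x) (fun t => hC.ext t x)).ennreal_ofReal
  refine (Finset.sum_le_sum step).trans ((sum_lintegral_le_lintegral_sum _ _ _).trans ?_)
  refine lintegral_mono fun ω => ?_
  simp only
  rw [Finset.sum_comm]
  refine Finset.sum_le_sum fun k _ => ?_
  rw [Finset.sum_eq_single (Z.X (Z.Λ k ω) ω)]
  · rw [Set.indicator_of_mem (by exact rfl)]
    rfl
  · intro x _ hx
    exact Set.indicator_of_notMem (fun hω => hx hω.symm) _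
  · exact fun hn => absurd (Finset.mem_univ _) hn

end Model.IsResetting

end

/-! ### Growth of the variance. -/

section

lemma lintegral_le_of_forall_fiber {Ω α : Type*} [MeasurableSpace Ω] [Countable α] [MeasurableSpace α]
    [MeasurableSingletonClass α] {P : Measure Ω} {V : Ω → α} (hV : Measurable V) {f g : Ω → ENNReal}
    (h : ∀ v, ∫⁻ ω in V ⁻¹' {v}, f ω ∂P ≤ ∫⁻ ω in V ⁻¹' {v}, g ω ∂P) : ∫⁻ ω, f ω ∂P ≤ ∫⁻ ω, g ω ∂P := by
  have hu : ⋃ v, V ⁻¹' {v} = Set.univ :=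
    Set.eq_univ_of_forall fun ω => Set.mem_iUnion.2 ⟨V ω, rfl⟩
  have hd : Pairwise (Function.onFun Disjoint fun v => V ⁻¹' {v}) := fun v w hvw =>
    Set.disjoint_left.2 fun ω h1 h2 => hvw (h1.symm.trans h2)
  have e (k : Ω → ENNReal) : ∫⁻ ω, k ω ∂P = ∑' v, ∫⁻ ω in V ⁻¹' {v}, k ω ∂P := by
    rw [← lintegral_iUnion (fun v => hV (measurableSet_singleton v)) hd, hu, Measure.restrict_univ]
  rw [e, e]
  exact ENNReal.tsum_le_tsum h

/-- If the next integer after `s` lies beyond `s + g/2`, a window in the first half of `[s, s + g]`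
stays in the current cycle. Otherwise a window in the second half stays in the next one. A margin of
`g/8` is kept after the preceding reset. -/
lemma exists_window {s g : ℝ≥0} (hg0 : 0 < g) (hg : g ≤ 1) : ∃ (m : ℕ) (a b : ℝ≥0), s ≤ a ∧ b ≤ s + g ∧
    m + g / 8 ≤ a ∧ a ≤ b ∧ b < m + 1 ∧ (b : ℝ) - a = g / 4 := by
  obtain ⟨m, hm1, hm2⟩ : ∃ m : ℕ, (m : ℝ≥0) ≤ s ∧ s < m + 1 :=
    ⟨⌊s⌋₊, Nat.floor_le zero_le, Nat.lt_floor_add_one s⟩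
  rw [← NNReal.coe_lt_coe] at hg0 hm2
  rw [← NNReal.coe_le_coe] at hg hm1
  push_cast at hg0 hg hm1 hm2
  rcases lt_or_ge (s + g / 2) (m + 1) with hlt | hge
  · rw [← NNReal.coe_lt_coe] at hlt
    push_cast at hlt
    refine ⟨m, s + g / 8, s + 3 * g / 8, ?_, ?_, ?_, ?_, ?_, ?_⟩ <;>
      first | rw [← NNReal.coe_le_coe] | rw [← NNReal.coe_lt_coe] | skip
    all_goals push_cast; linarith
  · rw [← NNReal.coe_le_coe] at hge
    push_cast at hge
    refine ⟨m + 1, s + 5 * g / 8, s + 7 * g / 8, ?_, ?_, ?_, ?_, ?_, ?_⟩ <;>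
      first | rw [← NNReal.coe_le_coe] | rw [← NNReal.coe_lt_coe] | skip
    all_goals push_cast; linarith

variable {S Ω : Type*} [Fintype S] [DecidableEq S] [TopologicalSpace S] [DiscreteTopology S]
  [MeasurableSpace S] [DiscreteMeasurableSpace S] [m0 : MeasurableSpace Ω]
  {E : Data S} {μ : ℕ → PMF S} {Z : Model S Ω} {Pr : Measure Ω} [IsProbabilityMeasure Pr] {C : ℝ}

namespace Model.IsResetting

variable (h : Z.IsResetting E μ Pr) (hC : E.BoundedBy C)
include h hC

/-- The mean conditional variance given `(X,N)` never exceeds the variance. On the events where `J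
n` and `N n` are fixed, the integral of the reward rate and the mean of `R n` form a
`σ(X,N)`-measurable shift, which cannot lower the second moment below the conditional variance. -/
lemma lintegral_variance_le (n : ℕ) :
    ∫⁻ ω, ENNReal.ofReal ((∑ k ∈ Finset.Icc 1 (Z.J n ω), variance id (Z.lawG E k ω))
        + (∑ k ∈ Finset.Icc 1 (scheduleCount E.τ n), variance id (Z.lawH E k ω))
        + ∑ k ∈ Finset.Icc 1 (Z.N n ω), variance id (Z.lawK E k ω)) ∂Pr
      ≤ ENNReal.ofReal (variance (Z.R E n) Pr) := by
  have hZ := h.isRegular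
  have hreg := isRegular_field hZ.cadlag hZ.counting
  rw [ofReal_variance ((h.memLp_R n).mono_exponent (by norm_num)), evariance_eq_lintegral_ofReal]
  have hm1 : ∀ t, Measurable[Z.field] (Z.J t) := fun t =>
    @IsRegular.measurable_J Ω S Z.field _ _ _ _ _ Z hreg t
  have hm2 : ∀ t, Measurable[Z.field] (Z.N t) := fun t =>
    @IsRegular.measurable_N Ω S Z.field _ _ Z hreg t
  have hm3 : Measurable[Z.field] fun ω => ∫ t in (0 : ℝ)..(n : ℝ≥0), E.r t.toNNReal (Z.X t.toNNReal ω) :=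
    @IsRegular.measurable_integral Ω S Z.field _ _ _ _ _ Z hreg _ h.a1.reward 0 (n : ℝ≥0)
  refine lintegral_le_of_forall_fiber ((hZ.measurable_J n).prodMk (hZ.measurable_N n)) ?_
  rintro ⟨p, q⟩
  have hΓ : MeasurableSet[Z.field] ((fun ω => (Z.J n ω, Z.N n ω)) ⁻¹' {(p, q)}) :=
    ((hm1 n).prodMk (hm2 n)) (measurableSet_singleton _)
  have hpq (ω : Ω) (hω : ω ∈ (fun ω => (Z.J n ω, Z.N n ω)) ⁻¹' {(p, q)}) :
      Z.J n ω = p ∧ Z.N n ω = q := by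
    have h1 : (Z.J n ω, Z.N n ω) = (p, q) := hω
    rwa [Prod.mk.injEq] at h1
  have key := h.law.setLIntegral_variance_le (l := scheduleCount E.τ n) hZ h.a1 hΓ
    (fun ω hω => ⟨⟨n, (hpq ω hω).1.ge⟩, n, (hpq ω hω).2.ge⟩)
    (fun k ω => memLp_id_of_compl_Icc (hC.jump _ _ _)) (fun k ω => memLp_id_of_compl_Icc (hC.sched _ _))
    (fun k ω => memLp_id_of_compl_Icc (hC.ext _ _))
    (a := fun ω => (∫ t in (0 : ℝ)..(n : ℝ≥0), E.r t.toNNReal (Z.X t.toNNReal ω)) - Pr[Z.R E n])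
    (hm3.sub measurable_const)
  refine le_trans (le_of_eq ?_) (key.trans (le_of_eq ?_))
  · refine setLIntegral_congr_fun (field_le hZ _ hΓ) fun ω hω => ?_
    obtain ⟨rfl, rfl⟩ := hpq ω hω
    rfl
  · refine setLIntegral_congr_fun (field_le hZ _ hΓ) fun ω hω => ?_
    obtain ⟨rfl, rfl⟩ := hpq ω hω
    congr 2
    unfold R
    ring

/-- The conditional variance collected between consecutive scheduled times. -/
lemma exists_le_lintegral_variance (hvar : E.VarianceBoundedBelow) : ∃ c : ℝ, 0 < c ∧ ∀ i : ℕ,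
    ENNReal.ofReal c ≤ ∫⁻ ω, ENNReal.ofReal (
      (∑ k ∈ Finset.Ioc (Z.J (E.τ i) ω) (Z.J (E.τ (i + 1)) ω), variance id (Z.lawG E k ω))
        + variance id (Z.lawH E (i + 1) ω)
        + ∑ k ∈ Finset.Ioc (Z.N (E.τ i) ω) (Z.N (E.τ (i + 1)) ω), variance id (Z.lawK E k ω)) ∂Pr := by
  have hZ := h.isRegular
  obtain ⟨δ, hδ, ε, hε, hV⟩ := hvar
  obtain ⟨q, hq0, hq⟩ := Data.exists_forall_le_Q h.a2 h.a3
  obtain ⟨g, hg0, hg1, hg⟩ : ∃ g : ℝ≥0, 0 < g ∧ g ≤ 1 ∧ ∀ i, E.τ i + g ≤ E.τ (i + 1) := by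
    have h5 : 0 < ⨅ i : ℕ, ((E.τ (i + 1) : ℝ) - E.τ i) := h.a5
    have hle (i : ℕ) : (⨅ i : ℕ, ((E.τ (i + 1) : ℝ) - E.τ i)) ≤ (E.τ (i + 1) : ℝ) - E.τ i := ciInf_le ⟨0, by
      rintro _ ⟨j, rfl⟩
      exact sub_nonneg.2 (NNReal.coe_le_coe.2 (h.schedule.2.1.monotone (Nat.le_succ j)))⟩ i
    refine ⟨(min 1 (⨅ i : ℕ, ((E.τ (i + 1) : ℝ) - E.τ i))).toNNReal, ?_, ?_, fun i => ?_⟩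
    · rw [Real.toNNReal_pos]; exact lt_min one_pos h5
    · rw [Real.toNNReal_le_one]; exact min_le_left _ _
    · rw [← NNReal.coe_le_coe, NNReal.coe_add, Real.coe_toNNReal _ (le_min zero_le_one h5.le)]
      have := (min_le_right 1 (⨅ i : ℕ, ((E.τ (i + 1) : ℝ) - E.τ i))).trans (hle i)
      linarith
  -- The scheduled times that count lie at least `δ` after the last reset, and the windows at least
  -- `g/8`, so one lower bound `κ` for the state probabilities covers both.
  have hη : 0 < min δ.toNNReal (g / 8) := lt_min (Real.toNNReal_pos.2 hδ) (by positivity)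
  obtain ⟨κ, hκ0, hκ⟩ := h.exists_le_real_state hC hη
  have hGn (k : ℕ) (ω : Ω) : 0 ≤ variance id (Z.lawG E k ω) := variance_nonneg _ _
  have hHn (k : ℕ) (ω : Ω) : 0 ≤ variance id (Z.lawH E k ω) := variance_nonneg _ _
  have hKn (k : ℕ) (ω : Ω) : 0 ≤ variance id (Z.lawK E k ω) := variance_nonneg _ _
  have hvn (ν : ProbabilityMeasure ℝ) : 0 ≤ var ν := variance_nonneg _ _
  set c₁ : ℝ := κ * (ε / 2) with hc₁
  -- Length `g/4` of the window times a lower bound for the rate at which variance accrues: jumps of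
  -- each possible type occur at rate at least `κ q`, external events in state `x` at rate at least
  -- `κ β(t,x)`.
  set c₂ : ℝ := κ * min q 1 * (ε / 2) * (g / 4) with hc₂
  have hc₁0 : 0 < c₁ := by positivity
  have hg0' : (0 : ℝ) < g := hg0
  have hq1 : 0 < min q 1 := lt_min hq0 one_pos
  have hc₂0 : 0 < c₂ := by positivity
  refine ⟨min c₁ c₂, lt_min hc₁0 hc₂0, fun i => ?_⟩
  -- Either the scheduled reward at the end of the interval carries half of `ε`, or jumps and
  -- external events carry the other half at every time in it.
  by_cases hs : ε / 2 ≤ E.scheduledVar δ (i + 1)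
  · have hfr : δ ≤ Int.fract (E.τ (i + 1) : ℝ) := by
      by_contra hn
      rw [Data.scheduledVar, if_neg hn] at hs
      linarith
    rw [Data.scheduledVar, if_pos hfr] at hs
    set t := E.τ (i + 1) with ht
    have hstate (x : S) : κ ≤ Pr.real (Z.X t ⁻¹' {x}) := by
      refine hκ ⌊t⌋₊ t ?_ (Nat.lt_floor_add_one t) x
      rw [← NNReal.coe_le_coe]
      push_cast
      have h1 : min (δ.toNNReal : ℝ) (g / 8) ≤ δ := (min_le_left _ _).trans (Real.coe_toNNReal δ hδ.le).le
      have h2 : ((⌊t⌋₊ : ℕ) : ℝ) = ⌊(t : ℝ)⌋ := by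
        exact natCast_floor_eq_intCast_floor (a := (t : ℝ)) t.2
      have h3 := Int.floor_add_fract (t : ℝ)
      rw [h2]
      linarith
    calc ENNReal.ofReal (min c₁ c₂) ≤ ENNReal.ofReal c₁ := ENNReal.ofReal_le_ofReal (min_le_left _ _)
      _ ≤ ENNReal.ofReal (∑ x, κ * var (E.H t x)) := by
          refine ENNReal.ofReal_le_ofReal ?_
          rw [← Finset.mul_sum, hc₁]
          gcongr
      _ ≤ ∑ x, ENNReal.ofReal (var (E.H t x)) * Pr (Z.X t ⁻¹' {x}) := by
          rw [ENNReal.ofReal_sum_of_nonneg fun x _ => mul_nonneg hκ0.le (hvn _)]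
          refine Finset.sum_le_sum fun x _ => ?_
          rw [mul_comm, ENNReal.ofReal_mul (hvn _), ← ofReal_measureReal (s := Z.X t ⁻¹' {x})]
          gcongr
          exact hstate x
      _ = ∫⁻ ω, ENNReal.ofReal (variance id (Z.lawH E (i + 1) ω)) ∂Pr := by
          have e := lintegral_map (μ := Pr) (measurable_of_finite fun x => ENNReal.ofReal (var (E.H t x)))
            (hZ.measurable_X t)
          rw [lintegral_fintype] at e
          refine Eq.trans ?_ e
          refine Finset.sum_congr rfl fun x _ => ?_
          rw [Measure.map_apply (hZ.measurable_X t) (measurableSet_singleton x)]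
      _ ≤ _ := by
          refine lintegral_mono fun ω => ENNReal.ofReal_le_ofReal ?_
          have h1 := Finset.sum_nonneg fun k (_ : k ∈ Finset.Ioc (Z.J (E.τ i) ω) (Z.J (E.τ (i + 1)) ω)) => hGn k ω
          have h2 := Finset.sum_nonneg fun k (_ : k ∈ Finset.Ioc (Z.N (E.τ i) ω) (Z.N (E.τ (i + 1)) ω)) => hKn k ω
          linarith
  · push Not at hs
    obtain ⟨m, a, b, hsa, hbs, hma, hab, hbm, hba⟩ := exists_window (s := E.τ i) hg0 hg1
    have hma' : m ≤ a := le_trans le_self_add hma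
    have hstate (t : ℝ≥0) (hat : a ≤ t) (htm : t < m + 1) (x : S) : κ ≤ Pr.real (Z.X t ⁻¹' {x}) :=
      hκ m t ((by gcongr; exact min_le_right _ _ : (m : ℝ≥0) + min δ.toNNReal (g / 8) ≤ m + g / 8).trans
        (hma.trans hat)) htm x
    have hbτ : b ≤ E.τ (i + 1) := hbs.trans (hg i)
    have kG := h.setLIntegral_varG_le hC hma' hab hbm hκ0.le hq0.le hstate hq
    have kK := h.setLIntegral_varK_le hC hma' hab hbm hκ0.le hstate
    have hdens : ENNReal.ofReal c₂ ≤ ∑ p ∈ E.B, (∫⁻ t in Set.Ioc (a : ℝ) b,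
          ENNReal.ofReal (κ * q) * ENNReal.ofReal (var (E.G t.toNNReal p.1 p.2)))
        + ∑ x, ∫⁻ t in Set.Ioc (a : ℝ) b,
          ENNReal.ofReal (κ * E.β t.toNNReal x) * ENNReal.ofReal (var (E.K t.toNNReal x)) := by
      have mG (p : S × S) : Measurable fun t : ℝ => ENNReal.ofReal (κ * q) * ENNReal.ofReal (var (E.G t.toNNReal p.1 p.2)) :=
        ((measurable_var (h.a1.jump p.1 p.2) (fun t => hC.jump t p.1 p.2)).comp
          measurable_real_toNNReal).ennreal_ofReal.const_mul _
      have mK (x : S) : Measurable fun t : ℝ => ENNReal.ofReal (κ * E.β t.toNNReal x) * ENNReal.ofReal (var (E.K t.toNNReal x)) :=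
        (((h.a1.intensity x).comp measurable_real_toNNReal).const_mul κ).ennreal_ofReal.mul
          ((measurable_var (h.a1.ext x) (fun t => hC.ext t x)).comp measurable_real_toNNReal).ennreal_ofReal
      rw [← lintegral_finsetSum _ fun p _ => mG p, ← lintegral_finsetSum _ fun x _ => mK x,
        ← lintegral_add_left (Finset.measurable_fun_sum _ fun p _ => mG p)]
      calc ENNReal.ofReal c₂ = ∫⁻ _ in Set.Ioc (a : ℝ) b, ENNReal.ofReal (κ * min q 1 * (ε / 2)) := by
            rw [setLIntegral_const, Real.volume_Ioc, hba, ← ENNReal.ofReal_mul (by positivity)]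
        _ ≤ _ := by
            refine setLIntegral_mono' measurableSet_Ioc fun t ht => ?_
            have ht1 : E.τ i < t.toNNReal := lt_of_le_of_lt hsa (by
              rw [Real.lt_toNNReal_iff_coe_lt]; exact ht.1)
            have ht2 : t.toNNReal ≤ E.τ (i + 1) := (Real.toNNReal_le_iff_le_coe.2 ht.2).trans hbτ
            have h1 := hV i t.toNNReal ht1 ht2
            have hβ (x : S) := hC.intensity_nonneg t.toNNReal x
            simp only [← ENNReal.ofReal_mul (mul_nonneg hκ0.le hq0.le),
              ← ENNReal.ofReal_mul (mul_nonneg hκ0.le (hβ _))]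
            rw [← ENNReal.ofReal_sum_of_nonneg fun p _ => mul_nonneg (mul_nonneg hκ0.le hq0.le) (hvn _),
              ← ENNReal.ofReal_sum_of_nonneg fun x _ => mul_nonneg (mul_nonneg hκ0.le (hβ x)) (hvn _),
              ← ENNReal.ofReal_add (Finset.sum_nonneg fun p _ => mul_nonneg (mul_nonneg hκ0.le hq0.le) (hvn _))
                (Finset.sum_nonneg fun x _ => mul_nonneg (mul_nonneg hκ0.le (hβ x)) (hvn _))]
            refine ENNReal.ofReal_le_ofReal ?_
            simp only [mul_assoc]
            rw [← Finset.mul_sum, ← Finset.mul_sum, ← Finset.mul_sum, ← mul_add]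
            refine mul_le_mul_of_nonneg_left ?_ hκ0.le
            have hG0 : 0 ≤ ∑ p ∈ E.B, var (E.G t.toNNReal p.1 p.2) := Finset.sum_nonneg fun p _ => hvn _
            have hK0 : 0 ≤ ∑ x, E.β t.toNNReal x * var (E.K t.toNNReal x) :=
              Finset.sum_nonneg fun x _ => mul_nonneg (hβ x) (hvn _)
            have h2 : ε / 2 ≤ (∑ p ∈ E.B, var (E.G t.toNNReal p.1 p.2))
              + ∑ x, E.β t.toNNReal x * var (E.K t.toNNReal x) := by linarith
            have h3 := mul_le_mul_of_nonneg_right (min_le_left q 1) hG0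
            have h4 := mul_le_mul_of_nonneg_right (min_le_right q 1) hK0
            have h5 := mul_le_mul_of_nonneg_left h2 hq1.le
            linarith
    calc ENNReal.ofReal (min c₁ c₂) ≤ ENNReal.ofReal c₂ := ENNReal.ofReal_le_ofReal (min_le_right _ _)
      _ ≤ _ := hdens.trans (add_le_add kG kK)
      _ ≤ _ := le_lintegral_add _ _
      _ ≤ _ := by
          refine lintegral_mono fun ω => ?_
          simp only
          rw [← ENNReal.ofReal_sum_of_nonneg fun k _ => hGn k ω,
            ← ENNReal.ofReal_sum_of_nonneg fun k _ => hKn k ω,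
            ← ENNReal.ofReal_add (Finset.sum_nonneg fun k _ => hGn k ω) (Finset.sum_nonneg fun k _ => hKn k ω)]
          refine ENNReal.ofReal_le_ofReal ?_
          have h1 := Finset.sum_le_sum_of_subset_of_nonneg
            (Finset.Ioc_subset_Ioc ((hZ.counting_J ω).mono hsa) ((hZ.counting_J ω).mono hbτ))
            fun k _ _ => hGn k ω
          have h2 := Finset.sum_le_sum_of_subset_of_nonneg
            (Finset.Ioc_subset_Ioc ((hZ.counting ω).mono hsa) ((hZ.counting ω).mono hbτ))
            fun k _ _ => hKn k ω
          have h3 := hHn (i + 1) ω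
          linarith

omit hC in
/-- The variance of the cumulative reward tends to infinity. -/
theorem tendsto_variance_R (hvar : E.VarianceBoundedBelow) :
    Tendsto (fun n : ℕ => variance (Z.R E n) Pr) atTop atTop := by
  obtain ⟨C, hC⟩ := h.exists_boundedBy
  have hZ := h.isRegular
  obtain ⟨c, hc0, hc⟩ := h.exists_le_lintegral_variance hC hvar
  have hGn (k : ℕ) (ω : Ω) : 0 ≤ variance id (Z.lawG E k ω) := variance_nonneg _ _
  have hHn (k : ℕ) (ω : Ω) : 0 ≤ variance id (Z.lawH E k ω) := variance_nonneg _ _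
  have hKn (k : ℕ) (ω : Ω) : 0 ≤ variance id (Z.lawK E k ω) := variance_nonneg _ _
  -- Each of the first `M` intervals between scheduled times contributes at least `c`. Their rewards
  -- are disjoint and are all collected by time `n`.
  have hmain (M n : ℕ) (hM : E.τ M ≤ n) : c * M ≤ variance (Z.R E n) Pr := by
    refine (ENNReal.ofReal_le_ofReal_iff (variance_nonneg _ _)).1 (le_trans ?_ (h.lintegral_variance_le hC n))
    calc ENNReal.ofReal (c * M) = ∑ _i ∈ Finset.range M, ENNReal.ofReal c := by
          rw [Finset.sum_const, Finset.card_range, nsmul_eq_mul, mul_comm, ENNReal.ofReal_mul (by positivity),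
            ENNReal.ofReal_natCast]
      _ ≤ _ := Finset.sum_le_sum fun i _ => hc i
      _ ≤ _ := sum_lintegral_le_lintegral_sum _ _ _
      _ ≤ _ := by
          refine lintegral_mono fun ω => ?_
          simp only
          rw [← ENNReal.ofReal_sum_of_nonneg fun i _ => add_nonneg (add_nonneg
            (Finset.sum_nonneg fun k _ => hGn k ω) (hHn _ ω)) (Finset.sum_nonneg fun k _ => hKn k ω)]
          refine ENNReal.ofReal_le_ofReal ?_
          rw [Finset.sum_add_distrib, Finset.sum_add_distrib,
            sum_range_sum_Ioc (fun i j hij => (hZ.counting_J ω).mono (h.schedule.2.1.monotone hij)) _ M,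
            sum_range_sum_Ioc (fun i j hij => (hZ.counting ω).mono (h.schedule.2.1.monotone hij)) _ M]
          have hsub {u v w : ℕ} (hvw : v ≤ w) : Finset.Ioc u v ⊆ Finset.Icc 1 w := fun k hk => by
            rw [Finset.mem_Ioc] at hk
            rw [Finset.mem_Icc]; omega
          have h1 := Finset.sum_le_sum_of_subset_of_nonneg
            (hsub (u := Z.J (E.τ 0) ω) ((hZ.counting_J ω).mono hM)) fun k _ _ => hGn k ω
          have h2 := Finset.sum_le_sum_of_subset_of_nonneg
            (hsub (u := Z.N (E.τ 0) ω) ((hZ.counting ω).mono hM)) fun k _ _ => hKn k ω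
          have hMs : M ≤ scheduleCount E.τ n := by
            rcases Nat.eq_zero_or_pos M with rfl | hM0
            · exact Nat.zero_le _
            · exact (h.schedule.le_scheduleCount_iff hM0 n).2 hM
          have h3 : ∑ i ∈ Finset.range M, variance id (Z.lawH E (i + 1) ω)
              = ∑ k ∈ Finset.Ioc 0 M, variance id (Z.lawH E k ω) := by
            refine Eq.trans ?_ (sum_range_sum_Ioc (c := id) monotone_id _ M)
            simp [Nat.Ioc_succ_singleton]
          have h4 := Finset.sum_le_sum_of_subset_of_nonneg (hsub (u := 0) hMs) fun k _ _ => hHn k ω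
          linarith
  refine tendsto_atTop.2 fun B => ?_
  obtain ⟨M, hM⟩ := exists_nat_ge (B / c)
  obtain ⟨n₀, hn₀⟩ := exists_nat_ge (E.τ M)
  filter_upwards [eventually_ge_atTop n₀] with n hn
  have h1 := hmain M n (hn₀.trans (by exact_mod_cast hn))
  rw [div_le_iff₀ hc0] at hM
  linarith

end Model.IsResetting

end

end Resetting

end
-- The central limit theorem for the cumulative reward.
theorem mainTheorem6 {S Ω : Type*} [Fintype S] [DecidableEq S]
    [TopologicalSpace S] [DiscreteTopology S] [MeasurableSpace S] [DiscreteMeasurableSpace S]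
    [MeasurableSpace Ω] (Pr : Measure Ω) [IsProbabilityMeasure Pr]
    (E : Resetting.Data S) (μ : ℕ → PMF S) (Z : Resetting.Model S Ω)
    (hQ : ∀ t, Resetting.IsRateMatrix (E.Q t)) (hτ : Resetting.IsSchedule E.τ)
    (h1 : E.A1) (h2 : E.A2) (h3 : E.A3) (h4 : E.A4) (h5 : E.A5)
    (hX : Resetting.IsResetJumpProcess E.Q μ Z.X Pr)
    (hN : Resetting.IsModulatedPoisson E.β Z.X Z.N Pr)
    (hZ : Z.HasRewardLaw E Pr)
    (hint : ∀ i, 1 ≤ i → ∀ m : ℕ, E.τ i ≠ m)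
    (hvar : E.VarianceBoundedBelow) :
    (∀ n : ℕ, MemLp (Z.R E n) 2 Pr) ∧
    (∀ᶠ n : ℕ in atTop, 0 < variance (Z.R E n) Pr) ∧
    TendstoInDistribution
      (fun (n : ℕ) ω => (Z.R E n ω - ∫ ω', Z.R E n ω' ∂Pr) / √(variance (Z.R E n) Pr))
      atTop id (fun _ => Pr) (gaussianReal 0 1) := by
  have h : Z.IsResetting E μ Pr := ⟨hQ, hτ, h1, h2, h3, h4, h5, hX, hN, hZ, hint⟩
  have htend := h.tendsto_variance_R hvar
  obtain ⟨A, hA⟩ := h.exists_fourth_moment_le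
  exact ⟨fun n => (h.memLp_R n).mono_exponent (by norm_num), htend.eventually_gt_atTop 0,
    Resetting.tendstoInDistribution_of_fourth_moment_le_variance
      (Eventually.of_forall fun ω => by simpa using h.R_zero ω) (fun n => h.memLp_R n)
      (fun n => h.indepFun_R n) (fun n => hA n) htend⟩
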